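/- Let $q=e^{2\pi i/3}$ and consider the rotor model on a semi-infinite cylinder of circumference $N\ge 1$, in which loops that wind around the cylinder are distinguished from contractible ones: PBC$+\infty$ for $N$ even, PBC (with the colour-preserving seam) for $N$ odd. A state is a pair $(\pi_R,\pi_G)$ (red, green) of non-crossing link patterns on $N$ cyclically ordered points of a punctured disk, with exactly one line running into the puncture for each colour if $N$ is odd and none if $N$ is even. A face with parameters $z$ (vertical), $w$ (horizontal) carries a red and a green tile, each joining either bottom–left and top–right (type $0$) or bottom–right and top–left (type $1$); its weight is $\omega_D=q(w-qz)(z+qw)$ if both tiles have type $0$, $\omega_A=(w-z)(w+qz)$ if both have type $1$, and $\omega_R=\omega_L=(w-z)(z+qw)$ otherwise. Let $T(t|z_1,\dots,z_N)$ be the resulting one-row transfer matrix on states (all closed loops have weight $1$), which adds a row with parameters $(z_i,t)$ in column $i$. Let $\Psi^*$ be a ground state: a nonzero vector of polynomials $\Psi^*_{\pi_R,\pi_G}\in\mathbb C[z_1,\dots,z_N]$ with $$T(t|z_1,\dots,z_N)\,\Psi^*=\prod_{i=1}^N(q t^2-z_i^2)\,\Psi^*\quad\text{for all }t,$$ whose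 components have degree at most $2(N-1)$ in each $z_i$ and are homogeneous of total degree $N(N-1)$ (the assumed degree, twice that of the $O(1)$ model). For $m+k=N$ let $\Psi^*_{m,k}$ be the maximally nested component, in which the red arcs join $i$ and $1-i$ and the green arcs join $m+i$ and $m+1-i$ for $1\le i\le\lfloor N/2\rfloor$ (points modulo $N$; each arc from $1-i$ to $i$, respectively from $m+1-i$ to $m+i$, runs along the points between these two integers, with the puncture on its other side; for odd $N$ the remaining red and green points are joined to the puncture). Define its nontrivial factor $\tilde\Psi^*_{m,k}$ by $$\Psi^*_{m,k}=\prod_{1\le i<j\le m}(z_i+qz_j)\prod_{m<i<j\le N}(z_i+qz_j)\prod_{i\le m<j}q^{-1}(z_i+qz_j)(z_j+qz_i)\;\tilde\Psi^*_{m,k}.$$ There are polynomials $P_k\in\mathbb C[z_1,\dots,z_k]$, $k\ge 0$, such that for all $n\ge 0$ $$P_{2n}(z_1,\dots,z_{2n})=(-3q^2)^{-n}\,\frac{\prod_{i\ne j}(z_i+qz_j)}{\prod_{i<j}(z_i-z_j)}\;\mathrm{Pf}\left[\frac{z_i^2-z_j^2}{(z_i+qz_j)(z_j+qz_i)}\right]_{1\le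 i,j\le 2n}$$ (at all points where no denominator with $i\neq j$ vanishes), $$P_{2n+1}(z_1,\dots,z_{2n+1})=-3q^{n+2}\lim_{z_{2n+2}\to\infty}\frac{P_{2n+2}(z_1,\dots,z_{2n+2})}{(z_{2n+2})^{2n+1}},$$ and such that for every $N\geq 1$ and every ground state $\Psi^*$ of size $N$ there is a constant $c\ne 0$ such that, for all $m+k=N$, $\tilde\Psi^*_{m,k}$ is a polynomial and $$\tilde\Psi^*_{m,k}(z_1,\dots,z_N)=c\,\kappa_{m,k}\,P_m(z_1,\dots,z_m)\,P_k(z_{m+1},\dots,z_{N}),$$ where $\kappa_{m,k}=\tfrac13$ if $m$ and $k$ are both odd and $\kappa_{m,k}=1$ otherwise. In particular $\tilde\Psi^*_{0,N}=c\,P_N$. Moreover $c=1$ if the ground state is normalized so that the sum of its components is $S_Y(z_1^2,\dots,z_N^2)\,S_{Y'}(z_1^2,\dots,z_N^2)$, with $S$ the Schur functions, $Y=(\lfloor\frac{N-1}2\rfloor,\lfloor\frac{N-2}2\rfloor,\dots,0)$ and $Y'=(\lfloor\frac N2\rfloor,\lfloor\frac{N-1}2\rfloor,\dots,\lfloor\frac12\rfloor)$.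 -/

import Mathlib

open Filter Topology MvPolynomial

namespace Rotor

/-! ### Link patterns on a punctured disk -/

/-- A link pattern with `N` cyclically ordered boundary points on a disk with a puncture, given by
its lift to the universal cover: the points are lifted to `ℤ` (the point `i` is identified with
`i + N`), the puncture is at infinity in the upper half plane, and `partner i` is the point that is
joined to `i` by an arc, or `i` itself if the line from `i` is unmatched, that is, runs into the
puncture.  No arc crosses another arc or an unmatched line, and there is at most one unmatched line;
so there is none for even `N` and exactly one for odd `N`. -/
@[ext] structure LinkPattern (N : ℕ) where
  partner : ℤ → ℤ
  invol : ∀ i, partner (partner i) = i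
  periodic : ∀ i, partner (i + N) = partner i + N
  noncrossing : ∀ i j, i < j → j < partner i →
    partner j ≠ j ∧ i < partner j ∧ partner j < partner i
  unmatched : ∀ i j, partner i = i → partner j = j → (N : ℤ) ∣ i - j

namespace LinkPattern

theorem partner_lt {N : ℕ} [NeZero N] (σ : LinkPattern N) (i : ℤ) : σ.partner i < i + N := by
  have hN : 0 < (N : ℤ) := by exact_mod_cast Nat.pos_of_ne_zero (NeZero.ne N)
  by_contra h
  have hp := σ.periodic i
  rcases lt_or_eq_of_le (not_lt.mp h) with h1 | h1
  · have := σ.noncrossing i (i + N) (by omega) h1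
    omega
  · have := σ.invol i
    rw [← h1, hp] at this
    omega

theorem lt_partner {N : ℕ} [NeZero N] (σ : LinkPattern N) (i : ℤ) : i - N < σ.partner i := by
  have := σ.partner_lt (σ.partner i)
  rw [σ.invol] at this
  omega

theorem partner_add_mul {N : ℕ} (σ : LinkPattern N) (i k : ℤ) :
    σ.partner (i + N * k) = σ.partner i + N * k := by
  induction k using Int.induction_on with
  | zero => simp
  | succ k ih =>
    have := σ.periodic (i + N * k)
    rw [mul_add, mul_one, ← add_assoc, this, ih, add_assoc]
  | pred k ih =>
    have := σ.periodic (i + N * (-k - 1))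
    rw [show i + (N : ℤ) * (-k - 1) + N = i + N * (-k) by ring, ih] at this
    linarith

instance {N : ℕ} [NeZero N] : Finite (LinkPattern N) := by
  have hN : 0 < (N : ℤ) := by exact_mod_cast Nat.pos_of_ne_zero (NeZero.ne N)
  let f : LinkPattern N → (Fin N → Set.Ioo (-(N : ℤ)) N) := fun σ k =>
    ⟨σ.partner (k : ℤ) - k, by
      have h1 := σ.partner_lt k
      have h2 := σ.lt_partner k
      constructor <;> omega⟩
  refine Finite.of_injective f ?_
  intro σ τ h
  ext i
  have hr := Int.emod_nonneg i hN.ne'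
  have hr' := Int.emod_lt_of_pos i hN
  have hk := congrFun h ⟨(i % N).toNat, by omega⟩
  have hk' := congrArg Subtype.val hk
  simp only [f, Int.toNat_of_nonneg hr] at hk'
  have e : i = i % N + N * (i / N) := (Int.emod_add_mul_ediv i N).symm
  rw [e, σ.partner_add_mul, τ.partner_add_mul]
  linarith

noncomputable instance {N : ℕ} [NeZero N] : Fintype (LinkPattern N) := Fintype.ofFinite _

end LinkPattern

/-- The arcs `c + i ↔ c - 1 - i` for `0 ≤ i < ⌊N / 2⌋`, repeated with period `N`; for odd `N`
the remaining points `c + ⌊N / 2⌋ + N * k` are fixed. -/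
def nestedMap (N : ℕ) (c x : ℤ) : ℤ :=
  if 2 * ((x - c) % N) + 1 < N then x - 2 * ((x - c) % N) - 1
  else if 2 * ((x - c) % N) + 1 = N then x
  else x + 2 * (N - (x - c) % N) - 1

theorem nestedMap_apply {N : ℕ} {c y k : ℤ} (h0 : 0 ≤ y) (h1 : y < N) :
    nestedMap N c (c + y + N * k) =
      if 2 * y + 1 < N then c + N * k - y - 1
      else if 2 * y + 1 = N then c + y + N * k
      else c + N * k + 2 * N - y - 1 := by
  have e : (c + y + N * k - c) % (N : ℤ) = y := by
    rw [show c + y + N * k - c = y + N * k by ring, Int.add_mul_emod_self_left]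
    exact Int.emod_eq_of_lt h0 h1
  unfold nestedMap
  rw [e]
  split_ifs <;> ring

theorem nested_coord {N : ℕ} [NeZero N] (c x : ℤ) :
    ∃ y k : ℤ, 0 ≤ y ∧ y < N ∧ x = c + y + N * k := by
  have hN : 0 < (N : ℤ) := by exact_mod_cast Nat.pos_of_ne_zero (NeZero.ne N)
  refine ⟨(x - c) % N, (x - c) / N, Int.emod_nonneg _ hN.ne', Int.emod_lt_of_pos _ hN, ?_⟩
  have := Int.emod_add_mul_ediv (x - c) N
  linarith

/-- The maximally nested link pattern whose arcs are nested around the gap between the points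
`c - 1` and `c`. -/
def nested (N : ℕ) [NeZero N] (c : ℤ) : LinkPattern N where
  partner := nestedMap N c
  invol i := by
    obtain ⟨y, k, h0, h1, rfl⟩ := nested_coord (N := N) c i
    rw [nestedMap_apply h0 h1]
    split_ifs with h2 h3
    · rw [show c + N * k - y - 1 = c + (N - 1 - y) + N * (k - 1) by ring,
        nestedMap_apply (by omega) (by omega), if_neg (by omega), if_neg (by omega)]
      ring
    · rw [nestedMap_apply h0 h1, if_neg h2, if_pos h3]
    · rw [show c + N * k + 2 * N - y - 1 = c + (N - 1 - y) + N * (k + 1) by ring,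
        nestedMap_apply (by omega) (by omega), if_pos (by omega)]
      ring
  periodic i := by
    obtain ⟨y, k, h0, h1, rfl⟩ := nested_coord (N := N) c i
    rw [show c + y + N * k + N = c + y + N * (k + 1) by ring, nestedMap_apply h0 h1,
      nestedMap_apply h0 h1]
    split_ifs <;> ring
  noncrossing i j hij hji := by
    obtain ⟨y, k, h0, h1, rfl⟩ := nested_coord (N := N) c i
    obtain ⟨y', k', h0', h1', rfl⟩ := nested_coord (N := N) c j
    rw [nestedMap_apply h0 h1] at hji ⊢
    rw [nestedMap_apply h0' h1']
    have hN : 0 < (N : ℤ) := by omega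
    have hk : k ≤ k' := by
      by_contra hlt
      have : (N : ℤ) * (k' + 1) ≤ N * k := by gcongr; omega
      rw [mul_add, mul_one] at this
      omega
    have hk' : k' ≤ k + 1 := by
      by_contra hlt
      have : (N : ℤ) * (k + 2) ≤ N * k' := by gcongr; omega
      rw [mul_add] at this
      split_ifs at hji <;> omega
    obtain rfl | rfl : k' = k ∨ k' = k + 1 := by omega
    · split_ifs at hji ⊢ <;> omega
    · rw [mul_add, mul_one] at *
      split_ifs at hji ⊢ <;> omega
  unmatched i j hi hj := by
    obtain ⟨y, k, h0, h1, rfl⟩ := nested_coord (N := N) c i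
    obtain ⟨y', k', h0', h1', rfl⟩ := nested_coord (N := N) c j
    rw [nestedMap_apply h0 h1] at hi
    rw [nestedMap_apply h0' h1'] at hj
    have e : y = y' := by
      split_ifs at hi hj <;> omega
    exact ⟨k - k', by rw [e]; ring⟩

/-! ### The rotor model -/

/-- `q = exp (2 π i / 3)`. -/
noncomputable def q : ℂ := Complex.exp (2 * Real.pi * Complex.I / 3)

noncomputable def omegaRL (z w : ℂ) : ℂ := (w - z) * (z + q * w)

noncomputable def omegaD (z w : ℂ) : ℂ := q * (w - q * z) * (z + q * w)

noncomputable def omegaA (z w : ℂ) : ℂ := (w - z) * (w + q * z)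

/-- The weight of a face.  A face consists of a red and a green tile.  The tile `false` joins bottom
to left and top to right, the tile `true` joins bottom to right and top to left.  The four faces
`D`, `A`, `R`, `L` have both tiles `false`, both tiles `true`, or two different tiles. -/
noncomputable def faceWeight (red green : Bool) (z w : ℂ) : ℂ :=
  match red, green with
  | false, false => omegaD z w
  | true, true => omegaA z w
  | _, _ => omegaRL z w

/-- The column of the cylinder of size `N` below the integer `i`. -/
def col {N : ℕ} [NeZero N] (i : ℤ) : Fin N :=
  ⟨(i % N).toNat, by
    have hN : 0 < (N : ℤ) := by exact_mod_cast Nat.pos_of_ne_zero (NeZero.ne N)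
    have := Int.emod_lt_of_pos i hN
    have := Int.emod_nonneg i hN.ne'
    omega⟩

/-- The edges of a row of faces, lifted to the universal cover: the bottom and the top edge of the
face in column `i`, and the vertical edge between the columns `i` and `i + 1`. -/
inductive Edge
  | bot (i : ℤ)
  | top (i : ℤ)
  | side (i : ℤ)

/-- The lines of one colour in a row of tiles `r` on top of which the link pattern `σ` is glued. -/
inductive Line {N : ℕ} [NeZero N] (r : Fin N → Bool) (σ : LinkPattern N) : Edge → Edge → Prop
  | botLeft (i : ℤ) : r (col i) = false → Line r σ (.bot i) (.side (i - 1))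
  | topRight (i : ℤ) : r (col i) = false → Line r σ (.top i) (.side i)
  | botRight (i : ℤ) : r (col i) = true → Line r σ (.bot i) (.side i)
  | topLeft (i : ℤ) : r (col i) = true → Line r σ (.top i) (.side (i - 1))
  | arc (i : ℤ) : Line r σ (.top i) (.top (σ.partner i))

/-- `σ'` is the connectivity of the bottom points after the row of tiles `r` has been added below
the link pattern `σ`.  Closed loops are discarded, with weight `1`. -/
def IsRowImage {N : ℕ} [NeZero N] (r : Fin N → Bool) (σ σ' : LinkPattern N) : Prop :=
  ∀ i j : ℤ, i ≠ j →
    (σ'.partner i = j ↔ Relation.EqvGen (Line r σ) (.bot i) (.bot j))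

/-- A state of the rotor model: a red and a green link pattern. -/
abbrev State (N : ℕ) := LinkPattern N × LinkPattern N

open Classical in
/-- The one-row transfer matrix `T(t | z₁, …, z_N)` of the rotor model on the cylinder:
the entry `(s', s)` is the total weight of the rows that turn the state `s` into `s'`. -/
noncomputable def transferMatrix {N : ℕ} [NeZero N] (t : ℂ) (z : Fin N → ℂ) :
    Matrix (State N) (State N) ℂ :=
  fun s' s => ∑ r : Fin N → Bool, ∑ g : Fin N → Bool,
    if IsRowImage r s.1 s'.1 ∧ IsRowImage g s.2 s'.2 then
      ∏ i, faceWeight (r i) (g i) (z i) t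
    else 0

/-- `Ψ` is a polynomial ground state of the rotor model on the cylinder of size `N`, of degree
`2 (N - 1)` in each spectral parameter and of total degree `N (N - 1)`. -/
structure IsGroundState {N : ℕ} [NeZero N] (Ψ : State N → MvPolynomial (Fin N) ℂ) : Prop where
  ne_zero : Ψ ≠ 0
  eigen : ∀ (t : ℂ) (z : Fin N → ℂ),
    (transferMatrix t z).mulVec (fun s => eval z (Ψ s)) =
      (∏ i, (q * t ^ 2 - z i ^ 2)) • (fun s => eval z (Ψ s))
  degree : ∀ s i, (Ψ s).degreeOf i ≤ 2 * (N - 1)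
  homogeneous : ∀ s, (Ψ s).IsHomogeneous (N * (N - 1))

/-- The Schur function `S_lam (x₁, …, x_N)` as a ratio of alternants (for distinct `x_i`). -/
noncomputable def schur {N : ℕ} (lam : Fin N → ℕ) (x : Fin N → ℂ) : ℂ :=
  (Matrix.of fun i j : Fin N => x i ^ (lam j + (N - 1 - j))).det /
    (Matrix.of fun i j : Fin N => x i ^ (N - 1 - (j : ℕ))).det

/-- The normalization of the ground state in which the sum of the components is
`S_Y(z₁², …, z_N²) S_Y'(z₁², …, z_N²)`, where `Y` and `Y'` have the rows
`⌊(N - 1) / 2⌋, ⌊(N - 2) / 2⌋, …, 0` and `⌊N / 2⌋, ⌊(N - 1) / 2⌋, …, ⌊1 / 2⌋`. -/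
def IsNormalized {N : ℕ} [NeZero N] (Ψ : State N → MvPolynomial (Fin N) ℂ) : Prop :=
  ∀ z : Fin N → ℂ, (Function.Injective fun i => z i ^ 2) →
    ∑ s, eval z (Ψ s) =
      schur (fun j => (N - 1 - j) / 2) (fun i => z i ^ 2) *
        schur (fun j => (N - j) / 2) (fun i => z i ^ 2)

/-- The maximally nested configuration of kind `(m, N - m)`; the points `1, …, N` are numbered
`0, …, N - 1` here. -/
def mnc (N : ℕ) [NeZero N] (m : ℕ) : State N := (nested N 0, nested N m)

/-- The trivial factor of the maximally nested component of kind `(m, N - m)`. -/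
noncomputable def trivialFactor (N m : ℕ) : MvPolynomial (Fin N) ℂ :=
  ∏ i : Fin N, ∏ j ∈ Finset.Ioi i,
    if (i : ℕ) < m ∧ m ≤ (j : ℕ) then
      C q⁻¹ * (X i + C q * X j) * (X j + C q * X i)
    else X i + C q * X j

/-! ### The Pfaffian formula -/

/-- The Pfaffian of a skew-symmetric matrix of size `2 n`. -/
noncomputable def pfaffian {n : ℕ} (A : Matrix (Fin (2 * n)) (Fin (2 * n)) ℂ) : ℂ :=
  (1 / (2 ^ n * (n.factorial : ℂ))) *
    ∑ π : Equiv.Perm (Fin (2 * n)), ((Equiv.Perm.sign π : ℤ) : ℂ) *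
      ∏ i : Fin n, A (π ⟨2 * i, by omega⟩) (π ⟨2 * i + 1, by omega⟩)

/-- The factor `(-3 q²)^{-n} ∏_{i ≠ j} (z_i + q z_j) / ∏_{i < j} (z_i - z_j)` times the Pfaffian of
`(z_i² - z_j²) / ((z_i + q z_j) (z_j + q z_i))`. -/
noncomputable def pfaffianFormula (n : ℕ) (z : Fin (2 * n) → ℂ) : ℂ :=
  ((-3 * q ^ 2) ^ n)⁻¹ *
    ((∏ i, ∏ j ∈ Finset.univ.erase i, (z i + q * z j)) /
      (∏ i, ∏ j ∈ Finset.Ioi i, (z i - z j))) *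
    pfaffian (Matrix.of fun i j =>
      (z i ^ 2 - z j ^ 2) / ((z i + q * z j) * (z j + q * z i)))

end Rotor

set_option linter.unusedSectionVars false

/-! When t equals one of the parameters, all weights with a factor w - z vanish, the face in that
column is forced to have both tiles of type 0, and the cylinder is cut open there. A face next to
the cut can be pulled out of the row as an operator on states (`rowOp_right`, `rowOp_left`), which
replaces the Yang–Baxter equation. If the other parameters are t or -q t, suitably placed, the row
is a multiple of a single map of states, whose iterates send every state to one nested state. Hence
the eigenvector is unique up to a factor, and a solution vanishes as soon as a functional that is 1
on the nested state does (`evalv_eq_zero`).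

By uniqueness, the cut row yields exchange and rotation relations up to scalar functions. For an
eigenvector without common divisors these scalars are polynomials; carrying one parameter around the
cylinder and looking at a diagonal shows that they are the expected ones (`IsEigen.factor_eq`). A
vector with these relations is `Good`. Conversely the relations imply the eigenvalue equation, the
symmetry in the two colours, and linear divisors of every component that has no small arcs of one
colour in some window (`Good.X_add_dvd`). The latter produce the trivial factors.

At z_last = -q z_first only states with a small arc across the seam in both colours survive, and
erasing this arc gives the square of a symmetric polynomial times a good vector with two points
fewer (`Good.exists_restr_eq`). Moving the arc by exchanges turns this into a recursion for the
nontrivial factors at z_{m-1} = -q z_0 (`Good.eval_factor_arcPt`). The Pfaffian polynomials satisfy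
the same recursion (`pv_arcPt`), because there only the permutations that pair the two special
points contribute; odd sizes follow by the limit. A nontrivial factor is symmetric in its first m
variables and of degree at most m - 1 in each of them, while vanishing at the special points forces
2 (m - 1) linear factors in z_0 (`eq_zero_of_arcPt`). So the recursion determines it, by induction
in steps of two; the cases m < 2 follow by rotation and exchange of colours.

A ground state with a non-constant common divisor would leave a good vector of too small degree. Its
product with the sum of the variables would factorize too, with another constant, which is absurd
(`Good.not_degreeOf_lt`). So ground states are good. The normalization is settled by the fact that
the product of the two Schur functions obeys the same recursion (`SumFormula.restr`). -/

namespace Rotor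

/-! ### Operations on link patterns -/

/-- `x` is congruent to `i` or `i + 1` modulo `N`. -/
def InPair (N : ℕ) (i x : ℤ) : Prop := (N : ℤ) ∣ x - i ∨ (N : ℤ) ∣ x - i - 1

open Classical in
/-- The exchange of the translates of `i` and `i + 1`. -/
noncomputable def pairSwap (N : ℕ) (i x : ℤ) : ℤ :=
  if (N : ℤ) ∣ x - i then x + 1 else if (N : ℤ) ∣ x - i - 1 then x - 1 else x

/-! ### Arithmetic of two neighbouring points modulo N. -/

section pair

variable {N : ℕ} {i x y : ℤ}

theorem not_dvd_one_of_two_le (hN : 2 ≤ N) : ¬ (N : ℤ) ∣ 1 := by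
  intro h
  have := Int.le_of_dvd one_pos h
  omega

theorem pairSwap_left (h : (N : ℤ) ∣ x - i) : pairSwap N i x = x + 1 := if_pos h

theorem pairSwap_right (hN : 2 ≤ N) (h : (N : ℤ) ∣ x - i - 1) : pairSwap N i x = x - 1 := by
  unfold pairSwap
  rw [if_neg, if_pos h]
  intro h'
  exact not_dvd_one_of_two_le hN (by simpa using dvd_sub h' h)

theorem pairSwap_self (hN : 2 ≤ N) : pairSwap N i (i + 1) = i := by
  rw [pairSwap_right hN (by simp)]; ring

theorem InPair.cases (hN : 2 ≤ N) (h : InPair N i x) :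
    (pairSwap N i x = x + 1 ∨ pairSwap N i x = x - 1) := by
  rcases h with h | h
  · exact Or.inl (pairSwap_left h)
  · exact Or.inr (pairSwap_right hN h)

theorem InPair.swap (hN : 2 ≤ N) (h : InPair N i x) : InPair N i (pairSwap N i x) := by
  rcases h with h | h
  · rw [pairSwap_left h]; right; simpa [add_sub_right_comm] using h
  · rw [pairSwap_right hN h]; left; simpa [sub_right_comm] using h

theorem pairSwap_pairSwap (hN : 2 ≤ N) (h : InPair N i x) :
    pairSwap N i (pairSwap N i x) = x := by
  rcases h with h | h
  · rw [pairSwap_left h, pairSwap_right hN (by simpa [add_sub_right_comm] using h)]; ring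
  · rw [pairSwap_right hN h, pairSwap_left (by simpa [sub_right_comm] using h)]; ring

theorem inPair_add_mul (k : ℤ) : InPair N i (x + N * k) ↔ InPair N i x := by
  unfold InPair
  rw [show x + N * k - i = x - i + N * k by ring,
    show x - i + N * k - 1 = x - i - 1 + N * k by ring]
  simp

theorem pairSwap_add_mul (k : ℤ) : pairSwap N i (x + N * k) = pairSwap N i x + N * k := by
  unfold pairSwap
  rw [show x + N * k - i = x - i + N * k by ring,
    show x - i + N * k - 1 = x - i - 1 + N * k by ring]
  simp only [Int.dvd_add_self_mul]
  split_ifs <;> ring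

theorem InPair.congr (hN : 2 ≤ N) (hx : InPair N i x) (hy : InPair N i y) :
    (∃ k : ℤ, y = x + N * k) ∨ ∃ k : ℤ, y = pairSwap N i x + N * k := by
  rcases hx with hx | hx <;> rcases hy with hy | hy
  · obtain ⟨k, hk⟩ := dvd_sub hy hx
    exact Or.inl ⟨k, by linarith⟩
  · obtain ⟨k, hk⟩ := dvd_sub hy hx
    rw [pairSwap_left hx]
    exact Or.inr ⟨k, by linarith⟩
  · obtain ⟨k, hk⟩ := dvd_sub hy hx
    rw [pairSwap_right hN hx]
    exact Or.inr ⟨k, by linarith⟩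
  · obtain ⟨k, hk⟩ := dvd_sub hy hx
    exact Or.inl ⟨k, by linarith⟩

theorem inPair_self : InPair N i i := Or.inl (by simp)

theorem inPair_succ : InPair N i (i + 1) := Or.inr (by simp)

end pair

/-! ### The Temperley–Lieb generators on link patterns. -/

namespace LinkPattern

variable {N : ℕ}

/-- The structure field reads an arc from its left end only; reading the same arc from its right end
gives the second half. -/
theorem noncrossing' (σ : LinkPattern N) (a b : ℤ) :
    (a < b → b < σ.partner a →
      σ.partner b ≠ b ∧ a < σ.partner b ∧ σ.partner b < σ.partner a) ∧
    (σ.partner a < b → b < a →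
      σ.partner b ≠ b ∧ σ.partner a < σ.partner b ∧ σ.partner b < a) := by
  refine ⟨σ.noncrossing a b, fun h1 h2 => ?_⟩
  have := σ.noncrossing (σ.partner a) b h1 (by rwa [σ.invol])
  rwa [σ.invol] at this

theorem partner_injective (σ : LinkPattern N) : Function.Injective σ.partner := fun a b h => by
  rw [← σ.invol a, h, σ.invol]

/-- This makes the joining case of `tlPartner` consistent. If the mate of σ x were matched inside
the pair, it would be matched with a translate of σ x, which puts x into the pair, or with a
translate of itself, which by involutivity leaves it unmatched. -/
theorem partner_pairSwap {σ : LinkPattern N} (hN : 2 ≤ N) {i x : ℤ} (hx : ¬ InPair N i x)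
    (hy : InPair N i (σ.partner x)) :
    σ.partner (pairSwap N i (σ.partner x)) = pairSwap N i (σ.partner x) ∨
      ¬ InPair N i (σ.partner (pairSwap N i (σ.partner x))) := by
  rw [or_iff_not_imp_right, not_not]
  intro hw
  rcases hy.congr hN hw with ⟨k, hk⟩ | ⟨k, hk⟩
  · exfalso
    have h1 := congrArg σ.partner hk
    rw [σ.invol, σ.partner_add_mul, σ.invol] at h1
    have := hy.swap hN
    rw [h1, inPair_add_mul] at this
    exact hx this
  · have h1 := congrArg σ.partner hk
    rw [σ.invol, σ.partner_add_mul, hk] at h1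
    rw [hk]
    linarith

open Classical in
/-- The partner function of `e_i σ`. -/
noncomputable def tlPartner (i : ℤ) (σ : LinkPattern N) (x : ℤ) : ℤ :=
  if InPair N i x then pairSwap N i x
  else if InPair N i (σ.partner x) then
    if σ.partner (pairSwap N i (σ.partner x)) = pairSwap N i (σ.partner x) then x
    else σ.partner (pairSwap N i (σ.partner x))
  else σ.partner x

theorem tlPartner_cases (hN : 2 ≤ N) (i : ℤ) (σ : LinkPattern N) (x : ℤ) :
    (InPair N i x ∧ tlPartner i σ x = pairSwap N i x) ∨
    (¬ InPair N i x ∧ InPair N i (σ.partner x) ∧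
      σ.partner (pairSwap N i (σ.partner x)) = pairSwap N i (σ.partner x) ∧
      tlPartner i σ x = x) ∨
    (¬ InPair N i x ∧ InPair N i (σ.partner x) ∧
      σ.partner (pairSwap N i (σ.partner x)) ≠ pairSwap N i (σ.partner x) ∧
      ¬ InPair N i (σ.partner (pairSwap N i (σ.partner x))) ∧
      tlPartner i σ x = σ.partner (pairSwap N i (σ.partner x))) ∨
    (¬ InPair N i x ∧ ¬ InPair N i (σ.partner x) ∧ tlPartner i σ x = σ.partner x) := by
  unfold tlPartner
  by_cases h1 : InPair N i x
  · simp [h1]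
  by_cases h2 : InPair N i (σ.partner x)
  · have := partner_pairSwap hN h1 h2
    by_cases h3 : σ.partner (pairSwap N i (σ.partner x)) = pairSwap N i (σ.partner x)
    · simp [h1, h2, h3]
    · simp only [h1, h2, h3, if_true, if_false, not_true, not_false_eq_true, ne_eq]
      tauto
  · simp [h1, h2]

/-- Planarity of `e_i σ` below an arc from a to v, for old and newly joined arcs at once. E contains
the pair points that were attached to a and v, and is empty for an old arc. All other points below
the arc have their old partners there, and a detour through the pair moves by one step, which cannot
jump over a or v since neither is in the pair. -/
theorem tlPartner_between (hN : 2 ≤ N) {i : ℤ} {σ : LinkPattern N} {a v : ℤ}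
    (ha : ¬ InPair N i a) (hv : ¬ InPair N i v) (E : Set ℤ) (hE : ∀ z ∈ E, InPair N i z)
    (hEs : ∀ z, InPair N i z → pairSwap N i z ∈ E → z ∈ E)
    (hσ : ∀ z, σ.partner z ∈ E → z = a ∨ z = v)
    (hC : ∀ z, a < z → z < v → z ∉ E →
      σ.partner z ≠ z ∧ a < σ.partner z ∧ σ.partner z < v) (b : ℤ) (hab : a < b) (hbv : b < v) :
    tlPartner i σ b ≠ b ∧ a < tlPartner i σ b ∧ tlPartner i σ b < v := by
  have ne : ∀ {s t : ℤ}, InPair N i s → ¬ InPair N i t → s ≠ t := by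
    rintro s t hs ht rfl
    exact ht hs
  have sw : ∀ z, InPair N i z → a < z → z < v → a < pairSwap N i z ∧ pairSwap N i z < v ∧
      pairSwap N i z ≠ z := by
    intro z hz h1 h2
    have := hz.cases hN
    have := ne (hz.swap hN) ha
    have := ne (hz.swap hN) hv
    omega
  have main : ¬ InPair N i b → InPair N i (σ.partner b) →
      σ.partner (pairSwap N i (σ.partner b)) ≠ pairSwap N i (σ.partner b) ∧
      a < σ.partner (pairSwap N i (σ.partner b)) ∧
      σ.partner (pairSwap N i (σ.partner b)) < v := by
    intro h1 h2
    have c1 := hC b hab hbv (fun h => h1 (hE b h))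
    have c2 := sw _ h2 c1.2.1 c1.2.2
    refine hC _ c2.1 c2.2.1 (fun h => ?_)
    rcases hσ b (hEs _ h2 h) with e | e <;> omega
  rcases tlPartner_cases hN i σ b with ⟨g1, g⟩ | ⟨g1, g2, g3, g⟩ | ⟨g1, g2, g3, g4, g⟩ |
    ⟨g1, g2, g⟩
  · rw [g]
    have := sw b g1 hab hbv
    tauto
  · exact absurd g3 (main g1 g2).1
  · rw [g]
    refine ⟨fun e => ?_, (main g1 g2).2⟩
    have e' : pairSwap N i (σ.partner b) = σ.partner b := by
      conv_rhs => rw [← e, σ.invol]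
    have := g2.cases hN
    omega
  · rw [g]
    exact hC b hab hbv (fun h => g1 (hE b h))

/-- Two old arcs are joined through the pair. They lie side by side between the new end points, or
the second is nested inside the first, or the second encloses the first. In each shape noncrossing
with both old arcs confines the remaining points. -/
theorem joined_between (hN : 2 ≤ N) {i : ℤ} {σ : LinkPattern N} {a : ℤ}
    (h1 : ¬ InPair N i a) (h2 : InPair N i (σ.partner a))
    (h3 : σ.partner (pairSwap N i (σ.partner a)) ≠ pairSwap N i (σ.partner a))
    (h4 : ¬ InPair N i (σ.partner (pairSwap N i (σ.partner a))))
    (hlt : a < σ.partner (pairSwap N i (σ.partner a))) (z : ℤ) (hz1 : a < z)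
    (hz2 : z < σ.partner (pairSwap N i (σ.partner a)))
    (hz : z ∉ ({σ.partner a, pairSwap N i (σ.partner a)} : Set ℤ)) :
    σ.partner z ≠ z ∧ a < σ.partner z ∧
      σ.partner z < σ.partner (pairSwap N i (σ.partner a)) := by
  have ku := h2.cases hN
  have n1 : σ.partner a ≠ a := fun h => h1 (h ▸ h2)
  have n2 : pairSwap N i (σ.partner a) ≠ a := fun h => h1 (h ▸ h2.swap hN)
  have n3 : σ.partner (pairSwap N i (σ.partner a)) ≠ σ.partner a := fun h => h4 (h.symm ▸ h2)
  generalize hu : pairSwap N i (σ.partner a) = u at *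
  have iv := σ.invol u
  have ia := σ.invol a
  generalize hv : σ.partner u = v at *
  generalize hy : σ.partner a = y at *
  have shape : (a < y ∧ u = y + 1 ∧ u < v) ∨ (v < u ∧ u = y - 1 ∧ a < v) ∨
      (u = y - 1 ∧ y < a) := by
    have c1 := σ.noncrossing' a u
    have c2 := σ.noncrossing' u a
    have c3 := σ.noncrossing' a v
    rw [hy, hv] at c1 c2
    rw [hy, iv] at c3
    omega
  have e1 : z ≠ y := fun h => hz (Or.inl h)
  have e2 : z ≠ u := fun h => hz (Or.inr h)
  have d1 := σ.noncrossing' a z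
  have d2 := σ.noncrossing' u z
  have d3 := σ.noncrossing' a (σ.partner z)
  have d4 := σ.noncrossing' u (σ.partner z)
  rw [hy] at d1
  rw [hv] at d2
  rw [hy, σ.invol] at d3
  rw [hv, σ.invol] at d4
  have l1 : σ.partner z = y → z = a := fun e => by rw [← ia, ← e, σ.invol]
  have l2 : σ.partner z = u → z = v := fun e => by rw [← hv, ← e, σ.invol]
  have l3 : σ.partner z = a → z = y := fun e => by rw [← hy, ← e, σ.invol]
  have l4 : σ.partner z = v → z = u := fun e => by rw [← iv, ← e, σ.invol]
  rcases shape with h | h | h <;> omega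

/-- The action of the Temperley-Lieb generator `e_i`: the points `i` and `i + 1` are joined by a
small arc, and so are their former partners. -/
noncomputable def tl (i : ℤ) (σ : LinkPattern N) : LinkPattern N :=
  if hN : 2 ≤ N then
  { partner := tlPartner i σ
    invol := fun x => by
      rcases tlPartner_cases hN i σ x with ⟨h1, h⟩ | ⟨h1, h2, h3, h⟩ | ⟨h1, h2, h3, h4, h⟩ |
        ⟨h1, h2, h⟩
      · rw [h, tlPartner, if_pos (h1.swap hN), pairSwap_pairSwap hN h1]
      · rw [h, h]
      · rw [h, tlPartner, if_neg h4, σ.invol, if_pos (h2.swap hN), pairSwap_pairSwap hN h2,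
          σ.invol, if_neg]
        intro e
        rw [← e] at h2
        exact h1 h2
      · rw [h, tlPartner, if_neg h2, σ.invol, if_neg h1]
    periodic := fun x => by
      unfold tlPartner
      have p : ∀ y, InPair N i (y + N) ↔ InPair N i y := fun y => by
        simpa using inPair_add_mul (N := N) (i := i) (x := y) 1
      have s : ∀ y, pairSwap N i (y + N) = pairSwap N i y + N := fun y => by
        simpa using pairSwap_add_mul (N := N) (i := i) (x := y) 1
      by_cases h1 : InPair N i x
      · rw [if_pos h1, if_pos ((p x).2 h1), s]
      rw [if_neg h1, if_neg (fun h => h1 ((p x).1 h)), σ.periodic]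
      by_cases h2 : InPair N i (σ.partner x)
      · rw [if_pos h2, if_pos ((p _).2 h2), s, σ.periodic]
        by_cases h3 : σ.partner (pairSwap N i (σ.partner x)) = pairSwap N i (σ.partner x)
        · rw [if_pos h3, if_pos (by rw [h3])]
        · rw [if_neg h3, if_neg (fun h => h3 (by linarith))]
      · rw [if_neg h2, if_neg (fun h => h2 ((p _).1 h))]
    noncrossing := fun a b hab hb => by
      change b < tlPartner i σ a at hb
      rcases tlPartner_cases hN i σ a with ⟨h1, h⟩ | ⟨h1, h2, h3, h⟩ | ⟨h1, h2, h3, h4, h⟩ |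
        ⟨h1, h2, h⟩
      · rw [h] at hb
        have := h1.cases hN
        omega
      · omega
      · rw [h] at hb ⊢
        refine tlPartner_between hN h1 h4 {σ.partner a, pairSwap N i (σ.partner a)} ?_ ?_ ?_ ?_
          b hab hb
        · rintro z (rfl | rfl)
          · exact h2
          · exact h2.swap hN
        · rintro z hz (e | e)
          · right; rw [← e, pairSwap_pairSwap hN hz]; rfl
          · left; rw [← pairSwap_pairSwap hN hz, e, pairSwap_pairSwap hN h2]
        · rintro z (e | e)
          · left; exact σ.partner_injective e
          · right; rw [← e, σ.invol]
        · exact joined_between hN h1 h2 h3 h4 (hab.trans hb)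
      · rw [h] at hb ⊢
        exact tlPartner_between hN h1 h2 ∅ (by simp) (by simp) (by simp)
          (fun z hz1 hz2 _ => σ.noncrossing a z hz1 hz2) b hab hb
    unmatched := fun a b ha hb => by
      -- A point unmatched after `e_i` was unmatched before, or it was joined to a pair point whose
      -- mate was unmatched. The two alternatives exclude each other: the unmatched line of σ would
      -- lie in the pair, where `e_i` matches it.
      have aux : ∀ x, tlPartner i σ x = x → σ.partner x = x ∨
          (InPair N i (σ.partner x) ∧
            σ.partner (pairSwap N i (σ.partner x)) = pairSwap N i (σ.partner x)) := by
        intro x hx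
        rcases tlPartner_cases hN i σ x with ⟨h1, h⟩ | ⟨h1, h2, h3, h⟩ | ⟨h1, h2, h3, h4, h⟩ |
          ⟨h1, h2, h⟩
        · have := h1.cases hN
          omega
        · exact Or.inr ⟨h2, h3⟩
        · exfalso
          have e : pairSwap N i (σ.partner x) = σ.partner x := by
            conv_rhs => rw [← hx, h, σ.invol]
          have := h2.cases hN
          omega
        · exact Or.inl (by rw [← h, hx])
      have aux2 : ∀ x y, σ.partner x = x → InPair N i (σ.partner y) →
          σ.partner (pairSwap N i (σ.partner y)) = pairSwap N i (σ.partner y) →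
          tlPartner i σ x = x → False := by
        intro x y hx hy1 hy2 hx2
        obtain ⟨k, hk⟩ := σ.unmatched _ _ hx hy2
        have : x = pairSwap N i (σ.partner y) + N * k := by linarith
        have hS : InPair N i x := by rw [this, inPair_add_mul]; exact hy1.swap hN
        rw [tlPartner, if_pos hS] at hx2
        have := hS.cases hN
        omega
      rcases aux a ha with h | ⟨h, h'⟩ <;> rcases aux b hb with g | ⟨g, g'⟩
      · exact σ.unmatched a b h g
      · exact (aux2 a b h g g' ha).elim
      · exact (aux2 b a g h h' hb).elim
      · obtain ⟨k, hk⟩ := σ.unmatched _ _ h' g'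
        have e : pairSwap N i (σ.partner a) = pairSwap N i (σ.partner b) + N * k := by linarith
        rw [← pairSwap_add_mul] at e
        have e' := congrArg (pairSwap N i) e
        rw [pairSwap_pairSwap hN h, pairSwap_pairSwap hN ((inPair_add_mul k).2 g)] at e'
        have := congrArg σ.partner e'
        rw [σ.invol, σ.partner_add_mul, σ.invol] at this
        exact ⟨k, by linarith⟩ }
  else σ

theorem tl_partner (hN : 2 ≤ N) (i : ℤ) (σ : LinkPattern N) :
    (tl i σ).partner = tlPartner i σ := by
  rw [tl, dif_pos hN]

end LinkPattern
namespace LinkPattern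

variable {N : ℕ}

theorem tl_partner_left (hN : 2 ≤ N) (i : ℤ) (σ : LinkPattern N) :
    (tl i σ).partner i = i + 1 := by
  rw [tl_partner hN, tlPartner, if_pos inPair_self, pairSwap_left (by simp)]

theorem tl_eq_self {i : ℤ} {σ : LinkPattern N} (h : σ.partner i = i + 1) : tl i σ = σ := by
  by_cases hN : 2 ≤ N
  swap
  · rw [tl, dif_neg hN]
  have hS : ∀ x, InPair N i x → σ.partner x = pairSwap N i x := by
    rintro x (⟨k, hk⟩ | ⟨k, hk⟩)
    · rw [pairSwap_left ⟨k, hk⟩, show x = i + N * k by linarith, σ.partner_add_mul, h]; ring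
    · have : σ.partner (i + 1) = i := by rw [← h, σ.invol]
      rw [pairSwap_right hN ⟨k, hk⟩, show x = i + 1 + N * k by linarith, σ.partner_add_mul, this]
      ring
  ext x
  rw [tl_partner hN]
  rcases tlPartner_cases hN i σ x with ⟨h1, g⟩ | ⟨h1, h2, h3, g⟩ | ⟨h1, h2, h3, h4, g⟩ |
    ⟨h1, h2, g⟩
  · rw [g, hS x h1]
  · exact absurd (by rw [← σ.invol x, hS _ h2]; exact h2.swap hN) h1
  · exact absurd (by rw [← σ.invol x, hS _ h2]; exact h2.swap hN) h1
  · exact g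

theorem tl_partner_of_small {i j : ℤ} {σ : LinkPattern N} (hN : 2 ≤ N)
    (h : σ.partner j = j + 1) (h1 : ¬ InPair N i j) (h2 : ¬ InPair N i (j + 1)) :
    (tl i σ).partner j = j + 1 := by
  rw [tl_partner hN, tlPartner, if_neg h1, h, if_neg h2]

/-- The rotation of a link pattern by one step. -/
def rot (σ : LinkPattern N) : LinkPattern N where
  partner x := σ.partner (x - 1) + 1
  invol x := by simp [σ.invol]
  periodic x := by
    rw [show x + (N : ℤ) - 1 = x - 1 + N by ring, σ.periodic]; ring
  noncrossing a b h1 h2 := by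
    have := σ.noncrossing (a - 1) (b - 1) (by omega) (by omega)
    omega
  unmatched a b h1 h2 := by
    have := σ.unmatched (a - 1) (b - 1) (by omega) (by omega)
    simpa using this

theorem rot_partner (σ : LinkPattern N) (x : ℤ) : (rot σ).partner x = σ.partner (x - 1) + 1 := rfl

theorem rot_injective : Function.Injective (rot : LinkPattern N → LinkPattern N) := by
  intro σ τ h
  ext x
  have := congrArg (fun ρ => ρ.partner (x + 1)) h
  simpa [rot_partner] using this

theorem rot_tl (i : ℤ) (σ : LinkPattern N) : rot (tl i σ) = tl (i + 1) (rot σ) := by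
  by_cases hN : 2 ≤ N
  swap
  · rw [tl, tl, dif_neg hN, dif_neg hN]
  have p : ∀ x, InPair N (i + 1) (x + 1) ↔ InPair N i x := fun x => by
    unfold InPair
    rw [show x + 1 - (i + 1) = x - i by ring]
  have s : ∀ x, pairSwap N (i + 1) (x + 1) = pairSwap N i x + 1 := fun x => by
    unfold pairSwap
    rw [show x + 1 - (i + 1) = x - i by ring]
    split_ifs <;> ring
  ext x
  obtain ⟨x, rfl⟩ : ∃ y, x = y + 1 := ⟨x - 1, by ring⟩
  rw [rot_partner, tl_partner hN, tl_partner hN]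
  unfold tlPartner
  rw [rot_partner, add_sub_cancel_right]
  by_cases h1 : InPair N i x
  · rw [if_pos h1, if_pos ((p x).2 h1), s]
  rw [if_neg h1, if_neg (fun h => h1 ((p x).1 h))]
  by_cases h2 : InPair N i (σ.partner x)
  · rw [if_pos h2, if_pos ((p _).2 h2), s, rot_partner, add_sub_cancel_right]
    by_cases h3 : σ.partner (pairSwap N i (σ.partner x)) = pairSwap N i (σ.partner x)
    · rw [if_pos h3, if_pos (by rw [h3])]
    · rw [if_neg h3, if_neg (fun h => h3 (by linarith))]
  · rw [if_neg h2, if_neg (fun h => h2 ((p _).1 h))]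

/-- `e_{i+1} e_i` fixes the link patterns in the image of `e_{i+1}`. -/
theorem tl_succ_tl (hN : 3 ≤ N) {i : ℤ} {σ : LinkPattern N} (h : σ.partner (i + 1) = i + 2) :
    tl (i + 1) (tl i σ) = σ := by
  have hN2 : 2 ≤ N := by omega
  have nd1 : ¬ (N : ℤ) ∣ 1 := not_dvd_one_of_two_le hN2
  have nd2 : ¬ (N : ℤ) ∣ 2 := fun h => by
    have := Int.le_of_dvd two_pos h
    omega
  have h' : σ.partner (i + 2) = i + 1 := by rw [← h, σ.invol]
  -- it suffices to compare the partners of the points outside of the translates of `i+1, i+2`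
  have hper : ∀ x k : ℤ, (tl (i + 1) (tl i σ)).partner x = σ.partner x →
      (tl (i + 1) (tl i σ)).partner (x + N * k) = σ.partner (x + N * k) := fun x k e => by
    rw [partner_add_mul, partner_add_mul, e]
  have outside : ∀ x, ¬ (N : ℤ) ∣ x - i → ¬ (N : ℤ) ∣ x - i - 1 → ¬ (N : ℤ) ∣ x - i - 2 →
      ¬ InPair N i x ∧ ¬ InPair N (i + 1) x := by
    intro x h0 h1 h2
    constructor
    · rintro (h | h) <;> contradiction
    · rintro (h | h)
      · exact h1 (by rwa [sub_sub])
      · exact h2 (by rwa [show x - i - 2 = x - (i + 1) - 1 by ring])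
  have hii : ¬ InPair N (i + 1) i := by
    rintro (h | h)
    · exact nd1 (by simpa using h)
    · exact nd2 (by rw [show i - (i + 1) - 1 = -2 by ring] at h; exact (dvd_neg.1 h))
  have hi2 : ¬ InPair N i (i + 2) := by
    rintro (h | h)
    · exact nd2 (by simpa using h)
    · exact nd1 (by rwa [show i + 2 - i - 1 = 1 by ring] at h)
  have e0 : (tl i σ).partner i = i + 1 := tl_partner_left hN2 i σ
  have e1 : (tl i σ).partner (i + 1) = i := by rw [← e0, invol]
  have s1 : pairSwap N (i + 1) (i + 1) = i + 2 := by rw [pairSwap_left (by simp)]; ring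
  have s0 : pairSwap N i (i + 1) = i := pairSwap_self hN2
  have s0' : pairSwap N i i = i + 1 := pairSwap_left (by simp)
  have e2 : (tl i σ).partner (i + 2) = if σ.partner i = i then i + 2 else σ.partner i := by
    rw [tl_partner hN2, tlPartner, if_neg hi2, h', if_pos inPair_succ, s0]
  ext x
  by_cases hx0 : (N : ℤ) ∣ x - i
  · obtain ⟨k, hk⟩ := hx0
    rw [show x = i + N * k by linarith]
    apply hper
    rw [tl_partner hN2, tlPartner, if_neg hii, e0, if_pos inPair_self, s1, e2]
    by_cases hf : σ.partner i = i
    · rw [if_pos hf, if_pos rfl, hf]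
    · rw [if_neg hf, if_neg]
      intro e
      have := congrArg σ.partner e
      rw [σ.invol, h'] at this
      omega
  by_cases hx1 : (N : ℤ) ∣ x - i - 1
  · obtain ⟨k, hk⟩ := hx1
    rw [show x = i + 1 + N * k by linarith]
    apply hper
    rw [tl_partner_left hN2, h]; ring
  by_cases hx2 : (N : ℤ) ∣ x - i - 2
  · obtain ⟨k, hk⟩ := hx2
    rw [show x = i + 2 + N * k by linarith]
    apply hper
    rw [h', show i + 2 = i + 1 + 1 by ring, ← tl_partner_left hN2 (i + 1) (tl i σ), invol]
  obtain ⟨o1, o2⟩ := outside x hx0 hx1 hx2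
  by_cases hy : (N : ℤ) ∣ σ.partner x - i
  · -- the partner of `x` is a translate of `i`
    obtain ⟨k, hk⟩ := hy
    have hxe : x = σ.partner i + N * k := by
      rw [← σ.invol x, show σ.partner x = i + N * k by linarith, σ.partner_add_mul]
    rw [hxe]
    apply hper
    rw [hxe, inPair_add_mul] at o1 o2
    have hf : σ.partner i ≠ i := fun e => o1 (by rw [e]; exact inPair_self)
    rw [if_neg hf] at e2
    have e3 : (tl i σ).partner (σ.partner i) = i + 2 := by rw [← e2, invol]
    have hd : (N : ℤ) ∣ i + 2 - (i + 1) - 1 := ⟨0, by ring⟩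
    have hp2 : InPair N (i + 1) (i + 2) := Or.inr hd
    have hs2 : pairSwap N (i + 1) (i + 2) = i + 1 := by
      rw [pairSwap_right hN2 hd]; ring
    rw [tl_partner hN2, tlPartner, if_neg o2, e3, if_pos hp2, hs2, e1, if_neg (by omega), σ.invol]
  · have hy1 : ¬ (N : ℤ) ∣ σ.partner x - i - 1 := fun ⟨k, hk⟩ => hx2 ⟨k, by
      rw [← σ.invol x, show σ.partner x = i + 1 + N * k by linarith, σ.partner_add_mul, h]; ring⟩
    have hy2 : ¬ (N : ℤ) ∣ σ.partner x - i - 2 := fun ⟨k, hk⟩ => hx1 ⟨k, by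
      rw [← σ.invol x, show σ.partner x = i + 2 + N * k by linarith, σ.partner_add_mul, h']; ring⟩
    obtain ⟨p1, p2⟩ := outside _ hy hy1 hy2
    have e3 : (tl i σ).partner x = σ.partner x := by
      rw [tl_partner hN2, tlPartner, if_neg o1, if_neg p1]
    rw [tl_partner hN2, tlPartner, if_neg o2, e3, if_neg p2]

/-! ### Insertion of a small arc -/

section ins

variable {n : ℕ} [NeZero n]

/-- The position of the point `y` after the insertion of two points at `i` and `i + 1`. -/
def insPos (n : ℕ) (i y : ℤ) : ℤ := y + 1 + 2 * ((y + 1 - i) / n + 1)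

/-- This fixes the numbering: the new points i and i + 1 come between the old points i - 2 and i -
1, which move to i - 1 and i + 2. In particular, insertion at n + 1 shifts the points 0, …, n - 1 to
1, …, n. -/
theorem insPos_apply (i : ℤ) {y : ℤ} (k : ℤ) (h0 : 0 ≤ y) (h1 : y < n) :
    insPos n i (i - 1 + y + n * k) = i + 2 + y + ((n + 2 : ℕ) : ℤ) * k := by
  have hn : (n : ℤ) ≠ 0 := by exact_mod_cast NeZero.ne n
  unfold insPos
  rw [show i - 1 + y + (n : ℤ) * k + 1 - i = y + n * k by ring, Int.add_mul_ediv_left _ _ hn,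
    Int.ediv_eq_zero_of_lt h0 h1]
  push_cast
  ring

theorem insPos_strictMono (i : ℤ) : StrictMono (insPos n i) := by
  intro a b hab
  unfold insPos
  have := Int.ediv_le_ediv (show 0 < (n : ℤ) by exact_mod_cast NeZero.pos n)
    (show a + 1 - i ≤ b + 1 - i by omega)
  omega

theorem insPos_add_mul (i y k : ℤ) : insPos n i (y + n * k) =
    insPos n i y + ((n + 2 : ℕ) : ℤ) * k := by
  have hn : (n : ℤ) ≠ 0 := by exact_mod_cast NeZero.ne n
  unfold insPos
  rw [show y + (n : ℤ) * k + 1 - i = y + 1 - i + n * k by ring, Int.add_mul_ediv_left _ _ hn]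
  push_cast
  ring

theorem insPos_coord (i x : ℤ) : InPair (n + 2) i x ∨ ∃ y, x = insPos n i y := by
  obtain ⟨y, k, h0, h1, rfl⟩ := nested_coord (N := n + 2) i x
  by_cases hy0 : y = 0
  · left; left; exact ⟨k, by rw [hy0]; ring⟩
  by_cases hy1 : y = 1
  · left; right; exact ⟨k, by rw [hy1]; ring⟩
  refine Or.inr ⟨i - 1 + (y - 2) + n * k, ?_⟩
  rw [insPos_apply _ _ (by omega) (by push_cast at h1; omega)]
  ring

theorem not_inPair_insPos (i y : ℤ) : ¬ InPair (n + 2) i (insPos n i y) := by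
  obtain ⟨y, k, h0, h1, rfl⟩ := nested_coord (N := n) (i - 1) y
  rw [insPos_apply _ _ h0 h1, inPair_add_mul]
  rintro (h | h)
  · have := Int.le_of_dvd (by omega) h
    push_cast at this
    omega
  · have := Int.le_of_dvd (by omega) h
    push_cast at this
    omega

open Classical in
/-- The partner function of the link pattern with an inserted small arc. -/
noncomputable def insPartner (i : ℤ) (σ : LinkPattern n) (x : ℤ) : ℤ :=
  if h : InPair (n + 2) i x then pairSwap (n + 2) i x
  else insPos n i (σ.partner ((insPos_coord i x).resolve_left h).choose)

theorem insPartner_insPos (i : ℤ) (σ : LinkPattern n) (y : ℤ) :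
    insPartner i σ (insPos n i y) = insPos n i (σ.partner y) := by
  unfold insPartner
  rw [dif_neg (not_inPair_insPos i y)]
  congr 2
  have := ((insPos_coord i (insPos n i y)).resolve_left (not_inPair_insPos i y)).choose_spec
  exact ((insPos_strictMono i).injective this).symm

theorem insPartner_pair {i : ℤ} (σ : LinkPattern n) {x : ℤ} (h : InPair (n + 2) i x) :
    insPartner i σ x = pairSwap (n + 2) i x := by
  rw [insPartner, dif_pos h]

/-- The insertion of a small arc between two new points `i` and `i + 1`. -/
noncomputable def ins (i : ℤ) (σ : LinkPattern n) : LinkPattern (n + 2) where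
  partner := insPartner i σ
  invol x := by
    rcases insPos_coord (n := n) i x with h | ⟨y, rfl⟩
    · rw [insPartner_pair σ h, insPartner_pair σ (h.swap (by omega)),
        pairSwap_pairSwap (by omega) h]
    · rw [insPartner_insPos, insPartner_insPos, σ.invol]
  periodic x := by
    rcases insPos_coord (n := n) i x with h | ⟨y, rfl⟩
    · have := (inPair_add_mul 1).2 h
      rw [mul_one] at this
      rw [insPartner_pair σ h, insPartner_pair σ this]
      simpa using pairSwap_add_mul (N := n + 2) (i := i) (x := x) 1
    · have := insPos_add_mul (n := n) i y 1
      rw [mul_one, mul_one] at this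
      rw [← this, insPartner_insPos, insPartner_insPos, σ.periodic]
      simpa using insPos_add_mul (n := n) i (σ.partner y) 1
  noncrossing a b hab hb := by
    rcases insPos_coord (n := n) i a with h | ⟨y, rfl⟩
    · rw [insPartner_pair σ h] at hb
      have := h.cases (by omega)
      omega
    · rw [insPartner_insPos] at hb ⊢
      rcases insPos_coord (n := n) i b with h | ⟨z, rfl⟩
      · have h' := h.swap (by omega)
        have n1 : ∀ t, pairSwap (n + 2) i b ≠ insPos n i t := fun t e =>
          not_inPair_insPos (n := n) i t (e ▸ h')
        have := n1 y
        have := n1 (σ.partner y)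
        rw [insPartner_pair σ h]
        have := h.cases (by omega)
        omega
      · rw [insPartner_insPos]
        have mono := insPos_strictMono (n := n) i
        have := σ.noncrossing y z (mono.lt_iff_lt.1 hab) (mono.lt_iff_lt.1 hb)
        exact ⟨fun e => this.1 (mono.injective e), mono this.2.1, mono this.2.2⟩
  unmatched a b ha hb := by
    rcases insPos_coord (n := n) i a with h | ⟨y, rfl⟩
    · rw [insPartner_pair σ h] at ha
      have := h.cases (by omega)
      omega
    rcases insPos_coord (n := n) i b with h | ⟨z, rfl⟩
    · rw [insPartner_pair σ h] at hb
      have := h.cases (by omega)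
      omega
    have mono := insPos_strictMono (n := n) i
    rw [insPartner_insPos] at ha hb
    obtain ⟨k, hk⟩ := σ.unmatched y z (mono.injective ha) (mono.injective hb)
    rw [show y = z + n * k by linarith, insPos_add_mul]
    exact ⟨k, by ring⟩

theorem ins_partner_insPos (i : ℤ) (σ : LinkPattern n) (y : ℤ) :
    (ins i σ).partner (insPos n i y) = insPos n i (σ.partner y) := insPartner_insPos i σ y

theorem ins_partner_pair {i : ℤ} (σ : LinkPattern n) {x : ℤ} (h : InPair (n + 2) i x) :
    (ins i σ).partner x = pairSwap (n + 2) i x := insPartner_pair σ h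

theorem ins_partner_left (i : ℤ) (σ : LinkPattern n) : (ins i σ).partner i = i + 1 := by
  rw [ins_partner_pair σ inPair_self, pairSwap_left (by simp)]

theorem ins_injective (i : ℤ) : Function.Injective (ins (n := n) i) := by
  intro σ τ h
  ext x
  have := congrArg (fun ρ => ρ.partner (insPos n i x)) h
  simp only [ins_partner_insPos] at this
  exact (insPos_strictMono i).injective this

/-- A link pattern with a small arc at `i` arises by insertion of this arc. -/
theorem exists_ins {i : ℤ} {τ : LinkPattern (n + 2)} (h : τ.partner i = i + 1) :
    ∃ σ : LinkPattern n, ins i σ = τ := by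
  have hS : ∀ x, InPair (n + 2) i x → τ.partner x = pairSwap (n + 2) i x := fun x hx => by
    conv_lhs => rw [← tl_eq_self h]
    rw [tl_partner (by omega), tlPartner, if_pos hx]
  have hc : ∀ y, ∃ z, τ.partner (insPos n i y) = insPos n i z := fun y => by
    refine (insPos_coord i _).resolve_left fun hp => not_inPair_insPos (n := n) i y ?_
    rw [← τ.invol (insPos n i y), hS _ hp]
    exact hp.swap (by omega)
  choose f hf using hc
  have mono := insPos_strictMono (n := n) i
  have key : ∀ y z, z = f y ↔ insPos n i z = τ.partner (insPos n i y) := fun y z => by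
    rw [hf, mono.injective.eq_iff]
  refine ⟨⟨f, fun y => ?_, fun y => ?_, fun a b hab hb => ?_, fun a b ha hb => ?_⟩, ?_⟩
  · symm
    rw [key, ← hf, τ.invol]
  · symm
    rw [key]
    have e1 := insPos_add_mul (n := n) i y 1
    have e2 := insPos_add_mul (n := n) i (f y) 1
    rw [mul_one, mul_one] at e1 e2
    rw [e1, e2, τ.periodic, hf]
  · have := τ.noncrossing (insPos n i a) (insPos n i b) (mono hab) (by rw [hf]; exact mono hb)
    rw [hf, hf] at this
    exact ⟨fun e => this.1 (by rw [e]), mono.lt_iff_lt.1 this.2.1, mono.lt_iff_lt.1 this.2.2⟩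
  · obtain ⟨k, hk⟩ := τ.unmatched (insPos n i a) (insPos n i b) (by rw [hf, ha]) (by rw [hf, hb])
    have : insPos n i a = insPos n i (b + n * k) := by rw [insPos_add_mul]; linarith
    exact ⟨k, by have := mono.injective this; linarith⟩
  · ext x
    rcases insPos_coord (n := n) i x with h | ⟨y, rfl⟩
    · rw [ins_partner_pair _ h, hS x h]
    · rw [ins_partner_insPos, hf]

theorem insPos_rot (n : ℕ) (i y : ℤ) : insPos n (i + 1) (y + 1) = insPos n i y + 1 := by
  unfold insPos
  rw [show y + 1 + 1 - (i + 1) = y + 1 - i by ring]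
  ring

theorem rot_ins (i : ℤ) (σ : LinkPattern n) : rot (ins i σ) = ins (i + 1) (rot σ) := by
  ext x
  rcases insPos_coord (n := n) (i + 1) x with h | ⟨y, rfl⟩
  · obtain ⟨x, rfl⟩ : ∃ y, x = y + 1 := ⟨x - 1, by ring⟩
    have p : InPair (n + 2) i x := by
      unfold InPair at h ⊢
      rwa [show x + 1 - (i + 1) = x - i by ring] at h
    have s : pairSwap (n + 2) (i + 1) (x + 1) = pairSwap (n + 2) i x + 1 := by
      unfold pairSwap
      rw [show x + 1 - (i + 1) = x - i by ring]
      split_ifs <;> ring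
    rw [ins_partner_pair _ h, rot_partner, add_sub_cancel_right, ins_partner_pair _ p, s]
  · obtain ⟨y, rfl⟩ : ∃ z, y = z + 1 := ⟨y - 1, by ring⟩
    rw [ins_partner_insPos, rot_partner, insPos_rot, add_sub_cancel_right, ins_partner_insPos,
      rot_partner, add_sub_cancel_right, insPos_rot]

end ins

end LinkPattern

/-! ### Rows of tiles -/

theorem col_eq_iff {N : ℕ} [NeZero N] {i j : ℤ} : (col i : Fin N) = col j ↔ (N : ℤ) ∣ i - j := by
  have hN : 0 < (N : ℤ) := by exact_mod_cast Nat.pos_of_ne_zero (NeZero.ne N)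
  have h1 := Int.emod_nonneg i hN.ne'
  have h2 := Int.emod_nonneg j hN.ne'
  rw [Fin.ext_iff]
  change (i % N).toNat = (j % N).toNat ↔ _
  rw [show (i % N).toNat = (j % N).toNat ↔ j % N = i % N by omega]
  exact Int.emod_eq_emod_iff_emod_sub_eq_zero.trans (by
    rw [← Int.dvd_iff_emod_eq_zero, ← dvd_neg, neg_sub])

theorem col_add_mul {N : ℕ} [NeZero N] (i k : ℤ) : (col (i + N * k) : Fin N) = col i := by
  rw [col_eq_iff]; simp

theorem col_val {N : ℕ} [NeZero N] (c : Fin N) : col ((c : ℕ) : ℤ) = c := by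
  have hN : 0 < (N : ℤ) := by exact_mod_cast Nat.pos_of_ne_zero (NeZero.ne N)
  ext
  change (((c : ℕ) : ℤ) % N).toNat = c
  rw [Int.emod_eq_of_lt (by omega) (by exact_mod_cast c.2)]
  simp

theorem eqvGen_map {α β : Type*} {R : α → α → Prop} {S : β → β → Prop} (f : α → β)
    (h : ∀ a b, R a b → Relation.EqvGen S (f a) (f b)) {a b : α} (hab : Relation.EqvGen R a b) :
    Relation.EqvGen S (f a) (f b) := by
  induction hab with
  | rel a b hab => exact h a b hab
  | refl a => exact .refl _
  | symm a b _ ih => exact .symm _ _ ih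
  | trans a b c _ _ ih ih' => exact .trans _ _ _ ih ih'

variable {N : ℕ} [NeZero N]

/-- `IsRowImage` is silent about i = j, but the unmatched points are those left over by the others.
-/
theorem IsRowImage.unique {r : Fin N → Bool} {σ τ τ' : LinkPattern N} (h : IsRowImage r σ τ)
    (h' : IsRowImage r σ τ') : τ = τ' := by
  ext i
  by_cases hi : i = τ.partner i
  · by_contra hne
    have hi' : i ≠ τ'.partner i := fun e => hne (hi.symm.trans e)
    exact hne ((h i _ hi').2 ((h' i _ hi').1 rfl))
  · exact ((h' i _ hi).2 ((h i _ hi).1 rfl)).symm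

theorem isRowImage_false (σ : LinkPattern N) : IsRowImage (fun _ => false) σ σ.rot := by
  intro i j hij
  have up : ∀ a, Relation.EqvGen (Line (fun _ => false) σ) (.bot a) (.top (a - 1)) := fun a =>
    .trans _ _ _ (.rel _ _ (.botLeft a rfl)) (.symm _ _ (.rel _ _ (.topRight (a - 1) rfl)))
  constructor
  · intro h
    refine .trans _ _ _ (up i) (.trans _ _ _ (.rel _ _ (.arc _)) (.symm _ _ ?_))
    have := up j
    rwa [show j - 1 = σ.partner (i - 1) by rw [← h, LinkPattern.rot_partner]; ring] at this
  · intro h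
    -- g labels each line by the smaller of its two bottom end points. It is constant along lines,
    -- so connected bottom points with equal labels are equal or partners.
    let g : Edge → ℤ := fun e => match e with
      | .bot a => min a (σ.rot.partner a)
      | .top a => min (a + 1) (σ.partner a + 1)
      | .side a => min (a + 1) (σ.partner a + 1)
    have key : ∀ a b, Relation.EqvGen (Line (fun _ => false) σ) a b → g a = g b := by
      intro a b hab
      induction hab with
      | rel a b hab =>
        cases hab with
        | botLeft i _ =>
          simp only [g, LinkPattern.rot_partner]
          rw [sub_add_cancel]
        | topRight i _ => rfl
        | botRight i h => simp at h
        | topLeft i h => simp at h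
        | arc i => simp [g, σ.invol, min_comm]
      | refl a => rfl
      | symm a b _ ih => exact ih.symm
      | trans a b c _ _ ih ih' => exact ih.trans ih'
    have := key _ _ h
    simp only [g] at this
    have e1 := σ.rot.invol i
    have e2 := σ.rot.invol j
    rcases min_choice i (σ.rot.partner i) with h1 | h1 <;>
      rcases min_choice j (σ.rot.partner j) with h2 | h2 <;> rw [h1, h2] at this
    · exact absurd this hij
    · rw [this, e2]
    · exact this
    · exact absurd (by rw [← e1, this, e2]) hij

/-! ### Trading a tile of type `true` for a Temperley–Lieb generator. -/

section exchange

open Classical in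
/-- The tops of the columns `i`, `i + 1` in a row of type `false`, `true` are replaced by the points
they are connected to. -/
noncomputable def liftTop {N : ℕ} (σ : LinkPattern N) (i x : ℤ) : Edge :=
  if ¬ InPair N i (σ.partner x) then .top (σ.partner x)
  else if ¬ InPair N i (σ.partner (x + 1)) then .top (σ.partner (x + 1))
  else .bot 0

open Classical in
/-- See `liftTop`. -/
noncomputable def liftEdge {N : ℕ} (σ : LinkPattern N) (i : ℤ) : Edge → Edge
  | .bot a => .bot a
  | .side a => if (N : ℤ) ∣ a - i then liftTop σ i a else .side a
  | .top a => if (N : ℤ) ∣ a - i then liftTop σ i a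
      else if (N : ℤ) ∣ a - i - 1 then liftTop σ i (a - 1) else .top a

open Classical in
/-- The edges above the point `i + 1` in a row of type `false`, `false` on top of an arc are
contracted. -/
noncomputable def dropEdge (N : ℕ) (i : ℤ) : Edge → Edge
  | .bot a => .bot a
  | .side a => if (N : ℤ) ∣ a - i then .bot (a + 1) else .side a
  | .top a => if (N : ℤ) ∣ a - i then .bot (a + 1)
      else if (N : ℤ) ∣ a - i - 1 then .bot a else .top a

theorem not_dvd_succ {N : ℕ} (hN : 2 ≤ N) {a i : ℤ} (h : (N : ℤ) ∣ a - i - 1) : ¬ (N : ℤ) ∣ a - i :=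
  fun h' => not_dvd_one_of_two_le hN (by simpa using dvd_sub h' h)

theorem not_dvd_pred {N : ℕ} (hN : 2 ≤ N) {a i : ℤ} (h : (N : ℤ) ∣ a - i) : ¬ (N : ℤ) ∣ a - i - 1 :=
  fun h' => not_dvd_one_of_two_le hN (by simpa using dvd_sub h h')

theorem partner_translate {N : ℕ} {σ : LinkPattern N} {x k : ℤ} (h : σ.partner x = x + N * k) : σ.partner x = x := by
  have := σ.invol x
  rw [h, σ.partner_add_mul, h] at this
  have h0 : (N : ℤ) * k = 0 := by linarith
  rw [h, h0, add_zero]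

/-- If the partner of a point `x` of the pair is in the pair, then `x` is unmatched or the partner
of its mate is in the pair too. -/
theorem partner_inPair {N : ℕ} {σ : LinkPattern N} {i : ℤ} (hN : 2 ≤ N) {x : ℤ} (hx : InPair N i x) (h : InPair N i (σ.partner x)) :
    σ.partner x = x ∨ InPair N i (σ.partner (pairSwap N i x)) := by
  rcases hx.congr hN h with ⟨k, hk⟩ | ⟨k, hk⟩
  · exact Or.inl (partner_translate hk)
  · right
    have : σ.partner (pairSwap N i x) = x + N * (-k) := by
      rw [show pairSwap N i x = σ.partner x + N * (-k) by rw [hk]; ring, σ.partner_add_mul, σ.invol]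
    rw [this, inPair_add_mul]
    exact hx

theorem liftEdge_pair {N : ℕ} {σ : LinkPattern N} {i : ℤ} (hN : 2 ≤ N) {a : ℤ} (h : (N : ℤ) ∣ a - i) :
    liftEdge σ i (.top a) = liftTop σ i a ∧ liftEdge σ i (.side a) = liftTop σ i a ∧
      liftEdge σ i (.top (a + 1)) = liftTop σ i a := by
  have h' : (N : ℤ) ∣ a + 1 - i - 1 := by rwa [show a + 1 - i - 1 = a - i by ring]
  refine ⟨if_pos h, if_pos h, ?_⟩
  rw [liftEdge, if_neg (not_dvd_succ hN h'), if_pos h', add_sub_cancel_right]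

variable {r : Fin N → Bool} {σ : LinkPattern N} {i : ℤ}

/-- In the row on top of `e_i σ` the partners of the two points of the pair are joined. -/
theorem liftEdge_arc (hN : 2 ≤ N) {r' : Fin N → Bool} {x : ℤ} (hx : InPair N i x) :
    Relation.EqvGen (Line r' (LinkPattern.tl i σ)) (liftEdge σ i (.top x))
      (liftEdge σ i (.top (σ.partner x))) := by
  -- the value on a pair
  have hval : ∀ x, InPair N i x → ∃ a, (x = a ∨ x = a + 1) ∧ (N : ℤ) ∣ a - i ∧
      liftEdge σ i (.top x) = liftTop σ i a := by
    rintro x (h | h)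
    · exact ⟨x, Or.inl rfl, h, (liftEdge_pair hN h).1⟩
    · refine ⟨x - 1, Or.inr (by ring), by rwa [sub_right_comm], ?_⟩
      have := (liftEdge_pair (σ := σ) hN (show (N : ℤ) ∣ x - 1 - i by rwa [sub_right_comm])).2.2
      rwa [sub_add_cancel] at this
  obtain ⟨a, hxa, ha, e⟩ := hval x hx
  have ha1 : (N : ℤ) ∣ a + 1 - i - 1 := by rwa [show a + 1 - i - 1 = a - i by ring]
  have p0 : InPair N i a := Or.inl ha
  have p1 : InPair N i (a + 1) := Or.inr ha1
  have s0 : pairSwap N i a = a + 1 := pairSwap_left ha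
  have s1 : pairSwap N i (a + 1) = a := by rw [pairSwap_right hN ha1]; ring
  by_cases hp : InPair N i (σ.partner x)
  · rcases partner_inPair hN hx hp with h | h
    · rw [h]; exact .refl _
    · obtain ⟨b, hb, hb', e'⟩ := hval _ hp
      have const : ∀ y, InPair N i y → InPair N i (σ.partner y) →
          InPair N i (σ.partner (pairSwap N i y)) →
          liftEdge σ i (.top y) = .bot 0 := by
        intro y hy h1 h2
        obtain ⟨d, hd, hd', f⟩ := hval y hy
        have hd1 : (N : ℤ) ∣ d + 1 - i - 1 := by rwa [show d + 1 - i - 1 = d - i by ring]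
        have t0 : pairSwap N i d = d + 1 := pairSwap_left hd'
        have t1 : pairSwap N i (d + 1) = d := by rw [pairSwap_right hN hd1]; ring
        have : InPair N i (σ.partner d) ∧ InPair N i (σ.partner (d + 1)) := by
          rcases hd with rfl | rfl
          · rw [t0] at h2; exact ⟨h1, h2⟩
          · rw [t1] at h2; exact ⟨h2, h1⟩
        rw [f, liftTop, if_neg (not_not.2 this.1), if_neg (not_not.2 this.2)]
      rw [const x hx hp h, const _ hp (by rwa [σ.invol])]
      · exact .refl _
      · rcases hx.congr hN hp with ⟨k, hk⟩ | ⟨k, hk⟩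
        · rw [hk, pairSwap_add_mul, σ.partner_add_mul, inPair_add_mul]; exact h
        · rw [hk, pairSwap_add_mul, σ.partner_add_mul, inPair_add_mul, pairSwap_pairSwap hN hx]
          exact hp
  · have e' : liftEdge σ i (.top (σ.partner x)) = .top (σ.partner x) := by
      rw [liftEdge, if_neg (fun h => hp (Or.inl h)), if_neg (fun h => hp (Or.inr h))]
    rw [e, e', liftTop]
    rcases hxa with rfl | rfl
    · rw [if_pos hp]; exact .refl _
    · by_cases hq : InPair N i (σ.partner a)
      · rw [if_neg (not_not.2 hq), if_pos hp]; exact .refl _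
      · rw [if_pos hq]
        have : (LinkPattern.tl i σ).partner (σ.partner a) = σ.partner (a + 1) := by
          rw [LinkPattern.tl_partner hN, LinkPattern.tlPartner, if_neg hq, σ.invol, if_pos p0, s0,
            if_neg (fun h : σ.partner (a + 1) = a + 1 => hp (by rw [h]; exact p1))]
        rw [← this]
        exact .rel _ _ (.arc _)

/-- The tiles at i and i + 1 join the two tops through their common side, so this piece can be
replaced by a point it is attached to above; `.bot 0` is an arbitrary value for a piece that does
not leave the pair. The bottom point i + 1 exits to the right in the old row; in the new row it
reaches the same side through the arc created by `e_i`. -/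
theorem eqvGen_line_of_false_true (hN : 2 ≤ N) (h0 : r (col i) = false)
    (h1 : r (col (i + 1)) = true) (a b : Edge) (hab : Line r σ a b) :
    Relation.EqvGen (Line (Function.update r (col (i + 1)) false) (LinkPattern.tl i σ))
      (liftEdge σ i a) (liftEdge σ i b) := by
  set r' := Function.update r (col (i + 1)) false with hr'
  have c0 : ∀ x, (N : ℤ) ∣ x - i → r (col x) = false := fun x h => by rw [col_eq_iff.2 h, h0]
  have c1 : ∀ x, (N : ℤ) ∣ x - i - 1 → r (col x) = true := fun x h => by
    rw [col_eq_iff.2 (show (N : ℤ) ∣ x - (i + 1) by rwa [← sub_sub]), h1]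
  have off : ∀ x, ¬ (N : ℤ) ∣ x - i - 1 → r' (col x) = r (col x) := fun x h => by
    rw [hr', Function.update_of_ne]
    rwa [Ne, col_eq_iff, ← sub_sub]
  have on : ∀ x, (N : ℤ) ∣ x - i - 1 → r' (col x) = false := fun x h => by
    rw [hr', col_eq_iff.2 (show (N : ℤ) ∣ x - (i + 1) by rwa [← sub_sub]), Function.update_self]
  have sideEq : ∀ x, ¬ (N : ℤ) ∣ x - i → liftEdge σ i (.side x) = .side x := fun x h => if_neg h
  cases hab with
  | botLeft x hx =>
    have hx1 : ¬ (N : ℤ) ∣ x - i - 1 := fun h => by rw [c1 x h] at hx; cases hx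
    rw [sideEq (x - 1) (by rwa [sub_right_comm])]
    exact .rel _ _ (.botLeft x (by rw [off x hx1, hx]))
  | topRight x hx =>
    have hx1 : ¬ (N : ℤ) ∣ x - i - 1 := fun h => by rw [c1 x h] at hx; cases hx
    by_cases h : (N : ℤ) ∣ x - i
    · rw [(liftEdge_pair hN h).1, (liftEdge_pair hN h).2.1]; exact .refl _
    · rw [sideEq x h, liftEdge, if_neg h, if_neg hx1]
      exact .rel _ _ (.topRight x (by rw [off x hx1, hx]))
  | botRight x hx =>
    have h : ¬ (N : ℤ) ∣ x - i := fun h => by rw [c0 x h] at hx; cases hx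
    rw [sideEq x h]
    by_cases h' : (N : ℤ) ∣ x - i - 1
    · have hx0 : (N : ℤ) ∣ x - 1 - i := by rwa [sub_right_comm]
      have e : (LinkPattern.tl i σ).partner (x - 1) = x := by
        rw [LinkPattern.tl_partner hN, LinkPattern.tlPartner,
          if_pos (show InPair N i (x - 1) from Or.inl hx0),
          pairSwap_left hx0]
        ring
      have arc := Line.arc (r := r') (σ := LinkPattern.tl i σ) (x - 1)
      rw [e] at arc
      refine .trans _ _ _ (.rel _ _ (.botLeft x (on x h'))) (.trans _ _ _ (.symm _ _
        (.rel _ _ (.topRight (x - 1) ?_))) (.trans _ _ _ (.rel _ _ arc)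
        (.rel _ _ (.topRight x (on x h')))))
      rw [off _ (not_dvd_pred hN hx0), c0 _ hx0]
    · exact .rel _ _ (.botRight x (by rw [off x h', hx]))
  | topLeft x hx =>
    have h : ¬ (N : ℤ) ∣ x - i := fun h => by rw [c0 x h] at hx; cases hx
    by_cases h' : (N : ℤ) ∣ x - i - 1
    · have hx0 : (N : ℤ) ∣ x - 1 - i := by rwa [sub_right_comm]
      have := liftEdge_pair (σ := σ) hN hx0
      rw [sub_add_cancel] at this
      rw [this.2.1, this.2.2]
      exact .refl _
    · rw [sideEq (x - 1) (by rwa [sub_right_comm]), liftEdge, if_neg h, if_neg h']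
      exact .rel _ _ (.topLeft x (by rw [off x h', hx]))
  | arc x =>
    by_cases hx : InPair N i x
    · exact liftEdge_arc hN hx
    by_cases hy : InPair N i (σ.partner x)
    · have := liftEdge_arc (σ := σ) (r' := r') hN hy
      rw [σ.invol] at this
      exact .symm _ _ this
    · have e : ∀ y, ¬ InPair N i y → liftEdge σ i (.top y) = .top y := fun y h => by
        rw [liftEdge, if_neg (fun h' => h (Or.inl h')), if_neg (fun h' => h (Or.inr h'))]
      rw [e x hx, e _ hy]
      have : (LinkPattern.tl i σ).partner x = σ.partner x := by
        rw [LinkPattern.tl_partner hN, LinkPattern.tlPartner, if_neg hx, if_neg hy]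
      rw [← this]
      exact .rel _ _ (.arc x)

/-- The converse translation: the arc created by `e_i` is contracted to the bottom point i + 1, and
a joined arc of `e_i σ` is traced in the old row as an arc, a passage through the pair, and another
arc. -/
theorem eqvGen_line_of_tl (hN : 2 ≤ N) (h0 : r (col i) = false)
    (h1 : r (col (i + 1)) = true) (a b : Edge)
    (hab : Line (Function.update r (col (i + 1)) false) (LinkPattern.tl i σ) a b) :
    Relation.EqvGen (Line r σ) (dropEdge N i a) (dropEdge N i b) := by
  set r' := Function.update r (col (i + 1)) false with hr'
  have c0 : ∀ x, (N : ℤ) ∣ x - i → r (col x) = false := fun x h => by rw [col_eq_iff.2 h, h0]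
  have c1 : ∀ x, (N : ℤ) ∣ x - i - 1 → r (col x) = true := fun x h => by
    rw [col_eq_iff.2 (show (N : ℤ) ∣ x - (i + 1) by rwa [← sub_sub]), h1]
  have off : ∀ x, ¬ (N : ℤ) ∣ x - i - 1 → r' (col x) = r (col x) := fun x h => by
    rw [hr', Function.update_of_ne]
    rwa [Ne, col_eq_iff, ← sub_sub]
  have on : ∀ x, (N : ℤ) ∣ x - i - 1 → r' (col x) = false := fun x h => by
    rw [hr', col_eq_iff.2 (show (N : ℤ) ∣ x - (i + 1) by rwa [← sub_sub]), Function.update_self]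
  have sideEq : ∀ x, ¬ (N : ℤ) ∣ x - i → dropEdge N i (.side x) = .side x := fun x h => if_neg h
  have topEq : ∀ x, ¬ InPair N i x → dropEdge N i (.top x) = .top x := fun x h => by
    rw [dropEdge, if_neg (fun h' => h (Or.inl h')), if_neg (fun h' => h (Or.inr h'))]
  have mate : ∀ x, (N : ℤ) ∣ x - i →
      Relation.EqvGen (Line r σ) (.top x) (.top (x + 1)) := fun x h => by
    have := Line.topLeft (σ := σ) (x + 1) (c1 (x + 1) (by rwa [show x + 1 - i - 1 = x - i by ring]))
    rw [add_sub_cancel_right] at this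
    exact .trans _ _ _ (.rel _ _ (.topRight x (c0 x h))) (.symm _ _ (.rel _ _ this))
  have mate' : ∀ x, InPair N i x →
      Relation.EqvGen (Line r σ) (.top x) (.top (pairSwap N i x)) := by
    rintro x (h | h)
    · rw [pairSwap_left h]; exact mate x h
    · rw [pairSwap_right hN h]
      have := mate (x - 1) (by rwa [sub_right_comm])
      rw [sub_add_cancel] at this
      exact .symm _ _ this
  cases hab with
  | botLeft x hx =>
    by_cases h : (N : ℤ) ∣ x - i - 1
    · rw [dropEdge, dropEdge, if_pos (by rwa [sub_right_comm]), sub_add_cancel]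
      exact .refl _
    · rw [sideEq (x - 1) (by rwa [sub_right_comm])]
      exact .rel _ _ (.botLeft x (by rw [← off x h, hx]))
  | topRight x hx =>
    by_cases h : (N : ℤ) ∣ x - i
    · rw [dropEdge, dropEdge, if_pos h, if_pos h]; exact .refl _
    rw [sideEq x h, dropEdge, if_neg h]
    by_cases h' : (N : ℤ) ∣ x - i - 1
    · rw [if_pos h']
      exact .rel _ _ (.botRight x (c1 x h'))
    · rw [if_neg h']
      exact .rel _ _ (.topRight x (by rw [← off x h', hx]))
  | botRight x hx =>
    have h' : ¬ (N : ℤ) ∣ x - i - 1 := fun h => by rw [on x h] at hx; cases hx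
    have h : ¬ (N : ℤ) ∣ x - i := fun h => by rw [off x h', c0 x h] at hx; cases hx
    rw [sideEq x h]
    exact .rel _ _ (.botRight x (by rw [← off x h', hx]))
  | topLeft x hx =>
    have h' : ¬ (N : ℤ) ∣ x - i - 1 := fun h => by rw [on x h] at hx; cases hx
    have h : ¬ (N : ℤ) ∣ x - i := fun h => by rw [off x h', c0 x h] at hx; cases hx
    rw [sideEq (x - 1) (by rwa [sub_right_comm]), dropEdge, if_neg h, if_neg h']
    exact .rel _ _ (.topLeft x (by rw [← off x h', hx]))
  | arc x =>
    rw [LinkPattern.tl_partner hN]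
    rcases LinkPattern.tlPartner_cases hN i σ x with ⟨g1, g⟩ | ⟨g1, g2, g3, g⟩ |
      ⟨g1, g2, g3, g4, g⟩ | ⟨g1, g2, g⟩
    · rw [g]
      rcases g1 with h | h
      · rw [pairSwap_left h]
        have h' : (N : ℤ) ∣ x + 1 - i - 1 := by rwa [show x + 1 - i - 1 = x - i by ring]
        rw [dropEdge, dropEdge, if_pos h, if_neg (not_dvd_succ hN h'), if_pos h']
        exact .refl _
      · rw [pairSwap_right hN h]
        rw [dropEdge, dropEdge, if_neg (not_dvd_succ hN h), if_pos h,
          if_pos (by rwa [sub_right_comm]), sub_add_cancel]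
        exact .refl _
    · rw [g]; exact .refl _
    · rw [g, topEq x g1, topEq _ g4]
      exact .trans _ _ _ (.rel _ _ (.arc x)) (.trans _ _ _ (mate' _ g2) (.rel _ _ (.arc _)))
    · rw [g, topEq x g1, topEq _ g2]
      exact .rel _ _ (.arc x)

/-- A tile of type `true` to the right of a tile of type `false` acts on the link pattern above. -/
theorem isRowImage_false_true (hN : 2 ≤ N) (h0 : r (col i) = false)
    (h1 : r (col (i + 1)) = true) (τ : LinkPattern N) :
    IsRowImage r σ τ ↔
      IsRowImage (Function.update r (col (i + 1)) false) (LinkPattern.tl i σ) τ := by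
  refine forall_congr' fun a => forall_congr' fun b => forall_congr' fun _ => iff_congr Iff.rfl ?_
  exact ⟨eqvGen_map (liftEdge σ i) (eqvGen_line_of_false_true hN h0 h1),
    eqvGen_map (dropEdge N i) (eqvGen_line_of_tl hN h0 h1)⟩

end exchange

/-! ### Rows of tiles as maps of link patterns. -/

section rowMap

variable {N : ℕ} [NeZero N]

theorem col_sub_mod (c : Fin N) (i : ℤ) :
    c = col (i + ((((c : ℕ) : ℤ) - i) % N)) := by
  conv_lhs => rw [← col_val c]
  rw [col_eq_iff, show ((c : ℕ) : ℤ) - (i + (((c : ℕ) : ℤ) - i) % N) =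
    ((c : ℕ) : ℤ) - i - (((c : ℕ) : ℤ) - i) % N by ring]
  exact Int.dvd_self_sub_emod

/-- If a cyclic word has the value `false` at `i` and the value `true` at `i + d`, then somewhere
in between a `false` is followed by a `true`. -/
theorem exists_false_true (r : Fin N → Bool) (i : ℤ) (h0 : r (col i) = false) (d : ℕ)
    (h1 : r (col (i + d)) = true) :
    ∃ e < d, r (col (i + (e : ℤ))) = false ∧ r (col (i + (e : ℤ) + 1)) = true := by
  induction d with
  | zero => simp [h0] at h1
  | succ d ih =>
    by_cases h : r (col (i + d)) = true
    · obtain ⟨e, he, h'⟩ := ih h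
      exact ⟨e, by omega, h'⟩
    · refine ⟨d, by omega, by simpa using h, ?_⟩
      rw [← h1]
      push_cast
      rw [add_assoc]

/-- The number of tiles of type `true`. -/
def numTrue (r : Fin N → Bool) : ℕ := (Finset.univ.filter fun c => r c = true).card

theorem numTrue_update {r : Fin N → Bool} {c : Fin N} (h : r c = true) :
    numTrue (Function.update r c false) < numTrue r := by
  refine Finset.card_lt_card ⟨fun x hx => ?_, fun hs => ?_⟩
  · simp only [Finset.mem_filter, Finset.mem_univ, true_and] at hx ⊢
    by_cases hxc : x = c
    · rw [hxc]; exact h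
    · rwa [Function.update_of_ne hxc] at hx
  · have := hs (show c ∈ _ by simpa using h)
    simp at this

theorem two_le_of_false_true {r : Fin N → Bool} {i j : ℤ} (h0 : r (col i) = false)
    (h1 : r (col j) = true) : 2 ≤ N := by
  by_contra hN
  have := NeZero.pos N
  have e : N = 1 := by omega
  have : (col i : Fin N) = col j := by rw [col_eq_iff, e]; simp
  rw [this, h1] at h0
  cases h0

/-- Going around the cylinder from a `false`, some `false` is followed by a `true`.
`isRowImage_false_true` turns that `true` into `false` at the price of a generator acting above, so
induction on the number of `true` tiles ends at the pure rotation. -/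
theorem exists_isRowImage (r : Fin N → Bool) (i : ℤ) (h0 : r (col i) = false)
    (σ : LinkPattern N) : ∃ τ, IsRowImage r σ τ := by
  induction hn : numTrue r using Nat.strong_induction_on generalizing r i σ with
  | _ n ih =>
    by_cases h : ∃ c, r c = true
    · obtain ⟨c, hc⟩ := h
      have hN : 0 < (N : ℤ) := by exact_mod_cast Nat.pos_of_ne_zero (NeZero.ne N)
      have hm := Int.emod_nonneg (((c : ℕ) : ℤ) - i) hN.ne'
      obtain ⟨e, -, g0, g1⟩ := exists_false_true r i h0 ((((c : ℕ) : ℤ) - i) % N).toNat (by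
        rw [Int.toNat_of_nonneg hm, ← col_sub_mod, hc])
      have hN2 := two_le_of_false_true g0 g1
      obtain ⟨τ, hτ⟩ := ih _ (by rw [← hn]; exact numTrue_update g1)
        (Function.update r (col (i + e + 1)) false) (i + e + 1) (by simp)
        (LinkPattern.tl (i + e) σ) rfl
      exact ⟨τ, (isRowImage_false_true hN2 g0 g1 τ).2 hτ⟩
    · have : r = fun _ => false := by
        funext c
        simpa using fun hc => h ⟨c, hc⟩
      rw [this]
      exact ⟨_, isRowImage_false σ⟩

open Classical in
/-- The link pattern below a row of tiles. -/
noncomputable def rowMap (r : Fin N → Bool) (σ : LinkPattern N) : LinkPattern N :=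
  if h : ∃ τ, IsRowImage r σ τ then h.choose else σ

theorem isRowImage_rowMap {r : Fin N → Bool} {i : ℤ} (h0 : r (col i) = false)
    (σ : LinkPattern N) : IsRowImage r σ (rowMap r σ) := by
  have h := exists_isRowImage r i h0 σ
  rw [rowMap, dif_pos h]
  exact h.choose_spec

theorem isRowImage_iff {r : Fin N → Bool} {i : ℤ} (h0 : r (col i) = false)
    (σ τ : LinkPattern N) : IsRowImage r σ τ ↔ rowMap r σ = τ := by
  constructor
  · exact fun h => (isRowImage_rowMap h0 σ).unique h
  · rintro rfl
    exact isRowImage_rowMap h0 σ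

theorem rowMap_false (σ : LinkPattern N) : rowMap (fun _ => false) σ = σ.rot :=
  (isRowImage_iff (i := 0) rfl _ _).1 (isRowImage_false σ)

theorem rowMap_update_right {r : Fin N → Bool} {i : ℤ} (h0 : r (col i) = false)
    (h1 : r (col (i + 1)) = true) (σ : LinkPattern N) :
    rowMap r σ = rowMap (Function.update r (col (i + 1)) false) (LinkPattern.tl i σ) := by
  rw [← isRowImage_iff h0, isRowImage_false_true (two_le_of_false_true h0 h1) h0 h1]
  exact isRowImage_rowMap (i := i + 1) (by simp) _

/-- A tile of type `true` to the left of a tile of type `false` acts on the link pattern below. -/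
theorem rowMap_update_left {r : Fin N → Bool} {i : ℤ} (h1 : r (col i) = true)
    (h0 : r (col (i + 1)) = false) (σ : LinkPattern N) :
    rowMap r σ = LinkPattern.tl i (rowMap (Function.update r (col i) false) σ) := by
  have hN := two_le_of_false_true h0 h1
  have hN0 : 0 < (N : ℤ) := by omega
  have hne : (col i : Fin N) ≠ col (i + 1) := by
    rw [Ne, col_eq_iff, show i - (i + 1) = -1 by ring, dvd_neg]
    exact not_dvd_one_of_two_le hN
  induction hn : numTrue r using Nat.strong_induction_on generalizing r σ with
  | _ n ih =>
    -- Any other `true` tile is removed first, by an exchange that keeps the tiles in the columns i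
    -- and i + 1. Once there is none, the tile at i also has a `false` on its left, and the claim is
    -- that rotation conjugates the generators.
    by_cases h : ∃ c, c ≠ col i ∧ r c = true
    · obtain ⟨c, hci, hc⟩ := h
      -- a `true` at `i + 1 + d` with `d < N - 1`
      have hm := Int.emod_nonneg (((c : ℕ) : ℤ) - (i + 1)) hN0.ne'
      have hm' := Int.emod_lt_of_pos (((c : ℕ) : ℤ) - (i + 1)) hN0
      have hcd := col_sub_mod c (i + 1)
      generalize (((c : ℕ) : ℤ) - (i + 1)) % (N : ℤ) = d at *
      lift d to ℕ using hm
      have hd : (d : ℤ) < N - 1 := by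
        by_contra hd
        refine hci (hcd.trans ?_)
        rw [col_eq_iff]
        exact ⟨1, by omega⟩
      obtain ⟨e, he, g0, g1⟩ := exists_false_true r (i + 1) h0 d (by rw [← hcd, hc])
      set j := i + 1 + (e : ℤ) with hj
      have n1 : (col i : Fin N) ≠ col (j + 1) := by
        rw [Ne, col_eq_iff]
        rintro ⟨k, hk⟩
        have : (N : ℤ) * k = -(e + 2) := by rw [← hk, hj]; ring
        have k0 : k < 0 := by nlinarith
        nlinarith
      have n2 : (col j : Fin N) ≠ col i := fun e' => by rw [e', h1] at g0; cases g0
      have n3 : (col (j + 1) : Fin N) ≠ col (i + 1) := fun e' => by rw [e', h0] at g1; cases g1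
      rw [rowMap_update_right g0 g1, ih _ (by rw [← hn]; exact numTrue_update g1)
        (by rw [Function.update_of_ne n1, h1]) (by rw [Function.update_of_ne n3.symm, h0]) _ rfl,
        rowMap_update_right (r := Function.update r (col i) false) (i := j)
          (by rw [Function.update_of_ne n2, g0]) (by rw [Function.update_of_ne n1.symm, g1]),
        Function.update_comm n1.symm]
    · have e0 : Function.update r (col i) false = fun _ => false := by
        funext c
        by_cases hc : c = col i
        · rw [hc, Function.update_self]
        · rw [Function.update_of_ne hc]
          simpa using fun hc' => h ⟨c, hc, hc'⟩
      have g0 : r (col (i - 1)) = false := by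
        by_contra hc
        refine h ⟨col (i - 1), ?_, by simpa using hc⟩
        rw [Ne, col_eq_iff, show i - 1 - i = -1 by ring, dvd_neg]
        exact not_dvd_one_of_two_le hN
      rw [rowMap_update_right g0 (by rwa [sub_add_cancel]), sub_add_cancel, e0, rowMap_false,
        rowMap_false, LinkPattern.rot_tl, sub_add_cancel]

/-! ### Rotation of a row -/

/-- Translation of the edges. -/
def shiftEdge (k : ℤ) : Edge → Edge
  | .bot i => .bot (i + k)
  | .top i => .top (i + k)
  | .side i => .side (i + k)

theorem rowMap_rot {r r' : Fin N → Bool} (hr : ∀ i, r' (col (i + 1)) = r (col i)) {i : ℤ}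
    (h0 : r (col i) = false) (σ : LinkPattern N) : rowMap r' σ.rot = (rowMap r σ).rot := by
  rw [← isRowImage_iff (show r' (col (i + 1)) = false by rw [hr, h0])]
  intro a b hab
  have hr' : ∀ i, r (col (i + -1)) = r' (col i) := fun i => by rw [← hr, neg_add_cancel_right]
  have key := isRowImage_rowMap h0 σ (a - 1) (b - 1) (fun h => hab (by linarith))
  rw [LinkPattern.rot_partner, show (rowMap r σ).partner (a - 1) + 1 = b ↔
    (rowMap r σ).partner (a - 1) = b - 1 from ⟨fun h => by rw [← h]; ring, fun h => by
      rw [h]; ring⟩, key]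
  constructor
  · intro h
    have := eqvGen_map (S := Line r' σ.rot) (shiftEdge 1) (fun x y hxy => .rel _ _ (by
      cases hxy with
      | botLeft i h =>
        have := Line.botLeft (σ := σ.rot) (i + 1) ((hr i).trans h)
        rwa [add_sub_right_comm] at this
      | topRight i h => exact Line.topRight (i + 1) ((hr i).trans h)
      | botRight i h => exact Line.botRight (i + 1) ((hr i).trans h)
      | topLeft i h =>
        have := Line.topLeft (σ := σ.rot) (i + 1) ((hr i).trans h)
        rwa [add_sub_right_comm] at this
      | arc i =>
        have := Line.arc (r := r') (σ := σ.rot) (i + 1)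
        rwa [LinkPattern.rot_partner, add_sub_cancel_right] at this)) h
    simpa [shiftEdge] using this
  · intro h
    have := eqvGen_map (S := Line r σ) (shiftEdge (-1)) (fun x y hxy => .rel _ _ (by
      cases hxy with
      | botLeft i h =>
        have := Line.botLeft (σ := σ) (i + -1) ((hr' i).trans h)
        rwa [add_sub_right_comm] at this
      | topRight i h => exact Line.topRight (i + -1) ((hr' i).trans h)
      | botRight i h => exact Line.botRight (i + -1) ((hr' i).trans h)
      | topLeft i h =>
        have := Line.topLeft (σ := σ) (i + -1) ((hr' i).trans h)
        rwa [add_sub_right_comm] at this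
      | arc i =>
        have := Line.arc (r := r) (σ := σ) (i + -1)
        rw [LinkPattern.rot_partner]
        simpa [shiftEdge, sub_eq_add_neg] using this)) h
    simpa [shiftEdge, sub_eq_add_neg] using this

/-! ### Convergence to the maximally nested pattern -/

/-- The first `k` arcs of the nested pattern. -/
def HasNested (c : ℤ) (k : ℕ) (σ : LinkPattern N) : Prop :=
  ∀ j : ℕ, j < k → σ.partner (c + j) = c - 1 - j

/-- The given arcs and their translates use up all points except, for odd N, one class modulo N. A
point of this class cannot be matched with a used point, and if matched with a translate of itself
it is unmatched. -/
theorem HasNested.eq_nested {c : ℤ} {σ : LinkPattern N} (h : HasNested c (N / 2) σ) :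
    σ = nested N c := by
  have aux : ∀ τ : LinkPattern N, HasNested c (N / 2) τ → ∀ y k : ℤ, 0 ≤ y → y < N →
      τ.partner (c + y + N * k) =
        if 2 * y + 1 < N then c + N * k - y - 1
        else if 2 * y + 1 = N then c + y + N * k
        else c + N * k + 2 * N - y - 1 := by
    intro τ h y k h0 h1
    have small : ∀ y k : ℤ, 0 ≤ y → 2 * y + 1 < N →
        τ.partner (c + y + N * k) = c + N * k - y - 1 := by
      intro y k h0 h1
      lift y to ℕ using h0
      rw [τ.partner_add_mul, h y (by omega)]
      ring
    have big : ∀ y k : ℤ, y < N → (N : ℤ) < 2 * y + 1 →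
        τ.partner (c + y + N * k) = c + N * k + 2 * N - y - 1 := by
      intro y k h0 h1
      have := small (N - 1 - y) (k + 1) (by omega) (by omega)
      rw [← τ.invol (c + N * k + 2 * N - y - 1), show c + N * k + 2 * N - y - 1 =
        c + (N - 1 - y) + N * (k + 1) by ring, this]
      ring_nf
    split_ifs with g1 g2
    · exact small y k h0 g1
    · obtain ⟨y', k', h0', h1', e⟩ := nested_coord (N := N) c (τ.partner (c + y + N * k))
      have e' := congrArg τ.partner e
      rw [τ.invol] at e'
      rcases lt_trichotomy (2 * y' + 1) (N : ℤ) with g | g | g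
      · rw [small y' k' h0' g] at e'
        have : c + y + N * k = c + (N - 1 - y') + N * (k' - 1) := by rw [e']; ring
        have hd : (N : ℤ) ∣ y - (N - 1 - y') := ⟨k' - 1 - k, by linarith⟩
        have := Int.eq_zero_of_abs_lt_dvd hd (by rw [abs_lt]; constructor <;> omega)
        omega
      · have hy : y' = y := by omega
        subst hy
        have h2 : τ.partner (c + y' + N * k) = c + y' + N * k + N * (k' - k) := by rw [e]; ring
        exact partner_translate h2
      · rw [big y' k' h1' g] at e'
        have : c + y + N * k = c + (N - 1 - y') + N * (k' + 1) := by rw [e']; ring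
        have hd : (N : ℤ) ∣ y - (N - 1 - y') := ⟨k' + 1 - k, by linarith⟩
        have := Int.eq_zero_of_abs_lt_dvd hd (by rw [abs_lt]; constructor <;> omega)
        omega
    · exact big y k h1 (by omega)
  ext x
  obtain ⟨y, k, h0, h1, rfl⟩ := nested_coord (N := N) c x
  exact (aux σ h y k h0 h1).trans (nestedMap_apply h0 h1).symm

/-- The row with tiles `false` in the columns `c, …, c + ⌈N / 2⌉ - 1` and tiles `true` in the
others. -/
def halfRow (N : ℕ) [NeZero N] (c : ℤ) (x : Fin N) : Bool :=
  decide ((N : ℤ) - (N / 2 : ℕ) ≤ (((x : ℕ) : ℤ) - c) % N)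

theorem halfRow_apply (c y k : ℤ) (h0 : 0 ≤ y) (h1 : y < N) :
    halfRow N c (col (c + y + N * k)) = decide ((N : ℤ) - (N / 2 : ℕ) ≤ y) := by
  have hN : 0 < (N : ℤ) := by omega
  unfold halfRow
  congr 2
  have e : (((col (c + y + N * k) : Fin N) : ℕ) : ℤ) = (c + y + N * k) % N :=
    Int.toNat_of_nonneg (Int.emod_nonneg _ hN.ne')
  rw [e, Int.emod_sub_emod, show c + y + (N : ℤ) * k - c = y + N * k by ring,
    Int.add_mul_emod_self_left, Int.emod_eq_of_lt h0 h1]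

/-- The row bends all strands away from the gap. The bottom points c and c - 1 meet at the side
between them, and an arc joining c + j and c - 1 - j above is passed on to c + j + 1 and c - 2 - j.
So each row adds one arc to the nest. -/
theorem hasNested_rowMap {c : ℤ} {k : ℕ} {σ : LinkPattern N} (h : HasNested c k σ) :
    HasNested c (min (k + 1) (N / 2)) (rowMap (halfRow N c) σ) := by
  have hF : ∀ j : ℕ, j < N - N / 2 → halfRow N c (col (c + j)) = false := fun j hj => by
    have := halfRow_apply (N := N) c j 0 (by omega) (by omega)
    rw [mul_zero, add_zero] at this
    rw [this, decide_eq_false_iff_not]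
    omega
  have hT : ∀ j : ℕ, j < N / 2 → halfRow N c (col (c - 1 - j)) = true := fun j hj => by
    have := halfRow_apply (N := N) c (N - 1 - j) (-1) (by omega) (by omega)
    rw [show c + (N - 1 - j) + (N : ℤ) * (-1) = c - 1 - j by ring] at this
    rw [this, decide_eq_true_eq]
    omega
  have hpos := NeZero.pos N
  have hc : halfRow N c (col c) = false := by simpa using hF 0 (by omega)
  intro j hj
  rw [isRowImage_rowMap hc σ _ _ (by omega)]
  have hj2 : j < N / 2 := lt_of_lt_of_le hj (min_le_right _ _)
  refine .trans _ _ _ (.rel _ _ (.botLeft _ (hF j (by omega)))) ?_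
  cases j with
  | zero =>
    have := Line.botRight (σ := σ) _ (hT 0 hj2)
    simp only [Nat.cast_zero, add_zero, sub_zero] at this ⊢
    exact .symm _ _ (.rel _ _ this)
  | succ j =>
    have hjk : j < k := by omega
    have l1 := Line.topRight (σ := σ) _ (hF j (by omega))
    have l2 := Line.arc (r := halfRow N c) (σ := σ) (c + j)
    rw [h j hjk] at l2
    have l3 := Line.topLeft (σ := σ) _ (hT j (by omega))
    have l4 := Line.botRight (σ := σ) _ (hT (j + 1) hj2)
    rw [show c + ((j + 1 : ℕ) : ℤ) - 1 = c + j by push_cast; ring]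
    rw [show c - 1 - ((j + 1 : ℕ) : ℤ) = c - 1 - j - 1 by push_cast; ring] at l4 ⊢
    exact .trans _ _ _ (.symm _ _ (.rel _ _ l1)) (.trans _ _ _ (.rel _ _ l2)
      (.trans _ _ _ (.rel _ _ l3) (.symm _ _ (.rel _ _ l4))))

theorem rowMap_halfRow_iterate (c : ℤ) (σ : LinkPattern N) :
    (rowMap (halfRow N c))^[N / 2] σ = nested N c := by
  have : ∀ k, HasNested c (min k (N / 2)) ((rowMap (halfRow N c))^[k] σ) := by
    intro k
    induction k with
    | zero => intro j hj; omega
    | succ k ih =>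
      rw [Function.iterate_succ_apply']
      have := hasNested_rowMap ih
      rwa [show min (min k (N / 2) + 1) (N / 2) = min (k + 1) (N / 2) by omega] at this
  have := this (N / 2)
  rw [min_self] at this
  exact this.eq_nested

end rowMap

/-! ### Operators on vectors indexed by states -/

section push

variable {S T U : Type*} [Fintype S] [Fintype T]

open Classical in
/-- The linear extension of a map of basis vectors. -/
noncomputable def push (φ : S → T) : (S → ℂ) →ₗ[ℂ] (T → ℂ) where
  toFun v s' := ∑ s, if φ s = s' then v s else 0
  map_add' v w := by
    funext s'
    simp only [Pi.add_apply, ← Finset.sum_add_distrib]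
    exact Finset.sum_congr rfl fun s _ => by split_ifs <;> simp
  map_smul' a v := by
    funext s'
    simp only [Pi.smul_apply, smul_eq_mul, RingHom.id_apply, Finset.mul_sum, mul_ite, mul_zero]

open Classical in
theorem push_apply (φ : S → T) (v : S → ℂ) (s' : T) :
    push φ v s' = ∑ s, if φ s = s' then v s else 0 := rfl

theorem push_push (φ : T → U) (ψ : S → T) (v : S → ℂ) : push φ (push ψ v) = push (φ ∘ ψ) v := by
  classical
  funext s'
  simp only [push_apply, Finset.sum_ite, Finset.sum_const_zero, add_zero, Function.comp]
  rw [Finset.sum_filter]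
  have : ∀ s, (if φ s = s' then ∑ x with ψ x = s, v x else 0) =
      ∑ x, if ψ x = s then (if φ s = s' then v x else 0) else 0 := fun s => by
    rw [Finset.sum_filter]
    split_ifs <;> simp
  rw [Finset.sum_congr rfl fun s _ => this s, Finset.sum_comm, Finset.sum_filter]
  refine Finset.sum_congr rfl fun x _ => ?_
  simp

theorem push_id (v : S → ℂ) : push id v = v := by
  classical
  funext s'
  simp [push_apply]

theorem push_apply_injective {φ : S → T} (h : Function.Injective φ) (v : S → ℂ) (s : S) :
    push φ v (φ s) = v s := by
  classical
  simp [push_apply, h.eq_iff]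

theorem sum_push (φ : S → T) (v : S → ℂ) : ∑ s, push φ v s = ∑ s, v s := by
  classical
  simp only [push_apply]
  rw [Finset.sum_comm]
  simp

theorem push_const (s₀ : T) (v : S → ℂ) (s : T) [Decidable (s = s₀)] :
    push (fun _ => s₀) v s = if s = s₀ then ∑ s, v s else 0 := by
  classical
  rw [push_apply]
  by_cases h : s = s₀
  · rw [if_pos h]; simp [h]
  · rw [if_neg h]
    refine Finset.sum_eq_zero fun x _ => if_neg fun e => h e.symm

theorem push_iterate {φ : S → S} {v : S → ℂ} (h : push φ v = v) (k : ℕ) : push φ^[k] v = v := by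
  induction k with
  | zero => exact push_id v
  | succ k ih => rw [Function.iterate_succ, ← push_push, h, ih]

end push

variable {N : ℕ} [NeZero N]

/-- The action of a face between the points `i` and `i + 1` on a state. -/
noncomputable def faceState (i : ℤ) (b : Bool × Bool) (s : State N) : State N :=
  (if b.1 then LinkPattern.tl i s.1 else s.1, if b.2 then LinkPattern.tl i s.2 else s.2)

/-- The action of a row of faces on a state. -/
noncomputable def rowState (f : Fin N → Bool × Bool) (s : State N) : State N :=
  (rowMap (fun c => (f c).1) s.1, rowMap (fun c => (f c).2) s.2)

/-- Rotation of a state. -/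
def rotState (s : State N) : State N := (s.1.rot, s.2.rot)

theorem rotState_injective : Function.Injective (rotState (N := N)) := fun _ _ h =>
  Prod.ext (LinkPattern.rot_injective (congrArg Prod.fst h))
    (LinkPattern.rot_injective (congrArg Prod.snd h))

/-- The row operator with arbitrary face weights. -/
noncomputable def rowOp (w : Fin N → Bool × Bool → ℂ) : (State N → ℂ) →ₗ[ℂ] (State N → ℂ) :=
  ∑ f : Fin N → Bool × Bool, (∏ c, w c (f c)) • push (rowState f)

/-- The operator of a single face with arbitrary weights. -/
noncomputable def faceOp (i : ℤ) (ω : Bool × Bool → ℂ) : (State N → ℂ) →ₗ[ℂ] (State N → ℂ) :=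
  ∑ b : Bool × Bool, ω b • push (faceState i b)

/-- The weights are supported on the face with both tiles of type `false`. -/
def Forced (ω : Bool × Bool → ℂ) : Prop := ∀ b, b ≠ (false, false) → ω b = 0

/-- The weight of the face with both tiles of type `false`. -/
def forcedWeight (d : ℂ) (b : Bool × Bool) : ℂ := if b = (false, false) then d else 0

theorem forced_forcedWeight (d : ℂ) : Forced (forcedWeight d) := fun _ h => if_neg h

theorem rowState_update_right {f : Fin N → Bool × Bool} {i : ℤ}
    (h : f (col i) = (false, false)) (s : State N) :
    rowState f s = rowState (Function.update f (col (i + 1)) (false, false))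
      (faceState i (f (col (i + 1))) s) := by
  have key : ∀ (r : Fin N → Bool) (σ : LinkPattern N), r (col i) = false →
      rowMap r σ = rowMap (Function.update r (col (i + 1)) false)
        (if r (col (i + 1)) then LinkPattern.tl i σ else σ) := fun r σ h0 => by
    by_cases h1 : r (col (i + 1)) = true
    · rw [if_pos h1, rowMap_update_right h0 h1]
    · rw [if_neg h1, Function.update_eq_self_iff.2 (by simpa using h1)]
  have e1 : ∀ c, (Function.update f (col (i + 1)) (false, false) c).1 =
      Function.update (fun c => (f c).1) (col (i + 1)) false c := fun c => by
    by_cases hc : c = col (i + 1)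
    · rw [hc, Function.update_self, Function.update_self]
    · rw [Function.update_of_ne hc, Function.update_of_ne hc]
  have e2 : ∀ c, (Function.update f (col (i + 1)) (false, false) c).2 =
      Function.update (fun c => (f c).2) (col (i + 1)) false c := fun c => by
    by_cases hc : c = col (i + 1)
    · rw [hc, Function.update_self, Function.update_self]
    · rw [Function.update_of_ne hc, Function.update_of_ne hc]
  unfold rowState faceState
  simp only [e1, e2]
  exact Prod.ext (key _ _ (by rw [h])) (key _ _ (by rw [h]))

theorem rowState_update_left {f : Fin N → Bool × Bool} {i : ℤ}
    (h : f (col (i + 1)) = (false, false)) (s : State N) :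
    rowState f s = faceState i (f (col i))
      (rowState (Function.update f (col i) (false, false)) s) := by
  have key : ∀ (r : Fin N → Bool) (σ : LinkPattern N), r (col (i + 1)) = false →
      rowMap r σ = if r (col i) then LinkPattern.tl i (rowMap (Function.update r (col i) false) σ)
        else rowMap (Function.update r (col i) false) σ := fun r σ h0 => by
    by_cases h1 : r (col i) = true
    · rw [if_pos h1, rowMap_update_left h1 h0]
    · rw [if_neg h1, Function.update_eq_self_iff.2 (by simpa using h1)]
  have e1 : ∀ c, (Function.update f (col i) (false, false) c).1 =
      Function.update (fun c => (f c).1) (col i) false c := fun c => by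
    by_cases hc : c = col i
    · rw [hc, Function.update_self, Function.update_self]
    · rw [Function.update_of_ne hc, Function.update_of_ne hc]
  have e2 : ∀ c, (Function.update f (col i) (false, false) c).2 =
      Function.update (fun c => (f c).2) (col i) false c := fun c => by
    by_cases hc : c = col i
    · rw [hc, Function.update_self, Function.update_self]
    · rw [Function.update_of_ne hc, Function.update_of_ne hc]
  unfold rowState faceState
  simp only [e1, e2]
  exact Prod.ext (key _ _ (by rw [h])) (key _ _ (by rw [h]))

/-- Summation over the value of a function at one point. -/
theorem sum_eq_sum_update {α β M : Type*} [Fintype α] [DecidableEq α] [Fintype β] [DecidableEq β]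
    [AddCommMonoid M] (j : α) (k : β) (H : (α → β) → M) :
    ∑ f, H f = ∑ f, if f j = k then ∑ b, H (Function.update f j b) else 0 := by
  rw [← Finset.sum_filter, Finset.sum_sigma']
  symm
  refine Finset.sum_bij' (fun x _ => Function.update x.1 j x.2)
    (fun f _ => ⟨Function.update f j k, f j⟩) ?_ ?_ ?_ ?_ ?_
  · simp
  · simp
  · rintro ⟨f, b⟩ hf
    simp only [Finset.mem_sigma, Finset.mem_filter, Finset.mem_univ, true_and, and_true] at hf
    simp [Function.update_eq_self_iff, hf]
  · simp
  · simp

theorem prod_update_weight (w : Fin N → Bool × Bool → ℂ) (f : Fin N → Bool × Bool) (j : Fin N)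
    (b : Bool × Bool) (hf : f j = (false, false)) :
    ∏ c, w c (Function.update f j b c) =
      w j b * ∏ c, Function.update w j (forcedWeight 1) c (f c) := by
  rw [← Finset.mul_prod_erase _ _ (Finset.mem_univ j),
    ← Finset.mul_prod_erase _ (fun c => Function.update w j (forcedWeight 1) c (f c))
      (Finset.mem_univ j)]
  simp only [Function.update_self, hf, forcedWeight, if_true, one_mul]
  congr 1
  refine Finset.prod_congr rfl fun c hc => ?_
  rw [Function.update_of_ne (Finset.ne_of_mem_erase hc),
    Function.update_of_ne (Finset.ne_of_mem_erase hc)]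

theorem col_succ_ne (hN : 2 ≤ N) (i : ℤ) : (col i : Fin N) ≠ col (i + 1) := by
  rw [Ne, col_eq_iff, show i - (i + 1) = -1 by ring, dvd_neg]
  exact not_dvd_one_of_two_le hN

theorem rowOp_eq_sum (w : Fin N → Bool × Bool → ℂ) (j : Fin N) (v : State N → ℂ) :
    rowOp w v = ∑ f : Fin N → Bool × Bool, (∏ c, Function.update w j (forcedWeight 1) c (f c)) •
      ∑ b, w j b • push (rowState (Function.update f j b)) v := by
  rw [rowOp, LinearMap.sum_apply, sum_eq_sum_update j (false, false)]
  refine Finset.sum_congr rfl fun f _ => ?_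
  split_ifs with h
  · rw [Finset.smul_sum]
    refine Finset.sum_congr rfl fun b _ => ?_
    rw [LinearMap.smul_apply, prod_update_weight w f j b h, smul_smul, mul_comm]
  · rw [Finset.prod_eq_zero (Finset.mem_univ j), zero_smul]
    rw [Function.update_self]
    exact if_neg h

/-- The forced face puts `false` tiles of both colours to the left of column i + 1, so the face
there can act on the state before the rest of the row does. -/
theorem rowOp_right (hN : 2 ≤ N) {w : Fin N → Bool × Bool → ℂ} {i : ℤ} (hw : Forced (w (col i)))
    (v : State N → ℂ) :
    rowOp w v = rowOp (Function.update w (col (i + 1)) (forcedWeight 1))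
      (faceOp i (w (col (i + 1))) v) := by
  have hne := col_succ_ne hN i
  rw [rowOp_eq_sum w (col (i + 1)), rowOp, LinearMap.sum_apply]
  refine Finset.sum_congr rfl fun f _ => ?_
  rw [LinearMap.smul_apply]
  by_cases h1 : f (col i) = (false, false)
  swap
  · rw [Finset.prod_eq_zero (Finset.mem_univ (col i)), zero_smul, zero_smul]
    rw [Function.update_of_ne hne]
    exact hw _ h1
  by_cases h2 : f (col (i + 1)) = (false, false)
  swap
  · rw [Finset.prod_eq_zero (Finset.mem_univ (col (i + 1))), zero_smul, zero_smul]
    rw [Function.update_self]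
    exact if_neg h2
  congr 1
  rw [faceOp, LinearMap.sum_apply, map_sum]
  refine Finset.sum_congr rfl fun b _ => ?_
  rw [LinearMap.smul_apply, map_smul, push_push]
  congr 3
  funext s
  rw [rowState_update_right (by rwa [Function.update_of_ne hne]), Function.update_self,
    Function.update_idem, Function.comp, Function.update_eq_self_iff.2 h2.symm]

/-- The mirror image: with a forced face on its right, the face in column i acts after the rest of
the row. -/
theorem rowOp_left (hN : 2 ≤ N) {w : Fin N → Bool × Bool → ℂ} {i : ℤ}
    (hw : Forced (w (col (i + 1)))) (v : State N → ℂ) :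
    rowOp w v = faceOp i (w (col i)) (rowOp (Function.update w (col i) (forcedWeight 1)) v) := by
  have hne := col_succ_ne hN i
  rw [rowOp_eq_sum w (col i), rowOp, LinearMap.sum_apply, map_sum]
  refine Finset.sum_congr rfl fun f _ => ?_
  rw [LinearMap.smul_apply, map_smul]
  by_cases h1 : f (col (i + 1)) = (false, false)
  swap
  · rw [Finset.prod_eq_zero (Finset.mem_univ (col (i + 1))), zero_smul, zero_smul]
    rw [Function.update_of_ne hne.symm]
    exact hw _ h1
  by_cases h2 : f (col i) = (false, false)
  swap
  · rw [Finset.prod_eq_zero (Finset.mem_univ (col i)), zero_smul, zero_smul]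
    rw [Function.update_self]
    exact if_neg h2
  congr 1
  rw [faceOp, LinearMap.sum_apply]
  refine Finset.sum_congr rfl fun b _ => ?_
  rw [LinearMap.smul_apply, push_push]
  congr 3
  funext s
  rw [rowState_update_left (by rwa [Function.update_of_ne hne.symm]), Function.update_self,
    Function.update_idem, Function.comp, Function.update_eq_self_iff.2 h2.symm]

theorem forcedWeight_mul (d : ℂ) (b : Bool × Bool) :
    forcedWeight d b = d * forcedWeight 1 b := by
  unfold forcedWeight
  split_ifs <;> simp

theorem prod_update_forced (w : Fin N → Bool × Bool → ℂ) (i : Fin N) (d : ℂ)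
    (f : Fin N → Bool × Bool) :
    ∏ c, Function.update w i (forcedWeight d) c (f c) =
      d * ∏ c, Function.update w i (forcedWeight 1) c (f c) := by
  rw [← Finset.mul_prod_erase _ _ (Finset.mem_univ i),
    ← Finset.mul_prod_erase _ (fun c => Function.update w i (forcedWeight 1) c (f c))
      (Finset.mem_univ i)]
  rw [Function.update_self, Function.update_self, forcedWeight_mul, mul_assoc]
  congr 2
  refine Finset.prod_congr rfl fun c hc => ?_
  rw [Function.update_of_ne (Finset.ne_of_mem_erase hc),
    Function.update_of_ne (Finset.ne_of_mem_erase hc)]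

theorem rowOp_update_smul (w : Fin N → Bool × Bool → ℂ) (i : Fin N) (d : ℂ) :
    rowOp (Function.update w i (forcedWeight d)) =
      d • rowOp (Function.update w i (forcedWeight 1)) := by
  unfold rowOp
  rw [Finset.smul_sum]
  exact Finset.sum_congr rfl fun f _ => by rw [prod_update_forced, smul_smul]

theorem rowOp_forced (w : Fin N → Bool × Bool → ℂ) (h : ∀ c, w c = forcedWeight 1) :
    rowOp w = push rotState := by
  classical
  have : ∀ f : Fin N → Bool × Bool, ∏ c, w c (f c) =
      if f = (fun _ => (false, false)) then 1 else 0 := fun f => by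
    split_ifs with hf
    · rw [hf]; simp [h, forcedWeight]
    · obtain ⟨c, hc⟩ := Function.ne_iff.1 hf
      exact Finset.prod_eq_zero (Finset.mem_univ c) (by rw [h]; exact if_neg hc)
  unfold rowOp
  rw [Finset.sum_congr rfl fun f _ => by rw [this f]]
  simp only [ite_smul, one_smul, zero_smul, Finset.sum_ite_eq', Finset.mem_univ, if_true]
  congr 1
  funext s
  simp only [rowState, rotState, rowMap_false]

/-! ### Symmetries of the operators -/

theorem push_comm_of {S T U V : Type*} [Fintype S] [Fintype T] [Fintype V] {φ : T → U}
    {ψ : S → T} {φ' : S → V} {ψ' : V → U} (h : ∀ s, φ (ψ s) = ψ' (φ' s)) (v : S → ℂ) : push φ (push ψ v) = push ψ' (push φ' v) := by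
  rw [push_push, push_push]
  congr 2
  funext s
  exact h s

theorem rotState_faceState (i : ℤ) (b : Bool × Bool) (s : State N) :
    rotState (faceState i b s) = faceState (i + 1) b (rotState s) := by
  unfold rotState faceState
  refine Prod.ext ?_ ?_
  · change LinkPattern.rot (if b.1 then _ else _) = if b.1 then _ else _
    split_ifs
    · exact LinkPattern.rot_tl _ _
    · rfl
  · change LinkPattern.rot (if b.2 then _ else _) = if b.2 then _ else _
    split_ifs
    · exact LinkPattern.rot_tl _ _
    · rfl

theorem push_rot_faceOp (i : ℤ) (ω : Bool × Bool → ℂ) (v : State N → ℂ) :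
    push rotState (faceOp i ω v) = faceOp (i + 1) ω (push rotState v) := by
  simp only [faceOp, LinearMap.sum_apply, map_sum, LinearMap.smul_apply, map_smul]
  exact Finset.sum_congr rfl fun b _ => by
    rw [push_comm_of fun s => rotState_faceState i b s]

theorem col_add_one (i : ℤ) : (col (i + 1) : Fin N) = col i + 1 := by
  have hN : 0 < (N : ℤ) := by exact_mod_cast Nat.pos_of_ne_zero (NeZero.ne N)
  have h : ∀ j : ℤ, (((col j : Fin N) : ℕ) : ℤ) = j % N := fun j =>
    Int.toNat_of_nonneg (Int.emod_nonneg _ hN.ne')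
  ext
  zify
  rw [h, Fin.val_add, Fin.val_one']
  push_cast
  rw [h]
  simp [Int.add_emod]

theorem rotState_rowState {f f' : Fin N → Bool × Bool} (hf : ∀ c, f' (c + 1) = f c) {c : Fin N}
    (h : f c = (false, false)) (s : State N) :
    rotState (rowState f s) = rowState f' (rotState s) := by
  have h1 : ∀ i, f' (col (i + 1)) = f (col i) := fun i => by rw [col_add_one, hf]
  unfold rotState rowState
  rw [← col_val c] at h
  exact Prod.ext (rowMap_rot (fun i => by rw [h1]) (show (f _).1 = false by rw [h]) _).symm
    (rowMap_rot (fun i => by rw [h1]) (show (f _).2 = false by rw [h]) _).symm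

/-- The forced column ensures that every row of nonzero weight has a genuine image, since the
default value of `rowMap` need not be compatible with rotation. -/
theorem push_rot_rowOp {w w' : Fin N → Bool × Bool → ℂ} (hw : ∀ c, w' (c + 1) = w c) {c : Fin N}
    (h : Forced (w c)) (v : State N → ℂ) :
    push rotState (rowOp w v) = rowOp w' (push rotState v) := by
  simp only [rowOp, LinearMap.sum_apply, map_sum, LinearMap.smul_apply, map_smul]
  refine Fintype.sum_equiv (Equiv.arrowCongr (Equiv.addRight (1 : Fin N)) (Equiv.refl _)) _ _ ?_
  intro f
  have e : ∀ c, (Equiv.arrowCongr (Equiv.addRight (1 : Fin N)) (Equiv.refl (Bool × Bool))) f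
      (c + 1) = f c := fun c => by simp
  have e2 : ∏ c, w' c ((Equiv.arrowCongr (Equiv.addRight (1 : Fin N)) (Equiv.refl _)) f c) =
      ∏ c, w c (f c) := by
    rw [← Equiv.prod_comp (Equiv.addRight (1 : Fin N))]
    exact Finset.prod_congr rfl fun c _ => by
      rw [Equiv.coe_addRight, hw, e]
  rw [e2]
  by_cases hf : f c = (false, false)
  · rw [push_comm_of fun s => rotState_rowState e hf s]
  · rw [Finset.prod_eq_zero (Finset.mem_univ c) (h _ hf), zero_smul, zero_smul]

theorem push_swap_rowOp {w : Fin N → Bool × Bool → ℂ} (hw : ∀ c b, w c b.swap = w c b)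
    (v : State N → ℂ) : push Prod.swap (rowOp w v) = rowOp w (push Prod.swap v) := by
  simp only [rowOp, LinearMap.sum_apply, map_sum, LinearMap.smul_apply, map_smul]
  refine Fintype.sum_equiv (Equiv.arrowCongr (Equiv.refl _) (Equiv.prodComm _ _)) _ _ ?_
  intro f
  have e2 : ∏ c, w c ((Equiv.arrowCongr (Equiv.refl _) (Equiv.prodComm _ _)) f c) =
      ∏ c, w c (f c) := Finset.prod_congr rfl fun c _ => hw c (f c)
  rw [e2, push_comm_of (ψ' := rowState ((Equiv.arrowCongr (Equiv.refl _) (Equiv.prodComm _ _)) f))]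
  exact fun s => rfl

/-! ### The transfer matrix -/

/-- The face weights of the transfer matrix. -/
noncomputable def wt (t : ℂ) (z : Fin N → ℂ) (c : Fin N) (b : Bool × Bool) : ℂ :=
  faceWeight b.1 b.2 (z c) t

/-- The eigenvalue. -/
noncomputable def ev (t : ℂ) (z : Fin N → ℂ) : ℂ := ∏ i, (q * t ^ 2 - z i ^ 2)

/-- Every weight other than ω_D contains the factor w - z. This is what cuts the cylinder open in a
column whose parameter is t. -/
theorem forced_faceWeight (a : ℂ) : Forced fun b => faceWeight b.1 b.2 a a := by
  rintro ⟨b1, b2⟩ h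
  cases b1 <;> cases b2 <;> simp [faceWeight, omegaRL, omegaA] at h ⊢

theorem forced_wt {t : ℂ} {z : Fin N → ℂ} {c : Fin N} (h : z c = t) : Forced (wt t z c) := by
  unfold wt
  rw [h]
  exact forced_faceWeight t

theorem forced_eq {ω : Bool × Bool → ℂ} (h : Forced ω) : ω = forcedWeight (ω (false, false)) := by
  funext b
  unfold forcedWeight
  split_ifs with hb
  · rw [hb]
  · exact h b hb

/-! ### Arithmetic of q, and the transfer matrix as a row operator. -/

theorem q_pow_three : q ^ 3 = 1 := by
  unfold q
  rw [← Complex.exp_nat_mul]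
  convert Complex.exp_two_pi_mul_I using 2
  push_cast
  ring

theorem q_ne_zero : q ≠ 0 := Complex.exp_ne_zero _

theorem q_ne_one : q ≠ 1 := by
  intro h
  have h' := (Complex.isPrimitiveRoot_exp 3 (by norm_num)).ne_one (by norm_num)
  apply h'
  rw [← h]
  unfold q
  norm_num

theorem q_sq : q ^ 2 = -1 - q := by
  have h : (q - 1) * (q ^ 2 + q + 1) = 0 := by linear_combination q_pow_three
  have := (mul_eq_zero.1 h).resolve_left (sub_ne_zero.2 q_ne_one)
  linear_combination this

/-- Rows without the forced face at c have weight zero, and the other rows have exactly one image,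
so the relation `IsRowImage` becomes the map `rowMap`. The eigenvalue equation is only ever used at
such values of t. -/
theorem mulVec_transferMatrix {t : ℂ} {z : Fin N → ℂ} {c : Fin N} (h : z c = t)
    (v : State N → ℂ) : (transferMatrix t z).mulVec v = rowOp (wt t z) v := by
  classical
  funext s'
  have hfw := forced_wt h
  simp only [Matrix.mulVec, dotProduct, transferMatrix]
  rw [rowOp, LinearMap.sum_apply, Finset.sum_apply,
    ← Equiv.sum_comp (Equiv.arrowProdEquivProdArrow (Fin N) (fun _ => Bool) (fun _ => Bool)).symm]
  refine Eq.trans ?_ (Fintype.sum_prod_type _).symm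
  simp only [Finset.sum_mul]
  rw [Finset.sum_comm]
  refine Finset.sum_congr rfl fun r _ => ?_
  rw [Finset.sum_comm]
  refine Finset.sum_congr rfl fun g _ => ?_
  simp only [LinearMap.smul_apply, Pi.smul_apply, push_apply, smul_eq_mul, Finset.mul_sum]
  refine Finset.sum_congr rfl fun s _ => ?_
  have e : ∏ c, wt t z c ((Equiv.arrowProdEquivProdArrow (Fin N) (fun _ => Bool)
      (fun _ => Bool)).symm (r, g) c) = ∏ i, faceWeight (r i) (g i) (z i) t := rfl
  rw [e]
  by_cases hrg : (r c, g c) = (false, false)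
  · obtain ⟨hr, hg⟩ := Prod.ext_iff.1 hrg
    have hr' : r (col ((c : ℕ) : ℤ)) = false := by rw [col_val]; exact hr
    have hg' : g (col ((c : ℕ) : ℤ)) = false := by rw [col_val]; exact hg
    rw [isRowImage_iff hr', isRowImage_iff hg']
    have : rowState ((Equiv.arrowProdEquivProdArrow (Fin N) (fun _ => Bool)
      (fun _ => Bool)).symm (r, g)) s = s' ↔ rowMap r s.1 = s'.1 ∧ rowMap g s.2 = s'.2 :=
      Prod.ext_iff
    simp only [this, ite_mul, mul_ite, zero_mul, mul_zero]
  · have : ∏ i, faceWeight (r i) (g i) (z i) t = 0 :=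
      Finset.prod_eq_zero (Finset.mem_univ c) (hfw _ hrg)
    simp [this]

/-! ### Polynomial functions -/

/-- A function given by a polynomial. -/
def IsPoly {σ : Type*} (F : (σ → ℂ) → ℂ) : Prop := ∃ p : MvPolynomial σ ℂ, ∀ z, eval z p = F z

namespace IsPoly

variable {σ ι : Type*} {F G : (σ → ℂ) → ℂ}

theorem const (a : ℂ) : IsPoly fun _ : σ → ℂ => a := ⟨C a, by simp⟩

theorem var (i : σ) : IsPoly fun z : σ → ℂ => z i := ⟨X i, by simp⟩

theorem eval (p : MvPolynomial σ ℂ) : IsPoly fun z => MvPolynomial.eval z p := ⟨p, fun _ => rfl⟩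

theorem add (hF : IsPoly F) (hG : IsPoly G) : IsPoly fun z => F z + G z := by
  obtain ⟨p, hp⟩ := hF
  obtain ⟨r, hr⟩ := hG
  exact ⟨p + r, fun z => by rw [map_add, hp, hr]⟩

theorem sub (hF : IsPoly F) (hG : IsPoly G) : IsPoly fun z => F z - G z := by
  obtain ⟨p, hp⟩ := hF
  obtain ⟨r, hr⟩ := hG
  exact ⟨p - r, fun z => by rw [map_sub, hp, hr]⟩

theorem mul (hF : IsPoly F) (hG : IsPoly G) : IsPoly fun z => F z * G z := by
  obtain ⟨p, hp⟩ := hF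
  obtain ⟨r, hr⟩ := hG
  exact ⟨p * r, fun z => by rw [map_mul, hp, hr]⟩

theorem pow (hF : IsPoly F) (n : ℕ) : IsPoly fun z => F z ^ n := by
  obtain ⟨p, hp⟩ := hF
  exact ⟨p ^ n, fun z => by rw [map_pow, hp]⟩

theorem sum (s : Finset ι) {F : ι → (σ → ℂ) → ℂ} (h : ∀ i ∈ s, IsPoly (F i)) :
    IsPoly fun z => ∑ i ∈ s, F i z := by
  choose! p hp using h
  exact ⟨∑ i ∈ s, p i, fun z => by rw [map_sum]; exact Finset.sum_congr rfl fun i hi => hp i hi z⟩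

theorem prod (s : Finset ι) {F : ι → (σ → ℂ) → ℂ} (h : ∀ i ∈ s, IsPoly (F i)) :
    IsPoly fun z => ∏ i ∈ s, F i z := by
  choose! p hp using h
  exact ⟨∏ i ∈ s, p i, fun z => by rw [map_prod]; exact Finset.prod_congr rfl fun i hi => hp i hi z⟩

theorem ite (P : Prop) [Decidable P] (hF : IsPoly F) (hG : IsPoly G) :
    IsPoly fun z => if P then F z else G z := by
  split_ifs
  · exact hF
  · exact hG

theorem faceWeight (r g : Bool) (hF : IsPoly F) (hG : IsPoly G) :
    IsPoly fun z => faceWeight r g (F z) (G z) := by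
  cases r <;> cases g <;> simp only [Rotor.faceWeight, omegaD, omegaA, omegaRL]
  · exact (((const q).mul (hG.sub ((const q).mul hF))).mul (hF.add ((const q).mul hG)))
  · exact ((hG.sub hF).mul (hF.add ((const q).mul hG)))
  · exact ((hG.sub hF).mul (hF.add ((const q).mul hG)))
  · exact ((hG.sub hF).mul (hG.add ((const q).mul hF)))

theorem det {n : Type*} [Fintype n] [DecidableEq n] {M : (σ → ℂ) → Matrix n n ℂ}
    (h : ∀ i j, IsPoly fun z => M z i j) : IsPoly fun z => (M z).det := by
  choose p hp using h
  refine ⟨(Matrix.of p).det, fun z => ?_⟩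
  rw [RingHom.map_det]
  congr 1
  ext i j
  exact hp i j z

/-- If a product of two polynomial functions vanishes, then one of them does. -/
theorem eq_zero_of_mul {F G : (σ → ℂ) → ℂ} (hF : IsPoly F) (hG : IsPoly G)
    (h : ∀ z, F z * G z = 0) {z₀ : σ → ℂ} (h0 : F z₀ ≠ 0) (z : σ → ℂ) : G z = 0 := by
  obtain ⟨p, hp⟩ := hF
  obtain ⟨r, hr⟩ := hG
  have : p * r = 0 := MvPolynomial.funext fun z => by rw [map_mul, hp, hr, h, map_zero]
  rcases mul_eq_zero.1 this with h' | h'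
  · rw [← hp, h', map_zero] at h0
    exact absurd rfl h0
  · rw [← hr, h', map_zero]

/-- Composition with a polynomial map. -/
theorem comp {τ : Type*} {F : (σ → ℂ) → ℂ} (hF : IsPoly F) {g : σ → (τ → ℂ) → ℂ}
    (hg : ∀ i, IsPoly (g i)) : IsPoly fun z => F fun i => g i z := by
  obtain ⟨p, hp⟩ := hF
  choose r hr using hg
  refine ⟨aeval r p, fun z => ?_⟩
  change _ = F fun i => g i z
  rw [← hp]
  have : (MvPolynomial.eval z).comp (aeval r : MvPolynomial σ ℂ →ₐ[ℂ] _).toRingHom =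
      MvPolynomial.eval fun i => g i z := by
    refine MvPolynomial.ringHom_ext (fun a => by simp) fun i => by simp [hr]
  exact RingHom.congr_fun this p

end IsPoly

variable {N : ℕ} [NeZero N]

/-- The values of a vector of polynomials. -/
noncomputable def evalv {S σ : Type*} (Ψ : S → MvPolynomial σ ℂ) (z : σ → ℂ) (s : S) : ℂ :=
  eval z (Ψ s)

/-- The factor in the exchange relation. -/
noncomputable def scal (w z : ℂ) : ℂ := q * w ^ 2 - z ^ 2

/-- The weights in the exchange relation. -/
noncomputable def xw (w z : ℂ) (b : Bool × Bool) : ℂ := faceWeight b.1 b.2 z w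

/-- With `sum_faceOp` this says that a face operator multiplies the sum of the components by the
factor on the left of the exchange relation, so the two sides of that relation have consistent sums.
-/
theorem sum_xw (w z : ℂ) : ∑ b, xw w z b = scal w z := by
  rw [Fintype.sum_prod_type]
  simp only [Fintype.sum_bool, xw, faceWeight, omegaD, omegaRL, omegaA, scal]
  linear_combination (w ^ 2 - z ^ 2) * q_sq - w * z * q_pow_three

theorem isPoly_xw {σ : Type*} {F G : (σ → ℂ) → ℂ} (hF : IsPoly F) (hG : IsPoly G)
    (b : Bool × Bool) : IsPoly fun z => xw (F z) (G z) b := IsPoly.faceWeight _ _ hG hF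

theorem isPoly_push {S σ : Type*} [Fintype S] {v : (σ → ℂ) → S → ℂ}
    (h : ∀ s, IsPoly fun z => v z s) (φ : S → S) (s : S) : IsPoly fun z => push φ (v z) s := by
  classical
  simp only [push_apply]
  exact IsPoly.sum _ fun s _ => IsPoly.ite _ (h s) (IsPoly.const 0)

theorem isPoly_faceOp {σ : Type*} {v : (σ → ℂ) → State N → ℂ} {ω : (σ → ℂ) → Bool × Bool → ℂ}
    (h : ∀ s, IsPoly fun z => v z s) (hω : ∀ b, IsPoly fun z => ω z b) (i : ℤ) (s : State N) :
    IsPoly fun z => faceOp i (ω z) (v z) s := by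
  simp only [faceOp, LinearMap.sum_apply, Finset.sum_apply, LinearMap.smul_apply, Pi.smul_apply,
    smul_eq_mul]
  exact IsPoly.sum _ fun b _ => (hω b).mul (isPoly_push h _ s)

theorem isPoly_rowOp {σ : Type*} {v : (σ → ℂ) → State N → ℂ}
    {w : (σ → ℂ) → Fin N → Bool × Bool → ℂ} (h : ∀ s, IsPoly fun z => v z s)
    (hw : ∀ c b, IsPoly fun z => w z c b) (s : State N) : IsPoly fun z => rowOp (w z) (v z) s := by
  simp only [rowOp, LinearMap.sum_apply, Finset.sum_apply, LinearMap.smul_apply, Pi.smul_apply,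
    smul_eq_mul]
  exact IsPoly.sum _ fun f _ => (IsPoly.prod _ fun c _ => hw c _).mul (isPoly_push h _ s)

theorem sum_faceOp (i : ℤ) (ω : Bool × Bool → ℂ) (v : State N → ℂ) :
    ∑ s, faceOp i ω v s = (∑ b, ω b) * ∑ s, v s := by
  simp only [faceOp, LinearMap.sum_apply, Finset.sum_apply, LinearMap.smul_apply, Pi.smul_apply,
    smul_eq_mul]
  rw [Finset.sum_comm, Finset.sum_mul]
  exact Finset.sum_congr rfl fun b _ => by rw [← Finset.mul_sum, sum_push]

/-! ### Uniqueness of the eigenvector -/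

/-- The point where the transfer matrix is a multiple of a map of states. -/
noncomputable def halfPoint (N : ℕ) [NeZero N] (c : ℤ) (a : ℂ) (x : Fin N) : ℂ :=
  if halfRow N c x then -q * a else a

theorem halfPoint_col (c : ℤ) (a : ℂ) : halfPoint N c a (col c) = a := by
  have := halfRow_apply (N := N) c 0 0 le_rfl (by exact_mod_cast NeZero.pos N)
  rw [add_zero, mul_zero, add_zero] at this
  have hN := NeZero.pos N
  rw [halfPoint, this, decide_eq_false, if_neg (by simp)]
  omega

/-- At z = a only ω_D is nonzero and at z = -q a only ω_A, and both then equal q a² - z². The sum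
over rows collapses to one row, the same in both colours. -/
theorem rowOp_halfPoint (c : ℤ) (a : ℂ) : rowOp (wt a (halfPoint N c a)) =
    ev a (halfPoint N c a) • push (rowState fun x => (halfRow N c x, halfRow N c x)) := by
  classical
  have hw : ∀ x b, wt a (halfPoint N c a) x b =
      if b = (halfRow N c x, halfRow N c x) then q * a ^ 2 - halfPoint N c a x ^ 2 else 0 := by
    rintro x ⟨b1, b2⟩
    unfold wt halfPoint
    cases halfRow N c x <;> cases b1 <;> cases b2 <;>
      simp [faceWeight, omegaD, omegaRL, omegaA]
    · linear_combination (-a ^ 2) * q_pow_three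
    · linear_combination (-a ^ 2) * q_pow_three
  have : ∀ f : Fin N → Bool × Bool, ∏ x, wt a (halfPoint N c a) x (f x) =
      if f = (fun x => (halfRow N c x, halfRow N c x)) then ev a (halfPoint N c a) else 0 :=
    fun f => by
    simp only [hw]
    split_ifs with hf
    · rw [hf]; simp [ev]
    · obtain ⟨x, hx⟩ := Function.ne_iff.1 hf
      exact Finset.prod_eq_zero (Finset.mem_univ x) (if_neg hx)
  unfold rowOp
  rw [Finset.sum_congr rfl fun f _ => by rw [this f]]
  simp only [ite_smul, zero_smul, Finset.sum_ite_eq', Finset.mem_univ, if_true]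

theorem ev_halfPoint_ne_zero (c : ℤ) {a : ℂ} (ha : a ≠ 0) : ev a (halfPoint N c a) ≠ 0 := by
  refine Finset.prod_ne_zero_iff.2 fun x _ => ?_
  unfold halfPoint
  have h1 : (q - 1) ≠ 0 := sub_ne_zero.2 q_ne_one
  split_ifs
  · rw [show q * a ^ 2 - (-q * a) ^ 2 = -(q * (q - 1) * a ^ 2) by ring]
    exact neg_ne_zero.2 (mul_ne_zero (mul_ne_zero q_ne_zero h1) (pow_ne_zero _ ha))
  · rw [show q * a ^ 2 - a ^ 2 = (q - 1) * a ^ 2 by ring]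
    exact mul_ne_zero h1 (pow_ne_zero _ ha)

theorem iterate_rowState_halfRow (c : ℤ) :
    (rowState fun x => (halfRow N c x, halfRow N c x))^[N / 2] =
      fun _ => (nested N c, nested N c) := by
  have : ∀ k (s : State N), (rowState fun x => (halfRow N c x, halfRow N c x))^[k] s =
      ((rowMap (halfRow N c))^[k] s.1, (rowMap (halfRow N c))^[k] s.2) := by
    intro k
    induction k with
    | zero => exact fun s => rfl
    | succ k ih =>
      intro s
      rw [Function.iterate_succ_apply, ih, Function.iterate_succ_apply, Function.iterate_succ_apply]
      rfl
  funext s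
  rw [this, rowMap_halfRow_iterate, rowMap_halfRow_iterate]

/-- A solution of the eigenvalue equation on the hyperplane `z_c = a` is zero there as soon as one
linear condition holds. -/
theorem evalv_eq_zero (c : ℤ) {a : ℂ} (ha : a ≠ 0) (v : State N → MvPolynomial (Fin N) ℂ)
    (l : State N → ℂ) (hl : l (nested N c, nested N c) = 1)
    (h : ∀ z, z (col c) = a → rowOp (wt a z) (evalv v z) = ev a z • evalv v z)
    (hl0 : ∀ z, z (col c) = a → ∑ s, l s * evalv v z s = 0) (z : Fin N → ℂ) (hz : z (col c) = a)
    (s : State N) : evalv v z s = 0 := by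
  classical
  set s₀ : State N := (nested N c, nested N c)
  -- A rank one correction of T - ev by l. It kills the vector v, hence det A · v = 0, and as det A
  -- is a polynomial in the free parameters it suffices to find one point of the hyperplane where A
  -- is invertible.
  let A : (Fin N → ℂ) → (State N → ℂ) →ₗ[ℂ] (State N → ℂ) := fun z => rowOp (wt a z) -
    ev a z • LinearMap.id + (∑ s, l s • LinearMap.proj s).smulRight (Pi.single s₀ 1)
  have hA : ∀ z v, A z v = rowOp (wt a z) v - ev a z • v + (∑ s, l s * v s) • Pi.single s₀ 1 :=
    fun z v => by simp [A, LinearMap.sum_apply]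
  let g : Fin N → (Fin N → ℂ) → ℂ := fun i z => if i = col c then a else z i
  have hg : ∀ i, IsPoly (g i) := fun i => IsPoly.ite _ (IsPoly.const a) (IsPoly.var i)
  let D : (Fin N → ℂ) → ℂ := fun z => (LinearMap.toMatrix' (A fun i => g i z)).det
  have hD : IsPoly D := by
    refine IsPoly.det fun s s' => ?_
    simp only [LinearMap.toMatrix'_apply, hA, Pi.add_apply, Pi.sub_apply, Pi.smul_apply,
      smul_eq_mul]
    refine (IsPoly.sub (isPoly_rowOp (v := fun _ => Pi.single s' 1)
      (w := fun z => wt a fun i => g i z) (fun s => IsPoly.const _) (fun c b => ?_) _) ?_).add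
      (IsPoly.const _)
    · exact IsPoly.faceWeight _ _ (hg c) (IsPoly.const a)
    · refine IsPoly.mul (IsPoly.prod _ fun i _ => ?_) (IsPoly.const _)
      exact (IsPoly.const _).sub ((hg i).pow 2)
  have hgz : ∀ z, (fun i => g i z) (col c) = a := fun z => if_pos rfl
  have hgid : ∀ z, z (col c) = a → (fun i => g i z) = z := fun z hz => by
    funext i
    change (if i = col c then a else z i) = z i
    split_ifs with hi
    · rw [hi, hz]
    · rfl
  have hprod : ∀ z, D z * evalv v (fun i => g i z) s = 0 := fun z => by
    have h0 : (LinearMap.toMatrix' (A fun i => g i z)).mulVec (evalv v fun i => g i z) = 0 := by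
      rw [LinearMap.toMatrix'_mulVec, hA, h _ (hgz z), hl0 _ (hgz z), sub_self, zero_smul, add_zero]
    have := congrArg (Matrix.mulVec (LinearMap.toMatrix' (A fun i => g i z)).adjugate) h0
    rw [Matrix.mulVec_mulVec, Matrix.adjugate_mul, Matrix.mulVec_zero, Matrix.smul_mulVec,
      Matrix.one_mulVec] at this
    exact congrFun this s
  -- Let u be in the kernel. The part T - ev has vanishing column sums at this point, so summing the
  -- components gives l u = 0. Then u is fixed by the map of states, whose iterates are constant, so
  -- u is supported on the nested state, where l is 1.
  have hne : D (halfPoint N c a) ≠ 0 := by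
    intro h0
    obtain ⟨u, hu, hu0⟩ := Matrix.exists_mulVec_eq_zero_iff.2 h0
    apply hu
    rw [LinearMap.toMatrix'_mulVec, hgid _ (halfPoint_col c a), hA, rowOp_halfPoint,
      LinearMap.smul_apply, ← smul_sub] at hu0
    have hs := congrArg (fun v => ∑ s, v s) hu0
    simp only [Pi.add_apply, Pi.smul_apply, Pi.sub_apply, smul_eq_mul, Finset.sum_add_distrib,
      ← Finset.mul_sum, Finset.sum_sub_distrib, sum_push, sub_self, mul_zero, zero_add,
      Pi.zero_apply, Finset.sum_const_zero, Finset.sum_pi_single', Finset.mem_univ, if_true,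
      mul_one] at hs
    rw [hs, zero_smul, add_zero, smul_eq_zero] at hu0
    have hfix := sub_eq_zero.1 (hu0.resolve_left (ev_halfPoint_ne_zero c ha))
    have hit := push_iterate hfix (N / 2)
    rw [iterate_rowState_halfRow] at hit
    have hus : ∀ s, u s = if s = s₀ then ∑ s, u s else 0 := fun s => by
      conv_lhs => rw [← hit, push_const]
    have hsum : ∑ s, u s = 0 := by
      have e : ∑ s, l s * u s = l s₀ * u s₀ := Finset.sum_eq_single s₀
        (fun s _ h => by rw [hus s, if_neg h, mul_zero]) (fun h => absurd (Finset.mem_univ _) h)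
      rw [hs, hl, one_mul, hus s₀, if_pos rfl] at e
      exact e.symm
    funext s
    rw [hus, hsum, ite_self, Pi.zero_apply]
  have := IsPoly.eq_zero_of_mul hD ((IsPoly.eval (v s)).comp hg) hprod hne z
  rw [hgid z hz] at this
  exact this

variable {N : ℕ} [NeZero N]

/-! ### Solutions of the exchange relations -/

/-- Vectors of polynomials that satisfy the exchange relation and the cyclicity relation. -/
structure Good (Ψ : State N → MvPolynomial (Fin N) ℂ) : Prop where
  exch : 2 ≤ N → ∀ z : Fin N → ℂ, scal (z (col 0)) (z (col (0 + 1))) •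
    evalv Ψ (z ∘ Equiv.swap (col 0) (col (0 + 1))) =
      faceOp 0 (xw (z (col 0)) (z (col (0 + 1)))) (evalv Ψ z)
  rot : ∀ z s, evalv Ψ z (rotState s) = evalv Ψ (fun j => z (j + 1)) s

theorem rotState_surjective : Function.Surjective (rotState (N := N)) :=
  Finite.injective_iff_surjective.1 rotState_injective

theorem eq_push_rot {v w : State N → ℂ} (h : ∀ s, v (rotState s) = w s) : v = push rotState w := by
  funext s
  obtain ⟨s, rfl⟩ := rotState_surjective s
  rw [h, push_apply_injective rotState_injective]

theorem col_nat {k : ℕ} (hk : k < N) : (col (k : ℤ) : Fin N) = ⟨k, hk⟩ := by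
  have := col_val (⟨k, hk⟩ : Fin N)
  exact this

theorem col_nat_inj {j k : ℕ} (hj : j < N) (hk : k < N) : (col (j : ℤ) : Fin N) = col (k : ℤ) ↔
    j = k := by
  rw [col_nat hj, col_nat hk, Fin.mk.injEq]

namespace Good

variable {Ψ : State N → MvPolynomial (Fin N) ℂ}

theorem push_rot (h : Good Ψ) (z : Fin N → ℂ) :
    evalv Ψ z = push rotState (evalv Ψ fun j => z (j + 1)) :=
  eq_push_rot fun s => h.rot z s

theorem exch_nat (h : Good Ψ) (hN : 2 ≤ N) (i : ℕ) (z : Fin N → ℂ) :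
    scal (z (col i)) (z (col (i + 1))) • evalv Ψ (z ∘ Equiv.swap (col i) (col (i + 1))) =
      faceOp i (xw (z (col i)) (z (col (i + 1)))) (evalv Ψ z) := by
  induction i generalizing z with
  | zero => exact_mod_cast h.exch hN z
  | succ i ih =>
    have := congrArg (push rotState) (ih fun j => z (j + 1))
    rw [push_rot_faceOp, map_smul, ← h.push_rot, ← col_add_one, ← col_add_one] at this
    push_cast
    rw [← this, h.push_rot]
    congr 3
    funext j
    simp only [Function.comp]
    congr 1
    simp only [col_add_one, Equiv.swap_apply_def, add_left_inj]
    split_ifs <;> rfl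

/-- Starting from the forced face in column 0, the faces in the columns 1, 2, … are pulled out one
by one, and by the exchange relation each moves the parameter t one column further. After N - 1
steps the rest of the row is a pure rotation and the parameters are shifted cyclically, which the
rotation relation undoes. In `y k` the parameter t sits in column k; in `W k` the columns up to k
have been used. -/
theorem rowOp_evalv_zero (h : Good Ψ) (z : Fin N → ℂ) :
    rowOp (wt (z (col 0)) z) (evalv Ψ z) = ev (z (col 0)) z • evalv Ψ z := by
  set t := z (col 0) with ht
  let y : ℕ → Fin N → ℂ := fun k => Nat.rec z (fun k y => y ∘ Equiv.swap (col k) (col (k + 1))) k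
  have y0 : y 0 = z := rfl
  have ys : ∀ k, y (k + 1) = y k ∘ Equiv.swap (col k) (col (k + 1)) := fun k => rfl
  have hy : ∀ k < N, y k (col k) = t ∧ (∀ j < k, y k (col j) = z (col (j + 1))) ∧
      ∀ j < N, k < j → y k (col j) = z (col j) := by
    intro k
    induction k with
    | zero => exact fun _ => ⟨rfl, fun j hj => absurd hj (by omega), fun j _ _ => rfl⟩
    | succ k ih =>
      intro hk
      obtain ⟨i1, i2, i3⟩ := ih (by omega)
      rw [ys]
      simp only [Function.comp]
      refine ⟨?_, fun j hj => ?_, fun j hj hj' => ?_⟩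
      · push_cast
        rw [Equiv.swap_apply_right, i1]
      · rcases Nat.lt_succ_iff_lt_or_eq.1 hj with hj | rfl
        · rw [Equiv.swap_apply_of_ne_of_ne, i2 j hj]
          · rw [Ne, col_nat_inj] <;> omega
          · have := col_nat_inj (N := N) (j := j) (k := k + 1) (by omega) hk
            push_cast at this
            rw [Ne, this]; omega
        · rw [Equiv.swap_apply_left]
          exact_mod_cast i3 (j + 1) hk (by omega)
      · rw [Equiv.swap_apply_of_ne_of_ne, i3 j hj (by omega)]
        · rw [Ne, col_nat_inj] <;> omega
        · have := col_nat_inj (N := N) (j := j) (k := k + 1) hj hk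
          push_cast at this
          rw [Ne, this]; omega
  let W : ℕ → Fin N → Bool × Bool → ℂ := fun k c =>
    if (c : ℕ) ≤ k then forcedWeight 1 else wt t z c
  have key : ∀ k < N, rowOp (wt t z) (evalv Ψ z) =
      (∏ j ∈ Finset.range (k + 1), scal t (z (col j))) • rowOp (W k) (evalv Ψ (y k)) := by
    intro k
    induction k with
    | zero =>
      intro _
      have e : wt t z = Function.update (W 0) (col 0) (forcedWeight (scal t t)) := by
        funext c
        by_cases hc : c = col 0
        · rw [hc, Function.update_self, forced_eq (forced_wt ht.symm)]
          congr 1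
          simp only [wt, faceWeight, omegaD, scal, ← ht]
          linear_combination (-t ^ 2) * q_pow_three
        · rw [Function.update_of_ne hc]
          change _ = if _ then _ else _
          rw [if_neg]
          intro h0
          exact hc ((col_nat (N := N) (k := 0) (NeZero.pos N)).symm ▸ Fin.ext (by simpa using h0))
      have e' : Function.update (W 0) (col 0) (forcedWeight 1) = W 0 := by
        rw [Function.update_eq_self_iff]
        change _ = if _ then _ else _
        rw [if_pos]
        have := col_nat (N := N) (k := 0) (NeZero.pos N)
        rw [Nat.cast_zero] at this
        rw [this]
      rw [e, rowOp_update_smul, e']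
      simp [y0, ht]
    | succ k ih =>
      intro hk
      have hN : 2 ≤ N := by omega
      obtain ⟨i1, -, i3⟩ := hy k (by omega)
      have i3' := i3 (k + 1) hk (by omega)
      have hc := col_nat (N := N) (k := k + 1) hk
      push_cast at i3' hc
      have hW : Forced (W k (col k)) := by
        change Forced (if _ then _ else _)
        rw [if_pos (by rw [col_nat (by omega)])]
        exact forced_forcedWeight 1
      have hW' : W k (col (k + 1)) = xw (y k (col k)) (y k (col (k + 1))) := by
        rw [i1, i3']
        change (if _ then _ else _) = _
        rw [if_neg (by rw [hc]; simp)]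
        rfl
      have hW2 : Function.update (W k) (col (k + 1)) (forcedWeight 1) = W (k + 1) := by
        funext c
        by_cases h1 : c = col (k + 1)
        · rw [h1, Function.update_self]
          change _ = if _ then _ else _
          rw [if_pos (by rw [hc])]
        · rw [Function.update_of_ne h1]
          change (if _ then _ else _) = if _ then _ else _
          have : (c : ℕ) ≠ k + 1 := fun e => h1 (by rw [hc]; exact Fin.ext e)
          by_cases h2 : (c : ℕ) ≤ k
          · rw [if_pos h2, if_pos (by omega)]
          · rw [if_neg h2, if_neg (by omega)]
      rw [ih (by omega), rowOp_right hN hW, hW', ← h.exch_nat hN, map_smul, hW2, smul_smul,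
        Finset.prod_range_succ _ (k + 1), ← ys, i1, i3']
      push_cast
      rfl
  have hpos := NeZero.pos N
  rw [key (N - 1) (by omega), Nat.sub_add_cancel hpos]
  have hlast : y (N - 1) = fun j => z (j + 1) := by
    obtain ⟨j1, j2, -⟩ := hy (N - 1) (by omega)
    funext c
    rcases Nat.lt_or_ge (c : ℕ) (N - 1) with hc | hc
    · have := j2 _ hc
      rwa [col_val, col_add_one, col_val] at this
    · have hcN : (c : ℕ) = N - 1 := by omega
      rw [← hcN, col_val] at j1
      rw [hcN.symm, j1, ht]
      congr 1
      rw [← col_val c, ← col_add_one, col_eq_iff, hcN]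
      exact ⟨-1, by push_cast [hpos]; ring⟩
  rw [hlast, rowOp_forced _ (fun c => if_pos (by omega)), ← h.push_rot]
  congr 1
  rw [ev, Finset.prod_range]
  exact Finset.prod_congr rfl fun c _ => by rw [col_val]; rfl

/-- The eigenvalue equation follows from the exchange relations. -/
theorem rowOp_evalv (h : Good Ψ) (z : Fin N → ℂ) (c : Fin N) :
    rowOp (wt (z c) z) (evalv Ψ z) = ev (z c) z • evalv Ψ z := by
  rw [← col_val c]
  generalize (c : ℕ) = k
  induction k generalizing z with
  | zero => exact h.rowOp_evalv_zero z
  | succ k ih =>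
    push_cast
    rw [col_add_one]
    have := congrArg (push rotState) (ih fun j => z (j + 1))
    rw [map_smul, push_rot_rowOp (w := wt (z (col k + 1)) fun j => z (j + 1))
      (w' := wt (z (col k + 1)) z) (fun c => rfl) (c := col k)
      (forced_wt rfl), ← h.push_rot] at this
    rw [this]
    congr 1
    exact Fintype.prod_equiv (Equiv.addRight (1 : Fin N)) _ _ fun c => rfl

theorem exch_sum (h : Good Ψ) (i : ℤ) (hi : 0 ≤ i) (hN : 2 ≤ N) (z : Fin N → ℂ) (s : State N) :
    scal (z (col i)) (z (col (i + 1))) * evalv Ψ (z ∘ Equiv.swap (col i) (col (i + 1))) s =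
      ∑ b, xw (z (col i)) (z (col (i + 1))) b * push (faceState i b) (evalv Ψ z) s := by
  lift i to ℕ using hi
  have := congrFun (h.exch_nat hN i z) s
  simpa [faceOp, LinearMap.sum_apply] using this

theorem of_mul {Q : MvPolynomial (Fin N) ℂ} (hQ : Q ≠ 0)
    (hsymm : ∀ (z : Fin N → ℂ) (π : Equiv.Perm (Fin N)), eval (z ∘ π) Q = eval z Q)
    (h : Good fun s => Q * Ψ s) : Good Ψ := by
  have hv : ∀ z, evalv (fun s => Q * Ψ s) z = eval z Q • evalv Ψ z := fun z => by
    funext s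
    simp [evalv]
  obtain ⟨z₀, hz₀⟩ : ∃ z, eval z Q ≠ 0 := by
    by_contra! hc
    exact hQ (MvPolynomial.funext fun z => by rw [hc, map_zero])
  constructor
  · intro hN z
    funext s
    have key := IsPoly.eq_zero_of_mul (IsPoly.eval Q)
      (G := fun z => scal (z (col 0)) (z (col (0 + 1))) *
        evalv Ψ (z ∘ Equiv.swap (col 0) (col (0 + 1))) s -
          faceOp 0 (xw (z (col 0)) (z (col (0 + 1)))) (evalv Ψ z) s) ?_ (fun z => ?_) hz₀ z
    · exact sub_eq_zero.1 key
    · refine IsPoly.sub (IsPoly.mul ?_ ?_) (isPoly_faceOp (fun s => IsPoly.eval _) (fun b =>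
        isPoly_xw (IsPoly.var _) (IsPoly.var _) b) _ _)
      · exact ((IsPoly.const q).mul ((IsPoly.var _).pow 2)).sub ((IsPoly.var _).pow 2)
      · exact (IsPoly.eval (Ψ s)).comp fun i => IsPoly.var _
    · have := congrFun (h.exch hN z) s
      rw [hv, hv, hsymm, map_smul] at this
      simp only [Pi.smul_apply, smul_eq_mul] at this
      rw [mul_sub, ← this]
      ring
  · intro z s
    have key := IsPoly.eq_zero_of_mul (IsPoly.eval Q)
      (G := fun z => evalv Ψ z (rotState s) - evalv Ψ (fun j => z (j + 1)) s) ?_ (fun z => ?_)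
      hz₀ z
    · exact sub_eq_zero.1 key
    · exact (IsPoly.eval _).sub ((IsPoly.eval (Ψ s)).comp fun i => IsPoly.var _)
    · have := h.rot z s
      rw [hv, hv] at this
      have e := hsymm z (Equiv.addRight 1)
      change eval (fun j => z (j + 1)) Q = _ at e
      rw [e] at this
      simp only [Pi.smul_apply, smul_eq_mul] at this
      rw [mul_sub, this, sub_self]

theorem mul {Q : MvPolynomial (Fin N) ℂ}
    (hsymm : ∀ (z : Fin N → ℂ) (π : Equiv.Perm (Fin N)), eval (z ∘ π) Q = eval z Q)
    (h : Good Ψ) : Good fun s => Q * Ψ s := by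
  have hv : ∀ z, evalv (fun s => Q * Ψ s) z = eval z Q • evalv Ψ z := fun z => by
    funext s
    simp [evalv]
  constructor
  · intro hN z
    rw [hv, hv, hsymm, map_smul, ← h.exch hN z, smul_comm]
  · intro z s
    rw [hv, hv]
    have e := hsymm z (Equiv.addRight 1)
    change eval (fun j => z (j + 1)) Q = _ at e
    rw [e, Pi.smul_apply, Pi.smul_apply, h.rot]

/-- Two solutions with the same sum agree. -/
theorem swap_colour (h : Good Ψ) (s : State N) : Ψ s.swap = Ψ s := by
  classical
  refine sub_eq_zero.1 (MvPolynomial.funext fun z => ?_)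
  rw [map_zero]
  have hsw : ∀ z, evalv (fun s => Ψ s.swap) z = push Prod.swap (evalv Ψ z) := fun z => by
    funext s
    conv_rhs => rw [← Prod.swap_swap s]
    rw [push_apply_injective Prod.swap_injective]
    rfl
  have hv : ∀ z, evalv (fun s => Ψ s.swap - Ψ s) z = push Prod.swap (evalv Ψ z) - evalv Ψ z :=
    fun z => by
      rw [← hsw]
      funext s
      simp [evalv]
  -- The weights are symmetric in the colours, so the difference of the two vectors again solves the
  -- eigenvalue equation, and its components sum to zero.
  have key : ∀ z, z (col 0) * evalv (fun s => Ψ s.swap - Ψ s) z s = 0 := fun z => by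
    by_cases hz : z (col 0) = 0
    · rw [hz, zero_mul]
    refine mul_eq_zero_of_right _ (evalv_eq_zero 0 hz _ (fun _ => 1) rfl (fun y hy => ?_)
      (fun y _ => ?_) z rfl s)
    · rw [hv, map_sub, ← push_swap_rowOp, ← hy, h.rowOp_evalv, map_smul, smul_sub]
      rintro c ⟨b1, b2⟩
      cases b1 <;> cases b2 <;> rfl
    · simp only [hv, one_mul, Pi.sub_apply, Finset.sum_sub_distrib, sum_push, sub_self]
  exact IsPoly.eq_zero_of_mul (IsPoly.var _) (IsPoly.eval _) key (z₀ := fun _ => 1) one_ne_zero z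

end Good

namespace LinkPattern

theorem partner_pred_of_succ {N : ℕ} {σ : LinkPattern N} {i : ℤ} (h : σ.partner i = i + 1) :
    σ.partner (i - 1) ≠ i - 1 + 1 := fun h' => by
  have := σ.invol (i - 1)
  rw [h', sub_add_cancel, h] at this
  omega

theorem partner_succ_of_succ {N : ℕ} {σ : LinkPattern N} {i : ℤ} (h : σ.partner i = i + 1) :
    σ.partner (i + 1) ≠ i + 1 + 1 := fun h' => by
  have := σ.invol i
  rw [h, h'] at this
  omega

/-! ### More on the insertion of a small arc -/

section ins

variable {n : ℕ} [NeZero n]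

theorem insPos_succ_of_dvd {i y : ℤ} (h : (n : ℤ) ∣ y - (i - 1)) :
    insPos n (i + 1) y = insPos n i y - 2 ∧ ((n + 2 : ℕ) : ℤ) ∣ insPos n i y - (i + 2) := by
  have hn : 0 < (n : ℤ) := by exact_mod_cast NeZero.pos n
  obtain ⟨k, hk⟩ := h
  have e1 := insPos_apply (n := n) i (y := 0) k le_rfl hn
  have e2 := insPos_apply (n := n) (i + 1) (y := n - 1) (k - 1) (by omega) (by omega)
  rw [show i - 1 + 0 + n * k = y by linarith] at e1
  rw [show i + 1 - 1 + ((n : ℤ) - 1) + n * (k - 1) = i - 1 + n * k by ring,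
    show i - 1 + n * k = y by linarith] at e2
  rw [e1, e2]
  exact ⟨by push_cast; ring, ⟨k, by ring⟩⟩

theorem insPos_succ_of_not_dvd {i y : ℤ} (h : ¬ (n : ℤ) ∣ y - (i - 1)) :
    insPos n (i + 1) y = insPos n i y := by
  obtain ⟨y, k, h0, h1, rfl⟩ := nested_coord (N := n) (i - 1) y
  have hy : y ≠ 0 := fun hy => h ⟨k, by rw [hy]; ring⟩
  have e2 := insPos_apply (n := n) (i + 1) (y := y - 1) k (by omega) (by omega)
  rw [show i + 1 - 1 + (y - 1) + n * k = i - 1 + y + n * k by ring] at e2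
  rw [insPos_apply _ _ h0 h1, e2]
  ring

/-- The two insertions number the old points alike except for the old point i - 1 and its
translates, which sit at i on the left and at i + 2 on the right. The generator joins i and i + 1
and reconnects their former partners, so that the strand from i now starts at i + 2. -/
theorem tl_ins_succ (i : ℤ) (σ : LinkPattern n) : tl i (ins (i + 1) σ) = ins i σ := by
  have hN : 2 ≤ n + 2 := by omega
  have hn : 0 < (n : ℤ) := by exact_mod_cast NeZero.pos n
  -- the position `i + 2` and its neighbours
  have A : ∀ y, (n : ℤ) ∣ y - (i - 1) → InPair (n + 2) i (insPos n (i + 1) y) ∧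
      pairSwap (n + 2) i (insPos n (i + 1) y) = insPos n i y - 1 ∧
      InPair (n + 2) i (insPos n i y - 1) ∧
      pairSwap (n + 2) i (insPos n i y - 1) = insPos n (i + 1) y ∧
      (ins (i + 1) σ).partner (insPos n i y) = insPos n i y - 1 ∧
      (ins (i + 1) σ).partner (insPos n i y - 1) = insPos n i y := fun y hy => by
    obtain ⟨e, hd⟩ := insPos_succ_of_dvd hy
    have d0 : ((n + 2 : ℕ) : ℤ) ∣ insPos n (i + 1) y - i := by
      rwa [e, show insPos n i y - 2 - i = insPos n i y - (i + 2) by ring]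
    have d1 : ((n + 2 : ℕ) : ℤ) ∣ insPos n i y - 1 - i - 1 := by
      rwa [show insPos n i y - 1 - i - 1 = insPos n i y - (i + 2) by ring]
    have d2 : ((n + 2 : ℕ) : ℤ) ∣ insPos n i y - (i + 1) - 1 := by
      rwa [show insPos n i y - (i + 1) - 1 = insPos n i y - (i + 2) by ring]
    have d3 : ((n + 2 : ℕ) : ℤ) ∣ insPos n i y - 1 - (i + 1) := by
      rwa [show insPos n i y - 1 - (i + 1) = insPos n i y - (i + 2) by ring]
    refine ⟨Or.inl d0, ?_, Or.inr d1, ?_, ?_, ?_⟩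
    · rw [pairSwap_left d0, e]; ring
    · rw [pairSwap_right hN d1, e]; ring
    · rw [ins_partner_pair σ (Or.inr d2), pairSwap_right hN d2]
    · rw [ins_partner_pair σ (Or.inl d3), pairSwap_left d3]; ring
  ext x
  rw [tl_partner hN]
  rcases insPos_coord (n := n) i x with hx | ⟨y, rfl⟩
  · rw [tlPartner, if_pos hx, ins_partner_pair σ hx]
  rw [ins_partner_insPos, tlPartner, if_neg (not_inPair_insPos i y)]
  by_cases hy : (n : ℤ) ∣ y - (i - 1)
  · obtain ⟨-, -, a3, a4, a5, -⟩ := A y hy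
    rw [a5, if_pos a3, a4, ins_partner_insPos]
    have mono := (insPos_strictMono (n := n) (i + 1)).injective
    by_cases hf : σ.partner y = y
    · rw [hf, if_pos rfl]
    · rw [if_neg (fun e => hf (mono e)), insPos_succ_of_not_dvd]
      intro hd
      obtain ⟨k, hk⟩ := dvd_sub hd hy
      exact hf (partner_translate (k := k) (by linarith))
  · rw [← insPos_succ_of_not_dvd hy, ins_partner_insPos]
    by_cases hz : (n : ℤ) ∣ σ.partner y - (i - 1)
    · obtain ⟨a1, a2, -, -, -, a6⟩ := A _ hz
      rw [if_pos a1, a2, a6, if_neg (by omega)]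
    · rw [insPos_succ_of_not_dvd hz, if_neg (not_inPair_insPos _ _)]

/-- `e_{i+1}` is a left inverse of `e_i` on the image of `e_{i+1}`. -/
theorem eq_ins_succ {i : ℤ} {σ : LinkPattern n} {τ : LinkPattern (n + 2)}
    (h : τ.partner (i + 1) = i + 2) (h' : tl i τ = ins i σ) : τ = ins (i + 1) σ := by
  have hn := NeZero.pos n
  have hl : (ins (i + 1) σ).partner (i + 1) = i + 2 := by
    rw [ins_partner_left]; ring
  rw [← tl_succ_tl (by omega) h, h', ← tl_ins_succ, tl_succ_tl (by omega) hl]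

theorem insPos_last (y k : ℤ) (h0 : 0 ≤ y) (h1 : y < n) :
    insPos n (n + 1) (y + n * k) = y + 1 + ((n + 2 : ℕ) : ℤ) * k := by
  have := insPos_apply (n := n) (n + 1) (k - 1) h0 h1
  rw [show (n : ℤ) + 1 - 1 + y + n * (k - 1) = y + n * k by ring] at this
  rw [this]
  push_cast
  ring

theorem inPair_insPos_last (hn : 2 ≤ n) (y : ℤ) :
    (InPair (n + 2) 1 (insPos n (n + 1) y) ↔ InPair n 0 y) ∧
      (InPair n 0 y →
        pairSwap (n + 2) 1 (insPos n (n + 1) y) = insPos n (n + 1) (pairSwap n 0 y)) := by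
  obtain ⟨y, k, h0, h1, e⟩ := nested_coord (N := n) 0 y
  rw [zero_add] at e
  subst e
  rw [insPos_last y k h0 h1, inPair_add_mul, inPair_add_mul, pairSwap_add_mul, pairSwap_add_mul]
  have small : ∀ t : ℤ, ∀ M : ℕ, -1 ≤ t → t < M → 2 ≤ M → ((M : ℤ) ∣ t ↔ t = 0) := by
    intro t M ht1 ht2 hM
    constructor
    · intro h
      refine Int.eq_zero_of_abs_lt_dvd h ?_
      rw [abs_lt]; constructor <;> omega
    · rintro rfl; exact dvd_zero _
  have i1 : ∀ M : ℕ, 2 ≤ M → y < M → (InPair M 0 y ↔ y = 0 ∨ y = 1) := fun M hM hy => by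
    unfold InPair
    rw [small _ M (by omega) (by omega) hM, small _ M (by omega) (by omega) hM]
    omega
  have i2 : InPair (n + 2) 1 (y + 1) ↔ InPair (n + 2) 0 y := by
    unfold InPair
    rw [show y + 1 - 1 = y - 0 by ring]
  have i3 : pairSwap (n + 2) 1 (y + 1) = pairSwap (n + 2) 0 y + 1 := by
    unfold pairSwap
    rw [show y + 1 - 1 = y - 0 by ring]
    split_ifs <;> ring
  rw [i2, i1 (n + 2) (by omega) (by push_cast; omega), i1 n hn h1]
  refine ⟨Iff.rfl, fun h => ?_⟩
  rw [i3]
  rcases h with rfl | rfl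
  · rw [pairSwap_left (by simp), pairSwap_left (by simp), insPos_last _ _ (by omega) (by omega)]
  · have := pairSwap_self (N := n + 2) (i := 0) (by omega)
    have h2 := pairSwap_self (N := n) (i := 0) hn
    rw [zero_add] at this h2
    rw [this, h2, insPos_last _ _ (by omega) (by omega)]

/-- The generator acts away from the inserted arc. Its index changes from 0 to 1 because the
insertion shifts all old points by one. -/
theorem tl_one_ins (hn : 2 ≤ n) (σ : LinkPattern n) :
    tl 1 (ins (n + 1) σ) = ins (n + 1) (tl 0 σ) := by
  have hN : 2 ≤ n + 2 := by omega
  have off : ∀ x, InPair (n + 2) (n + 1) x → ¬ InPair (n + 2) 1 x := by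
    have small : ∀ t : ℤ, 0 < t → t < n + 2 → ¬ ((n + 2 : ℕ) : ℤ) ∣ t := fun t h1 h2 h => by
      have := Int.le_of_dvd h1 h
      push_cast at this
      omega
    have e : ∀ {a b : ℤ}, ((n + 2 : ℕ) : ℤ) ∣ a → ((n + 2 : ℕ) : ℤ) ∣ b →
        0 < b - a → b - a < n + 2 → False := fun ha hb h1 h2 => small _ h1 h2 (dvd_sub hb ha)
    rintro x (h | h) (h' | h')
    · exact e h h' (by omega) (by omega)
    · exact e h h' (by omega) (by omega)
    · exact e h h' (by omega) (by omega)
    · exact e h h' (by omega) (by omega)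
  ext x
  rw [tl_partner hN]
  rcases insPos_coord (n := n) (n + 1) x with hx | ⟨y, rfl⟩
  · rw [tlPartner, if_neg (off x hx), ins_partner_pair _ hx, ins_partner_pair _ hx,
      if_neg (off _ (hx.swap hN))]
  rw [ins_partner_insPos, tl_partner hn, tlPartner, tlPartner]
  obtain ⟨p1, p2⟩ := inPair_insPos_last hn y
  by_cases hy : InPair n 0 y
  · rw [if_pos hy, if_pos (p1.2 hy), p2 hy]
  rw [if_neg hy, if_neg (fun h => hy (p1.1 h)), ins_partner_insPos]
  obtain ⟨p1, p2⟩ := inPair_insPos_last hn (σ.partner y)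
  by_cases hz : InPair n 0 (σ.partner y)
  · rw [if_pos hz, if_pos (p1.2 hz), p2 hz, ins_partner_insPos]
    have inj := (insPos_strictMono (n := n) (n + 1)).injective
    by_cases hf : σ.partner (pairSwap n 0 (σ.partner y)) = pairSwap n 0 (σ.partner y)
    · rw [if_pos hf, if_pos (by rw [hf])]
    · rw [if_neg hf, if_neg (fun h => hf (inj h))]
  · rw [if_neg hz, if_neg (fun h => hz (p1.1 h))]

end ins

/-! ### More on the maximally nested patterns -/

theorem dvd_of_nested_partner {N : ℕ} [NeZero N] {c j : ℤ}
    (h : (nested N c).partner j = j + 1) : (N : ℤ) ∣ j - (c - 1) := by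
  obtain ⟨y, k, h0, h1, rfl⟩ := nested_coord (N := N) c j
  have e : nestedMap N c (c + y + N * k) = c + y + N * k + 1 := h
  rw [nestedMap_apply h0 h1] at e
  split_ifs at e with g1 g2
  · omega
  · omega
  · have : y = N - 1 := by omega
    exact ⟨k + 1, by rw [this]; ring⟩

theorem nested_congr {N : ℕ} [NeZero N] {c c' : ℤ} (h : (N : ℤ) ∣ c - c') :
    nested N c = nested N c' := by
  ext x
  have : (x - c) % (N : ℤ) = (x - c') % N := by
    rw [Int.emod_eq_emod_iff_emod_sub_eq_zero, ← Int.dvd_iff_emod_eq_zero,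
      show x - c - (x - c') = -(c - c') by ring]
    exact h.neg_right
  simp only [nested, nestedMap, this]

theorem rot_nested {N : ℕ} [NeZero N] (c : ℤ) : rot (nested N c) = nested N (c + 1) := by
  ext x
  rw [rot_partner]
  change nestedMap N c (x - 1) + 1 = nestedMap N (c + 1) x
  unfold nestedMap
  rw [show x - 1 - c = x - (c + 1) by ring]
  split_ifs <;> ring

theorem ins_nested {n : ℕ} [NeZero n] (c : ℤ) :
    ins (c - 1) (nested n (c - 2)) = nested (n + 2) c := by
  refine HasNested.eq_nested fun j hj => ?_
  cases j with
  | zero =>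
    have hd : ((n + 2 : ℕ) : ℤ) ∣ c - (c - 1) - 1 := ⟨0, by ring⟩
    rw [Nat.cast_zero, add_zero, sub_zero, ins_partner_pair _ (Or.inr hd),
      pairSwap_right (by omega) hd]
  | succ j =>
    have e1 := insPos_apply (n := n) (c - 1) (y := j) 0 (by omega) (by omega)
    have e2 := insPos_apply (n := n) (c - 1) (y := n - 1 - j) (-1) (by omega) (by omega)
    rw [show c + ((j + 1 : ℕ) : ℤ) = insPos n (c - 1) (c - 1 - 1 + j + n * 0) by
      rw [e1]; push_cast; ring, ins_partner_insPos]
    have e3 : (nested n (c - 2)).partner (c - 1 - 1 + j + n * 0) =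
        c - 1 - 1 + (n - 1 - j) + n * (-1) := by
      change nestedMap n (c - 2) _ = _
      rw [show c - 1 - 1 + (j : ℤ) + n * 0 = c - 2 + j + n * 0 by ring,
        nestedMap_apply (by omega) (by omega), if_pos (by omega)]
      ring
    rw [e3, e2]
    push_cast
    ring

theorem ins_nested_zero (n : ℕ) [NeZero n] : ins (n + 1) (nested n 0) = nested (n + 2) 0 := by
  have := ins_nested (n := n) (n + 2)
  rw [show (n : ℤ) + 2 - 1 = n + 1 by ring, show (n : ℤ) + 2 - 2 = n by ring] at this
  rw [← nested_congr (N := n) (c := n) (by simp), this]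
  exact nested_congr (by simp)

/-- The innermost arc of the old nest lies to the left of the inserted arc or encloses it, so no
small arc starts between i + 1 and n + 1. This feeds the vanishing argument in `Good.move_arc`. -/
theorem ins_nested_partner_ne {n m i l : ℕ} [NeZero n] (hm : 2 ≤ m) (hi : m ≤ i + 1)
    (hl : i < l) (hln : l ≤ n + 1) :
    (ins i (nested n (m - 2))).partner l ≠ l + 1 := by
  rcases Nat.eq_or_lt_of_le (Nat.succ_le_of_lt hl) with rfl | hl
  · have := partner_succ_of_succ (ins_partner_left (i : ℤ) (nested n ((m : ℤ) - 2)))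
    exact_mod_cast this
  · intro h
    have e1 := insPos_apply (n := n) i (y := l - i - 2) 0 (by omega) (by omega)
    have e2 := insPos_apply (n := n) i (y := l + 1 - i - 2) 0 (by omega) (by omega)
    rw [show (l : ℤ) = insPos n i (i - 1 + (l - i - 2) + n * 0) by rw [e1]; ring,
      ins_partner_insPos, e1, show (i : ℤ) + 2 + (l - i - 2) + ((n + 2 : ℕ) : ℤ) * 0 + 1 =
        insPos n i (i - 1 + (l + 1 - i - 2) + n * 0) by rw [e2]; ring] at h
    have h' := (insPos_strictMono (n := n) i).injective h
    have := dvd_of_nested_partner (h'.trans (by ring))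
    rw [show (i : ℤ) - 1 + (l - i - 2) + n * 0 - (m - 2 - 1) = l - m by ring] at this
    have := Int.le_of_dvd (by omega) this
    omega

/-- The image of `e_i` for two or three points. -/
theorem tl_eq_nested {N : ℕ} [NeZero N] (hN : N / 2 = 1) (i : ℤ) (σ : LinkPattern N) :
    tl i σ = nested N (i + 1) := by
  refine HasNested.eq_nested fun j hj => ?_
  have hj0 : j = 0 := by omega
  subst hj0
  have := tl_partner_left (show 2 ≤ N by omega) i σ
  rw [Nat.cast_zero, add_zero, sub_zero, add_sub_cancel_right, ← this, invol]

theorem eq_nested_two (σ : LinkPattern 2) : σ = nested 2 0 ∨ σ = nested 2 1 := by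
  have h2 := σ.partner_lt 0
  have h3 := σ.lt_partner 0
  have i0 := σ.invol 0
  have p := σ.partner_add_mul
  have h0 : σ.partner 0 ≠ 0 := fun h0 => by
    have a1 := σ.partner_lt 1
    have a2 := σ.lt_partner 1
    have a3 := σ.invol 1
    push_cast at a1 a2
    have : σ.partner 1 = 0 ∨ σ.partner 1 = 1 ∨ σ.partner 1 = 2 := by omega
    rcases this with h | h | h
    · rw [h, h0] at a3; omega
    · have := σ.unmatched 1 0 h h0
      norm_num at this
    · have := p 0 1
      norm_num at this
      rw [h, this, h0] at a3
      omega
  push_cast at h2 h3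
  have : σ.partner 0 = 1 ∨ σ.partner 0 = -1 := by omega
  rcases this with h | h
  · right
    refine HasNested.eq_nested fun j hj => ?_
    have hj0 : j = 0 := by omega
    subst hj0
    rw [h] at i0
    simpa using i0
  · left
    refine HasNested.eq_nested fun j hj => ?_
    have hj0 : j = 0 := by omega
    subst hj0
    simpa using h

theorem nested_two_ne : nested 2 0 ≠ nested 2 1 := fun h => by
  have h1 : (nested 2 1).partner 0 = 0 + 1 := by
    have := tl_partner_left le_rfl 0 (nested 2 0)
    rwa [tl_eq_nested (by norm_num), zero_add] at this
  rw [← h] at h1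
  have := dvd_of_nested_partner h1
  norm_num at this

end LinkPattern

/-! ### Divisibility by linear factors -/

section dvd

variable {σ : Type*} [DecidableEq σ]

/-- The factor theorem: substituting r for X_a is the identity modulo X_a - r. The hypothesis says
that r does not involve X_a. -/
theorem X_sub_dvd_iff {a : σ} {r p : MvPolynomial σ ℂ}
    (hr : ∀ z t, eval (Function.update z a t) r = eval z r) :
    X a - r ∣ p ↔ ∀ z, z a = eval z r → eval z p = 0 := by
  constructor
  · rintro ⟨s, rfl⟩ z hz
    rw [map_mul, map_sub, eval_X, hz, sub_self, zero_mul]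
  · intro h
    have h0 : aeval (Function.update X a r) p = (0 : MvPolynomial σ ℂ) := by
      refine MvPolynomial.funext fun z => ?_
      have e : (eval z).comp (aeval (Function.update X a r) : MvPolynomial σ ℂ →ₐ[ℂ] _).toRingHom =
          eval (Function.update z a (eval z r)) := by
        refine MvPolynomial.ringHom_ext (fun c => by simp) fun i => ?_
        by_cases hi : i = a
        · rw [hi]; simp
        · simp [Function.update_of_ne hi]
      have := RingHom.congr_fun e p
      rw [h _ (by rw [Function.update_self, hr])] at this
      rw [map_zero]
      exact this
    rw [← Ideal.mem_span_singleton, ← Ideal.Quotient.eq_zero_iff_mem]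
    have e : (Ideal.Quotient.mk (Ideal.span {X a - r})).comp
        (aeval (Function.update X a r) : MvPolynomial σ ℂ →ₐ[ℂ] _).toRingHom =
        Ideal.Quotient.mk (Ideal.span {X a - r}) := by
      refine MvPolynomial.ringHom_ext (fun c => by simp) fun i => ?_
      by_cases hi : i = a
      · rw [hi]
        simp only [AlgHom.toRingHom_eq_coe, RingHom.coe_comp, RingHom.coe_coe, Function.comp_apply,
          aeval_X, Function.update_self]
        rw [eq_comm, Ideal.Quotient.mk_eq_mk_iff_sub_mem]
        exact Ideal.mem_span_singleton_self _
      · simp [Function.update_of_ne hi]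
    have := RingHom.congr_fun e p
    rw [← this]
    change Ideal.Quotient.mk _ (aeval (Function.update X a r) p) = 0
    rw [h0, map_zero]

/-- The hypersurface X_a = r is a graph over the other coordinates, so its ring of polynomial
functions has no zero divisors. -/
theorem X_sub_prime {a : σ} {r : MvPolynomial σ ℂ}
    (hr : ∀ z t, eval (Function.update z a t) r = eval z r) : Prime (X a - r) := by
  have pt : ∀ z : σ → ℂ, (Function.update z a (eval z r)) a =
      eval (Function.update z a (eval z r)) r := fun z => by rw [Function.update_self, hr]
  refine ⟨fun h0 => ?_, fun hu => ?_, fun p s h => ?_⟩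
  · have h1 := congrArg (eval (Function.update (0 : σ → ℂ) a (eval 0 r + 1))) h0
    rw [map_sub, eval_X, Function.update_self, hr, map_zero, add_sub_cancel_left] at h1
    exact one_ne_zero h1
  · have := (X_sub_dvd_iff hr).1 (isUnit_iff_dvd_one.1 hu) _ (pt 0)
    rw [map_one] at this
    exact one_ne_zero this
  · by_contra! hc
    obtain ⟨h1, h2⟩ := hc
    rw [X_sub_dvd_iff hr] at h h1
    push Not at h1
    obtain ⟨z₀, hz₀, hp⟩ := h1
    have hg : ∀ i, IsPoly fun z : σ → ℂ => Function.update z a (eval z r) i := fun i => by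
      by_cases hi : i = a
      · rw [hi]; simpa using IsPoly.eval r
      · simpa [Function.update_of_ne hi] using IsPoly.var i
    have hself : ∀ z : σ → ℂ, z a = eval z r → Function.update z a (eval z r) = z := fun z hz => by
      rw [← hz, Function.update_eq_self]
    apply h2
    rw [X_sub_dvd_iff hr]
    intro z hz
    have := IsPoly.eq_zero_of_mul ((IsPoly.eval p).comp hg) ((IsPoly.eval s).comp hg)
      (fun z => by
        have := h _ (pt z)
        rwa [map_mul] at this) (z₀ := z₀) (by rw [hself z₀ hz₀]; exact hp) z
    rwa [hself z hz] at this

theorem eval_C_mul_X_update {a b : σ} (hab : a ≠ b) (k : ℂ) (z : σ → ℂ) (t : ℂ) :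
    eval (Function.update z a t) (C k * X b) = eval z (C k * X b) := by
  simp [Function.update_of_ne hab.symm]

theorem X_add_eq (a b : σ) (k : ℂ) : (X a + C k * X b : MvPolynomial σ ℂ) = X a - C (-k) * X b := by
  simp

theorem X_add_dvd_iff {a b : σ} (hab : a ≠ b) {k : ℂ} {p : MvPolynomial σ ℂ} :
    X a + C k * X b ∣ p ↔ ∀ z, z a = -k * z b → eval z p = 0 := by
  rw [X_add_eq, X_sub_dvd_iff (eval_C_mul_X_update hab (-k))]
  simp

theorem X_add_prime {a b : σ} (hab : a ≠ b) (k : ℂ) :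
    Prime (X a + C k * X b : MvPolynomial σ ℂ) := by
  rw [X_add_eq]
  exact X_sub_prime (eval_C_mul_X_update hab (-k))

theorem X_sub_C_dvd_iff {a : σ} {k : ℂ} {p : MvPolynomial σ ℂ} :
    X a - C k ∣ p ↔ ∀ z, z a = k → eval z p = 0 := by
  rw [X_sub_dvd_iff (by simp)]
  simp

theorem X_sub_C_prime (a : σ) (k : ℂ) : Prime (X a - C k : MvPolynomial σ ℂ) :=
  X_sub_prime (by simp)

theorem isRelPrime_of_prime {p s : MvPolynomial σ ℂ} (hp : Prime p) (h : ¬ p ∣ s) :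
    IsRelPrime p s := hp.irreducible.isRelPrime_iff_not_dvd.2 h

theorem q_sq_ne_one : q ^ 2 ≠ 1 := fun h => q_ne_one (by
  have := q_pow_three
  rw [pow_succ, h, one_mul] at this
  exact this)

/-- Suitable points separate the two hyperplanes. For a pair and its reversal this needs q² ≠ 1. -/
theorem not_X_add_dvd {a b c d : σ} (hab : a ≠ b) (hcd : c ≠ d) (h : (a, b) ≠ (c, d)) :
    ¬ (X a + C q * X b : MvPolynomial σ ℂ) ∣ X c + C q * X d := by
  rw [X_add_dvd_iff hab]
  push Not
  by_cases hc : c ≠ a ∧ c ≠ b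
  · refine ⟨Pi.single c 1, ?_, ?_⟩
    · simp [hc.1.symm, hc.2.symm]
    · simp [hcd.symm]
  by_cases hd : d ≠ a ∧ d ≠ b
  · refine ⟨Pi.single d 1, ?_, ?_⟩
    · simp [hd.1.symm, hd.2.symm]
    · simp [hcd, q_ne_zero]
  have e : c = b ∧ d = a := by
    by_contra he
    simp only [Ne, Prod.mk.injEq] at h
    grind
  obtain ⟨rfl, rfl⟩ := e
  refine ⟨fun i => if i = d then -q else 1, ?_, ?_⟩
  · simp [hcd]
  · simp only [map_add, eval_X, map_mul, eval_C, if_neg hcd, if_true]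
    intro h0
    exact q_sq_ne_one (by linear_combination -h0)

end dvd

variable {N : ℕ} [NeZero N]

/-! ### Vanishing of components -/

theorem faceState_eq_of_ne {i : ℤ} {b : Bool × Bool} {s s' : State N} (hN : 2 ≤ N)
    (h : faceState i b s = s') (hs : s'.2.partner i ≠ i + 1) : b.2 = false ∧ s.2 = s'.2 := by
  obtain ⟨b1, b2⟩ := b
  cases b2
  · have := congrArg Prod.snd h
    exact ⟨rfl, this⟩
  · exfalso
    apply hs
    rw [← congrArg Prod.snd h]
    exact LinkPattern.tl_partner_left hN i _

theorem push_faceState_false (i : ℤ) (v : State N → ℂ) :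
    push (faceState i (false, false)) v = v := push_id v

theorem push_faceState_true (i : ℤ) (hN : 2 ≤ N) {b : Bool} {s : State N}
    (hs : s.2.partner i ≠ i + 1) (v : State N → ℂ) : push (faceState i (b, true)) v s = 0 := by
  rw [push_apply]
  refine Finset.sum_eq_zero fun s' _ => if_neg fun h => ?_
  have := (faceState_eq_of_ne hN h hs).1
  simp at this

/-- A component without arcs of one colour between the points `i` and `j` is divisible by
`z_i + q z_j`. -/
theorem Good.X_add_dvd {Ψ : State N → MvPolynomial (Fin N) ℂ} (h : Good Ψ) {γ : LinkPattern N}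
    {i j : ℕ} (hij : i < j) (hjN : j < i + N)
    (hγ : ∀ l : ℕ, i ≤ l → l < j → γ.partner l ≠ l + 1) (R : LinkPattern N) :
    X (col i) + C q * X (col j) ∣ Ψ (R, γ) := by
  have hN : 2 ≤ N := by omega
  have hne : ∀ a b : ℕ, a < b → b < a + N → (col (a : ℤ) : Fin N) ≠ col (b : ℤ) := by
    intro a b h1 h2
    rw [Ne, col_eq_iff]
    intro hd
    have := Int.le_of_dvd (by omega) ((dvd_neg (α := ℤ)).2 hd)
    omega
  induction j, hij using Nat.le_induction generalizing R with
  | base =>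
    have hc := hne i (i + 1) (by omega) (by omega)
    have hγi : γ.partner (i : ℤ) ≠ i + 1 := hγ i le_rfl (by omega)
    -- it suffices to consider points with nonzero coordinates
    refine ((X_add_prime hc q).dvd_or_dvd ((X_add_dvd_iff (p := X (col ((i + 1 : ℕ) : ℤ)) *
      Ψ (R, γ)) hc).2 fun z hz => ?_)).resolve_left ?_
    swap
    · rw [X_add_dvd_iff hc]
      push Not
      refine ⟨fun a => if a = col i then -q else 1, ?_, ?_⟩
      · simp only [if_true, if_neg hc.symm, mul_one]
      · rw [eval_X, if_neg hc.symm]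
        exact one_ne_zero
    rw [map_mul, eval_X]
    by_cases hz0 : z (col ((i + 1 : ℕ) : ℤ)) = 0
    · rw [hz0, zero_mul]
    refine mul_eq_zero_of_right _ ?_
    -- At z_i = -q z_{i+1} the left side of the exchange relation vanishes, and the faces with a
    -- green tile `true` do not contribute because γ has no small arc at i.
    have key : ∀ R, omegaD (z (col (i + 1))) (z (col i)) * evalv Ψ z (R, γ) +
        omegaRL (z (col (i + 1))) (z (col i)) *
          push (faceState i (true, false)) (evalv Ψ z) (R, γ) = 0 := fun R => by
      have := h.exch_sum i (by omega) hN z (R, γ)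
      rw [Fintype.sum_prod_type] at this
      simp only [Fintype.sum_bool] at this
      rw [push_faceState_true i hN hγi, push_faceState_true i hN hγi, push_faceState_false] at this
      push_cast at hz
      have e : scal (z (col i)) (z (col (i + 1))) = 0 := by
        rw [scal, hz]
        linear_combination (z (col (i + 1))) ^ 2 * q_pow_three
      rw [e] at this
      simp only [xw, faceWeight] at this
      linear_combination -this
    push_cast at hz hz0
    have hd : omegaD (z (col (i + 1))) (z (col i)) = -2 * (q ^ 2 * (1 - q ^ 2)) *
        z (col (i + 1)) ^ 2 := by
      rw [omegaD, hz]; ring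
    have hrl : omegaRL (z (col (i + 1))) (z (col i)) = (q ^ 2 * (1 - q ^ 2)) *
        z (col (i + 1)) ^ 2 := by
      rw [omegaRL, hz]
      linear_combination (-z (col (i + 1)) ^ 2) * (1 - q ^ 2) * q_sq
    have hk : (q ^ 2 * (1 - q ^ 2)) * z (col (i + 1)) ^ 2 ≠ 0 :=
      mul_ne_zero (mul_ne_zero (pow_ne_zero _ q_ne_zero) (sub_ne_zero.2 q_sq_ne_one.symm))
        (pow_ne_zero _ hz0)
    -- With κ = q² (1 - q²) z_{i+1}² ≠ 0 the weights are ω_D = -2 κ and ω_RL = κ. If red has no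
    -- small arc at i either, only the first term is left.
    have zero : ∀ R : LinkPattern N, R.partner i ≠ i + 1 → evalv Ψ z (R, γ) = 0 := by
      intro R hR
      have := key R
      have e : push (faceState i (true, false)) (evalv Ψ z) (R, γ) = 0 := by
        rw [push_apply]
        refine Finset.sum_eq_zero fun s' _ => if_neg fun h => hR ?_
        have e : LinkPattern.tl i s'.1 = R := congrArg Prod.fst h
        rw [← e]
        exact LinkPattern.tl_partner_left hN i _
      rw [e, mul_zero, add_zero, hd] at this
      refine (mul_eq_zero.1 this).resolve_left ?_
      rw [mul_assoc]
      exact mul_ne_zero (by norm_num) hk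
    change evalv Ψ z (R, γ) = 0
    by_cases hR : R.partner i = i + 1
    swap
    · exact zero R hR
    -- If red has the arc, all preimages except the state itself lack it and vanish by the previous
    -- case. The relation becomes (-2 + 1) κ Ψ = 0.
    have e : push (faceState i (true, false)) (evalv Ψ z) (R, γ) = evalv Ψ z (R, γ) := by
      rw [push_apply, Finset.sum_eq_single (R, γ)]
      · rw [if_pos]
        exact Prod.ext (LinkPattern.tl_eq_self hR) rfl
      · rintro ⟨a, c⟩ - hs
        split_ifs with he
        · have ec : c = γ := congrArg Prod.snd he
          have ea : LinkPattern.tl i a = R := congrArg Prod.fst he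
          rw [ec]
          refine zero a fun ha => hs ?_
          rw [ec, ← ea, LinkPattern.tl_eq_self ha]
        · rfl
      · simp
    have := key R
    rw [e, hd, hrl] at this
    refine (mul_eq_zero.1 (show -((q ^ 2 * (1 - q ^ 2)) * z (col (i + 1)) ^ 2) *
      evalv Ψ z (R, γ) = 0 by linear_combination this)).resolve_left (neg_ne_zero.2 hk)
  | succ j hj ih =>
    have hj' : i < j := hj
    have c1 := hne i (j + 1) (by omega) hjN
    have c2 := hne i j hj' (by omega)
    have c3 := hne j (j + 1) (by omega) (by omega)
    have hγj : γ.partner (j : ℤ) ≠ j + 1 := hγ j (by omega) (by omega)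
    have ih' := fun R => (X_add_dvd_iff c2).1 (ih (by omega) (fun l h1 h2 => hγ l h1 (by omega)) R)
    -- The exchange at j, read at the point with z_j and z_{j+1} interchanged, expresses Ψ times
    -- this quadratic factor by components with the same green pattern at a point where z_i = -q
    -- z_j, and these vanish by induction. The linear form does not divide the quadratic factor.
    refine ((X_add_prime c1 q).dvd_or_dvd ((X_add_dvd_iff
      (p := (C q * X (col ((j + 1 : ℕ) : ℤ)) ^ 2 - X (col (j : ℤ)) ^ 2) *
      Ψ (R, γ)) c1).2 fun z hz => ?_)).resolve_left ?_
    swap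
    · rw [X_add_dvd_iff c1]
      push Not
      refine ⟨Pi.single (col (j : ℤ)) 1, ?_, ?_⟩
      · rw [Pi.single_eq_of_ne c2, Pi.single_eq_of_ne c3.symm, mul_zero]
      · simp only [map_sub, map_mul, map_pow, eval_X, eval_C]
        rw [Pi.single_eq_of_ne c3.symm, Pi.single_eq_same]
        norm_num
    have := h.exch_sum j (by omega) hN (z ∘ Equiv.swap (col j) (col (j + 1))) (R, γ)
    push_cast at c1 c3 hz ⊢
    have e : (z ∘ Equiv.swap (col j) (col (j + 1))) ∘ Equiv.swap (col (j : ℤ)) (col (j + 1)) = z :=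
      by
        funext a
        simp
    rw [e] at this
    simp only [Function.comp, Equiv.swap_apply_left, Equiv.swap_apply_right] at this
    simp only [map_mul, map_sub, map_pow, eval_X, eval_C]
    refine this.trans (Finset.sum_eq_zero fun b _ => mul_eq_zero_of_right _ ?_)
    obtain ⟨b1, b2⟩ := b
    rw [push_apply]
    refine Finset.sum_eq_zero fun s' _ => ?_
    split_ifs with he
    · have e2 : s'.2 = γ := (faceState_eq_of_ne hN he hγj).2
      have e3 : s' = (s'.1, γ) := Prod.ext rfl e2
      rw [e3]
      refine ih' s'.1 _ ?_
      simp only [Function.comp]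
      rw [Equiv.swap_apply_left, Equiv.swap_apply_of_ne_of_ne c2 c1, hz]
    · rfl

/-! ### The trivial factor -/

theorem prod_Ioi_eq (N : ℕ) (f : ℕ → ℕ → ℂ) :
    ∏ i : Fin N, ∏ j ∈ Finset.Ioi i, f i j = ∏ j ∈ Finset.range N, ∏ i ∈ Finset.range j, f i j := by
  rw [Finset.prod_range, Finset.prod_comm' (t' := Finset.univ) (s' := Finset.Iio) (by simp)]
  refine Finset.prod_congr rfl fun j _ => ?_
  rw [← Nat.Iio_eq_range, ← Fin.map_valEmbedding_Iio, Finset.prod_map]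
  rfl

/-- The product of the `z_i + q z_j` over the pairs `i < j < m`. -/
noncomputable def pairProd (m : ℕ) (ζ : ℕ → ℂ) : ℂ :=
  ∏ j ∈ Finset.range m, ∏ i ∈ Finset.range j, (ζ i + q * ζ j)

/-- The factor of the trivial factor for points on different sides. -/
noncomputable def crossProd (m k : ℕ) (ζ η : ℕ → ℂ) : ℂ :=
  ∏ i ∈ Finset.range m, ∏ j ∈ Finset.range k, (q⁻¹ * (ζ i + q * η j) * (η j + q * ζ i))

theorem eval_trivialFactor (m k : ℕ) (ζ : ℕ → ℂ) :
    eval (fun j : Fin (m + k) => ζ j) (trivialFactor (m + k) m) =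
      pairProd m ζ * pairProd k (fun j => ζ (m + j)) * crossProd m k ζ (fun j => ζ (m + j)) := by
  let f : ℕ → ℕ → ℂ := fun i j => if i < m ∧ m ≤ j then
    q⁻¹ * (ζ i + q * ζ j) * (ζ j + q * ζ i) else ζ i + q * ζ j
  have e : eval (fun j : Fin (m + k) => ζ j) (trivialFactor (m + k) m) =
      ∏ i : Fin (m + k), ∏ j ∈ Finset.Ioi i, f i j := by
    rw [trivialFactor, map_prod]
    refine Finset.prod_congr rfl fun i _ => ?_
    rw [map_prod]
    refine Finset.prod_congr rfl fun j _ => ?_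
    simp only [f]
    split_ifs <;> simp
  rw [e, prod_Ioi_eq _ f, Finset.prod_range_add, mul_assoc]
  congr 1
  · refine Finset.prod_congr rfl fun j hj => Finset.prod_congr rfl fun i hi => ?_
    rw [Finset.mem_range] at hi hj
    exact if_neg (by omega)
  · rw [mul_comm, crossProd, Finset.prod_comm, pairProd, ← Finset.prod_mul_distrib]
    refine Finset.prod_congr rfl fun j hj => ?_
    rw [Finset.prod_range_add]
    congr 1
    · refine Finset.prod_congr rfl fun i hi => ?_
      rw [Finset.mem_range] at hi
      exact if_pos (by omega)
    · exact Finset.prod_congr rfl fun i _ => if_neg (by omega)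

theorem one_add_q : 1 + q = -q ^ 2 := by rw [q_sq]; ring

theorem one_add_q_ne_zero : 1 + q ≠ 0 := by
  rw [one_add_q]
  exact neg_ne_zero.2 (pow_ne_zero _ q_ne_zero)

theorem eval_one_trivialFactor_ne_zero (N m : ℕ) :
    eval (fun _ : Fin N => 1) (trivialFactor N m) ≠ 0 := by
  rw [trivialFactor, map_prod]
  refine Finset.prod_ne_zero_iff.2 fun i _ => ?_
  rw [map_prod]
  refine Finset.prod_ne_zero_iff.2 fun j _ => ?_
  split_ifs <;> simp [one_add_q_ne_zero, q_ne_zero]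

theorem trivialFactor_ne_zero (N m : ℕ) : trivialFactor N m ≠ 0 := fun h =>
  eval_one_trivialFactor_ne_zero N m (by rw [h, map_zero])

theorem prod_comp_perm (m : ℕ) (π : Equiv.Perm ℕ) (hπ : ∀ a, m ≤ a → π a = a) (f : ℕ → ℂ) :
    ∏ i ∈ Finset.range m, f (π i) = ∏ i ∈ Finset.range m, f i := by
  refine Equiv.Perm.prod_comp π _ f fun a ha => ?_
  by_contra h
  exact ha (hπ a (by simpa using h))

theorem pairProd_succ (m : ℕ) (ζ : ℕ → ℂ) :
    pairProd (m + 1) ζ = pairProd m ζ * ∏ i ∈ Finset.range m, (ζ i + q * ζ m) :=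
  Finset.prod_range_succ _ _

theorem pairProd_succ' (m : ℕ) (ζ : ℕ → ℂ) :
    pairProd (m + 1) ζ =
      pairProd m (fun i => ζ (i + 1)) * ∏ j ∈ Finset.range m, (ζ 0 + q * ζ (j + 1)) := by
  induction m with
  | zero => simp [pairProd]
  | succ m ih =>
    rw [pairProd_succ (m + 1), ih, pairProd_succ m, Finset.prod_range_succ' _ m,
      Finset.prod_range_succ _ m]
    ring

theorem swap_eq_self_of_le {l m a : ℕ} (hl : l + 1 < m) (ha : m ≤ a) :
    Equiv.swap l (l + 1) a = a :=
  Equiv.swap_apply_of_ne_of_ne (by omega) (by omega)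

/-- Only the factor of the pair (l, l + 1) itself is reversed by the swap. -/
theorem pairProd_swap {m l : ℕ} (hl : l + 1 < m) (ζ : ℕ → ℂ) :
    pairProd m (ζ ∘ Equiv.swap l (l + 1)) * (ζ l + q * ζ (l + 1)) =
      pairProd m ζ * (ζ (l + 1) + q * ζ l) := by
  induction m, hl using Nat.le_induction with
  | base =>
    have e : ∀ i < l, Equiv.swap l (l + 1) i = i := fun i hi =>
      Equiv.swap_apply_of_ne_of_ne (by omega) (by omega)
    have e1 : pairProd l (ζ ∘ Equiv.swap l (l + 1)) = pairProd l ζ := by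
      refine Finset.prod_congr rfl fun j hj => Finset.prod_congr rfl fun i hi => ?_
      rw [Finset.mem_range] at hi hj
      simp only [Function.comp]
      rw [e i (by omega), e j hj]
    have e2 : ∀ w, ∏ i ∈ Finset.range l, ((ζ ∘ Equiv.swap l (l + 1)) i + q * w) =
        ∏ i ∈ Finset.range l, (ζ i + q * w) := fun w => by
      refine Finset.prod_congr rfl fun i hi => ?_
      rw [Finset.mem_range] at hi
      simp only [Function.comp]
      rw [e i hi]
    simp only [Nat.succ_eq_add_one]
    rw [pairProd_succ (l + 1), pairProd_succ l, pairProd_succ (l + 1), pairProd_succ l, e1,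
      Finset.prod_range_succ _ l, Finset.prod_range_succ _ l, e2, e2]
    simp only [Function.comp, Equiv.swap_apply_left, Equiv.swap_apply_right]
    ring
  | succ m hm ih =>
    have hm' : l + 1 < m := hm
    rw [pairProd_succ, pairProd_succ, mul_right_comm, ih]
    simp only [Function.comp]
    rw [swap_eq_self_of_le hm' le_rfl, prod_comp_perm m _ (fun a => swap_eq_self_of_le hm')
      (fun a => ζ a + q * ζ m)]
    ring

theorem crossProd_comp_perm (m k : ℕ) (π : Equiv.Perm ℕ) (hπ : ∀ a, m ≤ a → π a = a)
    (ζ η : ℕ → ℂ) : crossProd m k (ζ ∘ π) η = crossProd m k ζ η :=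
  prod_comp_perm m π hπ fun a =>
    ∏ j ∈ Finset.range k, (q⁻¹ * (ζ a + q * η j) * (η j + q * ζ a))

theorem eval_trivialFactor_swap {m k l : ℕ} (hl : l + 1 < m) (ζ : ℕ → ℂ) :
    eval (fun j : Fin (m + k) => (ζ ∘ Equiv.swap l (l + 1)) j) (trivialFactor (m + k) m) *
      (ζ l + q * ζ (l + 1)) =
    eval (fun j : Fin (m + k) => ζ j) (trivialFactor (m + k) m) * (ζ (l + 1) + q * ζ l) := by
  have e : (fun j => (ζ ∘ Equiv.swap l (l + 1)) (m + j)) = fun j => ζ (m + j) := by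
    funext j
    simp only [Function.comp]
    rw [swap_eq_self_of_le hl (by omega)]
  rw [eval_trivialFactor, eval_trivialFactor, e,
    crossProd_comp_perm m k _ (fun a => swap_eq_self_of_le hl)]
  linear_combination (pairProd k (fun j => ζ (m + j)) * crossProd m k ζ (fun j => ζ (m + j))) *
    pairProd_swap hl ζ

/-! ### Division by the trivial factor -/

variable {N : ℕ} [NeZero N] {Ψ : State N → MvPolynomial (Fin N) ℂ}

theorem Good.X_add_dvd_fst (h : Good Ψ) {γ : LinkPattern N}
    {i j : ℕ} (hij : i < j) (hjN : j < i + N)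
    (hγ : ∀ l : ℕ, i ≤ l → l < j → γ.partner l ≠ l + 1) (G : LinkPattern N) :
    X (col i) + C q * X (col j) ∣ Ψ (γ, G) := by
  rw [← h.swap_colour]
  exact h.X_add_dvd hij hjN hγ G

theorem nested_partner_ne {c l : ℤ} (h1 : c ≤ l) (h2 : l < c + N - 1) :
    (nested N c).partner l ≠ l + 1 := fun h => by
  have := Int.le_of_dvd (by omega) (LinkPattern.dvd_of_nested_partner h)
  omega

theorem nested_partner_ne' {c l : ℤ} (h1 : c - N ≤ l) (h2 : l < c - 1) :
    (nested N c).partner l ≠ l + 1 := fun h => by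
  have h := LinkPattern.dvd_of_nested_partner h
  have := Int.le_of_dvd (by omega) ((dvd_neg (α := ℤ)).2 h)
  omega

theorem isRelPrime_pairs {i j i' j' : Fin N} (hij : i < j) (hij' : i' < j')
    (h : (i, j) ≠ (i', j')) :
    IsRelPrime ((X i + C q * X j) * (X j + C q * X i) : MvPolynomial (Fin N) ℂ)
      ((X i' + C q * X j') * (X j' + C q * X i')) := by
  have key : ∀ a b c d : Fin N, a ≠ b → c ≠ d → (a, b) ≠ (c, d) →
      IsRelPrime (X a + C q * X b : MvPolynomial (Fin N) ℂ) (X c + C q * X d) :=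
    fun a b c d hab hcd h => isRelPrime_of_prime (X_add_prime hab q) (not_X_add_dvd hab hcd h)
  have e1 : (i, j) ≠ (j', i') := fun e => by
    simp only [Prod.mk.injEq] at e
    omega
  have e2 : (j, i) ≠ (i', j') := fun e => by
    simp only [Prod.mk.injEq] at e
    omega
  have e3 : (j, i) ≠ (j', i') := fun e => h (by
    simp only [Prod.mk.injEq] at e ⊢
    exact ⟨e.2, e.1⟩)
  refine IsRelPrime.mul_left ?_ ?_
  · exact (key _ _ _ _ hij.ne hij'.ne h).mul_right (key _ _ _ _ hij.ne hij'.ne' e1)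
  · exact (key _ _ _ _ hij.ne' hij'.ne e2).mul_right (key _ _ _ _ hij.ne' hij'.ne' e3)

/-- The factors are pairwise coprime and each comes from a window without small arcs. For i < j on
the same side of m the green window from i to j gives z_i + q z_j. For i < m ≤ j this factor comes
from red, and green, read around the seam from j to i + N, adds the factor z_j + q z_i. -/
theorem Good.trivialFactor_dvd (h : Good Ψ) {m : ℕ} (hm : m ≤ N) :
    trivialFactor N m ∣ Ψ (mnc N m) := by
  have hval : ∀ i : Fin N, col ((i : ℕ) : ℤ) = i := col_val
  have hu : ∀ i j : Fin N, (if (i : ℕ) < m ∧ m ≤ (j : ℕ) then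
      C q⁻¹ * (X i + C q * X j) * (X j + C q * X i) else X i + C q * X j :
        MvPolynomial (Fin N) ℂ) ∣ (X i + C q * X j) * (X j + C q * X i) := fun i j => by
    split_ifs
    · refine ⟨C q, ?_⟩
      have : (C q⁻¹ * C q : MvPolynomial (Fin N) ℂ) = 1 := by
        rw [← C_mul, inv_mul_cancel₀ q_ne_zero, C_1]
      linear_combination (-(X i + C q * X j) * (X j + C q * X i)) * this
    · exact dvd_mul_right _ _
  rw [trivialFactor, Finset.prod_sigma']
  refine Finset.prod_dvd_of_isRelPrime ?_ ?_
  · rintro ⟨i, j⟩ hij ⟨i', j'⟩ hij' hne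
    simp only [Finset.coe_sigma, Finset.coe_univ, Set.mem_sigma_iff, Set.mem_univ, true_and,
      Finset.coe_Ioi, Set.mem_Ioi] at hij hij'
    exact ((isRelPrime_pairs hij hij' fun e => hne (by
      simp only [Prod.mk.injEq] at e
      obtain ⟨rfl, rfl⟩ := e
      rfl)).of_dvd_left (hu i j)).of_dvd_right (hu i' j')
  · rintro ⟨i, j⟩ hij
    simp only [Finset.mem_sigma, Finset.mem_univ, Finset.mem_Ioi, true_and] at hij
    have hij' : (i : ℕ) < j := hij
    have hi := i.2
    have hj := j.2
    by_cases hc : (i : ℕ) < m ∧ m ≤ (j : ℕ)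
    · rw [if_pos hc]
      have d1 := h.X_add_dvd_fst (γ := nested N 0) hij' (by omega)
        (fun l h1 h2 => nested_partner_ne (by omega) (by omega)) (nested N m)
      have d2 := h.X_add_dvd (γ := nested N m) (i := j) (j := i + N) (by omega) (by omega)
        (fun l h1 h2 => nested_partner_ne (by omega) (by omega)) (nested N 0)
      have e : (col ((i + N : ℕ) : ℤ) : Fin N) = i := by
        have := col_add_mul (N := N) ((i : ℕ) : ℤ) 1
        rw [hval, mul_one] at this
        exact_mod_cast this
      rw [hval, hval] at d1
      rw [hval, e] at d2
      have d : (X i + C q * X j) * (X j + C q * X i) ∣ Ψ (mnc N m) := by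
        refine IsRelPrime.mul_dvd (isRelPrime_of_prime (X_add_prime hij.ne q)
          (not_X_add_dvd hij.ne hij.ne' fun e => ?_)) d1 d2
        simp only [Prod.mk.injEq] at e
        omega
      have := hu i j
      rw [if_pos hc] at this
      exact this.trans d
    · rw [if_neg hc]
      have := h.X_add_dvd (γ := nested N m) hij' (by omega) (fun l h1 h2 => ?_) (nested N 0)
      · rwa [hval, hval] at this
      · rcases Nat.lt_or_ge (i : ℕ) m with him | him
        · exact nested_partner_ne' (by omega) (by omega)
        · exact nested_partner_ne (by omega) (by omega)

/-- A face with a `true` tile creates a small arc at i in that colour, so only ω_D contributes. -/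
theorem Good.exch_of_ne (h : Good Ψ) {i : ℕ} (hN : 2 ≤ N) {s : State N}
    (h1 : s.1.partner i ≠ i + 1) (h2 : s.2.partner i ≠ i + 1) (z : Fin N → ℂ) :
    scal (z (col i)) (z (col (i + 1))) * evalv Ψ (z ∘ Equiv.swap (col i) (col (i + 1))) s =
      omegaD (z (col (i + 1))) (z (col i)) * evalv Ψ z s := by
  have := h.exch_sum i (by omega) hN z s
  rw [Fintype.sum_prod_type] at this
  simp only [Fintype.sum_bool] at this
  have e : push (faceState (i : ℤ) (true, false)) (evalv Ψ z) s = 0 := by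
    rw [push_apply]
    refine Finset.sum_eq_zero fun s' _ => if_neg fun h => h1 ?_
    have e : LinkPattern.tl i s'.1 = s.1 := congrArg Prod.fst h
    rw [← e]
    exact LinkPattern.tl_partner_left hN i _
  rw [push_faceState_true i hN h2, push_faceState_true i hN h2, push_faceState_false, e] at this
  rw [this]
  simp [xw, faceWeight]

theorem comp_swap_col {l : ℕ} (hl : l + 1 < N) (ζ : ℕ → ℂ) :
    (fun j : Fin N => ζ j) ∘ Equiv.swap (col (l : ℤ)) (col ((l : ℤ) + 1)) =
      fun j : Fin N => (ζ ∘ Equiv.swap l (l + 1)) j := by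
  have e1 := col_nat (N := N) (k := l) (by omega)
  have e2 := col_nat (N := N) (k := l + 1) hl
  push_cast at e2
  funext j
  simp only [Function.comp]
  congr 1
  rw [e1, e2]
  simp only [Equiv.swap_apply_def, Fin.ext_iff]
  split_ifs <;> rfl

theorem exists_nat_ext (z : Fin N → ℂ) : ∃ ζ : ℕ → ℂ, z = fun j : Fin N => ζ j :=
  ⟨fun i => if h : i < N then z ⟨i, h⟩ else 0, by funext j; simp⟩

/-- The nontrivial factor of a maximally nested component is symmetric in the first variables. -/
theorem Good.factor_swap (h : Good Ψ) {m k l : ℕ} (hmk : m + k = N) {F : MvPolynomial (Fin N) ℂ}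
    (hF : Ψ (mnc N m) = trivialFactor N m * F) (hl : l + 1 < m) (ζ : ℕ → ℂ) :
    eval (fun j : Fin N => (ζ ∘ Equiv.swap l (l + 1)) j) F = eval (fun j : Fin N => ζ j) F := by
  subst hmk
  have hN : 2 ≤ m + k := by omega
  have e1 := col_nat (N := m + k) (k := l) (by omega)
  have e2 := col_nat (N := m + k) (k := l + 1) (by omega)
  push_cast at e2
  have key := IsPoly.eq_zero_of_mul (σ := Fin (m + k))
    (F := fun z => (z (col l) - q * z (col (l + 1))) * (z (col (l + 1)) + q * z (col l)) *
      eval z (trivialFactor (m + k) m))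
    (G := fun z => eval (z ∘ Equiv.swap (col (l : ℤ)) (col ((l : ℤ) + 1))) F - eval z F)
    (z₀ := fun _ => 1) ?_ ?_ (fun z => ?_) ?_ (fun j => ζ j)
  · rw [comp_swap_col (by omega)] at key
    exact sub_eq_zero.1 key
  · exact ((((IsPoly.var _).sub ((IsPoly.const _).mul (IsPoly.var _))).mul
      ((IsPoly.var _).add ((IsPoly.const _).mul (IsPoly.var _)))).mul (IsPoly.eval _))
  · exact ((IsPoly.eval F).comp fun i => IsPoly.var _).sub (IsPoly.eval F)
  · obtain ⟨ζ, rfl⟩ := exists_nat_ext z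
    have ex := h.exch_of_ne (i := l) (s := mnc (m + k) m) hN
      (nested_partner_ne (by omega) (by omega)) (nested_partner_ne' (by omega) (by omega))
      (fun j => ζ j)
    have es := eval_trivialFactor_swap (k := k) hl ζ
    rw [evalv, evalv, hF, map_mul, map_mul, comp_swap_col (by omega)] at ex
    rw [comp_swap_col (by omega)]
    simp only [e1, e2, scal, omegaD] at ex ⊢
    -- Both sides of the exchange relation share the factor q (z_l - q z_{l+1}). What is left is
    -- exactly the change of the trivial factor under the swap.
    have e3 : q * ζ l ^ 2 - ζ (l + 1) ^ 2 =
        q * (ζ l - q * ζ (l + 1)) * (ζ l + q * ζ (l + 1)) := by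
      linear_combination (-ζ (l + 1) ^ 2) * q_pow_three * (-1)
    rw [e3] at ex
    have e4 := mul_left_cancel₀ q_ne_zero (show q * ((ζ l - q * ζ (l + 1)) *
      (ζ l + q * ζ (l + 1)) * (eval (fun j : Fin (m + k) => (ζ ∘ Equiv.swap l (l + 1)) j)
        (trivialFactor (m + k) m) * eval (fun j : Fin (m + k) =>
          (ζ ∘ Equiv.swap l (l + 1)) j) F)) = q * ((ζ l - q * ζ (l + 1)) *
        (ζ (l + 1) + q * ζ l) * (eval (fun j : Fin (m + k) => ζ j) (trivialFactor (m + k) m) *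
          eval (fun j : Fin (m + k) => ζ j) F)) by linear_combination ex)
    linear_combination e4 - (ζ l - q * ζ (l + 1)) *
      eval (fun j : Fin (m + k) => (ζ ∘ Equiv.swap l (l + 1)) j) F * es
  · refine mul_ne_zero (mul_ne_zero ?_ ?_) (eval_one_trivialFactor_ne_zero _ _)
    · rw [mul_one]; exact sub_ne_zero.2 q_ne_one.symm
    · rw [mul_one]; exact one_add_q_ne_zero

/-! ### Restriction to `z_{n+1} = -q z_0` -/

section restrict

variable {n : ℕ} [NeZero n]

/-- Insertion of a small arc between the last and the first point for both colours. -/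
noncomputable def insState (s : State n) : State (n + 2) :=
  (LinkPattern.ins (n + 1) s.1, LinkPattern.ins (n + 1) s.2)

theorem insState_injective : Function.Injective (insState (n := n)) := fun _ _ h =>
  Prod.ext (LinkPattern.ins_injective _ (congrArg Prod.fst h))
    (LinkPattern.ins_injective _ (congrArg Prod.snd h))

/-- The point `(x, z, -q x)`. -/
noncomputable def bpt (x : ℂ) (z : Fin n → ℂ) (j : Fin (n + 2)) : ℂ :=
  if (j : ℕ) = 0 then x else if h : (j : ℕ) - 1 < n then z ⟨j - 1, h⟩ else -q * x

/-- The substitution of `(x, z, -q x)`. -/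
noncomputable def bsub (x : ℂ) (j : Fin (n + 2)) : MvPolynomial (Fin n) ℂ :=
  if (j : ℕ) = 0 then C x else if h : (j : ℕ) - 1 < n then X ⟨j - 1, h⟩ else C (-q * x)

/-- The components with an arc between the last and the first point at `(x, z, -q x)`. -/
noncomputable def restr (Ψ : State (n + 2) → MvPolynomial (Fin (n + 2)) ℂ) (x : ℂ) (s : State n) :
    MvPolynomial (Fin n) ℂ :=
  aeval (bsub x) (Ψ (insState s))

theorem eval_bsub (x : ℂ) (z : Fin n → ℂ) (j : Fin (n + 2)) : eval z (bsub x j) = bpt x z j := by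
  unfold bsub bpt
  split_ifs <;> simp

theorem eval_aeval_eq {σ τ : Type*} (g : σ → MvPolynomial τ ℂ) (p : MvPolynomial σ ℂ)
    (z : τ → ℂ) : eval z (aeval g p) = eval (fun i => eval z (g i)) p := by
  have : (eval z).comp (aeval g : MvPolynomial σ ℂ →ₐ[ℂ] _).toRingHom =
      eval fun i => eval z (g i) :=
    MvPolynomial.ringHom_ext (fun a => by simp) fun i => by simp
  exact RingHom.congr_fun this p

theorem evalv_restr (Ψ : State (n + 2) → MvPolynomial (Fin (n + 2)) ℂ) (x : ℂ) (z : Fin n → ℂ)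
    (s : State n) : evalv (restr Ψ x) z s = evalv Ψ (bpt x z) (insState s) := by
  rw [evalv, restr, eval_aeval_eq]
  simp only [eval_bsub]
  rfl

theorem bpt_zero (x : ℂ) (z : Fin n → ℂ) {j : Fin (n + 2)} (hj : (j : ℕ) = 0) : bpt x z j = x :=
  if_pos hj

theorem bpt_last (x : ℂ) (z : Fin n → ℂ) {j : Fin (n + 2)} (hj : (j : ℕ) = n + 1) :
    bpt x z j = -q * x := by
  rw [bpt, if_neg (by omega), dif_neg (by omega)]

theorem bpt_mid (x : ℂ) (z : Fin n → ℂ) {j : Fin (n + 2)} (i : Fin n) (hj : (j : ℕ) = i + 1) :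
    bpt x z j = z i := by
  rw [bpt, if_neg (by omega), dif_pos (by omega)]
  congr 1
  ext
  simp only
  omega

theorem col_nat_val {N k : ℕ} [NeZero N] (hk : k < N) : ((col (k : ℤ) : Fin N) : ℕ) = k := by
  rw [col_nat hk]

variable {Ψ : State (n + 2) → MvPolynomial (Fin (n + 2)) ℂ}

theorem col_wrap : (col ((n + 1 + 1 : ℕ) : ℤ) : Fin (n + 2)) = col ((0 : ℕ) : ℤ) := by
  rw [col_eq_iff]
  exact ⟨1, by push_cast; ring⟩

/-- The first parameter also belongs to the point n + 2, so z_{n+1} = -q z_{n+2}, and every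
component that lacks the small arc across the seam in one of the colours is divisible by z_{n+1} + q
z_{n+2}. -/
theorem Good.evalv_bpt (h : Good Ψ) (x : ℂ) (z : Fin n → ℂ) :
    evalv Ψ (bpt x z) = push insState (evalv (restr Ψ x) z) := by
  classical
  funext S
  by_cases hS : ∃ s, insState s = S
  · obtain ⟨s, rfl⟩ := hS
    rw [push_apply_injective insState_injective, evalv_restr]
  · have e : push insState (evalv (restr Ψ x) z) S = 0 := by
      rw [push_apply]
      exact Finset.sum_eq_zero fun s _ => if_neg fun e => hS ⟨s, e⟩
    rw [e]
    have hz : bpt x z (col ((n + 1 : ℕ) : ℤ)) = -q * bpt x z (col ((n + 1 + 1 : ℕ) : ℤ)) := by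
      rw [col_wrap, bpt_last x z (col_nat_val (by omega)), bpt_zero x z (col_nat_val (by omega))]
    have hne : (col ((n + 1 : ℕ) : ℤ) : Fin (n + 2)) ≠ col ((n + 1 + 1 : ℕ) : ℤ) := by
      rw [col_wrap, Ne, col_nat_inj] <;> omega
    by_cases h2 : S.2.partner ((n + 1 : ℕ) : ℤ) = ((n + 1 : ℕ) : ℤ) + 1
    · have h1 : S.1.partner ((n + 1 : ℕ) : ℤ) ≠ ((n + 1 : ℕ) : ℤ) + 1 := fun h1 => by
        push_cast at h1 h2
        obtain ⟨a, ha⟩ := LinkPattern.exists_ins h1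
        obtain ⟨b, hb⟩ := LinkPattern.exists_ins h2
        exact hS ⟨(a, b), Prod.ext ha hb⟩
      refine (X_add_dvd_iff hne).1 (h.X_add_dvd_fst (i := n + 1) (j := n + 1 + 1) (by omega)
        (by omega) (fun l h3 h4 => ?_) S.2) _ hz
      rw [show l = n + 1 by omega]
      exact h1
    · refine (X_add_dvd_iff hne).1 (h.X_add_dvd (i := n + 1) (j := n + 1 + 1) (by omega)
        (by omega) (fun l h3 h4 => ?_) S.1) _ hz
      rw [show l = n + 1 by omega]
      exact h2

theorem faceState_insState (hn : 2 ≤ n) (b : Bool × Bool) (s : State n) :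
    faceState 1 b (insState s) = insState (faceState 0 b s) := by
  unfold faceState insState
  refine Prod.ext ?_ ?_
  · change (if b.1 then _ else _) = LinkPattern.ins _ (if b.1 then _ else _)
    split_ifs
    · exact LinkPattern.tl_one_ins hn _
    · rfl
  · change (if b.2 then _ else _) = LinkPattern.ins _ (if b.2 then _ else _)
    split_ifs
    · exact LinkPattern.tl_one_ins hn _
    · rfl

theorem faceOp_push_insState (hn : 2 ≤ n) (ω : Bool × Bool → ℂ) (v : State n → ℂ) :
    faceOp 1 ω (push insState v) = push insState (faceOp 0 ω v) := by
  simp only [faceOp, LinearMap.sum_apply, map_sum, LinearMap.smul_apply, map_smul]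
  exact Finset.sum_congr rfl fun b _ => by
    rw [push_comm_of fun s => faceState_insState hn b s]

theorem restr_exch (h : Good Ψ) (x : ℂ) (hn : 2 ≤ n) (z : Fin n → ℂ) :
    scal (z (col 0)) (z (col (0 + 1))) •
      evalv (restr Ψ x) (z ∘ Equiv.swap (col 0) (col (0 + 1))) =
        faceOp 0 (xw (z (col 0)) (z (col (0 + 1)))) (evalv (restr Ψ x) z) := by
  have c0 := col_nat_val (N := n) (k := 0) (by omega)
  have c1 := col_nat_val (N := n) (k := 1) (by omega)
  have d1 := col_nat_val (N := n + 2) (k := 1) (by omega)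
  have d2 := col_nat_val (N := n + 2) (k := 2) (by omega)
  have ex := h.exch_nat (by omega) 1 (bpt x z)
  rw [Nat.cast_zero] at c0
  rw [Nat.cast_one] at c1 d1 ex
  rw [Nat.cast_ofNat] at d2
  rw [one_add_one_eq_two] at ex
  rw [zero_add]
  have e1 : bpt x z (col 1) = z (col 0) := bpt_mid x z _ (by rw [d1, c0])
  have e2 : bpt x z (col 2) = z (col 1) := bpt_mid x z _ (by rw [d2, c1])
  have e3 : bpt x z ∘ Equiv.swap (col 1) (col 2) = bpt x (z ∘ Equiv.swap (col 0) (col 1)) := by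
    funext j
    simp only [Function.comp]
    rcases Nat.lt_or_ge 0 (j : ℕ) with h0 | h0
    swap
    · rw [Equiv.swap_apply_of_ne_of_ne, bpt_zero _ _ (by omega), bpt_zero _ _ (by omega)]
      · intro e; rw [e, d1] at h0; omega
      · intro e; rw [e, d2] at h0; omega
    rcases Nat.lt_or_ge (j : ℕ) (n + 1) with h1 | h1
    swap
    · rw [Equiv.swap_apply_of_ne_of_ne, bpt_last _ _ (by omega), bpt_last _ _ (by omega)]
      · intro e; rw [e, d1] at h1; omega
      · intro e; rw [e, d2] at h1; omega
    rw [bpt_mid x (z ∘ _) ⟨j - 1, by omega⟩ (by simp only; omega)]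
    simp only [Function.comp]
    apply bpt_mid
    simp only [Equiv.swap_apply_def, Fin.ext_iff, d1, d2, c0, c1]
    split_ifs <;> simp_all <;> omega
  rw [e1, e2, e3, h.evalv_bpt, h.evalv_bpt, faceOp_push_insState hn, ← map_smul] at ex
  funext s
  have := congrFun ex (insState s)
  rwa [push_apply_injective insState_injective, push_apply_injective insState_injective] at this

theorem ins_partner_zero (σ : LinkPattern n) :
    (LinkPattern.ins (n + 1) σ).partner 0 = -1 := by
  have h1 := LinkPattern.ins_partner_left (n + 1 : ℤ) σ
  have h2 := LinkPattern.partner_add_mul (LinkPattern.ins (n + 1) σ) (n + 1) (-1)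
  rw [h1] at h2
  have h3 := LinkPattern.invol (LinkPattern.ins (n + 1) σ) (n + 1 + ((n + 2 : ℕ) : ℤ) * (-1))
  rw [h2] at h3
  push_cast at h3
  rw [show (n : ℤ) + 1 + 1 + (n + 2) * (-1) = 0 by ring] at h3
  rw [h3]
  ring

/-- The words in the operators `e_0`, `e_{n+1}` that lead back to states with an arc between the
last and the first point. -/
theorem faceState_rotState_insState (b b' : Bool × Bool) (s t : State n) :
    faceState 0 b (faceState (n + 1) b' (rotState (insState t))) = insState s ↔
      (b = (false, false) ∧ b' = (true, true)) ∧ rotState t = s := by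
  have key : ∀ (b b' : Bool) (σ τ : LinkPattern n),
      (if b then LinkPattern.tl 0 (if b' then LinkPattern.tl (n + 1)
        (LinkPattern.rot (LinkPattern.ins (n + 1) τ)) else
          LinkPattern.rot (LinkPattern.ins (n + 1) τ)) else
        (if b' then LinkPattern.tl (n + 1) (LinkPattern.rot (LinkPattern.ins (n + 1) τ)) else
          LinkPattern.rot (LinkPattern.ins (n + 1) τ))) = LinkPattern.ins (n + 1) σ ↔
      (b = false ∧ b' = true) ∧ LinkPattern.rot τ = σ := by
    intro b b' σ τ
    cases b
    · cases b'
      · simp only [Bool.false_eq_true, if_false, and_false, false_and, iff_false]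
        intro e
        have h0 := ins_partner_zero σ
        rw [← e, LinkPattern.rot_partner] at h0
        have h1 := LinkPattern.partner_add_mul (LinkPattern.ins (n + 1) τ) (n + 1) (-1)
        rw [LinkPattern.ins_partner_left] at h1
        push_cast at h1
        rw [show (n : ℤ) + 1 + (n + 2) * (-1) = 0 - 1 by ring] at h1
        rw [h1] at h0
        omega
      · simp only [Bool.false_eq_true, if_false, if_true, and_self, true_and]
        rw [LinkPattern.rot_ins, LinkPattern.tl_ins_succ]
        exact (LinkPattern.ins_injective _).eq_iff
    · simp only [if_true, Bool.true_eq_false, false_and, iff_false]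
      intro e
      have h0 := ins_partner_zero σ
      rw [← e, LinkPattern.tl_partner_left (by omega)] at h0
      omega
  obtain ⟨b1, b2⟩ := b
  obtain ⟨c1, c2⟩ := b'
  rw [Prod.ext_iff]
  have k1 := key b1 c1 s.1 t.1
  have k2 := key b2 c2 s.2 t.2
  refine (and_congr k1 k2).trans ?_
  simp only [Prod.mk.injEq]
  rw [Prod.ext_iff (x := rotState t)]
  simp only [rotState]
  tauto

/-- A rotation of the small system carries its first parameter past the inserted pair x, -q x. In
the large system this is an exchange with x, a rotation, and an exchange with -q x. -/
theorem restr_rot (h : Good Ψ) {x : ℂ} (hx : x ≠ 0) (z : Fin n → ℂ) (s : State n) :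
    evalv (restr Ψ x) z (rotState s) = evalv (restr Ψ x) (fun j => z (j + 1)) s := by
  classical
  have hn := NeZero.pos n
  have c0 := col_nat_val (N := n) (k := 0) (by omega)
  have d0 := col_nat_val (N := n + 2) (k := 0) (by omega)
  have d1 := col_nat_val (N := n + 2) (k := 1) (by omega)
  have dn := col_nat_val (N := n + 2) (k := n) (by omega)
  have dn1 := col_nat_val (N := n + 2) (k := n + 1) (by omega)
  rw [Nat.cast_zero] at c0 d0
  rw [Nat.cast_one] at d1
  rw [Nat.cast_add, Nat.cast_one] at dn1
  have step : ∀ z : Fin n → ℂ,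
      (scal (z (col 0)) (-q * x) * scal (z (col 0)) x) * evalv (restr Ψ x) z (rotState s) =
      (scal (z (col 0)) (-q * x) * scal (z (col 0)) x) *
        evalv (restr Ψ x) (fun j => z (j + 1)) s := fun z => by
    set z' : Fin n → ℂ := fun j => z (j + 1) with hz'
    -- The intermediate point (z_0, x, z_1, …, -q x). Rotated, it becomes (x, z_1, …, -q x, z_0),
    -- which differs from the point for the shifted parameters z' by an exchange of the last two
    -- columns.
    set r : Fin (n + 2) → ℂ := bpt x z ∘ Equiv.swap (col 0) (col (0 + 1)) with hr
    -- the special points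
    have r0 : r (col 0) = z (col 0) := by
      rw [hr, Function.comp, Equiv.swap_apply_left]
      exact bpt_mid x z _ (by rw [zero_add, d1, c0])
    have r1 : r (col (0 + 1)) = x := by
      rw [hr, Function.comp, Equiv.swap_apply_right]
      exact bpt_zero x z d0
    have rr : r ∘ Equiv.swap (col 0) (col (0 + 1)) = bpt x z := by
      funext j
      simp [hr]
    have pn : bpt x z' (col (n : ℤ)) = z (col 0) := by
      rw [bpt_mid x z' ⟨n - 1, by omega⟩ (by rw [dn]; simp only; omega), hz']
      simp only
      congr 1
      have := col_add_one (N := n) ((n - 1 : ℕ) : ℤ)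
      rw [col_nat (by omega)] at this
      rw [← this, col_eq_iff]
      exact ⟨1, by push_cast [hn]; ring⟩
    have pn1 : bpt x z' (col ((n : ℤ) + 1)) = -q * x := bpt_last x z' dn1
    have rho : (fun j => r (j + 1)) = bpt x z' ∘ Equiv.swap (col (n : ℤ)) (col ((n : ℤ) + 1)) := by
      funext j
      obtain ⟨k, hk⟩ := j
      rw [← col_nat hk, ← col_add_one, hr]
      simp only [Function.comp]
      rcases Nat.lt_or_ge k n with h1 | h1
      · have hk1 := col_nat_val (N := n + 2) (k := k + 1) (by omega)
        have hk0 := col_nat_val (N := n + 2) (k := k) (by omega)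
        push_cast at hk1
        rw [Equiv.swap_apply_of_ne_of_ne (a := col (n : ℤ))]
        rotate_left
        · intro e; rw [e, dn] at hk0; omega
        · intro e; rw [e, dn1] at hk0; omega
        by_cases hk00 : k = 0
        · subst hk00
          rw [Nat.cast_zero, Equiv.swap_apply_right, bpt_zero x z d0, bpt_zero x z' d0]
        · rw [Equiv.swap_apply_of_ne_of_ne, bpt_mid x z ⟨k, h1⟩ (by rw [hk1]),
            bpt_mid x z' ⟨k - 1, by omega⟩ (by rw [hk0]; simp only; omega), hz']
          · simp only
            congr 1
            have := col_add_one (N := n) ((k - 1 : ℕ) : ℤ)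
            rw [col_nat (by omega)] at this
            rw [← this, ← col_nat h1, col_eq_iff]
            exact ⟨0, by push_cast [Nat.one_le_iff_ne_zero.2 hk00]; ring⟩
          · intro e; rw [e, d0] at hk1; omega
          · intro e; rw [e, zero_add, d1] at hk1; omega
      · rcases Nat.eq_or_lt_of_le h1 with rfl | h2
        · rw [Equiv.swap_apply_left, Equiv.swap_apply_of_ne_of_ne, bpt_last x z dn1,
            bpt_last x z' dn1]
          · intro e; rw [e, d0] at dn1; omega
          · intro e; rw [e, zero_add, d1] at dn1; omega
        · have hkn : k = n + 1 := by omega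
          subst hkn
          have e : (col (((n + 1 : ℕ) : ℤ) + 1) : Fin (n + 2)) = col 0 := by
            have := col_wrap (n := n)
            push_cast at this ⊢
            exact this
          rw [e, Equiv.swap_apply_left]
          push_cast
          rw [Equiv.swap_apply_right, pn]
          exact bpt_mid x z _ (by rw [d1, c0])
    have e1 := h.exch_nat (by omega) n (bpt x z')
    have e2 := h.push_rot r
    have e3 := h.exch (by omega) r
    rw [rr, r0, r1] at e3
    rw [pn, pn1, ← rho] at e1
    have e4 := congrArg (scal (z (col 0)) (-q * x) • ·) e3
    beta_reduce at e4
    rw [← map_smul, e2, ← map_smul, e1, push_rot_faceOp, h.evalv_bpt, h.evalv_bpt, smul_smul] at e4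
    have e5 := congrFun e4 (insState (rotState s))
    rw [Pi.smul_apply, push_apply_injective insState_injective, smul_eq_mul] at e5
    rw [e5, faceOp, LinearMap.sum_apply, Finset.sum_apply]
    -- Of the sixteen pairs of faces only one leads back to a state with the arc across the seam.
    -- Its weight ω_D ω_A equals the product of the two scalar factors on the left.
    have e6 : ∀ b b' : Bool × Bool, push (faceState 0 b) (push (faceState (n + 1) b')
        (push rotState (push insState (evalv (restr Ψ x) z')))) (insState (rotState s)) =
        if b = (false, false) ∧ b' = (true, true) then evalv (restr Ψ x) z' s else 0 := by
      intro b b'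
      rw [push_push, push_push, push_push, push_apply]
      simp only [Function.comp, faceState_rotState_insState, rotState_injective.eq_iff]
      by_cases hb : b = (false, false) ∧ b' = (true, true)
      · rw [if_pos hb]
        simp only [hb.1, hb.2, and_self, true_and]
        simp
      · rw [if_neg hb]
        exact Finset.sum_eq_zero fun t _ => if_neg fun ht => hb ht.1
    simp only [LinearMap.smul_apply, faceOp, LinearMap.sum_apply, map_sum, map_smul, Pi.smul_apply,
      Finset.sum_apply, e6, smul_eq_mul]
    rw [Finset.sum_eq_single (false, false), Finset.sum_eq_single (true, true)]
    · rw [if_pos ⟨rfl, rfl⟩]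
      simp only [xw, faceWeight, omegaD, omegaA, scal]
      linear_combination (evalv (restr Ψ x) z' s) * (q ^ 3 * z (col 0) * x ^ 3 -
        q * z (col 0) ^ 2 * x ^ 2 - q * z (col 0) ^ 3 * x + q ^ 2 * x ^ 4) * q_pow_three
    · intro b _ hb
      rw [if_neg (fun h => hb h.2), mul_zero, mul_zero]
    · simp
    · intro b _ hb
      exact Finset.sum_eq_zero fun b' _ => by
        rw [if_neg (fun h => hb h.1), mul_zero, mul_zero]
    · simp
  have key := IsPoly.eq_zero_of_mul (F := fun z : Fin n → ℂ =>
      scal (z (col 0)) (-q * x) * scal (z (col 0)) x)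
    (G := fun z => evalv (restr Ψ x) z (rotState s) - evalv (restr Ψ x) (fun j => z (j + 1)) s)
    (z₀ := fun _ => 0) ?_ ?_ (fun z => ?_) ?_ z
  · exact sub_eq_zero.1 key
  · exact (((IsPoly.const q).mul ((IsPoly.var _).pow 2)).sub ((IsPoly.const _).pow 2)).mul
      (((IsPoly.const q).mul ((IsPoly.var _).pow 2)).sub ((IsPoly.const _).pow 2))
  · exact (IsPoly.eval _).sub ((IsPoly.eval (restr Ψ x s)).comp fun i => IsPoly.var _)
  · rw [mul_sub, step, sub_self]
  · simp [scal, hx, q_ne_zero]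

theorem Good.restr (h : Good Ψ) {x : ℂ} (hx : x ≠ 0) : Good (restr Ψ x) :=
  ⟨fun hn z => restr_exch h x hn z, restr_rot h hx⟩

end restrict

/-! ### Moving a small arc -/

theorem push_faceState_true_fst {N : ℕ} [NeZero N] (i : ℤ) (hN : 2 ≤ N) {b : Bool} {s : State N}
    (hs : s.1.partner i ≠ i + 1) (v : State N → ℂ) : push (faceState i (true, b)) v s = 0 := by
  rw [push_apply]
  refine Finset.sum_eq_zero fun s' _ => if_neg fun h => hs ?_
  have e : LinkPattern.tl i s'.1 = s.1 := congrArg Prod.fst h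
  rw [← e]
  exact LinkPattern.tl_partner_left hN i _

/-- The sequence `ζ` with `x` and `-q x` inserted at the positions `0` and `i`. -/
noncomputable def arcPt (x : ℂ) (i : ℕ) (ζ : ℕ → ℂ) (j : ℕ) : ℂ :=
  if j = 0 then x else if j < i then ζ (j - 1) else if j = i then -q * x else ζ (j - 2)

theorem arcPt_zero (x : ℂ) (i : ℕ) (ζ : ℕ → ℂ) : arcPt x i ζ 0 = x := if_pos rfl

theorem arcPt_self (x : ℂ) {i : ℕ} (hi : i ≠ 0) (ζ : ℕ → ℂ) : arcPt x i ζ i = -q * x := by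
  rw [arcPt, if_neg hi, if_neg (lt_irrefl i), if_pos rfl]

theorem arcPt_succ_of_lt (x : ℂ) {i j : ℕ} (h : j + 1 < i) (ζ : ℕ → ℂ) :
    arcPt x i ζ (j + 1) = ζ j := by
  rw [arcPt, if_neg (by omega), if_pos h, Nat.add_sub_cancel]

theorem arcPt_add_two_of_le (x : ℂ) {i j : ℕ} (h : i ≤ j + 1) (ζ : ℕ → ℂ) :
    arcPt x i ζ (j + 2) = ζ j := by
  rw [arcPt, if_neg (by omega), if_neg (by omega), if_neg (by omega), Nat.add_sub_cancel]

theorem arcPt_comp_swap (x : ℂ) {i : ℕ} (hi : i ≠ 0) (ζ : ℕ → ℂ) :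
    arcPt x (i + 1) ζ ∘ Equiv.swap i (i + 1) = arcPt x i ζ := by
  obtain ⟨i, rfl⟩ := Nat.exists_eq_succ_of_ne_zero hi
  funext j
  simp only [Function.comp, Nat.succ_eq_add_one]
  rcases lt_trichotomy j (i + 1) with h | rfl | h
  · rw [Equiv.swap_apply_of_ne_of_ne (by omega) (by omega)]
    cases j with
    | zero => rw [arcPt_zero, arcPt_zero]
    | succ j => rw [arcPt_succ_of_lt x (by omega), arcPt_succ_of_lt x h]
  · rw [Equiv.swap_apply_left, arcPt_self x (by omega), arcPt_self x (by omega)]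
  · rcases Nat.eq_or_lt_of_le (Nat.succ_le_of_lt h) with rfl | h
    · rw [Nat.succ_eq_add_one, Equiv.swap_apply_right, arcPt_succ_of_lt x (by omega)]
      exact (arcPt_add_two_of_le x le_rfl ζ).symm
    · rw [Equiv.swap_apply_of_ne_of_ne (by omega) (by omega)]
      obtain ⟨j, rfl⟩ := Nat.exists_eq_add_of_le' (show 2 ≤ j by omega)
      rw [arcPt_add_two_of_le x (by omega), arcPt_add_two_of_le x (by omega)]

section chain

variable {n : ℕ} [NeZero n] {Ψ : State (n + 2) → MvPolynomial (Fin (n + 2)) ℂ}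

theorem arcPt_last (x : ℂ) (ζ : ℕ → ℂ) :
    (fun j : Fin (n + 2) => arcPt x (n + 1) ζ j) = bpt x fun j : Fin n => ζ j := by
  funext ⟨j, hj⟩
  rcases Nat.eq_zero_or_pos j with rfl | h0
  · exact (arcPt_zero _ _ _).trans (bpt_zero _ _ rfl).symm
  · rcases Nat.lt_or_ge j (n + 1) with h1 | h1
    · rw [bpt_mid x _ ⟨j - 1, by omega⟩ (by simp only; omega)]
      obtain ⟨j, rfl⟩ := Nat.exists_eq_add_of_le' h0
      exact arcPt_succ_of_lt x h1 ζ
    · obtain rfl : j = n + 1 := by omega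
      rw [bpt_last x _ rfl]
      exact arcPt_self x (by omega) ζ

/-- In the exchange at i red has no small arc there, so its tile is `false`. The remaining terms are
components at a point with z_{i+1} = -q z_{n+2}, since the point n + 2 is the point 0. They vanish
if green has no small arc from i + 1 up to the seam. Among the preimages of the green pattern under
`e_i` only the one with its arc at i + 1 survives. -/
theorem Good.move_arc (h : Good Ψ) (x : ℂ) {m i : ℕ} (hm : 2 ≤ m) (hi : m ≤ i + 1) (hin : i ≤ n)
    (ζ : ℕ → ℂ) :
    scal (ζ (i - 1)) (-q * x) * evalv Ψ (fun j => arcPt x i ζ j)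
      (nested (n + 2) 0, LinkPattern.ins i (nested n (m - 2))) =
    omegaRL (-q * x) (ζ (i - 1)) * evalv Ψ (fun j => arcPt x (i + 1) ζ j)
      (nested (n + 2) 0, LinkPattern.ins (i + 1) (nested n (m - 2))) := by
  have hN : 2 ≤ n + 2 := by omega
  have e1 := col_nat (N := n + 2) (k := i) (by omega)
  have e2 := col_nat (N := n + 2) (k := i + 1) (by omega)
  have e3 := col_nat (N := n + 2) (k := 0) (by omega)
  have e4 : (col ((n + 2 : ℕ) : ℤ) : Fin (n + 2)) = col ((0 : ℕ) : ℤ) := col_wrap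
  set z : Fin (n + 2) → ℂ := fun j => arcPt x (i + 1) ζ j with hz
  have van : ∀ (R γ : LinkPattern (n + 2)),
      (∀ l : ℕ, i + 1 ≤ l → l < n + 2 → γ.partner l ≠ l + 1) → evalv Ψ z (R, γ) = 0 := by
    intro R γ hγ
    refine (X_add_dvd_iff ?_).1 (h.X_add_dvd (by omega) (by omega) hγ R) z ?_
    · rw [e4, Ne, col_nat_inj] <;> omega
    · rw [e4, e2, e3, hz]
      simp only
      rw [arcPt_self x (by omega), arcPt_zero]
  have ex := h.exch_sum i (by omega) hN z
    (nested (n + 2) 0, LinkPattern.ins i (nested n (m - 2)))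
  have hR : (nested (n + 2) 0).partner (i : ℤ) ≠ i + 1 :=
    nested_partner_ne (by omega) (by push_cast; omega)
  rw [Fintype.sum_prod_type] at ex
  simp only [Fintype.sum_bool] at ex
  push_cast at e2
  rw [push_faceState_true_fst i hN hR, push_faceState_true_fst i hN hR, push_faceState_false,
    van _ _ fun l h1 h2 => LinkPattern.ins_nested_partner_ne hm hi (by omega) (by omega),
    comp_swap_col (by omega), arcPt_comp_swap x (by omega), e1, e2] at ex
  have z1 : z ⟨i, by omega⟩ = ζ (i - 1) := by
    obtain ⟨i, rfl⟩ := Nat.exists_eq_add_of_le' (show 1 ≤ i by omega)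
    exact arcPt_succ_of_lt x (by omega) ζ
  have z2 : z ⟨i + 1, by omega⟩ = -q * x := arcPt_self x (by omega) ζ
  rw [z1, z2] at ex
  rw [ex, push_apply, Finset.sum_eq_single
    (nested (n + 2) 0, LinkPattern.ins (i + 1) (nested n (m - 2))), if_pos]
  · simp only [xw, faceWeight]
    ring
  · exact Prod.ext rfl (LinkPattern.tl_ins_succ _ _)
  · rintro ⟨R, γ⟩ - hne
    split_ifs with hs
    swap
    · rfl
    refine van _ _ fun l h1 h2 h3 => ?_
    have hs1 : R = nested (n + 2) 0 := congrArg Prod.fst hs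
    have hs2 : LinkPattern.tl i γ = LinkPattern.ins i (nested n (m - 2)) := congrArg Prod.snd hs
    rcases Nat.eq_or_lt_of_le h1 with rfl | h1
    · exact hne (Prod.ext hs1 (LinkPattern.eq_ins_succ (by push_cast at h3; rw [h3]; ring) hs2))
    · have small : ∀ t : ℤ, 0 < t → t < n + 2 → ¬ ((n + 2 : ℕ) : ℤ) ∣ t := fun t h1 h2 h => by
        have := Int.le_of_dvd h1 h
        push_cast at this
        omega
      have := LinkPattern.tl_partner_of_small hN h3 (i := i) ?_ ?_
      · rw [hs2] at this
        exact LinkPattern.ins_nested_partner_ne hm hi (by omega) (by omega) this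
      · rintro (hd | hd)
        · exact small _ (by omega) (by omega) hd
        · exact small _ (by omega) (by omega) hd
      · rintro (hd | hd)
        · exact small _ (by omega) (by omega) hd
        · exact small _ (by omega) (by omega) hd
  · simp

/-- The component of kind `(m, k)` at `z_{m-1} = -q z_0`. -/
theorem Good.move_arc_last (h : Good Ψ) (x : ℂ) {m k : ℕ} (hmk : m + k = n) (ζ : ℕ → ℂ) :
    (∏ j ∈ Finset.range k, scal (ζ (m + j)) (-q * x)) *
      evalv Ψ (fun j => arcPt x (m + 1) ζ j) (mnc (n + 2) (m + 2)) =
    (∏ j ∈ Finset.range k, omegaRL (-q * x) (ζ (m + j))) *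
      evalv (Rotor.restr Ψ x) (fun j => ζ j) (mnc n m) := by
  have key : ∀ l ≤ k, (∏ j ∈ Finset.range l, scal (ζ (m + j)) (-q * x)) *
      evalv Ψ (fun j => arcPt x (m + 1) ζ j) (mnc (n + 2) (m + 2)) =
      (∏ j ∈ Finset.range l, omegaRL (-q * x) (ζ (m + j))) *
      evalv Ψ (fun j => arcPt x (m + 1 + l) ζ j)
        (nested (n + 2) 0, LinkPattern.ins ((m + 1 + l : ℕ) : ℤ) (nested n m)) := by
    intro l
    induction l with
    | zero =>
      intro _
      have := LinkPattern.ins_nested (n := n) ((m + 2 : ℕ) : ℤ)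
      push_cast at this
      rw [show (m : ℤ) + 2 - 1 = m + 1 by ring, add_sub_cancel_right] at this
      push_cast
      rw [add_zero, add_zero, this]
      rfl
    | succ l ih =>
      intro hl
      have st := h.move_arc x (m := m + 2) (i := m + 1 + l) (by omega) (by omega) (by omega) ζ
      rw [show m + 1 + l - 1 = m + l by omega] at st
      push_cast at st
      rw [add_sub_cancel_right] at st
      have ih := ih (by omega)
      push_cast at ih ⊢
      rw [Finset.prod_range_succ, Finset.prod_range_succ, mul_right_comm, ih, mul_right_comm,
        mul_assoc (∏ j ∈ Finset.range l, omegaRL (-q * x) (ζ (m + j))), ← add_assoc, ← add_assoc, st]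
      ring
  rw [key k le_rfl, evalv_restr, ← arcPt_last, show m + 1 + k = n + 1 by omega]
  congr 2
  refine Prod.ext ?_ ?_
  · exact (LinkPattern.ins_nested_zero n).symm
  · push_cast; rfl

end chain

/-! ### The trivial factor at `z_{m+1} = -q z_0` -/

theorem pow_mul_prod_range (a : ℂ) (k : ℕ) (f : ℕ → ℂ) :
    a ^ k * ∏ j ∈ Finset.range k, f j = ∏ j ∈ Finset.range k, (a * f j) := by
  rw [Finset.prod_mul_distrib, Finset.prod_const, Finset.card_range]

theorem eval_trivialFactor_of_eq {N m k : ℕ} (h : m + k = N) (ζ : ℕ → ℂ) :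
    eval (fun j : Fin N => ζ j) (trivialFactor N m) =
      pairProd m ζ * pairProd k (fun j => ζ (m + j)) * crossProd m k ζ (fun j => ζ (m + j)) := by
  subst h
  exact eval_trivialFactor m k ζ

theorem pairProd_congr {m : ℕ} {ζ η : ℕ → ℂ} (h : ∀ i < m, ζ i = η i) :
    pairProd m ζ = pairProd m η := by
  refine Finset.prod_congr rfl fun j hj => Finset.prod_congr rfl fun i hi => ?_
  rw [Finset.mem_range] at hi hj
  rw [h i (by omega), h j hj]

/-- The factors of z_i with x and with -q x multiply to q (z_i² - q x²); the mixed terms cancel by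
q³ = 1. -/
theorem pairProd_arcPt (m : ℕ) (x : ℂ) (ζ : ℕ → ℂ) :
    pairProd (m + 2) (arcPt x (m + 1) ζ) =
      (1 - q ^ 2) * x * q ^ m * (∏ i ∈ Finset.range m, (ζ i ^ 2 - q * x ^ 2)) * pairProd m ζ := by
  have e : ∀ i ∈ Finset.range m, arcPt x (m + 1) ζ (i + 1) = ζ i := fun i hi =>
    arcPt_succ_of_lt x (by simpa using hi) ζ
  have e1 : ∏ i ∈ Finset.range m, (x + q * arcPt x (m + 1) ζ (i + 1)) =
      ∏ i ∈ Finset.range m, (x + q * ζ i) := Finset.prod_congr rfl fun i hi => by rw [e i hi]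
  have e2 : ∏ i ∈ Finset.range m, (arcPt x (m + 1) ζ (i + 1) + q * (-q * x)) =
      ∏ i ∈ Finset.range m, (ζ i + q * (-q * x)) := Finset.prod_congr rfl fun i hi => by rw [e i hi]
  have e3 : (∏ i ∈ Finset.range m, (x + q * ζ i)) * ∏ i ∈ Finset.range m, (ζ i + q * (-q * x)) =
      q ^ m * ∏ i ∈ Finset.range m, (ζ i ^ 2 - q * x ^ 2) := by
    rw [← Finset.prod_mul_distrib, pow_mul_prod_range]
    refine Finset.prod_congr rfl fun i _ => ?_
    linear_combination (-(x * ζ i)) * q_pow_three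
  rw [pairProd_succ, pairProd_succ', Finset.prod_range_succ' _ m, arcPt_self x (by omega),
    arcPt_zero, e1, e2, pairProd_congr fun i hi => e i (by simpa using hi)]
  linear_combination (x + q * (-q * x)) * pairProd m ζ * e3

/-- Points on the other side carry both orientations. The additional factors (z + q x) (z - x) will
cancel against the weights ω_RL collected in `Good.move_arc_last`. -/
theorem crossProd_arcPt (m k : ℕ) (x : ℂ) (ζ : ℕ → ℂ) :
    crossProd (m + 2) k (arcPt x (m + 1) ζ) (fun j => arcPt x (m + 1) ζ (m + 2 + j)) =
      (∏ j ∈ Finset.range k, (ζ (m + j) ^ 2 - q * x ^ 2)) *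
      (∏ j ∈ Finset.range k, ((ζ (m + j) + q * x) * (ζ (m + j) - x))) *
        crossProd m k ζ fun j => ζ (m + j) := by
  have e : ∀ i ∈ Finset.range m, arcPt x (m + 1) ζ (i + 1) = ζ i := fun i hi =>
    arcPt_succ_of_lt x (by simpa using hi) ζ
  have e' : (fun j => arcPt x (m + 1) ζ (m + 2 + j)) = fun j => ζ (m + j) := by
    funext j
    rw [add_right_comm]
    exact arcPt_add_two_of_le x (by omega) ζ
  have hq := q_ne_zero
  rw [e', crossProd, Finset.prod_range_succ, Finset.prod_range_succ' _ m,
    arcPt_self x (by omega), arcPt_zero, mul_assoc, mul_comm, ← Finset.prod_mul_distrib,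
    ← Finset.prod_mul_distrib]
  congr 1
  · refine Finset.prod_congr rfl fun j _ => ?_
    field_simp
    linear_combination (-x * ζ (m + j) ^ 3 + x ^ 2 * ζ (m + j) ^ 2 - q * x ^ 2 * ζ (m + j) ^ 2 +
      q * x ^ 3 * ζ (m + j)) * q_pow_three
  · exact Finset.prod_congr rfl fun i hi => by rw [e i hi]

theorem eval_trivialFactor_arcPt {n m k : ℕ} (h : m + k = n) (x : ℂ) (ζ : ℕ → ℂ) :
    eval (fun j : Fin (n + 2) => arcPt x (m + 1) ζ j) (trivialFactor (n + 2) (m + 2)) =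
      (1 - q ^ 2) * x * q ^ m * (∏ j ∈ Finset.range n, (ζ j ^ 2 - q * x ^ 2)) *
      (∏ j ∈ Finset.range k, ((ζ (m + j) + q * x) * (ζ (m + j) - x))) *
        eval (fun j : Fin n => ζ j) (trivialFactor n m) := by
  have e' : (fun j => arcPt x (m + 1) ζ (m + 2 + j)) = fun j => ζ (m + j) := by
    funext j
    rw [add_right_comm]
    exact arcPt_add_two_of_le x (by omega) ζ
  rw [eval_trivialFactor_of_eq (k := k) (by omega), eval_trivialFactor_of_eq h, crossProd_arcPt,
    pairProd_arcPt, e', ← h, Finset.prod_range_add]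
  ring

/-! ### Functions of finitely many variables -/

/-- Extension of a point by zero. -/
noncomputable def natExt {n : ℕ} (z : Fin n → ℂ) (i : ℕ) : ℂ := if h : i < n then z ⟨i, h⟩ else 0

theorem natExt_val {n : ℕ} (z : Fin n → ℂ) : (fun j : Fin n => natExt z j) = z := by
  funext j
  simp [natExt]

theorem isPoly_natExt {n : ℕ} (i : ℕ) : IsPoly fun z : Fin n → ℂ => natExt z i := by
  unfold natExt
  split_ifs
  · exact IsPoly.var _
  · exact IsPoly.const 0

theorem isPoly_arcPt {n : ℕ} (x : ℂ) (i j : ℕ) :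
    IsPoly fun z : Fin n → ℂ => arcPt x i (natExt z) j := by
  unfold arcPt
  refine IsPoly.ite _ (IsPoly.const x) (IsPoly.ite _ (isPoly_natExt _) (IsPoly.ite _
    (IsPoly.const _) (isPoly_natExt _)))

/-- The product of the `z_j ^ 2 - q x ^ 2`. -/
noncomputable def quadProd (n : ℕ) (x : ℂ) : MvPolynomial (Fin n) ℂ :=
  ∏ j, ((X j - C (q ^ 2 * x)) * (X j - C (-(q ^ 2 * x))))

/-- The roots ± q² x come from (q² x)² = q⁴ x² = q x². -/
theorem eval_quadProd {n : ℕ} (x : ℂ) (z : Fin n → ℂ) :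
    eval z (quadProd n x) = ∏ j, (z j ^ 2 - q * x ^ 2) := by
  rw [quadProd, map_prod]
  refine Finset.prod_congr rfl fun j _ => ?_
  simp only [map_mul, map_sub, eval_X, eval_C]
  linear_combination (-q * x ^ 2) * q_pow_three

theorem eval_quadProd_nat {n : ℕ} (x : ℂ) (ζ : ℕ → ℂ) :
    eval (fun j : Fin n => ζ j) (quadProd n x) =
      ∏ j ∈ Finset.range n, (ζ j ^ 2 - q * x ^ 2) := by
  rw [eval_quadProd, Finset.prod_range]

theorem eval_quadProd_perm {n : ℕ} (x : ℂ) (z : Fin n → ℂ) (π : Equiv.Perm (Fin n)) :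
    eval (z ∘ π) (quadProd n x) = eval z (quadProd n x) := by
  rw [eval_quadProd, eval_quadProd]
  exact Equiv.prod_comp π fun j => z j ^ 2 - q * x ^ 2

theorem eval_zero_quadProd_ne_zero {n : ℕ} {x : ℂ} (hx : x ≠ 0) :
    eval (fun _ => 0) (quadProd n x) ≠ 0 := by
  rw [eval_quadProd]
  refine Finset.prod_ne_zero_iff.2 fun _ _ => ?_
  simp [hx, q_ne_zero]

theorem quadProd_ne_zero {n : ℕ} {x : ℂ} (hx : x ≠ 0) : quadProd n x ≠ 0 := fun h =>
  eval_zero_quadProd_ne_zero hx (by rw [h, map_zero])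

theorem quadProd_dvd {n : ℕ} {x : ℂ} (hx : x ≠ 0) {p : MvPolynomial (Fin n) ℂ}
    (h1 : ∀ j z, z j = q ^ 2 * x → eval z p = 0)
    (h2 : ∀ j z, z j = -(q ^ 2 * x) → eval z p = 0) : quadProd n x ∣ p := by
  have ha : q ^ 2 * x ≠ -(q ^ 2 * x) := fun h => by
    have : q ^ 2 * x = 0 := by linear_combination h / 2
    exact mul_ne_zero (pow_ne_zero 2 q_ne_zero) hx this
  have key : ∀ (i j : Fin n) (a b : ℂ), (i ≠ j ∨ a ≠ b) →
      IsRelPrime (X i - C a : MvPolynomial (Fin n) ℂ) (X j - C b) := by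
    intro i j a b h
    refine isRelPrime_of_prime (X_sub_C_prime i a) fun hd => ?_
    rw [X_sub_C_dvd_iff] at hd
    by_cases hij : i = j
    · have := hd (fun _ => a) rfl
      simp only [map_sub, eval_X, eval_C] at this
      exact (h.resolve_left (not_not.2 hij)) (sub_eq_zero.1 this)
    · have := hd (Function.update (fun _ => b + 1) i a) (Function.update_self _ _ _)
      simp [Function.update_of_ne (Ne.symm hij)] at this
  refine Finset.prod_dvd_of_isRelPrime (fun i _ j _ hij => ?_) fun j _ => ?_
  · exact ((key _ _ _ _ (Or.inl hij)).mul_right (key _ _ _ _ (Or.inl hij))).mul_left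
      ((key _ _ _ _ (Or.inl hij)).mul_right (key _ _ _ _ (Or.inl hij)))
  · exact (key _ _ _ _ (Or.inr ha)).mul_dvd (X_sub_C_dvd_iff.2 (h1 j)) (X_sub_C_dvd_iff.2 (h2 j))

/-! ### Factors of the restriction -/

/-- The rotation relation carries one hyperplane z_i = a to all the others. -/
theorem Good.evalv_eq_zero_of_col {N : ℕ} [NeZero N] {Φ : State N → MvPolynomial (Fin N) ℂ}
    (h : Good Φ) {a : ℂ} {i : ℤ} (hv : ∀ z s, z (col i) = a → evalv Φ z s = 0) (j : Fin N)
    (z : Fin N → ℂ) (s : State N) (hz : z j = a) : evalv Φ z s = 0 := by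
  have key : ∀ (k : ℕ) (z : Fin N → ℂ) (s : State N), z (col (i + k)) = a → evalv Φ z s = 0 := by
    intro k
    induction k with
    | zero => simpa using hv
    | succ k ih =>
      intro z s hz
      obtain ⟨t, rfl⟩ := rotState_surjective s
      rw [h.rot]
      refine ih _ _ ?_
      rwa [← col_add_one, add_assoc]
  obtain ⟨y, k, h0, -, e⟩ := nested_coord (N := N) i (j : ℕ)
  lift y to ℕ using h0
  refine key y z s ?_
  rwa [← col_add_mul (i + y) k, ← e, col_val]

section restrict

variable {n : ℕ} [NeZero n] {Ψ : State (n + 2) → MvPolynomial (Fin (n + 2)) ℂ}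

/-- The arc across the seam excludes small arcs at n and at 0, so the components are divisible by
z_n + q z_{n+1} and by z_0 + q z_1. With z_{n+1} = -q x and z_0 = x these vanish when the last small
parameter is q² x or the first one is -q² x, and rotation gives the rest. -/
theorem Good.quadProd_dvd_restr (h : Good Ψ) {x : ℂ} (hx : x ≠ 0) (s : State n) :
    quadProd n x ∣ Rotor.restr Ψ x s := by
  have hn := NeZero.pos n
  have hg := h.restr hx
  have d0 := col_nat_val (N := n + 2) (k := 0) (by omega)
  have d1 := col_nat_val (N := n + 2) (k := 1) (by omega)
  have dn := col_nat_val (N := n + 2) (k := n) (by omega)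
  have dn1 := col_nat_val (N := n + 2) (k := n + 1) (by omega)
  refine quadProd_dvd hx (fun j z hz => hg.evalv_eq_zero_of_col (i := ((n - 1 : ℕ) : ℤ)) ?_ j z s hz)
    (fun j z hz => hg.evalv_eq_zero_of_col (i := ((0 : ℕ) : ℤ)) ?_ j z s hz)
  · intro z s hz
    rw [evalv_restr]
    refine (X_add_dvd_iff ?_).1 (h.X_add_dvd (i := n) (j := n + 1) (by omega) (by omega)
      (fun l h1 h2 => ?_) _) (bpt x z) ?_
    · rw [Ne, col_nat_inj] <;> omega
    · obtain rfl : l = n := by omega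
      have := LinkPattern.partner_pred_of_succ (LinkPattern.ins_partner_left (l + 1 : ℤ) s.2)
      rwa [add_sub_cancel_right] at this
    · rw [bpt_last x z dn1, bpt_mid x z (col ((n - 1 : ℕ) : ℤ)) (by
        rw [dn, col_nat_val (by omega)]; omega), hz]
      ring
  · intro z s hz
    rw [evalv_restr]
    refine (X_add_dvd_iff ?_).1 (h.X_add_dvd (i := 0) (j := 1) (by omega) (by omega)
      (fun l h1 h2 => ?_) _) (bpt x z) ?_
    · rw [Ne, col_nat_inj] <;> omega
    · obtain rfl : l = 0 := by omega
      rw [Nat.cast_zero]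
      have := ins_partner_zero s.2
      change (LinkPattern.ins (n + 1) s.2).partner 0 ≠ _
      rw [this]
      omega
    · rw [bpt_zero x z d0, bpt_mid x z (col ((0 : ℕ) : ℤ)) (by
        rw [d1, col_nat_val (by omega)]), hz]
      linear_combination (-x) * q_pow_three

/-- The restriction of a maximally nested component. -/
theorem Good.restr_mnc (h : Good Ψ) {x : ℂ} (hx : x ≠ 0) {m k : ℕ} (hmk : m + k = n)
    {F : MvPolynomial (Fin (n + 2)) ℂ}
    (hF : Ψ (mnc (n + 2) (m + 2)) = trivialFactor (n + 2) (m + 2) * F) (z : Fin n → ℂ) :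
    evalv (Rotor.restr Ψ x) z (mnc n m) =
      (1 - q ^ 2) * x * q ^ m * eval z (quadProd n x) *
        (∏ j ∈ Finset.range k, (natExt z (m + j) ^ 2 - q * x ^ 2)) *
        eval z (trivialFactor n m) * eval (fun j : Fin (n + 2) => arcPt x (m + 1) (natExt z) j) F := by
  have key := IsPoly.eq_zero_of_mul (F := fun z : Fin n → ℂ =>
      q ^ k * ∏ j ∈ Finset.range k, ((natExt z (m + j) + q * x) * (natExt z (m + j) - x)))
    (G := fun z => evalv (Rotor.restr Ψ x) z (mnc n m) -
      (1 - q ^ 2) * x * q ^ m * eval z (quadProd n x) *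
        (∏ j ∈ Finset.range k, (natExt z (m + j) ^ 2 - q * x ^ 2)) *
        eval z (trivialFactor n m) * eval (fun j : Fin (n + 2) => arcPt x (m + 1) (natExt z) j) F)
    (z₀ := fun _ => 0) ?_ ?_ (fun z => ?_) ?_ z
  · exact sub_eq_zero.1 key
  · exact (IsPoly.const _).mul (IsPoly.prod _ fun j _ =>
      ((isPoly_natExt _).add (IsPoly.const _)).mul ((isPoly_natExt _).sub (IsPoly.const _)))
  · exact (IsPoly.eval _).sub (((((IsPoly.const _).mul (IsPoly.eval _)).mul (IsPoly.prod _ fun j _ =>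
      ((isPoly_natExt _).pow 2).sub (IsPoly.const _))).mul (IsPoly.eval _)).mul
        ((IsPoly.eval F).comp fun j => isPoly_arcPt _ _ _))
  · have mv := h.move_arc_last x hmk (natExt z)
    have e1 : ∏ j ∈ Finset.range k, scal (natExt z (m + j)) (-q * x) =
        q ^ k * ∏ j ∈ Finset.range k, (natExt z (m + j) ^ 2 - q * x ^ 2) := by
      rw [pow_mul_prod_range]
      exact Finset.prod_congr rfl fun j _ => by rw [scal]; ring
    have e2 : ∏ j ∈ Finset.range k, omegaRL (-q * x) (natExt z (m + j)) =
        q ^ k * ∏ j ∈ Finset.range k, ((natExt z (m + j) + q * x) * (natExt z (m + j) - x)) := by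
      rw [pow_mul_prod_range]
      exact Finset.prod_congr rfl fun j _ => by rw [omegaRL]; ring
    have e3 := eval_trivialFactor_arcPt hmk x (natExt z)
    rw [← eval_quadProd_nat] at e3
    rw [e1, e2] at mv
    rw [natExt_val] at mv e3
    rw [mul_sub, ← mv, evalv, hF, map_mul, e3]
    ring
  · refine mul_ne_zero (pow_ne_zero _ q_ne_zero) (Finset.prod_ne_zero_iff.2 fun j _ => ?_)
    simp [natExt, q_ne_zero, hx]

/-- The restriction is divisible by the square of the product of the `z_j ^ 2 - q x ^ 2`. -/
theorem Good.exists_restr_eq (h : Good Ψ) {x : ℂ} (hx : x ≠ 0) :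
    ∃ Φ : State n → MvPolynomial (Fin n) ℂ, Good Φ ∧
      ∀ s, Rotor.restr Ψ x s = quadProd n x ^ 2 * Φ s := by
  choose Φ₁ h₁ using fun s => h.quadProd_dvd_restr hx s
  have e₁ : Rotor.restr Ψ x = fun s => quadProd n x * Φ₁ s := funext h₁
  have g₁ : Good Φ₁ := Good.of_mul (quadProd_ne_zero hx) (eval_quadProd_perm x)
    (e₁ ▸ h.restr hx)
  obtain ⟨F, hF⟩ := h.trivialFactor_dvd (m := 2) (by omega)
  -- For the component of kind (0, n) the factor `quadProd` occurs twice in the restriction, so one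
  -- copy is left after the first division.
  have v0 : ∀ z, evalv Φ₁ z (mnc n 0) =
      (1 - q ^ 2) * x * eval z (quadProd n x) *
        eval z (trivialFactor n 0) * eval (fun j : Fin (n + 2) => arcPt x (0 + 1) (natExt z) j) F := by
    intro z
    have key := IsPoly.eq_zero_of_mul (F := fun z : Fin n → ℂ => eval z (quadProd n x))
      (G := fun z => evalv Φ₁ z (mnc n 0) - (1 - q ^ 2) * x * eval z (quadProd n x) *
        eval z (trivialFactor n 0) * eval (fun j : Fin (n + 2) => arcPt x (0 + 1) (natExt z) j) F)
      (z₀ := fun _ => 0) (IsPoly.eval _) ?_ (fun z => ?_) (eval_zero_quadProd_ne_zero hx) z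
    · exact sub_eq_zero.1 key
    · exact (IsPoly.eval _).sub ((((IsPoly.const _).mul (IsPoly.eval _)).mul (IsPoly.eval _)).mul
        ((IsPoly.eval F).comp fun j => isPoly_arcPt _ _ _))
    · have := h.restr_mnc hx (m := 0) (k := n) (by omega) hF z
      rw [evalv, h₁, map_mul] at this
      have e := eval_quadProd_nat (n := n) x (natExt z)
      rw [natExt_val] at e
      simp only [zero_add] at this
      rw [← e] at this
      rw [mul_sub, evalv, this]
      ring
  -- That component therefore vanishes on z_0 = a, and the uniqueness theorem, with this component
  -- as linear condition, makes the whole vector vanish there. This allows the second division.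
  have van : ∀ a, a ^ 2 = q * x ^ 2 → ∀ j z s, z j = a → evalv Φ₁ z s = 0 := by
    classical
    intro a ha
    have ha0 : a ≠ 0 := fun h0 => by
      rw [h0] at ha
      simp [q_ne_zero, hx] at ha
    have := g₁.evalv_eq_zero_of_col (a := a) (i := 0) fun z s hz => evalv_eq_zero 0 ha0 Φ₁
      (Pi.single (mnc n 0) 1) ?_ ?_ ?_ z hz s
    · exact this
    · rw [mnc, Nat.cast_zero, Pi.single_eq_same]
    · intro z hz
      rw [← hz]
      exact g₁.rowOp_evalv z _
    · intro z hz
      simp only [Pi.single_apply, ite_mul, one_mul, zero_mul, Finset.sum_ite_eq', Finset.mem_univ,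
        if_true]
      rw [v0, eval_quadProd, Finset.prod_eq_zero (Finset.mem_univ (col 0)) (by rw [hz, ha, sub_self])]
      ring
  choose Φ₂ h₂ using fun s => quadProd_dvd hx (p := Φ₁ s)
    (fun j z hz => van _ (by linear_combination (q * x ^ 2) * q_pow_three) j z s hz)
    (fun j z hz => van _ (by linear_combination (q * x ^ 2) * q_pow_three) j z s hz)
  have e₂ : Φ₁ = fun s => quadProd n x * Φ₂ s := funext h₂
  refine ⟨Φ₂, Good.of_mul (quadProd_ne_zero hx) (eval_quadProd_perm x) (e₂ ▸ g₁), fun s => ?_⟩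
  rw [h₁, h₂]
  ring

/-- The nontrivial factors at `z_{m+1} = -q z_0`. -/
theorem Good.factor_restr (h : Good Ψ) {x : ℂ} (hx : x ≠ 0) {Φ : State n → MvPolynomial (Fin n) ℂ}
    (hΦ : ∀ s, Rotor.restr Ψ x s = quadProd n x ^ 2 * Φ s) {m : ℕ} (hm : m ≤ n)
    {F : MvPolynomial (Fin (n + 2)) ℂ} {F' : MvPolynomial (Fin n) ℂ}
    (hF : Ψ (mnc (n + 2) (m + 2)) = trivialFactor (n + 2) (m + 2) * F)
    (hF' : Φ (mnc n m) = trivialFactor n m * F') (ζ : ℕ → ℂ) :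
    (1 - q ^ 2) * x * q ^ m * eval (fun j : Fin (n + 2) => arcPt x (m + 1) ζ j) F =
      (∏ j ∈ Finset.range m, (ζ j ^ 2 - q * x ^ 2)) * eval (fun j : Fin n => ζ j) F' := by
  obtain ⟨k, rfl⟩ := Nat.exists_eq_add_of_le hm
  obtain ⟨z₀, hz₀⟩ : ∃ z, eval z (quadProd (m + k) x * trivialFactor (m + k) m) ≠ 0 := by
    by_contra! hc
    exact mul_ne_zero (quadProd_ne_zero hx) (trivialFactor_ne_zero _ _)
      (MvPolynomial.funext fun z => by rw [hc, map_zero])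
  have e := fun z : Fin (m + k) → ℂ => eval_quadProd_nat (n := m + k) x (natExt z)
  simp only [natExt_val, Finset.prod_range_add] at e
  have key := IsPoly.eq_zero_of_mul (F := fun z : Fin (m + k) → ℂ =>
      eval z (quadProd (m + k) x * trivialFactor (m + k) m) *
        ∏ j ∈ Finset.range k, (natExt z (m + j) ^ 2 - q * x ^ 2))
    (G := fun z => (1 - q ^ 2) * x * q ^ m *
      eval (fun j : Fin (m + k + 2) => arcPt x (m + 1) (natExt z) j) F -
      (∏ j ∈ Finset.range m, (natExt z j ^ 2 - q * x ^ 2)) * eval z F')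
    (z₀ := z₀) ?_ ?_ (fun z => ?_) ?_ (fun j => ζ j)
  · have hc : ∀ i < m + k, natExt (fun j : Fin (m + k) => ζ j) i = ζ i := fun i hi => by
      rw [natExt, dif_pos hi]
    have ha : (fun j : Fin (m + k + 2) => arcPt x (m + 1) (natExt fun j : Fin (m + k) => ζ j) j) =
        fun j : Fin (m + k + 2) => arcPt x (m + 1) ζ j := by
      funext ⟨j, hj⟩
      unfold arcPt
      split_ifs
      · rfl
      · exact hc _ (by omega)
      · rfl
      · exact hc _ (by omega)
    rw [ha, Finset.prod_congr rfl fun i hi => by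
      rw [hc i (by rw [Finset.mem_range] at hi; omega)]] at key
    exact sub_eq_zero.1 key
  · exact (IsPoly.eval _).mul (IsPoly.prod _ fun j _ =>
      ((isPoly_natExt _).pow 2).sub (IsPoly.const _))
  · exact ((IsPoly.const _).mul ((IsPoly.eval F).comp fun j => isPoly_arcPt _ _ _)).sub
      ((IsPoly.prod _ fun j _ => ((isPoly_natExt _).pow 2).sub (IsPoly.const _)).mul
        (IsPoly.eval _))
  · have := h.restr_mnc hx (k := k) rfl hF z
    rw [evalv, hΦ, hF', map_mul, map_mul, map_pow] at this
    rw [map_mul, mul_sub]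
    rw [e] at this ⊢
    linear_combination -this
  · refine mul_ne_zero hz₀ fun h0 => hz₀ ?_
    rw [map_mul, e, h0, mul_zero, zero_mul]

end restrict

/-! ### The numerator of the Pfaffian formula -/

/-- The contribution of the identity to the numerator of the Pfaffian formula. -/
noncomputable def pfTerm (k : ℕ) : MvPolynomial (Fin k) ℂ :=
  ∏ a : Fin k, ∏ b : Fin k, if (a : ℕ) / 2 = (b : ℕ) / 2 then
    (if a < b then X a ^ 2 - X b ^ 2 else 1) else X a + C q * X b

/-- The numerator of the Pfaffian formula, without normalization. -/
noncomputable def pfNum (k : ℕ) : MvPolynomial (Fin k) ℂ :=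
  ∑ π : Equiv.Perm (Fin k), C ((Equiv.Perm.sign π : ℤ) : ℂ) * rename π (pfTerm k)

/-- The denominator of the Pfaffian formula. -/
noncomputable def vdm (k : ℕ) : MvPolynomial (Fin k) ℂ :=
  ∏ i : Fin k, ∏ j ∈ Finset.Ioi i, (X i - X j)

variable {k : ℕ}

theorem eval_pfNum (z : Fin k → ℂ) : eval z (pfNum k) =
    ∑ π : Equiv.Perm (Fin k), ((Equiv.Perm.sign π : ℤ) : ℂ) * eval (z ∘ π) (pfTerm k) := by
  simp [pfNum, map_sum, eval_rename]

theorem eval_pfNum_perm (z : Fin k → ℂ) (σ : Equiv.Perm (Fin k)) :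
    eval (z ∘ σ) (pfNum k) = ((Equiv.Perm.sign σ : ℤ) : ℂ) * eval z (pfNum k) := by
  have : ((Equiv.Perm.sign σ : ℤ) : ℂ) * ((Equiv.Perm.sign σ : ℤ) : ℂ) = 1 := by
    rcases Int.units_eq_one_or (Equiv.Perm.sign σ) with h | h <;> simp [h]
  rw [eval_pfNum, eval_pfNum, Finset.mul_sum]
  refine Fintype.sum_equiv (Equiv.mulLeft σ) _ _ fun π => ?_
  simp only [Equiv.coe_mulLeft, map_mul, Units.val_mul, Int.cast_mul, Equiv.Perm.coe_mul]
  rw [← mul_assoc, ← mul_assoc, this, one_mul]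
  rfl

theorem eval_vdm (z : Fin k → ℂ) : eval z (vdm k) = ∏ i, ∏ j ∈ Finset.Ioi i, (z i - z j) := by
  simp [vdm, map_prod]

theorem eval_vdm_eq_det (z : Fin k → ℂ) :
    eval z (vdm k) = (Matrix.vandermonde fun i => -z i).det := by
  rw [eval_vdm, Matrix.det_vandermonde]
  exact Finset.prod_congr rfl fun i _ => Finset.prod_congr rfl fun j _ => by ring

theorem eval_vdm_perm (z : Fin k → ℂ) (σ : Equiv.Perm (Fin k)) :
    eval (z ∘ σ) (vdm k) = ((Equiv.Perm.sign σ : ℤ) : ℂ) * eval z (vdm k) := by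
  rw [eval_vdm_eq_det, eval_vdm_eq_det, ← Matrix.det_permute]
  rfl

theorem vdm_ne_zero (k : ℕ) : vdm k ≠ 0 := fun h => by
  have := congrArg (eval fun i : Fin k => ((i : ℕ) : ℂ)) h
  rw [eval_vdm, map_zero, Finset.prod_eq_zero_iff] at this
  obtain ⟨i, -, hi⟩ := this
  obtain ⟨j, hj, h0⟩ := Finset.prod_eq_zero_iff.1 hi
  rw [sub_eq_zero, Nat.cast_inj] at h0
  exact (Finset.mem_Ioi.1 hj).ne (Fin.ext h0)

theorem X_sub_X_dvd_iff {σ : Type*} [Fintype σ] [DecidableEq σ] {a b : σ} (hab : a ≠ b)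
    {p : MvPolynomial σ ℂ} : X a - X b ∣ p ↔ ∀ z, z a = z b → eval z p = 0 := by
  have := X_add_dvd_iff hab (k := -1) (p := p)
  simpa [sub_eq_add_neg] using this

theorem X_sub_X_prime {σ : Type*} [Fintype σ] [DecidableEq σ] {a b : σ} (hab : a ≠ b) :
    Prime (X a - X b : MvPolynomial σ ℂ) := by
  have := X_add_prime hab (-1)
  simpa [sub_eq_add_neg] using this

theorem vdm_dvd_of_perm {p : MvPolynomial (Fin k) ℂ}
    (h : ∀ (z : Fin k → ℂ) (i j : Fin k), i ≠ j → z i = z j → eval z p = 0) : vdm k ∣ p := by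
  rw [vdm, Finset.prod_sigma']
  refine Finset.prod_dvd_of_isRelPrime ?_ ?_
  · rintro ⟨i, j⟩ hij ⟨i', j'⟩ hij' hne
    simp only [Finset.coe_sigma, Finset.coe_univ, Set.mem_sigma_iff, Set.mem_univ, true_and,
      Finset.coe_Ioi, Set.mem_Ioi] at hij hij'
    refine isRelPrime_of_prime (X_sub_X_prime hij.ne) fun hd => ?_
    rw [X_sub_X_dvd_iff hij.ne] at hd
    by_cases h1 : j' = i ∨ j' = j
    · have hi : i' ≠ j := by
        rintro rfl
        rcases h1 with rfl | rfl
        · exact absurd (hij.trans hij') (lt_irrefl _)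
        · exact absurd hij' (lt_irrefl _)
      have hi2 : i' ≠ i := by
        rintro rfl
        rcases h1 with rfl | rfl
        · exact absurd hij' (lt_irrefl _)
        · exact hne rfl
      have := hd (Pi.single i' 1) (by simp [hi.symm, hi2.symm])
      simp [hij'.ne'] at this
    · push Not at h1
      have := hd (Pi.single j' 1) (by simp [h1.1.symm, h1.2.symm])
      simp [hij'.ne] at this
  · rintro ⟨i, j⟩ hij
    simp only [Finset.mem_sigma, Finset.mem_univ, Finset.mem_Ioi, true_and] at hij
    exact (X_sub_X_dvd_iff hij.ne).2 fun z hz => h z i j hij.ne hz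

/-- The numerator is antisymmetric, hence zero when two variables coincide. -/
theorem vdm_dvd_pfNum (k : ℕ) : vdm k ∣ pfNum k := by
  refine vdm_dvd_of_perm fun z i j hij hz => ?_
  have h := eval_pfNum_perm z (Equiv.swap i j)
  have e : z ∘ Equiv.swap i j = z := by
    funext l
    simp only [Function.comp, Equiv.swap_apply_def]
    split_ifs with h1 h2
    · rw [h1, hz]
    · rw [h2, hz]
    · rfl
  rw [e, Equiv.Perm.sign_swap hij] at h
  simp only [Units.val_neg, Units.val_one, Int.cast_neg, Int.cast_one] at h
  linear_combination h / 2

/-! ### Degrees -/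

theorem degreeOf_sub_le' {σ : Type*} (c : σ) (p r : MvPolynomial σ ℂ) (d : ℕ)
    (hp : degreeOf c p ≤ d) (hr : degreeOf c r ≤ d) : degreeOf c (p - r) ≤ d :=
  (degreeOf_sub_le c p r).trans (max_le hp hr)

theorem degreeOf_X_add_le {σ : Type*} [DecidableEq σ] (a b c : σ) (k : ℂ) :
    degreeOf c (X a + C k * X b) ≤ if c = a ∨ c = b then 1 else 0 := by
  refine (degreeOf_add_le _ _ _).trans (max_le ?_ ((degreeOf_C_mul_le _ _ _).trans ?_)) <;>
    rw [degreeOf_X] <;> split_ifs <;> simp_all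

/-- Every point other than c contributes at most two: the partner of c through one difference of
squares, any other point through two linear factors. -/
theorem degreeOf_pfTerm_le (c : Fin k) (hk : Even k) : degreeOf c (pfTerm k) ≤ 2 * (k - 1) := by
  obtain ⟨n, hn⟩ := hk
  let w : Fin k → Fin k → ℕ := fun a b => if (a : ℕ) / 2 = (b : ℕ) / 2 then
    (if a < b then (if c = a ∨ c = b then 2 else 0) else 0) else if c = a ∨ c = b then 1 else 0
  have h1 : degreeOf c (pfTerm k) ≤ ∑ a, ∑ b, w a b := by
    refine (degreeOf_prod_le _ _ _).trans (Finset.sum_le_sum fun a _ =>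
      (degreeOf_prod_le _ _ _).trans (Finset.sum_le_sum fun b _ => ?_))
    simp only [w]
    split_ifs with g1 g2 g3 g4
    · exact degreeOf_sub_le' _ _ _ _ ((degreeOf_pow_le _ _ _).trans (by
        rw [degreeOf_X]; split_ifs <;> simp)) ((degreeOf_pow_le _ _ _).trans (by
        rw [degreeOf_X]; split_ifs <;> simp))
    · push Not at g3
      refine degreeOf_sub_le' _ _ _ _ ((degreeOf_pow_le _ _ _).trans ?_)
        ((degreeOf_pow_le _ _ _).trans ?_)
      · rw [degreeOf_X, if_neg g3.1]
      · rw [degreeOf_X, if_neg g3.2]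
    · simp
    · exact (degreeOf_X_add_le _ _ _ _).trans (by rw [if_pos g4])
    · exact (degreeOf_X_add_le _ _ _ _).trans (by rw [if_neg (by assumption)])
  refine h1.trans ?_
  -- the sum over pairs that contain `c`
  have h2 : ∑ a, ∑ b, w a b ≤ ∑ b, (w c b + w b c) := by
    rw [Finset.sum_add_distrib, ← Finset.add_sum_erase _ _ (Finset.mem_univ c)]
    refine Nat.add_le_add_left ?_ _
    calc ∑ a ∈ Finset.univ.erase c, ∑ b, w a b = ∑ a ∈ Finset.univ.erase c, w a c := by
          refine Finset.sum_congr rfl fun a ha => Finset.sum_eq_single c (fun b _ hb => ?_) (by simp)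
          have ha' := (Finset.mem_erase.1 ha).1.symm
          simp only [w, if_neg (not_or.2 ⟨ha', hb.symm⟩), ite_self]
      _ ≤ _ := Finset.sum_le_sum_of_subset (Finset.subset_univ _)
  refine h2.trans ?_
  have h3 : ∀ b, w c b + w b c ≤ if b = c then 0 else 2 := by
    intro b
    simp only [w, true_or, or_true, if_true]
    by_cases hbc : b = c
    · subst hbc; simp
    · rw [if_neg hbc]
      split_ifs <;> omega
  refine (Finset.sum_le_sum fun b _ => h3 b).trans ?_
  rw [← Finset.add_sum_erase _ _ (Finset.mem_univ c), if_pos rfl, zero_add,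
    Finset.sum_congr rfl (g := fun _ => 2) fun b hb => if_neg (Finset.mem_erase.1 hb).1,
    Finset.sum_const, Finset.card_erase_of_mem (Finset.mem_univ c), Finset.card_univ,
    Fintype.card_fin, smul_eq_mul, mul_comm]

theorem degreeOf_pfNum_le (c : Fin k) (hk : Even k) : degreeOf c (pfNum k) ≤ 2 * (k - 1) := by
  refine (degreeOf_sum_le _ _ _).trans (Finset.sup_le fun π _ =>
    (degreeOf_C_mul_le _ _ _).trans ?_)
  rw [← π.apply_symm_apply c, degreeOf_rename_of_injective π.injective]
  exact degreeOf_pfTerm_le _ hk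

theorem one_le_degreeOf {σ : Type*} [DecidableEq σ] {c : σ} {p : MvPolynomial σ ℂ} {z : σ → ℂ}
    {t : ℂ} (h : eval (Function.update z c t) p ≠ eval z p) : 1 ≤ degreeOf c p := by
  by_contra hc
  refine h (eval₂Hom_congr' rfl (fun i hi _ => ?_) rfl)
  refine Function.update_of_ne (fun hic => ?_) _ _
  rw [hic, mem_vars_iff_degreeOf_ne_zero] at hi
  omega

theorem sum_degreeOf_le {σ ι : Type*} {c : σ} {s : Finset ι} {f : ι → MvPolynomial σ ℂ}
    (hf : ∏ i ∈ s, f i ≠ 0) {t : Finset ι} (ht : t ⊆ s) :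
    ∑ i ∈ t, degreeOf c (f i) ≤ degreeOf c (∏ i ∈ s, f i) := by
  rw [degreeOf_prod_eq _ _ (Finset.prod_ne_zero_iff.1 hf)]
  exact Finset.sum_le_sum_of_subset ht

theorem le_degreeOf_vdm (hk : 0 < k) : k - 1 ≤ degreeOf ⟨0, hk⟩ (vdm k) := by
  have h0 := vdm_ne_zero k
  have h1 := Finset.prod_ne_zero_iff.1 h0 ⟨0, hk⟩ (Finset.mem_univ _)
  have h2 := sum_degreeOf_le (c := ⟨0, hk⟩) h0 (Finset.singleton_subset_iff.2
    (Finset.mem_univ (⟨0, hk⟩ : Fin k)))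
  rw [Finset.sum_singleton] at h2
  refine le_trans ?_ h2
  refine le_trans ?_ (sum_degreeOf_le (c := ⟨0, hk⟩) h1 subset_rfl)
  have h3 : ∀ j ∈ Finset.Ioi (⟨0, hk⟩ : Fin k),
      1 ≤ degreeOf ⟨0, hk⟩ (X ⟨0, hk⟩ - X j : MvPolynomial (Fin k) ℂ) := fun j hj =>
    one_le_degreeOf (z := 0) (t := 1) (by simp [(Finset.mem_Ioi.1 hj).ne'])
  refine le_trans ?_ (Finset.sum_le_sum h3)
  simp

/-- The quotient of the numerator and the denominator of the Pfaffian formula. -/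
@[irreducible] noncomputable def pfQuot (k : ℕ) : MvPolynomial (Fin k) ℂ := (vdm_dvd_pfNum k).choose

theorem pfNum_eq (k : ℕ) : pfNum k = vdm k * pfQuot k := by
  unfold pfQuot
  exact (vdm_dvd_pfNum k).choose_spec

theorem eval_pfQuot_perm (z : Fin k → ℂ) (σ : Equiv.Perm (Fin k)) :
    eval (z ∘ σ) (pfQuot k) = eval z (pfQuot k) := by
  obtain ⟨z₀, hz₀⟩ : ∃ z, eval z (vdm k) ≠ 0 := by
    by_contra! hc
    exact vdm_ne_zero k (MvPolynomial.funext fun z => by rw [hc, map_zero])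
  have key := IsPoly.eq_zero_of_mul (F := fun z => eval z (vdm k))
    (G := fun z => eval (z ∘ σ) (pfQuot k) - eval z (pfQuot k)) (IsPoly.eval _)
    (((IsPoly.eval (pfQuot k)).comp fun i => IsPoly.var _).sub (IsPoly.eval _)) (fun z => ?_) hz₀ z
  · exact sub_eq_zero.1 key
  · have h := eval_pfNum_perm z σ
    rw [pfNum_eq, map_mul, map_mul, eval_vdm_perm, mul_assoc] at h
    have h0 : ((Equiv.Perm.sign σ : ℤ) : ℂ) ≠ 0 := by exact_mod_cast (Equiv.Perm.sign σ).ne_zero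
    have := mul_left_cancel₀ h0 h
    rw [mul_sub, this, sub_self]

theorem degreeOf_pfQuot_le (hk : 0 < k) (he : Even k) :
    degreeOf ⟨0, hk⟩ (pfQuot k) ≤ k - 1 := by
  by_cases h0 : pfQuot k = 0
  · rw [h0, degreeOf_zero]
    exact Nat.zero_le _
  · have h1 := degreeOf_pfNum_le ⟨0, hk⟩ he
    rw [pfNum_eq, degreeOf_mul_eq (vdm_ne_zero k) h0] at h1
    have := le_degreeOf_vdm hk
    omega

/-! ### Symmetries of the terms of the Pfaffian -/

variable {k : ℕ}

/-- The part of a term of the Pfaffian that comes from the pairs. -/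
noncomputable def pairPart (y : Fin k → ℂ) : ℂ :=
  ∏ i : Fin (k / 2), (y ⟨2 * i, by omega⟩ ^ 2 - y ⟨2 * i + 1, by omega⟩ ^ 2)

/-- The product over the points in different pairs. -/
noncomputable def crossPart (y : Fin k → ℂ) : ℂ :=
  ∏ a : Fin k, ∏ b : Fin k, if (a : ℕ) / 2 = (b : ℕ) / 2 then 1 else y a + q * y b

/-- A product over pairs. -/
theorem prod_prod_pair (f : Fin k → Fin k → ℂ) :
    ∏ a : Fin k, ∏ b : Fin k, (if (a : ℕ) / 2 = (b : ℕ) / 2 ∧ a < b then f a b else 1) =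
      ∏ i : Fin (k / 2), f ⟨2 * i, by omega⟩ ⟨2 * i + 1, by omega⟩ := by
  symm
  refine Finset.prod_of_injOn (fun i : Fin (k / 2) => (⟨2 * i, by omega⟩ : Fin k)) ?_ ?_ ?_ ?_
  · intro i _ j _ h
    simp only [Fin.mk.injEq] at h
    exact Fin.ext (by omega)
  · exact fun _ _ => Finset.mem_coe.2 (Finset.mem_univ _)
  · rintro a - ha
    refine Finset.prod_eq_one fun b _ => if_neg fun h => ha ?_
    have hb := b.2
    have h1 : (a : ℕ) < b := h.2
    exact ⟨⟨a / 2, by omega⟩, Finset.mem_coe.2 (Finset.mem_univ _), Fin.ext (by simp only; omega)⟩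
  · intro i _
    symm
    rw [Finset.prod_eq_single (⟨2 * i + 1, by omega⟩ : Fin k), if_pos]
    · refine ⟨?_, Fin.mk_lt_mk.2 (by omega)⟩
      simp only
      omega
    · intro b _ hb
      refine if_neg fun h => hb (Fin.ext ?_)
      have h1 : 2 * (i : ℕ) < b := h.2
      have h2 := h.1
      simp only at h2 ⊢
      omega
    · simp

theorem eval_pfTerm (y : Fin k → ℂ) : eval y (pfTerm k) = pairPart y * crossPart y := by
  rw [pairPart, ← prod_prod_pair fun a b => y a ^ 2 - y b ^ 2, crossPart, pfTerm, map_prod,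
    ← Finset.prod_mul_distrib]
  refine Finset.prod_congr rfl fun a _ => ?_
  rw [map_prod, ← Finset.prod_mul_distrib]
  refine Finset.prod_congr rfl fun b _ => ?_
  split_ifs <;> simp_all

theorem crossPart_comp (y : Fin k → ℂ) {h : Equiv.Perm (Fin k)}
    (hh : ∀ a b, (h a : ℕ) / 2 = (h b : ℕ) / 2 ↔ (a : ℕ) / 2 = (b : ℕ) / 2) :
    crossPart (y ∘ h) = crossPart y := by
  rw [crossPart, crossPart]
  refine Fintype.prod_equiv h _ _ fun a => Fintype.prod_equiv h _ _ fun b => ?_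
  simp only [hh, Function.comp]

/-- The flip of a pair. -/
def flipPair (i : Fin (k / 2)) : Equiv.Perm (Fin k) :=
  Equiv.swap ⟨2 * i, by omega⟩ ⟨2 * i + 1, by omega⟩

/-- The exchange of two pairs. -/
def swapPair (i j : Fin (k / 2)) : Equiv.Perm (Fin k) :=
  Equiv.swap ⟨2 * i, by omega⟩ ⟨2 * j, by omega⟩ *
    Equiv.swap ⟨2 * i + 1, by omega⟩ ⟨2 * j + 1, by omega⟩

theorem flipPair_val (i : Fin (k / 2)) (a : Fin k) : (flipPair i a : ℕ) =
    if (a : ℕ) = 2 * i then 2 * (i : ℕ) + 1 else if (a : ℕ) = 2 * i + 1 then 2 * i else a := by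
  rw [flipPair, Equiv.swap_apply_def]
  simp only [Fin.ext_iff]
  split_ifs <;> rfl

theorem swapPair_val (i j : Fin (k / 2)) (a : Fin k) : (swapPair i j a : ℕ) =
    if (a : ℕ) = 2 * i then 2 * (j : ℕ) else if (a : ℕ) = 2 * i + 1 then 2 * j + 1 else
      if (a : ℕ) = 2 * j then 2 * i else if (a : ℕ) = 2 * j + 1 then 2 * i + 1 else a := by
  simp only [swapPair, Equiv.Perm.coe_mul, Function.comp, Equiv.swap_apply_def, Fin.ext_iff]
  split_ifs <;> simp_all <;> omega

theorem eval_pfTerm_flipPair (y : Fin k → ℂ) (i : Fin (k / 2)) :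
    eval (y ∘ flipPair i) (pfTerm k) =
      ((Equiv.Perm.sign (flipPair i) : ℤ) : ℂ) * eval y (pfTerm k) := by
  have hs : Equiv.Perm.sign (flipPair i) = -1 := Equiv.Perm.sign_swap (by simp [Fin.ext_iff])
  have hp : pairPart (y ∘ flipPair i) = -pairPart y := by
    rw [pairPart, pairPart, ← Finset.mul_prod_erase _ _ (Finset.mem_univ i),
      ← Finset.mul_prod_erase Finset.univ (fun i : Fin (k / 2) =>
        y ⟨2 * i, by omega⟩ ^ 2 - y ⟨2 * i + 1, by omega⟩ ^ 2) (Finset.mem_univ i), ← neg_mul]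
    congr 1
    · simp [flipPair]
    · refine Finset.prod_congr rfl fun j hj => ?_
      have hj := Fin.val_ne_of_ne (Finset.mem_erase.1 hj).1
      have e1 : flipPair i ⟨2 * j, by omega⟩ = ⟨2 * j, by omega⟩ := Fin.ext (by
        rw [flipPair_val]; simp only; split_ifs <;> omega)
      have e2 : flipPair i ⟨2 * j + 1, by omega⟩ = ⟨2 * j + 1, by omega⟩ := Fin.ext (by
        rw [flipPair_val]; simp only; split_ifs <;> omega)
      simp only [Function.comp, e1, e2]
  rw [eval_pfTerm, eval_pfTerm, hp, hs, crossPart_comp]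
  · simp
  · intro a b
    rw [flipPair_val, flipPair_val]
    split_ifs <;> omega

theorem eval_pfTerm_swapPair (y : Fin k → ℂ) {i j : Fin (k / 2)} (hij : i ≠ j) :
    eval (y ∘ swapPair i j) (pfTerm k) =
      ((Equiv.Perm.sign (swapPair i j) : ℤ) : ℂ) * eval y (pfTerm k) := by
  have hij' := Fin.val_ne_of_ne hij
  have hs : Equiv.Perm.sign (swapPair i j) = 1 := by
    rw [swapPair, map_mul, Equiv.Perm.sign_swap, Equiv.Perm.sign_swap] <;>
      simp [Fin.ext_iff, hij']
  have hp : pairPart (y ∘ swapPair i j) = pairPart y := by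
    rw [pairPart, pairPart, ← Equiv.prod_comp (Equiv.swap i j) fun i : Fin (k / 2) =>
        y ⟨2 * i, by omega⟩ ^ 2 - y ⟨2 * i + 1, by omega⟩ ^ 2]
    refine Finset.prod_congr rfl fun l _ => ?_
    have hv : (Equiv.swap i j l : ℕ) = if (l : ℕ) = i then (j : ℕ) else if (l : ℕ) = j then
        (i : ℕ) else l := by
      rw [Equiv.swap_apply_def]
      simp only [Fin.ext_iff]
      split_ifs <;> rfl
    have e1 : swapPair i j ⟨2 * l, by omega⟩ = ⟨2 * (Equiv.swap i j l : ℕ), by omega⟩ := Fin.ext (by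
      rw [swapPair_val]; simp only [hv]; split_ifs <;> omega)
    have e2 : swapPair i j ⟨2 * l + 1, by omega⟩ =
        ⟨2 * (Equiv.swap i j l : ℕ) + 1, by omega⟩ := Fin.ext (by
      rw [swapPair_val]; simp only [hv]; split_ifs <;> omega)
    simp only [Function.comp, e1, e2]
  rw [eval_pfTerm, eval_pfTerm, hp, hs, crossPart_comp]
  · simp
  · intro a b
    rw [swapPair_val, swapPair_val]
    split_ifs <;> omega

/-- The terms of the Pfaffian are invariant under a transitive group of permutations. -/
theorem exists_perm_pfTerm {m : ℕ} (hm : Even m) (j : Fin (m + 2)) :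
    ∃ h : Equiv.Perm (Fin (m + 2)), h (Fin.last (m + 1)) = j ∧ ∀ y : Fin (m + 2) → ℂ,
      eval (y ∘ h) (pfTerm (m + 2)) =
        ((Equiv.Perm.sign h : ℤ) : ℂ) * eval y (pfTerm (m + 2)) := by
  obtain ⟨n, rfl⟩ := hm
  have hj := j.2
  let i : Fin ((n + n + 2) / 2) := ⟨j / 2, by omega⟩
  let l : Fin ((n + n + 2) / 2) := ⟨n, by omega⟩
  obtain ⟨h, h1, h2⟩ : ∃ h : Equiv.Perm (Fin (n + n + 2)),
      (h (Fin.last (n + n + 1)) : ℕ) = 2 * i + 1 ∧ ∀ y : Fin (n + n + 2) → ℂ,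
      eval (y ∘ h) (pfTerm (n + n + 2)) =
        ((Equiv.Perm.sign h : ℤ) : ℂ) * eval y (pfTerm (n + n + 2)) := by
    by_cases hil : i = l
    · refine ⟨1, ?_, fun y => by simp⟩
      have : (i : ℕ) = n := congrArg Fin.val hil
      simp only [Equiv.Perm.coe_one, id, Fin.val_last]
      omega
    · refine ⟨swapPair i l, ?_, fun y => eval_pfTerm_swapPair y hil⟩
      have : (i : ℕ) ≠ n := fun h => hil (Fin.ext h)
      rw [swapPair_val]
      simp only [Fin.val_last, l]
      split_ifs <;> omega
  rcases Nat.even_or_odd (j : ℕ) with hj2 | hj2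
  · refine ⟨flipPair i * h, Fin.ext ?_, fun y => ?_⟩
    · obtain ⟨r, hr⟩ := hj2
      simp only [Equiv.Perm.coe_mul, Function.comp, flipPair_val, h1, i]
      split_ifs <;> omega
    · have e : y ∘ (flipPair i * h) = (y ∘ flipPair i) ∘ h := rfl
      rw [e, h2, eval_pfTerm_flipPair, map_mul]
      push_cast
      ring
  · refine ⟨h, Fin.ext ?_, h2⟩
    obtain ⟨r, hr⟩ := hj2
    rw [h1]
    simp only [i]
    omega

/-- The sum over permutations reduces to the permutations that fix the last element. -/
theorem eval_pfNum_eq_last {m : ℕ} (hm : Even m) (z : Fin (m + 2) → ℂ) :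
    eval z (pfNum (m + 2)) = (m + 2) * ∑ π : Equiv.Perm (Fin (m + 2)),
      if π (Fin.last (m + 1)) = Fin.last (m + 1) then
        ((Equiv.Perm.sign π : ℤ) : ℂ) * eval (z ∘ π) (pfTerm (m + 2)) else 0 := by
  -- The permutations are grouped by the index j that is sent to the last point. Right
  -- multiplication by a symmetry of `pfTerm` taking the last index to j identifies the groups, and
  -- its sign occurs twice.
  have key : ∀ j : Fin (m + 2), (∑ π : Equiv.Perm (Fin (m + 2)),
      if π j = Fin.last (m + 1) then
        ((Equiv.Perm.sign π : ℤ) : ℂ) * eval (z ∘ π) (pfTerm (m + 2)) else 0) =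
      ∑ π : Equiv.Perm (Fin (m + 2)), if π (Fin.last (m + 1)) = Fin.last (m + 1) then
        ((Equiv.Perm.sign π : ℤ) : ℂ) * eval (z ∘ π) (pfTerm (m + 2)) else 0 := by
    intro j
    obtain ⟨h, h1, h2⟩ := exists_perm_pfTerm hm j
    refine Fintype.sum_equiv (Equiv.mulRight h) _ _ fun π => ?_
    have hs : ((Equiv.Perm.sign h : ℤ) : ℂ) * ((Equiv.Perm.sign h : ℤ) : ℂ) = 1 := by
      rcases Int.units_eq_one_or (Equiv.Perm.sign h) with h | h <;> simp [h]
    simp only [Equiv.coe_mulRight, Equiv.Perm.coe_mul, Function.comp, h1]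
    refine if_congr Iff.rfl ?_ rfl
    rw [← Function.comp_assoc, h2, map_mul]
    push_cast
    linear_combination (-((Equiv.Perm.sign π : ℤ) : ℂ) * eval (z ∘ π) (pfTerm (m + 2))) * hs
  have e : eval z (pfNum (m + 2)) = ∑ j : Fin (m + 2), ∑ π : Equiv.Perm (Fin (m + 2)),
      if π j = Fin.last (m + 1) then
        ((Equiv.Perm.sign π : ℤ) : ℂ) * eval (z ∘ π) (pfTerm (m + 2)) else 0 := by
    rw [eval_pfNum, Finset.sum_comm]
    refine Finset.sum_congr rfl fun π _ => ?_
    rw [Finset.sum_eq_single (π.symm (Fin.last (m + 1))), if_pos (π.apply_symm_apply _)]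
    · intro j _ hj
      exact if_neg fun h => hj (by rw [← h, π.symm_apply_apply])
    · simp
  rw [e, Finset.sum_congr rfl fun j _ => key j, Finset.sum_const, Finset.card_univ,
    Fintype.card_fin, nsmul_eq_mul]
  push_cast
  ring

/-! ### Recursion for the Pfaffian formula -/

variable {m : ℕ}

theorem eval_pfTerm_add_two (hm : Even m) (y : Fin (m + 2) → ℂ) :
    eval y (pfTerm (m + 2)) =
      (y (Fin.last m).castSucc ^ 2 - y (Fin.last (m + 1)) ^ 2) *
      (∏ j : Fin m, ((y j.castSucc.castSucc + q * y (Fin.last m).castSucc) *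
        (y j.castSucc.castSucc + q * y (Fin.last (m + 1))) *
        (y (Fin.last m).castSucc + q * y j.castSucc.castSucc) *
        (y (Fin.last (m + 1)) + q * y j.castSucc.castSucc))) *
      eval (fun j => y j.castSucc.castSucc) (pfTerm m) := by
  obtain ⟨n, rfl⟩ := hm
  have c1 : ∀ j : Fin (n + n), (j : ℕ) / 2 ≠ (n + n) / 2 := fun j => by have := j.2; omega
  have c2 : ∀ j : Fin (n + n), (j : ℕ) / 2 ≠ (n + n + 1) / 2 := fun j => by have := j.2; omega
  have c3 : (n + n) / 2 = (n + n + 1) / 2 := by omega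
  have c4 : ∀ i j : Fin (n + n), i.castSucc.castSucc < j.castSucc.castSucc ↔ i < j := fun i j =>
    Iff.rfl
  rw [pfTerm, pfTerm]
  simp only [Fin.prod_univ_castSucc, Fin.val_castSucc, Fin.val_last, c1, (c1 _).symm, c3.symm, c4,
    if_true, if_false, lt_irrefl, mul_one, Finset.prod_mul_distrib, Fin.castSucc_lt_last,
    (Fin.castSucc_lt_last _).not_gt]
  simp only [map_prod, apply_ite (eval y), apply_ite (eval fun j : Fin (n + n) => y j.castSucc.castSucc),
    map_add, map_sub, map_mul, map_pow, eval_X, eval_C, map_one]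
  ring

/-- The extension of a permutation by the identity on two more elements. -/
def extendTwo (σ : Equiv.Perm (Fin m)) : Equiv.Perm (Fin (m + 2)) :=
  finSumFinEquiv.permCongr (Equiv.Perm.sumCongr σ (1 : Equiv.Perm (Fin 2)))

theorem extendTwo_castSucc (σ : Equiv.Perm (Fin m)) (j : Fin m) :
    extendTwo σ j.castSucc.castSucc = (σ j).castSucc.castSucc := by
  have : (j.castSucc.castSucc : Fin (m + 2)) = finSumFinEquiv (m := m) (n := 2) (Sum.inl j) := rfl
  rw [extendTwo, Equiv.permCongr_apply, this, Equiv.symm_apply_apply]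
  rfl

theorem extendTwo_natAdd (σ : Equiv.Perm (Fin m)) (j : Fin 2) :
    extendTwo σ (Fin.natAdd m j) = Fin.natAdd m j := by
  have : (Fin.natAdd m j : Fin (m + 2)) = finSumFinEquiv (Sum.inr j) := by simp
  rw [extendTwo, Equiv.permCongr_apply, this, Equiv.symm_apply_apply]
  rfl

theorem sign_extendTwo (σ : Equiv.Perm (Fin m)) :
    Equiv.Perm.sign (extendTwo σ) = Equiv.Perm.sign σ := by
  rw [extendTwo, Equiv.Perm.sign_permCongr, Equiv.Perm.sign_sumCongr, map_one, mul_one]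

theorem extendTwo_injective : Function.Injective (extendTwo (m := m)) := fun σ τ h => by
  ext j
  have := congrArg (fun π : Equiv.Perm (Fin (m + 2)) => (π j.castSucc.castSucc : ℕ)) h
  simpa [extendTwo_castSucc] using this

theorem exists_extendTwo {π : Equiv.Perm (Fin (m + 2))} (h : ∀ j : Fin 2,
    π (Fin.natAdd m j) = Fin.natAdd m j) : ∃ σ, extendTwo σ = π := by
  have lt : ∀ i : Fin m, (π i.castSucc.castSucc : ℕ) < m := fun i => by
    by_contra hc
    have h2 := (π i.castSucc.castSucc).2
    have e : π i.castSucc.castSucc =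
        Fin.natAdd m ⟨π i.castSucc.castSucc - m, by omega⟩ := Fin.ext (by simp; omega)
    rw [← h] at e
    have := congrArg Fin.val (π.injective e)
    simp at this
    omega
  let φ : Fin m → Fin m := fun i => ⟨π i.castSucc.castSucc, lt i⟩
  have hφ : Function.Injective φ := fun i j hij => by
    have h3 : (π i.castSucc.castSucc : ℕ) = π j.castSucc.castSucc := Fin.mk.inj_iff.1 hij
    have := π.injective (Fin.ext h3)
    exact Fin.castSucc_injective _ (Fin.castSucc_injective _ this)
  refine ⟨Equiv.ofBijective φ (Finite.injective_iff_bijective.1 hφ), Equiv.ext fun j => ?_⟩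
  refine Fin.addCases (fun i => ?_) (fun i => ?_) j
  · exact (extendTwo_castSucc _ i).trans (Fin.ext rfl)
  · rw [extendTwo_natAdd, h]

/-- By `eval_pfNum_eq_last` only permutations fixing the last index matter. If the last two points
are not paired, z_last + q z_prev = 0 is among the cross factors; otherwise the permutation fixes
both and extends one of the first m indices. -/
theorem eval_pfNum_add_two (hm : Even m) (z : Fin (m + 2) → ℂ)
    (hz : z (Fin.last (m + 1)) + q * z (Fin.last m).castSucc = 0) :
    eval z (pfNum (m + 2)) = (m + 2) *
      ((z (Fin.last m).castSucc ^ 2 - z (Fin.last (m + 1)) ^ 2) *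
      (∏ j : Fin m, ((z j.castSucc.castSucc + q * z (Fin.last m).castSucc) *
        (z j.castSucc.castSucc + q * z (Fin.last (m + 1))) *
        (z (Fin.last m).castSucc + q * z j.castSucc.castSucc) *
        (z (Fin.last (m + 1)) + q * z j.castSucc.castSucc))) *
      eval (fun j => z j.castSucc.castSucc) (pfNum m)) := by
  have n0 : (Fin.natAdd m (0 : Fin 2)) = (Fin.last m).castSucc := rfl
  have n1 : (Fin.natAdd m (1 : Fin 2)) = Fin.last (m + 1) := rfl
  rw [eval_pfNum_eq_last hm]
  congr 1
  rw [eval_pfNum, Finset.mul_sum]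
  symm
  refine Finset.sum_of_injOn (s := Finset.univ) (t := Finset.univ) extendTwo
    extendTwo_injective.injOn (fun _ _ => Finset.mem_coe.2 (Finset.mem_univ _)) ?_ ?_
  · rintro π - hπ
    refine ite_eq_right_iff.2 fun h => mul_eq_zero_of_right _ ?_
    have h0 : π (Fin.last m).castSucc ≠ (Fin.last m).castSucc := fun h0 => hπ (by
      obtain ⟨σ, hσ⟩ := exists_extendTwo (π := π) (fun j => by
        fin_cases j
        · exact h0
        · exact h)
      exact ⟨σ, Finset.mem_coe.2 (Finset.mem_univ _), hσ⟩)
    -- the factor of the last two points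
    set b := π.symm (Fin.last m).castSucc with hb
    have hb' : π b = (Fin.last m).castSucc := π.apply_symm_apply _
    have hb1 : b ≠ (Fin.last m).castSucc := fun e => h0 (by rw [← e, hb', e])
    have hb2 : b ≠ Fin.last (m + 1) := fun e => by
      rw [e, h] at hb'
      exact absurd (congrArg Fin.val hb') (by simp)
    obtain ⟨n, hn⟩ := hm
    have hb3 : (b : ℕ) < m := by
      have := b.2
      have h1 : (b : ℕ) ≠ m := fun e => hb1 (Fin.ext e)
      have h2 : (b : ℕ) ≠ m + 1 := fun e => hb2 (Fin.ext e)
      omega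
    rw [eval_pfTerm, crossPart]
    refine mul_eq_zero_of_right _ (Finset.prod_eq_zero (Finset.mem_univ (Fin.last (m + 1)))
      (Finset.prod_eq_zero (Finset.mem_univ b) ?_))
    rw [if_neg (by rw [Fin.val_last]; omega)]
    simp only [Function.comp, h, hb']
    exact hz
  · intro σ _
    have e0 : extendTwo σ (Fin.last m).castSucc = (Fin.last m).castSucc := extendTwo_natAdd σ 0
    have e1 : extendTwo σ (Fin.last (m + 1)) = Fin.last (m + 1) := extendTwo_natAdd σ 1
    rw [if_pos e1, sign_extendTwo, eval_pfTerm_add_two hm]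
    simp only [Function.comp, e0, e1, extendTwo_castSucc]
    rw [← Equiv.prod_comp σ fun j : Fin m =>
      (z j.castSucc.castSucc + q * z (Fin.last m).castSucc) *
        (z j.castSucc.castSucc + q * z (Fin.last (m + 1))) *
        (z (Fin.last m).castSucc + q * z j.castSucc.castSucc) *
        (z (Fin.last (m + 1)) + q * z j.castSucc.castSucc)]
    have e : ((fun j : Fin m => z j.castSucc.castSucc) ∘ σ) =
        fun j => z (σ j).castSucc.castSucc := rfl
    rw [e]
    ring

theorem eval_vdm_nat (k : ℕ) (ζ : ℕ → ℂ) : eval (fun j : Fin k => ζ j) (vdm k) =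
    ∏ j ∈ Finset.range k, ∏ i ∈ Finset.range j, (ζ i - ζ j) := by
  rw [eval_vdm]
  exact prod_Ioi_eq k fun i j => ζ i - ζ j

/-- The sequence `ζ` with `x` and `-q x` at the positions `m` and `m + 1`. -/
noncomputable def endPt (x : ℂ) (m : ℕ) (ζ : ℕ → ℂ) (j : ℕ) : ℂ :=
  if j < m then ζ j else if j = m then x else -q * x

/-- The polynomials of the Pfaffian formula. -/
noncomputable def evenP (k : ℕ) : MvPolynomial (Fin k) ℂ :=
  C (((-3 * q ^ 2) ^ (k / 2) * (2 ^ (k / 2) * ((k / 2).factorial : ℂ)))⁻¹) * pfQuot k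

theorem eval_vdm_endPt (x : ℂ) (ζ : ℕ → ℂ) :
    eval (fun j : Fin (m + 2) => endPt x m ζ j) (vdm (m + 2)) =
      eval (fun j : Fin m => ζ j) (vdm m) *
        (∏ j ∈ Finset.range m, ((ζ j - x) * (ζ j + q * x))) * (x + q * x) := by
  have p0 : ∀ j < m, endPt x m ζ j = ζ j := fun j hj => if_pos hj
  have p1 : endPt x m ζ m = x := by rw [endPt, if_neg (lt_irrefl m), if_pos rfl]
  have p2 : endPt x m ζ (m + 1) = -q * x := by
    rw [endPt, if_neg (by omega), if_neg (by omega)]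
  have v1 : ∏ j ∈ Finset.range m, ∏ i ∈ Finset.range j, (endPt x m ζ i - endPt x m ζ j) =
      ∏ j ∈ Finset.range m, ∏ i ∈ Finset.range j, (ζ i - ζ j) := by
    refine Finset.prod_congr rfl fun j hj => Finset.prod_congr rfl fun i hi => ?_
    rw [Finset.mem_range] at hi hj
    rw [p0 i (by omega), p0 j hj]
  have v2 : ∀ w, ∏ i ∈ Finset.range m, (endPt x m ζ i - w) = ∏ j ∈ Finset.range m, (ζ j - w) :=
    fun w => Finset.prod_congr rfl fun j hj => by rw [p0 j (Finset.mem_range.1 hj)]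
  rw [eval_vdm_nat, Finset.prod_range_succ, Finset.prod_range_succ, Finset.prod_range_succ _ m,
    p1, p2, v1, v2, v2, eval_vdm_nat, Finset.prod_mul_distrib]
  simp only [neg_mul, sub_neg_eq_add]
  ring

theorem eval_pfNum_endPt (hm : Even m) (x : ℂ) (ζ : ℕ → ℂ) :
    eval (fun j : Fin (m + 2) => endPt x m ζ j) (pfNum (m + 2)) =
      (m + 2) * (1 - q ^ 2) * x ^ 2 * q ^ (2 * m) *
        (∏ j ∈ Finset.range m, (ζ j ^ 2 - q * x ^ 2)) *
        (∏ j ∈ Finset.range m, ((ζ j - x) * (ζ j + q * x))) *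
        eval (fun j : Fin m => ζ j) (pfNum m) := by
  have p0 : ∀ j : Fin m, endPt x m ζ j = ζ j := fun j => if_pos j.2
  have p1 : endPt x m ζ m = x := by rw [endPt, if_neg (lt_irrefl m), if_pos rfl]
  have p2 : endPt x m ζ (m + 1) = -q * x := by
    rw [endPt, if_neg (by omega), if_neg (by omega)]
  rw [eval_pfNum_add_two hm]
  · simp only [Fin.val_last, Fin.val_castSucc, p0, p1, p2]
    have e3 : ∏ j : Fin m, ((ζ j + q * x) * (ζ j + q * (-q * x)) * (x + q * ζ j) *
        (-q * x + q * ζ j)) = q ^ (2 * m) * ((∏ j ∈ Finset.range m, (ζ j ^ 2 - q * x ^ 2)) *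
          ∏ j ∈ Finset.range m, ((ζ j - x) * (ζ j + q * x))) := by
      rw [pow_mul, ← Finset.prod_mul_distrib, pow_mul_prod_range, Finset.prod_range]
      refine Finset.prod_congr rfl fun j _ => ?_
      linear_combination (-q * x * ζ j * (ζ j + q * x) * (ζ j - x)) * q_pow_three
    rw [e3]
    ring
  · simp only [Fin.val_last, Fin.val_castSucc, p1, p2]
    ring

theorem IsPoly.eq_of_mul {σ : Type*} {p : MvPolynomial σ ℂ} (hp : p ≠ 0) {F G : (σ → ℂ) → ℂ}
    (hF : IsPoly F) (hG : IsPoly G) (h : ∀ z, MvPolynomial.eval z p * F z =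
      MvPolynomial.eval z p * G z) (z : σ → ℂ) : F z = G z := by
  obtain ⟨r, hr⟩ := hF
  obtain ⟨s, hs⟩ := hG
  have : p * r = p * s := MvPolynomial.funext fun z => by rw [map_mul, map_mul, hr, hs, h]
  rw [← hr, ← hs, mul_left_cancel₀ hp this]

theorem isPoly_endPt (x : ℂ) (j : ℕ) : IsPoly fun z : Fin m → ℂ => endPt x m (natExt z) j := by
  unfold endPt
  exact IsPoly.ite _ (isPoly_natExt _) (IsPoly.ite _ (IsPoly.const _) (IsPoly.const _))

theorem natExt_apply (ζ : ℕ → ℂ) {i : ℕ} (hi : i < m) :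
    natExt (fun j : Fin m => ζ j) i = ζ i := by rw [natExt, dif_pos hi]

theorem eval_pfQuot_endPt (hm : Even m) {x : ℂ} (hx : x ≠ 0) (ζ : ℕ → ℂ) :
    eval (fun j : Fin (m + 2) => endPt x m ζ j) (pfQuot (m + 2)) =
      (m + 2) * (1 - q) * x * q ^ (2 * m) * (∏ j ∈ Finset.range m, (ζ j ^ 2 - q * x ^ 2)) *
        eval (fun j : Fin m => ζ j) (pfQuot m) := by
  have hp : vdm m * ∏ j : Fin m, ((X j - C x) * (X j - C (-(q * x)))) ≠ 0 :=
    mul_ne_zero (vdm_ne_zero m) (Finset.prod_ne_zero_iff.2 fun j _ =>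
      mul_ne_zero (X_sub_C_prime _ _).ne_zero (X_sub_C_prime _ _).ne_zero)
  have hF : IsPoly fun z : Fin m → ℂ =>
      eval (fun j : Fin (m + 2) => endPt x m (natExt z) j) (pfQuot (m + 2)) :=
    (IsPoly.eval (pfQuot (m + 2))).comp fun j => isPoly_endPt x j
  have hG : IsPoly fun z : Fin m → ℂ => (m + 2) * (1 - q) * x * q ^ (2 * m) *
      (∏ j ∈ Finset.range m, (natExt z j ^ 2 - q * x ^ 2)) * eval z (pfQuot m) :=
    ((IsPoly.const _).mul (IsPoly.prod _ fun j _ =>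
        ((isPoly_natExt _).pow 2).sub (IsPoly.const _))).mul (IsPoly.eval _)
  have key := IsPoly.eq_of_mul hp hF hG (fun z => ?_) (fun j => ζ j)
  · have ha : (fun j : Fin (m + 2) => endPt x m (natExt fun j : Fin m => ζ j) j) =
        fun j : Fin (m + 2) => endPt x m ζ j := by
      funext j
      unfold endPt
      split_ifs with h1
      · exact natExt_apply ζ h1
      · rfl
      · rfl
    rw [ha, Finset.prod_congr rfl fun i hi => by
      rw [natExt_apply ζ (Finset.mem_range.1 hi)]] at key
    exact key
  · have hn := eval_pfNum_endPt hm x (natExt z)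
    rw [pfNum_eq, pfNum_eq, map_mul, map_mul, eval_vdm_endPt, natExt_val] at hn
    have h2 : (x + q * x) ≠ 0 := by
      rw [← one_add_mul]
      exact mul_ne_zero one_add_q_ne_zero hx
    have e : eval z (∏ j : Fin m, ((X j - C x) * (X j - C (-(q * x))))) =
        ∏ j ∈ Finset.range m, ((natExt z j - x) * (natExt z j + q * x)) := by
      rw [Finset.prod_range, map_prod]
      refine Finset.prod_congr rfl fun j _ => ?_
      rw [show natExt z j = z j from congrFun (natExt_val z) j]
      simp
    refine mul_left_cancel₀ h2 ?_
    rw [map_mul, e]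
    linear_combination hn

/-- In passing from n to n + 1 pairs the factor m + 2 = 2 (n + 1) is absorbed by the normalization
2^n n!, and 1 / (-3 q²) = -q / 3 remains. -/
theorem eval_evenP_endPt (hm : Even m) {x : ℂ} (hx : x ≠ 0) (ζ : ℕ → ℂ) :
    eval (fun j : Fin (m + 2) => endPt x m ζ j) (evenP (m + 2)) =
      -(q / 3) * (1 - q) * x * q ^ (2 * m) * (∏ j ∈ Finset.range m, (ζ j ^ 2 - q * x ^ 2)) *
        eval (fun j : Fin m => ζ j) (evenP m) := by
  obtain ⟨n, rfl⟩ := hm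
  have e1 : (n + n + 2) / 2 = n + 1 := by omega
  have e2 : (n + n) / 2 = n := by omega
  have e3 : ((n + n : ℕ) : ℂ) + 2 = 2 * (n + 1) := by push_cast; ring
  have h1 : ((n : ℂ) + 1) ≠ 0 := by exact_mod_cast n.succ_ne_zero
  have h2 : (n.factorial : ℂ) ≠ 0 := by exact_mod_cast n.factorial_ne_zero
  have hq := q_ne_zero
  rw [evenP, evenP, map_mul, map_mul, eval_C, eval_C, eval_pfQuot_endPt ⟨n, rfl⟩ hx, e1, e2, e3,
    Nat.factorial_succ]
  generalize eval (fun j : Fin (n + n) => ζ j) (pfQuot (n + n)) = a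
  generalize ∏ j ∈ Finset.range (n + n), (ζ j ^ 2 - q * x ^ 2) = b
  push_cast
  field_simp
  linear_combination (6 * (q - 1) * q ^ (n * 2) * b * a * (-3) ^ n * 2 ^ n) * q_pow_three

/-! ### The Pfaffian formula -/

theorem prod_erase_eq {k : ℕ} (y : Fin k → ℂ) :
    ∏ i, ∏ j ∈ Finset.univ.erase i, (y i + q * y j) =
      crossPart y * ∏ i : Fin (k / 2), ((y ⟨2 * i, by omega⟩ + q * y ⟨2 * i + 1, by omega⟩) *
        (y ⟨2 * i + 1, by omega⟩ + q * y ⟨2 * i, by omega⟩)) := by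
  have e1 : ∀ i, ∏ j ∈ Finset.univ.erase i, (y i + q * y j) =
      ∏ j, if i = j then 1 else y i + q * y j := fun i => by
    rw [← Finset.mul_prod_erase _ _ (Finset.mem_univ i), if_pos rfl, one_mul]
    exact Finset.prod_congr rfl fun j hj => (if_neg (Finset.mem_erase.1 hj).1.symm).symm
  rw [Finset.prod_mul_distrib, ← prod_prod_pair fun a b => y a + q * y b,
    ← prod_prod_pair fun a b => y b + q * y a,
    Finset.prod_comm (f := fun a b : Fin k =>
      if (a : ℕ) / 2 = (b : ℕ) / 2 ∧ a < b then y b + q * y a else 1), crossPart,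
    ← Finset.prod_mul_distrib, ← Finset.prod_mul_distrib]
  refine Finset.prod_congr rfl fun a _ => ?_
  rw [e1, ← Finset.prod_mul_distrib, ← Finset.prod_mul_distrib]
  refine Finset.prod_congr rfl fun b _ => ?_
  rcases lt_trichotomy a b with h | rfl | h
  · rw [if_neg h.ne]
    by_cases h2 : (a : ℕ) / 2 = (b : ℕ) / 2
    · rw [if_pos h2, if_pos ⟨h2, h⟩, if_neg fun h3 => absurd (h.trans h3.2) (lt_irrefl _)]
      ring
    · rw [if_neg h2, if_neg fun h3 => h2 h3.1, if_neg fun h3 => h2 h3.1.symm]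
      ring
  · simp
  · rw [if_neg h.ne']
    by_cases h2 : (a : ℕ) / 2 = (b : ℕ) / 2
    · rw [if_pos h2, if_neg fun h3 => absurd (h.trans h3.2) (lt_irrefl _),
        if_pos ⟨h2.symm, h⟩]
      ring
    · rw [if_neg h2, if_neg fun h3 => h2 h3.1, if_neg fun h3 => h2 h3.1.symm]
      ring

theorem prod_erase_comp_perm {k : ℕ} (y : Fin k → ℂ) (π : Equiv.Perm (Fin k)) :
    ∏ i, ∏ j ∈ Finset.univ.erase i, ((y ∘ π) i + q * (y ∘ π) j) =
      ∏ i, ∏ j ∈ Finset.univ.erase i, (y i + q * y j) := by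
  refine Fintype.prod_equiv π _ _ fun i => Finset.prod_equiv π (fun j => ?_) fun j _ => rfl
  simp

/-- The product over all i ≠ j consists of the cross factors and the factors within pairs. The
latter cancel the denominators of a term of the Pfaffian, and `pfTerm` is left. -/
theorem eval_evenP_eq_pfaffianFormula (n : ℕ) (z : Fin (2 * n) → ℂ)
    (h : ∀ i j, i ≠ j → z i ≠ z j ∧ z i + q * z j ≠ 0) :
    eval z (evenP (2 * n)) = pfaffianFormula n z := by
  have hn : 2 * n / 2 = n := by omega
  have hv : ∏ i, ∏ j ∈ Finset.Ioi i, (z i - z j) ≠ 0 :=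
    Finset.prod_ne_zero_iff.2 fun i _ => Finset.prod_ne_zero_iff.2 fun j hj =>
      sub_ne_zero.2 (h i j (Finset.mem_Ioi.1 hj).ne).1
  have hq := congrArg (eval z) (pfNum_eq (2 * n))
  rw [map_mul, eval_vdm] at hq
  have key : eval z (pfNum (2 * n)) = (∏ i, ∏ j ∈ Finset.univ.erase i, (z i + q * z j)) *
      ∑ π : Equiv.Perm (Fin (2 * n)), ((Equiv.Perm.sign π : ℤ) : ℂ) *
        ∏ i : Fin n, (z (π ⟨2 * i, by omega⟩) ^ 2 - z (π ⟨2 * i + 1, by omega⟩) ^ 2) /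
          ((z (π ⟨2 * i, by omega⟩) + q * z (π ⟨2 * i + 1, by omega⟩)) *
          (z (π ⟨2 * i + 1, by omega⟩) + q * z (π ⟨2 * i, by omega⟩))) := by
    rw [eval_pfNum, Finset.mul_sum]
    refine Finset.sum_congr rfl fun π _ => ?_
    rw [eval_pfTerm, ← prod_erase_comp_perm z π, prod_erase_eq, pairPart,
      ← Equiv.prod_comp (finCongr hn), Finset.prod_div_distrib]
    have hne : ∏ i : Fin (2 * n / 2), (((z ∘ π) ⟨2 * i, by omega⟩ +
        q * (z ∘ π) ⟨2 * i + 1, by omega⟩) * ((z ∘ π) ⟨2 * i + 1, by omega⟩ +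
          q * (z ∘ π) ⟨2 * i, by omega⟩)) ≠ 0 := by
      refine Finset.prod_ne_zero_iff.2 fun i _ => mul_ne_zero (h _ _ ?_).2 (h _ _ ?_).2 <;>
        rw [Ne, π.injective.eq_iff] <;> simp
    simp only [finCongr_apply, Fin.val_cast]
    simp only [Function.comp] at hne ⊢
    have aux : ∀ c d s n : ℂ, d ≠ 0 → s * (n * c) = c * d * (s * (n / d)) := fun c d s n hd => by
      field_simp
    exact aux _ _ _ _ hne
  rw [evenP, map_mul, eval_C, hn, pfaffianFormula, pfaffian]
  simp only [Matrix.of_apply]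
  rw [key] at hq
  rw [(eq_div_iff hv).2 ((mul_comm _ _).trans hq.symm)]
  simp only [div_eq_mul_inv, mul_inv]
  ring

/-! ### The polynomials -/

/-- The polynomials of the theorem. -/
noncomputable def rotorP (k : ℕ) : MvPolynomial (Fin k) ℂ :=
  if Even k then evenP k else
    C (-3 * q ^ (k / 2 + 2)) * (finSuccEquiv ℂ k (evenP (k + 1))).coeff k

theorem tendsto_eval_div_pow {p : Polynomial ℂ} {d : ℕ} (hp : p.natDegree ≤ d) :
    Tendsto (fun w : ℂ => p.eval w / w ^ d) (Bornology.cobounded ℂ) (𝓝 (p.coeff d)) := by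
  have h1 : Tendsto (fun w : ℂ => ∑ i ∈ Finset.range (d + 1), p.coeff i * (w⁻¹) ^ (d - i))
      (Bornology.cobounded ℂ) (𝓝 (∑ i ∈ Finset.range (d + 1), p.coeff i * 0 ^ (d - i))) :=
    tendsto_finsetSum _ fun i _ => (tendsto_inv₀_cobounded.pow _).const_mul _
  have h2 : ∑ i ∈ Finset.range (d + 1), p.coeff i * (0 : ℂ) ^ (d - i) = p.coeff d := by
    rw [Finset.sum_range_succ, Finset.sum_eq_zero fun i hi => ?_]
    · simp
    · rw [Finset.mem_range] at hi
      rw [zero_pow (by omega), mul_zero]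
  rw [h2] at h1
  refine h1.congr' ?_
  filter_upwards [Bornology.eventually_ne_cobounded (0 : ℂ)] with w hw
  rw [Polynomial.eval_eq_sum_range' (Nat.lt_succ_of_le hp), Finset.sum_div]
  refine Finset.sum_congr rfl fun i hi => ?_
  have hi : i ≤ d := by rw [Finset.mem_range] at hi; omega
  rw [mul_div_assoc]
  congr 1
  rw [inv_pow, eq_div_iff (pow_ne_zero _ hw), inv_mul_eq_iff_eq_mul₀ (pow_ne_zero _ hw), ← pow_add,
    Nat.sub_add_cancel hi]

theorem eval_evenP_perm {k : ℕ} (z : Fin k → ℂ) (σ : Equiv.Perm (Fin k)) :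
    eval (z ∘ σ) (evenP k) = eval z (evenP k) := by
  rw [evenP, map_mul, map_mul, eval_pfQuot_perm, eval_C, eval_C]

theorem degreeOf_evenP_le {k : ℕ} (hk : 0 < k) (he : Even k) :
    degreeOf ⟨0, hk⟩ (evenP k) ≤ k - 1 :=
  (degreeOf_C_mul_le _ _ _).trans (degreeOf_pfQuot_le hk he)

theorem rotorP_even {k : ℕ} (hk : Even k) : rotorP k = evenP k := if_pos hk

/-- The limit picks the coefficient of the highest possible degree k in one variable. `finSuccEquiv`
singles out the first variable and `Fin.snoc` adds a last one; symmetry makes this immaterial. -/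
theorem tendsto_rotorP_odd {k : ℕ} (hk : Odd k) (z : Fin k → ℂ) :
    Tendsto (fun w : ℂ => (-3 * q ^ (k / 2 + 2)) *
      (eval (Fin.snoc z w : Fin (k + 1) → ℂ) (rotorP (k + 1)) / w ^ k))
      (Bornology.cobounded ℂ) (𝓝 (eval z (rotorP k))) := by
  have e : rotorP k = _ := if_neg (Nat.not_even_iff_odd.2 hk)
  rw [e, map_mul, eval_C, rotorP_even hk.add_one]
  refine Tendsto.const_mul _ ?_
  have hd : (Polynomial.map (eval z) (finSuccEquiv ℂ k (evenP (k + 1)))).natDegree ≤ k :=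
    (Polynomial.natDegree_map_le).trans (by
      rw [natDegree_finSuccEquiv]
      exact degreeOf_evenP_le (Nat.succ_pos k) hk.add_one)
  have := tendsto_eval_div_pow hd
  rw [Polynomial.coeff_map] at this
  refine this.congr fun w => ?_
  rw [← eval_eq_eval_mv_eval', Fin.snoc_eq_cons_rotate]
  congr 1
  exact (eval_evenP_perm _ _).symm

/-- The value of `rotorP k` at the first `k` terms of a sequence. -/
noncomputable def pv (k : ℕ) (ζ : ℕ → ℂ) : ℂ := eval (fun j : Fin k => ζ j) (rotorP k)

theorem pv_congr {k : ℕ} {ζ η : ℕ → ℂ} (h : ∀ i < k, ζ i = η i) : pv k ζ = pv k η := by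
  rw [pv, pv]
  congr 2
  funext j
  exact h j j.2

theorem tendsto_pv {k : ℕ} (hk : Odd k) (ζ : ℕ → ℂ) :
    Tendsto (fun w : ℂ => (-3 * q ^ (k / 2 + 2)) *
      (pv (k + 1) (Function.update ζ k w) / w ^ k)) (Bornology.cobounded ℂ) (𝓝 (pv k ζ)) := by
  refine (tendsto_rotorP_odd hk fun j => ζ j).congr fun w => ?_
  rw [pv]
  congr 4
  funext j
  refine Fin.lastCases ?_ (fun i => ?_) j
  · simp
  · rw [Fin.snoc_castSucc, Fin.val_castSucc, Function.update_of_ne i.2.ne]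

theorem pv_swap {k l : ℕ} (hl : l + 1 < k) (ζ : ℕ → ℂ) :
    pv k (ζ ∘ Equiv.swap l (l + 1)) = pv k ζ := by
  have even : ∀ k, Even k → l + 1 < k → ∀ ζ : ℕ → ℂ, pv k (ζ ∘ Equiv.swap l (l + 1)) = pv k ζ := by
    intro k hk hl ζ
    have e : (fun j : Fin k => (ζ ∘ Equiv.swap l (l + 1)) j) =
        (fun j : Fin k => ζ j) ∘ Equiv.swap ⟨l, by omega⟩ ⟨l + 1, hl⟩ := by
      funext j
      simp only [Function.comp, Equiv.swap_apply_def, Fin.ext_iff]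
      split_ifs <;> rfl
    rw [pv, pv, rotorP_even hk, e, eval_evenP_perm]
  rcases Nat.even_or_odd k with hk | hk
  · exact even k hk hl ζ
  -- Odd sizes inherit the symmetry from the next even size: the variable that tends to infinity has
  -- index k and is not moved by the swap.
  · refine tendsto_nhds_unique (tendsto_pv hk _) ((tendsto_pv hk ζ).congr fun w => ?_)
    rw [← even (k + 1) hk.add_one (by omega) (Function.update ζ k w)]
    congr 3
    funext j
    simp only [Function.comp, Function.update_apply]
    by_cases hj : j = k
    · subst hj
      rw [swap_eq_self_of_le hl le_rfl, if_pos rfl]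
    · rw [if_neg hj, if_neg]
      intro h
      apply hj
      rw [← Equiv.swap_apply_self l (l + 1) j, h, swap_eq_self_of_le hl le_rfl]

theorem pv_endPt {m : ℕ} (hm : Even m) {x : ℂ} (hx : x ≠ 0) (ζ : ℕ → ℂ) :
    pv (m + 2) (endPt x m ζ) = -(q / 3) * (1 - q) * x * q ^ (2 * m) *
      (∏ j ∈ Finset.range m, (ζ j ^ 2 - q * x ^ 2)) * pv m ζ := by
  rw [pv, pv, rotorP_even hm, rotorP_even (hm.add even_two), eval_evenP_endPt hm hx]

/-- The recursion for the polynomials. -/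
theorem pv_arcPt (m : ℕ) {x : ℂ} (hx : x ≠ 0) (ζ : ℕ → ℂ) :
    pv (m + 2) (arcPt x (m + 1) ζ) = -(q / 3) * (1 - q) * x * q ^ (2 * m) *
      (∏ j ∈ Finset.range m, (ζ j ^ 2 - q * x ^ 2)) * pv m ζ := by
  have even : ∀ m, Even m → ∀ ζ : ℕ → ℂ, pv (m + 2) (arcPt x (m + 1) ζ) =
      -(q / 3) * (1 - q) * x * q ^ (2 * m) *
        (∏ j ∈ Finset.range m, (ζ j ^ 2 - q * x ^ 2)) * pv m ζ := by
    intro m hm ζ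
    rw [← pv_endPt hm hx]
    -- The sequence with x at position i and -q x at the end. Adjacent swaps carry x from position 0
    -- to position m.
    let g : ℕ → ℕ → ℂ := fun i j => if j < i then ζ j else if j = i then x else
      if j < m + 1 then ζ (j - 1) else -q * x
    have g0 : pv (m + 2) (arcPt x (m + 1) ζ) = pv (m + 2) (g 0) := pv_congr fun j hj => by
      simp only [g, arcPt]
      split_ifs <;> first | rfl | omega
    have gm : pv (m + 2) (endPt x m ζ) = pv (m + 2) (g m) := pv_congr fun j hj => by
      simp only [g, endPt]
      split_ifs <;> first | rfl | omega
    have key : ∀ i ≤ m, pv (m + 2) (g i) = pv (m + 2) (g 0) := by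
      intro i
      induction i with
      | zero => exact fun _ => rfl
      | succ i ih =>
        intro hi
        rw [← ih (by omega), ← pv_swap (l := i) (by omega) (g i)]
        refine pv_congr fun j hj => ?_
        simp only [g, Function.comp, Equiv.swap_apply_def]
        split_ifs <;> first | rfl | omega | congr 1
    rw [g0, gm, key m le_rfl]
  rcases Nat.even_or_odd m with hm | hm
  · exact even m hm ζ
  · have hm2 : Odd (m + 2) := hm.add_even even_two
    refine tendsto_nhds_unique (tendsto_pv hm2 _) ?_
    have t1 := (tendsto_pv hm ζ).const_mul (-(q / 3) * (1 - q) * x * q ^ (2 * m) *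
      (∏ j ∈ Finset.range m, (ζ j ^ 2 - q * x ^ 2)))
    -- The recursion for the even size m + 1 has one further factor, that of the variable w, which
    -- tends to 1 after division by w².
    have t2 : Tendsto (fun w : ℂ => (w ^ 2 - q * x ^ 2) / w ^ 2) (Bornology.cobounded ℂ) (𝓝 1) := by
      have := tendsto_eval_div_pow (p := Polynomial.X ^ 2 - Polynomial.C (q * x ^ 2)) (d := 2)
        (by compute_degree)
      have e : (Polynomial.X ^ 2 - Polynomial.C (q * x ^ 2)).coeff 2 = 1 := by
        rw [Polynomial.coeff_sub, Polynomial.coeff_X_pow, Polynomial.coeff_C]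
        simp
      rw [e] at this
      refine this.congr fun w => ?_
      rw [Polynomial.eval_sub, Polynomial.eval_pow, Polynomial.eval_X, Polynomial.eval_C]
    have t3 := t1.mul t2
    rw [mul_one] at t3
    refine t3.congr' ?_
    filter_upwards [Bornology.eventually_ne_cobounded (0 : ℂ)] with w hw
    have e1 : pv (m + 2 + 1) (Function.update (arcPt x (m + 1) ζ) (m + 2) w) =
        pv (m + 1 + 2) (arcPt x (m + 1 + 1) (Function.update ζ m w)) := by
      rw [← pv_swap (l := m + 1) (by omega)
        (arcPt x (m + 1 + 1) (Function.update ζ m w)), arcPt_comp_swap x (by omega)]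
      refine pv_congr fun j hj => ?_
      simp only [arcPt, Function.update_apply]
      split_ifs <;> first | rfl | omega
    have e2 : ∏ i ∈ Finset.range m, (Function.update ζ m w i ^ 2 - q * x ^ 2) =
        ∏ i ∈ Finset.range m, (ζ i ^ 2 - q * x ^ 2) := Finset.prod_congr rfl fun i hi => by
      rw [Function.update_of_ne (Finset.mem_range.1 hi).ne]
    rw [e1, even (m + 1) hm.add_one, Finset.prod_range_succ, Function.update_self, e2,
      show (m + 2) / 2 = m / 2 + 1 by omega]
    generalize ∏ i ∈ Finset.range m, (ζ i ^ 2 - q * x ^ 2) = A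
    generalize pv (m + 1) (Function.update ζ m w) = B
    have e3 : q ^ (m / 2 + 1 + 2) * q ^ (2 * (m + 1)) = q ^ (m / 2 + 2) * q ^ (2 * m) := by
      linear_combination q ^ (m / 2 + 2) * q ^ (2 * m) * q_pow_three
    rw [pow_add w m 2]
    field_simp
    linear_combination (-(B * A * (1 - q) * q * (w ^ 2 - q * x ^ 2))) * e3

/-! ### Small cases, non-vanishing and degrees of the polynomials -/

theorem pv_zero (ζ : ℕ → ℂ) : pv 0 ζ = 1 := by
  rw [pv, rotorP_even Even.zero]
  refine (eval_evenP_eq_pfaffianFormula 0 (fun j => ζ j) fun i => i.elim0).trans ?_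
  simp [pfaffianFormula, pfaffian]

theorem pv_two (ζ : ℕ → ℂ) : pv 2 ζ = -(q / 3) * (ζ 0 + ζ 1) := by
  have h := fun z : Fin 2 → ℂ => congrArg (eval z) (pfNum_eq 2)
  simp only [map_mul, eval_vdm] at h
  have e : ∀ z : Fin 2 → ℂ, eval z (pfNum 2) = 2 * (z 0 ^ 2 - z 1 ^ 2) := by
    intro z
    rw [eval_pfNum, show (Finset.univ : Finset (Equiv.Perm (Fin 2))) = {1, Equiv.swap 0 1} by decide,
      Finset.sum_pair (by decide)]
    have e2 : ∀ y : Fin 2 → ℂ, eval y (pfTerm 2) = y 0 ^ 2 - y 1 ^ 2 := fun y => by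
      rw [eval_pfTerm_add_two (m := 0) Even.zero]
      have e3 : eval (fun j : Fin 0 => y j.castSucc.castSucc) (pfTerm 0) = 1 := by
        simp [pfTerm]
      rw [e3]
      simp
    rw [e2, e2]
    simp
    ring
  have hz : ∀ z : Fin 2 → ℂ, eval z (pfQuot 2) = eval z (C 2 * (X 0 + X 1)) :=
    IsPoly.eq_of_mul (vdm_ne_zero 2) (IsPoly.eval _) (IsPoly.eval _) fun z => by
      rw [eval_vdm, ← h z, e, Fin.prod_univ_two]
      have : Finset.Ioi (0 : Fin 2) = {1} := by decide
      have h1 : Finset.Ioi (1 : Fin 2) = ∅ := by decide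
      rw [this, h1]
      simp
      ring
  rw [pv, rotorP_even even_two, evenP, map_mul, hz]
  simp only [eval_C, map_mul, map_add, eval_X, Fin.val_zero, Fin.val_one]
  norm_num
  have := q_ne_zero
  field_simp
  linear_combination (-(ζ 0 + ζ 1)) * q_pow_three

theorem pv_one (ζ : ℕ → ℂ) : pv 1 ζ = 1 := by
  refine tendsto_nhds_unique (tendsto_pv odd_one ζ) ?_
  have t : Tendsto (fun w : ℂ => (Polynomial.X + Polynomial.C (ζ 0)).eval w / w ^ 1)
      (Bornology.cobounded ℂ) (𝓝 ((Polynomial.X + Polynomial.C (ζ 0)).coeff 1)) :=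
    tendsto_eval_div_pow (by compute_degree)
  have e : (Polynomial.X + Polynomial.C (ζ 0)).coeff 1 = 1 := by
    rw [Polynomial.coeff_add, Polynomial.coeff_X_one, Polynomial.coeff_C]
    simp
  rw [e] at t
  refine t.congr fun w => ?_
  rw [pv_two, Function.update_self, Function.update_of_ne (by norm_num)]
  simp only [Polynomial.eval_add, Polynomial.eval_X, Polynomial.eval_C]
  norm_num
  linear_combination (-(w + ζ 0) / w) * q_pow_three

theorem exists_pv_arcPt_ne_zero {k : ℕ} (hk : rotorP k ≠ 0) {x : ℂ} (hx : x ≠ 0) :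
    ∃ ζ, pv (k + 2) (arcPt x (k + 1) ζ) ≠ 0 := by
  obtain ⟨z, hz⟩ : ∃ z, eval z (quadProd k x * rotorP k) ≠ 0 := by
    by_contra! h
    exact mul_ne_zero (quadProd_ne_zero hx) hk (MvPolynomial.funext fun z => by rw [h, map_zero])
  obtain ⟨ζ, rfl⟩ : ∃ ζ : ℕ → ℂ, z = fun j : Fin k => ζ j := ⟨natExt z, (natExt_val z).symm⟩
  refine ⟨ζ, ?_⟩
  rw [map_mul, eval_quadProd_nat] at hz
  rw [pv_arcPt k hx, mul_assoc]
  refine mul_ne_zero (mul_ne_zero (mul_ne_zero (mul_ne_zero ?_ ?_) hx) ?_) hz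
  · exact neg_ne_zero.2 (div_ne_zero q_ne_zero (by norm_num))
  · exact sub_ne_zero.2 q_ne_one.symm
  · exact pow_ne_zero _ q_ne_zero

theorem rotorP_ne_zero : ∀ k, rotorP k ≠ 0
  | 0 => fun h => by simpa [pv, h] using pv_zero 0
  | 1 => fun h => by simpa [pv, h] using pv_one 0
  | k + 2 => fun h => by
    obtain ⟨ζ, hζ⟩ := exists_pv_arcPt_ne_zero (rotorP_ne_zero k) one_ne_zero
    exact hζ (by rw [pv, h, map_zero])

theorem rename_perm_evenP {k : ℕ} (σ : Equiv.Perm (Fin k)) : rename σ (evenP k) = evenP k :=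
  MvPolynomial.funext fun z => by rw [eval_rename, eval_evenP_perm]

theorem degreeOf_evenP_le' {k : ℕ} (he : Even k) (c : Fin k) : degreeOf c (evenP k) ≤ k - 1 := by
  have hk : 0 < k := c.pos
  have h := degreeOf_rename_of_injective (p := evenP k) (Equiv.swap ⟨0, hk⟩ c).injective ⟨0, hk⟩
  rw [rename_perm_evenP, Equiv.swap_apply_left] at h
  rw [h]
  exact degreeOf_evenP_le hk he

theorem degreeOf_rotorP_le {k : ℕ} (c : Fin k) : degreeOf c (rotorP k) ≤ k := by
  rcases Nat.even_or_odd k with hk | hk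
  · rw [rotorP_even hk]
    exact (degreeOf_evenP_le' hk c).trans (Nat.sub_le _ _)
  · rw [show rotorP k = _ from if_neg (Nat.not_even_iff_odd.2 hk)]
    exact (degreeOf_C_mul_le _ _ _).trans ((degreeOf_coeff_finSuccEquiv _ _ _).trans
      (degreeOf_evenP_le' hk.add_one _))

theorem degreeOf_rotorP_le_of_even {k : ℕ} (hk : Even k) (c : Fin k) :
    degreeOf c (rotorP k) ≤ k - 1 := by
  rw [rotorP_even hk]
  exact degreeOf_evenP_le' hk c

/-! ### Rotation and interpolation of the nontrivial factors -/

variable {N : ℕ} [NeZero N] {Ψ : State N → MvPolynomial (Fin N) ℂ}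

theorem col_zero : (col 0 : Fin N) = 0 := by
  have := col_nat (N := N) (Nat.pos_of_ne_zero (NeZero.ne N))
  rw [Nat.cast_zero] at this
  rw [this]
  rfl

theorem col_add_nat (a : ℤ) (m : ℕ) : (col (a + m) : Fin N) = col a + col (m : ℤ) := by
  induction m with
  | zero => rw [Nat.cast_zero, add_zero, col_zero, add_zero]
  | succ m ih => rw [Nat.cast_succ, ← add_assoc, col_add_one, col_add_one, ih, add_assoc]

theorem Good.rot_nested (h : Good Ψ) (c c' : ℤ) (m : ℕ) (z : Fin N → ℂ) :
    evalv Ψ z (nested N (c + m), nested N (c' + m)) =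
      evalv Ψ (fun j => z (j + col (m : ℤ))) (nested N c, nested N c') := by
  induction m generalizing z with
  | zero =>
    simp [col_zero]
  | succ m ih =>
    have e := h.rot z (nested N (c + m), nested N (c' + m))
    rw [show rotState (nested N (c + m), nested N (c' + m)) =
      (nested N (c + (m + 1 : ℕ)), nested N (c' + (m + 1 : ℕ))) by
        rw [rotState, LinkPattern.rot_nested, LinkPattern.rot_nested]
        push_cast
        simp only [add_assoc]] at e
    rw [e, ih]
    congr 1
    funext j
    rw [show ((m + 1 : ℕ) : ℤ) = (m : ℤ) + 1 by push_cast; ring, col_add_one, add_assoc]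

/-- The sequence in which the first `m + k` terms are rotated by `m` steps. -/
def rotSeq (m k : ℕ) (ζ : ℕ → ℂ) (j : ℕ) : ℂ := if j < k then ζ (m + j) else ζ (j - k)

theorem rotSeq_of_lt {m k j : ℕ} (ζ : ℕ → ℂ) (h : j < k) : rotSeq m k ζ j = ζ (m + j) := if_pos h

theorem rotSeq_add (m k j : ℕ) (ζ : ℕ → ℂ) : rotSeq m k ζ (k + j) = ζ j := by
  rw [rotSeq, if_neg (by omega), Nat.add_sub_cancel_left]

/-- Rotation by m takes the nests at 0 and k to nests at m and k + m, and the latter is the nest at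
0. The colours are now interchanged, which `Good.swap_colour` repairs. -/
theorem Good.evalv_rotSeq (h : Good Ψ) {m k : ℕ} (hmk : m + k = N) (ζ : ℕ → ℂ) :
    evalv Ψ (fun j => rotSeq m k ζ j) (mnc N k) = evalv Ψ (fun j => ζ j) (mnc N m) := by
  have h1 := h.rot_nested 0 (k : ℤ) m (fun j : Fin N => ζ j)
  have e1 : nested N ((k : ℤ) + m) = nested N 0 :=
    LinkPattern.nested_congr ⟨1, by rw [← hmk]; push_cast; ring⟩
  rw [e1, zero_add] at h1
  have e2 : evalv Ψ (fun j : Fin N => ζ j) (nested N m, nested N 0) =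
      evalv Ψ (fun j => ζ j) (mnc N m) := congrArg (eval _) (h.swap_colour (mnc N m))
  rw [← e2, h1]
  have e3 : (fun j : Fin N => rotSeq m k ζ j) =
      fun j : Fin N => ζ ((j + col (m : ℤ) : Fin N) : ℕ) := by
    funext j
    have hj := j.2
    rw [← col_val j]
    rw [← col_add_nat, ← Nat.cast_add, col_val, rotSeq]
    split_ifs with h5
    · rw [col_nat (by omega), add_comm]
    · rw [show ((j + m : ℕ) : ℤ) = ((j - k : ℕ) : ℤ) + N * 1 by omega, col_add_mul,
        col_nat (by omega)]
  rw [e3]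
  rfl

theorem crossProd_comm (m k : ℕ) (ζ η : ℕ → ℂ) : crossProd m k ζ η = crossProd k m η ζ := by
  rw [crossProd, crossProd, Finset.prod_comm]
  exact Finset.prod_congr rfl fun _ _ => Finset.prod_congr rfl fun _ _ => by ring

theorem eval_trivialFactor_rotSeq {m k : ℕ} (hmk : m + k = N) (ζ : ℕ → ℂ) :
    eval (fun j : Fin N => rotSeq m k ζ j) (trivialFactor N k) =
      eval (fun j : Fin N => ζ j) (trivialFactor N m) := by
  have e : ∀ j < k, rotSeq m k ζ j = ζ (m + j) := fun j hj => rotSeq_of_lt ζ hj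
  rw [eval_trivialFactor_of_eq hmk, eval_trivialFactor_of_eq (by omega : k + m = N),
    crossProd_comm m k]
  simp only [rotSeq_add]
  rw [pairProd_congr e]
  have e2 : crossProd k m (rotSeq m k ζ) ζ = crossProd k m (fun j => ζ (m + j)) ζ :=
    Finset.prod_congr rfl fun i hi => by rw [e i (Finset.mem_range.1 hi)]
  have e3 : crossProd k m (rotSeq m k ζ) (fun j => ζ j) = crossProd k m (fun j => ζ (m + j)) ζ := e2
  rw [e3, mul_comm (pairProd k _)]

theorem isPoly_rotSeq (m k j : ℕ) : IsPoly fun z : Fin N → ℂ => rotSeq m k (natExt z) j := by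
  unfold rotSeq
  exact IsPoly.ite _ (isPoly_natExt _) (isPoly_natExt _)

/-- The two maximally nested components of kind `(m, k)` and `(k, m)` agree up to a rotation. -/
theorem Good.factor_rotSeq (h : Good Ψ) {m k : ℕ} (hmk : m + k = N)
    {F F' : MvPolynomial (Fin N) ℂ} (hF : Ψ (mnc N m) = trivialFactor N m * F)
    (hF' : Ψ (mnc N k) = trivialFactor N k * F') (ζ : ℕ → ℂ) :
    eval (fun j : Fin N => rotSeq m k ζ j) F' = eval (fun j : Fin N => ζ j) F := by
  have i1 : IsPoly fun z : Fin N → ℂ => eval (fun j : Fin N => rotSeq m k (natExt z) j) F' :=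
    (IsPoly.eval F').comp fun j => isPoly_rotSeq m k j
  have key := IsPoly.eq_of_mul (trivialFactor_ne_zero N m) i1 (IsPoly.eval F) (fun z => by
    have e := h.evalv_rotSeq hmk (natExt z)
    rw [evalv, evalv, hF, hF', map_mul, map_mul, eval_trivialFactor_rotSeq hmk, natExt_val] at e
    exact e) fun j => ζ j
  rw [← key]
  congr 2
  funext j
  have := j.2
  rw [rotSeq, rotSeq]
  split_ifs <;> rw [natExt_apply ζ (by omega)]

theorem comp_swap_of_adjacent {α : Type*} {m : ℕ} {f : (ℕ → ℂ) → α}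
    (hf : ∀ l ζ, l + 1 < m → f (ζ ∘ Equiv.swap l (l + 1)) = f ζ) {a b : ℕ} (hab : a < b)
    (hb : b < m) (ζ : ℕ → ℂ) : f (ζ ∘ Equiv.swap a b) = f ζ := by
  obtain ⟨d, rfl⟩ : ∃ d, b = a + 1 + d := ⟨b - (a + 1), by omega⟩
  clear hab
  induction d generalizing ζ with
  | zero => exact hf a ζ hb
  | succ d ih =>
    have e : ζ ∘ Equiv.swap a (a + 1 + (d + 1)) = ((ζ ∘ Equiv.swap (a + 1 + d) (a + 1 + d + 1)) ∘
        Equiv.swap a (a + 1 + d)) ∘ Equiv.swap (a + 1 + d) (a + 1 + d + 1) := by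
      funext j
      simp only [Function.comp, Equiv.swap_apply_def]
      congr 1
      split_ifs <;> omega
    rw [e, hf _ _ (by omega), ih _ (by omega), hf _ _ (by omega)]

/-- Points with z_b = 0 may be left out, since the linear form is prime and does not divide X_b. The
recursions are available only for nonzero x. -/
theorem eval_eq_zero_of_linear {σ : Type*} [Fintype σ] [DecidableEq σ] {a b : σ} (hab : a ≠ b)
    {E : MvPolynomial σ ℂ}
    (h : ∀ z, z a = -q * z b → z b ≠ 0 → eval z E = 0) : X a + C q * X b ∣ E := by
  have hd : X a + C q * X b ∣ X b * E := (X_add_dvd_iff hab).2 fun z hz => by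
    rw [map_mul, eval_X]
    by_cases hb : z b = 0
    · rw [hb, zero_mul]
    · rw [h z hz hb, mul_zero]
  refine ((X_add_prime hab q).dvd_or_dvd hd).resolve_left fun h1 => ?_
  have := (X_add_dvd_iff hab).1 h1 (fun c => if c = a then -q else 1) (by simp [hab.symm])
  simp [hab.symm] at this

/-- A polynomial that is symmetric in the first `m` variables and of small degree vanishes if it
vanishes at the points with `z_{m - 1} = -q z_0`. -/
theorem eq_zero_of_arcPt {m : ℕ} (hm : 2 ≤ m) (hmN : m ≤ N) {E : MvPolynomial (Fin N) ℂ}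
    (hs : ∀ l ζ, l + 1 < m → eval (fun j : Fin N => (ζ ∘ Equiv.swap l (l + 1)) j) E =
      eval (fun j : Fin N => ζ j) E)
    (h : ∀ x ζ, x ≠ 0 → eval (fun j : Fin N => arcPt x (m - 1) ζ j) E = 0)
    (hd : degreeOf (0 : Fin N) E < 2 * (m - 1)) : E = 0 := by
  by_contra hE
  have hN : 0 < N := by omega
  have h0 : ((0 : Fin N) : ℕ) = 0 := rfl
  -- Every sequence with ζ (m - 1) = -q ζ 0 is an `arcPt` with x = ζ 0, after these two terms are
  -- removed from it.
  have key : ∀ ζ : ℕ → ℂ, ζ (m - 1) = -q * ζ 0 → ζ 0 ≠ 0 → eval (fun j : Fin N => ζ j) E = 0 := by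
    intro ζ h1 h2
    rw [← h (ζ 0) (fun j => if j + 2 < m then ζ (j + 1) else ζ (j + 2)) h2]
    congr 2
    funext j
    rw [arcPt]
    split_ifs with h3 h4 h5 h6 h7
    · rw [h3]
    · congr 1; omega
    · omega
    · rw [← h1, h6]
    · omega
    · congr 1; omega
  have swap : ∀ (ζ : ℕ → ℂ) (a b : ℕ), a < b → b < m →
      eval (fun j : Fin N => (ζ ∘ Equiv.swap a b) j) E = eval (fun j : Fin N => ζ j) E :=
    fun ζ a b h1 h2 => comp_swap_of_adjacent
      (f := fun ζ : ℕ → ℂ => eval (fun j : Fin N => ζ j) E) (fun l ζ hl => hs l ζ hl) h1 h2 ζ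
  have v1 : ∀ (ζ : ℕ → ℂ) (b : ℕ), 0 < b → b < m → ζ b = -q * ζ 0 → ζ 0 ≠ 0 →
      eval (fun j : Fin N => ζ j) E = 0 := by
    intro ζ b hb hbm h1 h2
    rcases Nat.lt_or_ge b (m - 1) with h3 | h3
    · rw [← swap ζ b (m - 1) h3 (by omega)]
      have e0 : (ζ ∘ Equiv.swap b (m - 1)) 0 = ζ 0 := by
        rw [Function.comp, Equiv.swap_apply_of_ne_of_ne (by omega) (by omega)]
      refine key _ ?_ (by rwa [e0])
      rw [e0, Function.comp, Equiv.swap_apply_right, h1]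
    · exact key ζ (by rwa [show m - 1 = b by omega]) h2
  have v2 : ∀ (ζ : ℕ → ℂ) (b : ℕ), 0 < b → b < m → ζ 0 = -q * ζ b → ζ b ≠ 0 →
      eval (fun j : Fin N => ζ j) E = 0 := by
    intro ζ b hb hbm h1 h2
    rw [← swap ζ 0 b hb hbm]
    refine v1 _ b hb hbm ?_ ?_
    · simp [h1]
    · simpa using h2
  let s : Finset (Fin N) := Finset.univ.filter fun b => 0 < (b : ℕ) ∧ (b : ℕ) < m
  have hs0 : ∀ b ∈ s, (0 : Fin N) < b ∧ (b : ℕ) < m := fun b hb => by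
    rw [Finset.mem_filter] at hb
    exact ⟨hb.2.1, hb.2.2⟩
  -- By symmetry E vanishes on both hyperplanes z_b = -q z_0 and z_0 = -q z_b for all 0 < b < m.
  -- These are 2 (m - 1) coprime linear factors that contain z_0, too many for the degree of E.
  have hdvd : ∏ b ∈ s, ((X 0 + C q * X b) * (X b + C q * X 0)) ∣ E := by
    refine Finset.prod_dvd_of_isRelPrime ?_ fun b hb => ?_
    · intro b hb b' hb' hne
      exact isRelPrime_pairs (hs0 b hb).1 (hs0 b' hb').1 fun e => hne (Prod.mk.inj e).2
    · obtain ⟨hb0, hbm⟩ := hs0 b hb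
      refine IsRelPrime.mul_dvd (isRelPrime_of_prime (X_add_prime hb0.ne q)
        (not_X_add_dvd hb0.ne hb0.ne' fun e => hb0.ne (Prod.mk.inj e).1))
        (eval_eq_zero_of_linear hb0.ne fun z h1 h2 => ?_)
        (eval_eq_zero_of_linear hb0.ne' fun z h1 h2 => ?_)
      · obtain ⟨ζ, rfl⟩ := exists_nat_ext z
        exact v2 ζ b hb0 hbm h1 h2
      · obtain ⟨ζ, rfl⟩ := exists_nat_ext z
        exact v1 ζ b hb0 hbm h1 h2
  obtain ⟨R, rfl⟩ := hdvd
  have hp := left_ne_zero_of_mul hE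
  rw [degreeOf_mul_eq hp (right_ne_zero_of_mul hE)] at hd
  have h2 : ∀ b ∈ s, 2 ≤ degreeOf (0 : Fin N)
      ((X 0 + C q * X b) * (X b + C q * X 0) : MvPolynomial (Fin N) ℂ) := by
    intro b hb
    obtain ⟨hb0, hbm⟩ := hs0 b hb
    rw [degreeOf_mul_eq (X_add_prime hb0.ne q).ne_zero (X_add_prime hb0.ne' q).ne_zero]
    have d1 : 1 ≤ degreeOf (0 : Fin N) (X 0 + C q * X b : MvPolynomial (Fin N) ℂ) :=
      one_le_degreeOf (z := 0) (t := 1) (by simp [hb0.ne'])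
    have d2 : 1 ≤ degreeOf (0 : Fin N) (X b + C q * X 0 : MvPolynomial (Fin N) ℂ) :=
      one_le_degreeOf (z := 0) (t := 1) (by simp [hb0.ne', q_ne_zero])
    omega
  have h3 := (Finset.sum_le_sum h2).trans (sum_degreeOf_le (c := 0) hp subset_rfl)
  have h4 : s.card = m - 1 := by
    have : s = (Finset.Ico 1 m).attachFin fun n hn => (Finset.mem_Ico.1 hn).2.trans_le hmN := by
      ext b
      simp [s, Finset.mem_attachFin, Nat.one_le_iff_ne_zero, Nat.pos_iff_ne_zero]
    rw [this, Finset.card_attachFin, Nat.card_Ico]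
  rw [Finset.sum_const, h4, smul_eq_mul] at h3
  omega

/-- The variable z_0 meets the m - 1 other points of its own side in one factor each and the k
points of the other side in two. -/
theorem le_degreeOf_trivialFactor {m k : ℕ} (hm : 1 ≤ m) (hmk : m + k = N) :
    m - 1 + 2 * k ≤ degreeOf (0 : Fin N) (trivialFactor N m) := by
  have h0 := trivialFactor_ne_zero N m
  have h1 := Finset.prod_ne_zero_iff.1 h0 0 (Finset.mem_univ _)
  have h2 := sum_degreeOf_le (c := 0) h0 (Finset.singleton_subset_iff.2
    (Finset.mem_univ (0 : Fin N)))
  rw [Finset.sum_singleton] at h2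
  refine le_trans ?_ h2
  refine le_trans ?_ (sum_degreeOf_le (c := 0) h1 subset_rfl)
  have h3 : ∀ j ∈ Finset.Ioi (0 : Fin N), (if (j : ℕ) < m then 1 else 2) ≤
      degreeOf (0 : Fin N) (if ((0 : Fin N) : ℕ) < m ∧ m ≤ (j : ℕ) then
        C q⁻¹ * (X 0 + C q * X j) * (X j + C q * X 0) else X 0 + C q * X j :
          MvPolynomial (Fin N) ℂ) := fun j hj => by
    have hj := Finset.mem_Ioi.1 hj
    have d1 : 1 ≤ degreeOf (0 : Fin N) (X 0 + C q * X j : MvPolynomial (Fin N) ℂ) :=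
      one_le_degreeOf (z := 0) (t := 1) (by simp [hj.ne'])
    have d2 : 1 ≤ degreeOf (0 : Fin N) (X j + C q * X 0 : MvPolynomial (Fin N) ℂ) :=
      one_le_degreeOf (z := 0) (t := 1) (by simp [hj.ne', q_ne_zero])
    by_cases hjm : (j : ℕ) < m
    · rw [if_pos hjm, if_neg (by omega)]
      exact d1
    · have hC : (C q⁻¹ : MvPolynomial (Fin N) ℂ) ≠ 0 := by
        rw [Ne, C_eq_zero]
        exact inv_ne_zero q_ne_zero
      rw [if_neg hjm, if_pos ⟨hm, not_lt.1 hjm⟩, degreeOf_mul_eq (mul_ne_zero hC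
        (X_add_prime hj.ne q).ne_zero) (X_add_prime hj.ne' q).ne_zero,
        degreeOf_mul_eq hC (X_add_prime hj.ne q).ne_zero]
      omega
  refine le_trans (le_of_eq ?_) (Finset.sum_le_sum h3)
  have h4 : ∑ j : Fin N, (if (j : ℕ) < m then 1 else 2) = m + 2 * k := by
    rw [Fin.sum_univ_eq_sum_range (fun j => if j < m then 1 else 2), ← hmk,
      Finset.sum_range_add]
    rw [Finset.sum_congr rfl fun j hj => if_pos (Finset.mem_range.1 hj)]
    simp [mul_comm]
  have h5 : Finset.Ioi (0 : Fin N) = Finset.univ.erase 0 := by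
    ext j
    simp [Fin.pos_iff_ne_zero]
  have h6 := Finset.add_sum_erase Finset.univ (fun j : Fin N => if (j : ℕ) < m then 1 else 2)
    (Finset.mem_univ 0)
  rw [h4] at h6
  rw [h5]
  have h7 : ((0 : Fin N) : ℕ) < m := hm
  simp only [h7, if_true] at h6
  omega

/-- The degree of the nontrivial factor. -/
theorem degreeOf_factor_le {m k : ℕ} (hm : 1 ≤ m) (hmk : m + k = N) {P F : MvPolynomial (Fin N) ℂ}
    (hP : P = trivialFactor N m * F) (hd : degreeOf 0 P ≤ 2 * (N - 1)) :
    degreeOf (0 : Fin N) F ≤ m - 1 := by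
  by_cases hF : F = 0
  · simp [hF]
  · rw [hP, degreeOf_mul_eq (trivialFactor_ne_zero N m) hF] at hd
    have := le_degreeOf_trivialFactor hm hmk
    omega

/-! ### The nontrivial factors for small sizes -/

theorem exists_eval_update {σ : Type*} [Fintype σ] [DecidableEq σ] (p : MvPolynomial σ ℂ) (c : σ)
    (z : σ → ℂ) : ∃ P : Polynomial ℂ, P.natDegree ≤ degreeOf c p ∧
      ∀ t, eval (Function.update z c t) p = P.eval t := by
  refine ⟨∑ d ∈ p.support, Polynomial.C (p.coeff d * ∏ j ∈ Finset.univ.erase c, z j ^ d j) *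
    Polynomial.X ^ d c, ?_, fun t => ?_⟩
  · refine Polynomial.natDegree_sum_le_of_forall_le _ _ fun d hd => ?_
    exact (Polynomial.natDegree_C_mul_X_pow_le _ _).trans (monomial_le_degreeOf c hd)
  · rw [eval_eq', Polynomial.eval_finsetSum]
    refine Finset.sum_congr rfl fun d _ => ?_
    rw [← Finset.mul_prod_erase _ _ (Finset.mem_univ c), Function.update_self,
      Finset.prod_congr rfl fun j hj => by
        rw [Function.update_of_ne (Finset.ne_of_mem_erase hj)]]
    rw [Polynomial.eval_mul, Polynomial.eval_C, Polynomial.eval_pow, Polynomial.eval_X]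
    ring

theorem eval_update_of_degreeOf_zero {σ : Type*} [Fintype σ] [DecidableEq σ]
    {p : MvPolynomial σ ℂ} {c : σ} (h : degreeOf c p ≤ 0) (z : σ → ℂ) (t : ℂ) :
    eval (Function.update z c t) p = eval z p := by
  obtain ⟨P, h1, h2⟩ := exists_eval_update p c z
  have h3 := h2 (z c)
  rw [Function.update_eq_self] at h3
  rw [h2, h3, Polynomial.eq_C_of_natDegree_le_zero (h1.trans h)]
  simp

theorem eval_update_of_degreeOf_one {σ : Type*} [Fintype σ] [DecidableEq σ]
    {p : MvPolynomial σ ℂ} {c : σ} (h : degreeOf c p ≤ 1) (z : σ → ℂ) (t : ℂ) :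
    eval (Function.update z c t) p = eval (Function.update z c 0) p +
      t * (eval (Function.update z c 1) p - eval (Function.update z c 0) p) := by
  obtain ⟨P, h1, h2⟩ := exists_eval_update p c z
  rw [h2, h2, h2, Polynomial.eq_X_add_C_of_natDegree_le_one (h1.trans h)]
  simp
  ring

variable {N : ℕ} [NeZero N] {Ψ : State N → MvPolynomial (Fin N) ℂ}

/-- The exchange relation for link patterns with one arc, between components that lie in the image
of a face for one colour only. -/
theorem Good.exch_of_half_eq_one (h : Good Ψ) (hN : N / 2 = 1) {i : ℕ} (hi : i + 1 < N)
    (ζ : ℕ → ℂ) :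
    scal (ζ i) (ζ (i + 1)) *
        evalv Ψ (fun j => (ζ ∘ Equiv.swap i (i + 1)) j) (mnc N (i + 1)) =
      omegaD (ζ (i + 1)) (ζ i) * evalv Ψ (fun j => ζ j) (mnc N (i + 1)) +
      omegaRL (ζ (i + 1)) (ζ i) * ∑ G, evalv Ψ (fun j => ζ j) (nested N 0, G) := by
  have hN2 : 2 ≤ N := by omega
  have e0 : ((col (i : ℤ) : Fin N) : ℕ) = i := by rw [col_nat (by omega)]
  have e1 : ((col ((i : ℤ) + 1) : Fin N) : ℕ) = i + 1 := by
    rw [← Nat.cast_succ, col_nat (by omega)]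
  have hx := h.exch_sum (i : ℤ) (by omega) hN2 (fun j : Fin N => ζ j) (mnc N (i + 1))
  rw [Fintype.sum_prod_type] at hx
  simp only [Fintype.sum_bool] at hx
  have hs : (mnc N (i + 1)).1.partner (i : ℤ) ≠ i + 1 := nested_partner_ne (by omega) (by omega)
  -- With a single arc, e_i maps every green pattern to the same nest. The sum therefore runs over
  -- all green patterns and does not depend on i.
  have ev : push (faceState (i : ℤ) (false, true)) (evalv Ψ fun j => ζ j) (mnc N (i + 1)) =
      ∑ G, evalv Ψ (fun j => ζ j) (nested N 0, G) := by
    rw [push_apply, Fintype.sum_prod_type, Finset.sum_eq_single (nested N 0)]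
    · refine Finset.sum_congr rfl fun G _ => if_pos ?_
      have := LinkPattern.tl_eq_nested hN (i : ℤ) G
      simp [faceState, this, mnc]
    · refine fun R _ hR => Finset.sum_eq_zero fun G _ => if_neg fun hc => hR ?_
      exact congrArg Prod.fst hc
    · exact fun hc => absurd (Finset.mem_univ _) hc
  rw [push_faceState_true_fst _ hN2 hs, push_faceState_true_fst _ hN2 hs, push_faceState_false, ev,
    comp_swap_col hi, e0, e1] at hx
  rw [hx]
  simp [xw, faceWeight]
  ring

theorem q_inv : q⁻¹ = q ^ 2 :=
  inv_eq_of_mul_eq_one_right (by linear_combination q_pow_three)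

/-- The factor `κ` of the theorem. -/
noncomputable def kap (m k : ℕ) : ℂ := if Odd m ∧ Odd k then 1 / 3 else 1

theorem kap_comm (m k : ℕ) : kap m k = kap k m := by simp only [kap, and_comm]

theorem kap_add_two (m k : ℕ) : kap (m + 2) k = kap m k := by
  rw [kap, kap]
  congr 2
  simp [Nat.odd_add, even_two]

/-- The factorization of the maximally nested components. -/
def Factorizes (Ψ : State N → MvPolynomial (Fin N) ℂ) (c : ℂ) : Prop :=
  ∀ m k, m + k = N → ∀ F, Ψ (mnc N m) = trivialFactor N m * F → ∀ ζ : ℕ → ℂ,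
    eval (fun j : Fin N => ζ j) F = c * kap m k * pv m ζ * pv k fun j => ζ (m + j)

theorem pv_rotSeq (m k : ℕ) (ζ : ℕ → ℂ) : pv k (rotSeq m k ζ) = pv k fun j => ζ (m + j) :=
  pv_congr fun _ hi => rotSeq_of_lt ζ hi

/-- It suffices to know the factorization for one of the two components that are related by a
rotation. -/
theorem Good.factor_of_rotSeq (h : Good Ψ) {m k : ℕ} (hmk : m + k = N) {c : ℂ}
    (hk : ∀ F, Ψ (mnc N k) = trivialFactor N k * F → ∀ ζ : ℕ → ℂ,
      eval (fun j : Fin N => ζ j) F = c * kap k m * pv k ζ * pv m fun j => ζ (k + j))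
    {F : MvPolynomial (Fin N) ℂ} (hF : Ψ (mnc N m) = trivialFactor N m * F) (ζ : ℕ → ℂ) :
    eval (fun j : Fin N => ζ j) F = c * kap m k * pv m ζ * pv k fun j => ζ (m + j) := by
  obtain ⟨F', hF'⟩ := h.trivialFactor_dvd (m := k) (by omega)
  rw [← h.factor_rotSeq hmk hF hF', hk F' hF', pv_rotSeq, kap_comm]
  simp only [rotSeq_add]
  ring

theorem Good.exists_factorizes_one {Ψ : State 1 → MvPolynomial (Fin 1) ℂ}
    (hd : ∀ s i, degreeOf i (Ψ s) ≤ 2 * (1 - 1)) : ∃ c, Factorizes Ψ c := by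
  have hc : ∀ s (z : Fin 1 → ℂ), eval z (Ψ s) = eval 0 (Ψ s) := fun s z => by
    rw [← eval_update_of_degreeOf_zero (hd s 0) z 0]
    congr 2
    funext j
    simp [Subsingleton.elim j 0]
  have ht : ∀ m, trivialFactor 1 m = 1 := fun m => by
    simp [trivialFactor]
  refine ⟨eval 0 (Ψ (mnc 1 0)), fun m k hmk F hF ζ => ?_⟩
  rw [ht, one_mul] at hF
  have h1 : mnc 1 m = mnc 1 0 := by
    rw [mnc, mnc, LinkPattern.nested_congr (c := (m : ℤ)) (c' := ((0 : ℕ) : ℤ)) ⟨m, by simp⟩]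
  have h2 : kap m k = 1 := if_neg fun h => by
    obtain ⟨⟨a, ha⟩, b, hb⟩ := h
    omega
  rw [← hF, h1, hc, h2]
  obtain ⟨rfl, rfl⟩ | ⟨rfl, rfl⟩ : (m = 0 ∧ k = 1) ∨ (m = 1 ∧ k = 0) := by omega
  · simp [pv_zero, pv_one]
  · simp [pv_zero, pv_one]

/-- The factor of kind (1, 1) does not involve z_0, hence by rotation it is a constant a. The
exchange relation between the kinds (1, 1) and (0, 2) then forces the factor of kind (0, 2) to be -q
a (z_0 + z_1). -/
theorem Good.exists_factorizes_two {Ψ : State 2 → MvPolynomial (Fin 2) ℂ} (h : Good Ψ)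
    (hd : ∀ s i, degreeOf i (Ψ s) ≤ 2 * (2 - 1)) : ∃ c, Factorizes Ψ c := by
  obtain ⟨F1, hF1⟩ := h.trivialFactor_dvd (m := 1) (by omega)
  obtain ⟨F0, hF0⟩ := h.trivialFactor_dvd (m := 0) (by omega)
  have d0 : degreeOf (0 : Fin 2) F1 ≤ 0 := degreeOf_factor_le (m := 1) (k := 1) le_rfl rfl hF1
    (hd _ _)
  obtain ⟨a, ha⟩ : ∃ a, ∀ ζ : ℕ → ℂ, eval (fun j : Fin 2 => ζ j) F1 = a := by
    have e1 : ∀ ζ η : ℕ → ℂ, ζ 1 = η 1 →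
        eval (fun j : Fin 2 => ζ j) F1 = eval (fun j : Fin 2 => η j) F1 := fun ζ η h1 => by
      rw [← eval_update_of_degreeOf_zero d0 (fun j : Fin 2 => ζ j) (η 0)]
      congr 2
      funext j
      fin_cases j <;> simp [h1]
    refine ⟨eval (fun j : Fin 2 => (0 : ℕ → ℂ) j) F1, fun ζ => ?_⟩
    obtain ⟨η, h0, h1⟩ : ∃ η : ℕ → ℂ, η 0 = 0 ∧ η 1 = ζ 1 := ⟨Function.update ζ 0 0, by simp⟩
    rw [e1 ζ η h1.symm, ← h.factor_rotSeq (m := 1) (k := 1) rfl hF1 hF1 η]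
    exact e1 _ _ (by rw [rotSeq, if_neg (by omega)]; exact h0)
  have t1 : ∀ ζ : ℕ → ℂ, evalv Ψ (fun j => ζ j) (mnc 2 1) =
      q ^ 2 * (ζ 0 + q * ζ 1) * (ζ 1 + q * ζ 0) * a := fun ζ => by
    rw [evalv, hF1, map_mul, ha, eval_trivialFactor_of_eq (k := 1) rfl]
    simp [pairProd, crossProd, q_inv]
  have t0 : ∀ ζ : ℕ → ℂ, evalv Ψ (fun j => ζ j) (mnc 2 0) =
      (ζ 0 + q * ζ 1) * eval (fun j : Fin 2 => ζ j) F0 := fun ζ => by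
    rw [evalv, hF0, map_mul, eval_trivialFactor_of_eq (k := 2) rfl]
    simp [pairProd, crossProd, Finset.prod_range_succ]
  have key : ∀ z : Fin 2 → ℂ, eval z F0 = eval z (C (-q * a) * (X 0 + X 1)) := by
    refine IsPoly.eq_of_mul (p := (X 0 - X 1) * ((X 1 + C q * X 0) * (X 0 + C q * X 1)))
      (mul_ne_zero (X_sub_X_prime (by decide)).ne_zero (mul_ne_zero
        (X_add_prime (by decide) q).ne_zero (X_add_prime (by decide) q).ne_zero)) (IsPoly.eval _)
      (IsPoly.eval _) fun z => ?_
    obtain ⟨ζ, rfl⟩ := exists_nat_ext z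
    have hx := h.exch_of_half_eq_one (by norm_num) (i := 0) (by norm_num) ζ
    have hG : ∑ G, evalv Ψ (fun j => ζ j) (nested 2 0, G) =
        evalv Ψ (fun j => ζ j) (mnc 2 0) + evalv Ψ (fun j => ζ j) (mnc 2 1) := by
      classical
      rw [show (Finset.univ : Finset (LinkPattern 2)) = {nested 2 0, nested 2 1} from
        (Finset.eq_univ_of_forall fun σ => by simpa using LinkPattern.eq_nested_two σ).symm,
        Finset.sum_pair LinkPattern.nested_two_ne]
      rfl
    rw [hG, t0, t1, t1] at hx
    simp only [Function.comp, scal, omegaD, omegaRL, Equiv.swap_apply_left,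
      Equiv.swap_apply_right, zero_add] at hx
    simp only [map_mul, map_add, map_sub, map_neg, eval_X, eval_C, Fin.val_zero, Fin.val_one]
    have h3 := q_pow_three
    generalize eval (fun j : Fin 2 => ζ j) F0 = f at *
    grind
  have f0 : ∀ F, Ψ (mnc 2 0) = trivialFactor 2 0 * F → ∀ ζ : ℕ → ℂ,
      eval (fun j : Fin 2 => ζ j) F = 3 * a * kap 0 2 * pv 0 ζ * pv 2 fun j => ζ (0 + j) := by
    intro F hF ζ
    obtain rfl := mul_left_cancel₀ (trivialFactor_ne_zero 2 0) (hF0.symm.trans hF)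
    rw [key, pv_zero, pv_two, kap, if_neg (by simp)]
    simp
    ring
  -- P_2 is -(q / 3) (z_0 + z_1), whence the constant 3 a; in kind (1, 1) this is compensated by κ =
  -- 1 / 3.
  refine ⟨3 * a, fun m k hmk F hF ζ => ?_⟩
  obtain ⟨rfl, rfl⟩ | ⟨rfl, rfl⟩ | ⟨rfl, rfl⟩ :
    (m = 0 ∧ k = 2) ∨ (m = 1 ∧ k = 1) ∨ (m = 2 ∧ k = 0) := by omega
  · exact f0 F hF ζ
  · obtain rfl := mul_left_cancel₀ (trivialFactor_ne_zero 2 1) (hF1.symm.trans hF)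
    rw [ha, pv_one, pv_one, kap, if_pos (by simp)]
    ring
  · exact h.factor_of_rotSeq rfl f0 hF ζ

/-- For three points, the factor of kind `(2, 1)` is proportional to `z_0 + z_1`. -/
theorem Good.exists_factor_three {Ψ : State 3 → MvPolynomial (Fin 3) ℂ} (h : Good Ψ)
    (hd : ∀ s i, degreeOf i (Ψ s) ≤ 2 * (3 - 1)) {F : MvPolynomial (Fin 3) ℂ}
    (hF : Ψ (mnc 3 2) = trivialFactor 3 2 * F) :
    ∃ b, ∀ ζ : ℕ → ℂ, eval (fun j : Fin 3 => ζ j) F = b * (ζ 0 + ζ 1) := by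
  obtain ⟨F1, hF1⟩ := h.trivialFactor_dvd (m := 1) (by omega)
  have d1 : degreeOf (0 : Fin 3) F1 ≤ 0 := degreeOf_factor_le (m := 1) (k := 2) le_rfl rfl hF1
    (hd _ _)
  have d2 : degreeOf (0 : Fin 3) F ≤ 1 := degreeOf_factor_le (m := 2) (k := 1) (by omega) rfl hF
    (hd _ _)
  -- One function of two variables describes both factors: that of kind (1, 2) does not involve z_0,
  -- and rotation identifies the two. It is symmetric and of degree at most one in each variable.
  let f : ℂ → ℂ → ℂ := fun u v => eval (fun j : Fin 3 => if (j : ℕ) = 0 then u else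
    if (j : ℕ) = 1 then v else 0) F
  have r1 : ∀ ζ : ℕ → ℂ, eval (fun j : Fin 3 => ζ j) F1 = f (ζ 1) (ζ 2) := fun ζ => by
    rw [← eval_update_of_degreeOf_zero d1 _ 0]
    have e := h.factor_rotSeq (m := 1) (k := 2) rfl hF1 hF (Function.update ζ 0 0)
    rw [show Function.update (fun j : Fin 3 => ζ j) 0 0 =
      fun j : Fin 3 => Function.update ζ 0 0 j by funext j; fin_cases j <;> simp, ← e]
    simp only [f]
    congr 2
    funext j
    fin_cases j <;> simp [rotSeq]
  have r2 : ∀ ζ : ℕ → ℂ, eval (fun j : Fin 3 => ζ j) F = f (ζ 0) (ζ 1) := fun ζ => by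
    rw [← h.factor_rotSeq (m := 2) (k := 1) rfl hF hF1, r1]
    simp [rotSeq]
  have f1 : ∀ u v, f u v = f 0 v + u * (f 1 v - f 0 v) := fun u v => by
    have e := eval_update_of_degreeOf_one d2
      (fun j : Fin 3 => if (j : ℕ) = 0 then u else if (j : ℕ) = 1 then v else 0) u
    have e2 : ∀ t, Function.update (fun j : Fin 3 => if (j : ℕ) = 0 then u else
        if (j : ℕ) = 1 then v else 0) 0 t = fun j : Fin 3 => if (j : ℕ) = 0 then t else
          if (j : ℕ) = 1 then v else 0 := fun t => by
      funext j
      fin_cases j <;> simp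
    rw [e2, e2, e2] at e
    exact e
  have f2 : ∀ u v, f u v = f v u := fun u v => by
    obtain ⟨ζ, h0, h1⟩ : ∃ ζ : ℕ → ℂ, ζ 0 = v ∧ ζ 1 = u :=
      ⟨fun j => if j = 0 then v else u, by simp⟩
    have e := h.factor_swap (m := 2) (k := 1) (l := 0) rfl hF (by omega) ζ
    rw [r2 ζ, r2 (ζ ∘ _), Function.comp, Function.comp, Equiv.swap_apply_left,
      zero_add, Equiv.swap_apply_right, h0, h1] at e
    exact e
  have hform : ∀ u v, f u v = f 0 0 + (f 1 0 - f 0 0) * (u + v) +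
      (f 1 1 - 2 * f 1 0 + f 0 0) * (u * v) := fun u v => by
    rw [f1 u v, f2 0 v, f1 v 0, f2 1 v, f1 v 1, f2 0 1]
    ring
  have t1 : ∀ ζ : ℕ → ℂ, evalv Ψ (fun j => ζ j) (mnc 3 1) =
      q * ((ζ 0 + q * ζ 1) * (ζ 1 + q * ζ 0) * (ζ 0 + q * ζ 2) * (ζ 2 + q * ζ 0) *
        (ζ 1 + q * ζ 2) * f (ζ 1) (ζ 2)) := fun ζ => by
    rw [evalv, hF1, map_mul, r1, eval_trivialFactor_of_eq (k := 2) rfl]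
    simp [pairProd, crossProd, q_inv, Finset.prod_range_succ]
    linear_combination q * ((ζ 0 + q * ζ 1) * (ζ 1 + q * ζ 0) * (ζ 0 + q * ζ 2) * (ζ 2 + q * ζ 0) *
        (ζ 1 + q * ζ 2) * f (ζ 1) (ζ 2)) * q_pow_three
  have t2 : ∀ ζ : ℕ → ℂ, evalv Ψ (fun j => ζ j) (mnc 3 2) =
      q * ((ζ 0 + q * ζ 1) * (ζ 0 + q * ζ 2) * (ζ 2 + q * ζ 0) * (ζ 1 + q * ζ 2) *
        (ζ 2 + q * ζ 1) * f (ζ 0) (ζ 1)) := fun ζ => by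
    rw [evalv, hF, map_mul, r2, eval_trivialFactor_of_eq (k := 1) rfl]
    simp [pairProd, crossProd, q_inv, Finset.prod_range_succ]
    linear_combination q * ((ζ 0 + q * ζ 1) * (ζ 0 + q * ζ 2) * (ζ 2 + q * ζ 0) * (ζ 1 + q * ζ 2) *
        (ζ 2 + q * ζ 1) * f (ζ 0) (ζ 1)) * q_pow_three
  -- The unknown sum S is common to the exchanges at 0 and at 1, so it can be eliminated between
  -- them.
  have key : ∀ ζ : ℕ → ℂ, ∃ S,
      (q * ζ 0 ^ 2 - ζ 1 ^ 2) * evalv Ψ (fun j => (ζ ∘ Equiv.swap 0 1) j) (mnc 3 1) =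
        q * (ζ 0 - q * ζ 1) * (ζ 1 + q * ζ 0) * evalv Ψ (fun j => ζ j) (mnc 3 1) +
        (ζ 0 - ζ 1) * (ζ 1 + q * ζ 0) * S ∧
      (q * ζ 1 ^ 2 - ζ 2 ^ 2) * evalv Ψ (fun j => (ζ ∘ Equiv.swap 1 2) j) (mnc 3 2) =
        q * (ζ 1 - q * ζ 2) * (ζ 2 + q * ζ 1) * evalv Ψ (fun j => ζ j) (mnc 3 2) +
        (ζ 1 - ζ 2) * (ζ 2 + q * ζ 1) * S := fun ζ =>
    ⟨_, h.exch_of_half_eq_one (by norm_num) (i := 0) (by norm_num) ζ,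
      h.exch_of_half_eq_one (by norm_num) (i := 1) (by norm_num) ζ⟩
  simp only [t1, t2] at key
  simp only [Function.comp, Equiv.swap_apply_left, Equiv.swap_apply_right,
    show Equiv.swap (0 : ℕ) 1 2 = 2 from rfl, show Equiv.swap (1 : ℕ) 2 0 = 0 from rfl] at key
  have hq := q_sq
  -- Eliminating S at the points (1, 0, -1) and (1, -1, 0) isolates the constant and the bilinear
  -- coefficient of f.
  have a0 : f 0 0 = 0 := by
    obtain ⟨ζ, z0, z1, z2⟩ : ∃ ζ : ℕ → ℂ, ζ 0 = 1 ∧ ζ 1 = 0 ∧ ζ 2 = -1 :=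
      ⟨fun j => if j = 0 then 1 else if j = 1 then 0 else -1, by simp⟩
    obtain ⟨S, h1, h2⟩ := key ζ
    rw [z0, z1, z2] at h1 h2
    rw [hform 1 (-1), hform 0 (-1)] at h1
    rw [hform 1 (-1)] at h2
    generalize f 0 0 = A at *
    generalize f 1 0 = B at *
    generalize f 1 1 = D at *
    clear key t1 t2 hform f1 f2 r1 r2
    grind
  have c0 : f 1 1 - 2 * f 1 0 + f 0 0 = 0 := by
    obtain ⟨ζ, z0, z1, z2⟩ : ∃ ζ : ℕ → ℂ, ζ 0 = 1 ∧ ζ 1 = -1 ∧ ζ 2 = 0 :=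
      ⟨fun j => if j = 0 then 1 else if j = 1 then -1 else 0, by simp⟩
    obtain ⟨S, h1, h2⟩ := key ζ
    rw [z0, z1, z2] at h1 h2
    rw [hform (-1) 0] at h1
    rw [hform 1 (-1)] at h2
    generalize f 0 0 = A at *
    generalize f 1 0 = B at *
    generalize f 1 1 = D at *
    clear key t1 t2 hform f1 f2 r1 r2
    grind
  refine ⟨f 1 0, fun ζ => ?_⟩
  rw [r2, hform, c0, a0]
  ring

/-! ### The factorization of the maximally nested components -/

theorem degreeOf_aeval_le {σ τ : Type*} [Fintype σ] (c : τ) (g : σ → MvPolynomial τ ℂ)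
    (p : MvPolynomial σ ℂ) {D : ℕ} (h : ∀ d ∈ p.support, ∑ j, d j * degreeOf c (g j) ≤ D) :
    degreeOf c (aeval g p) ≤ D := by
  have e : aeval g p = ∑ d ∈ p.support, C (p.coeff d) * ∏ j, g j ^ d j := by
    rw [aeval_eq_eval₂Hom, coe_eval₂Hom, eval₂_eq']
    rfl
  rw [e]
  refine (degreeOf_sum_le _ _ _).trans (Finset.sup_le fun d hd => ?_)
  refine (degreeOf_C_mul_le _ _ _).trans ((degreeOf_prod_le _ _ _).trans (le_trans ?_ (h d hd)))
  exact Finset.sum_le_sum fun j _ => degreeOf_pow_le _ _ _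

theorem degreeOf_rename_eq_zero {σ τ : Type*} [Fintype σ] {c : τ} {f : σ → τ} (hf : ∀ j, f j ≠ c)
    (p : MvPolynomial σ ℂ) : degreeOf c (rename f p) = 0 := by
  classical
  have e : rename f = aeval (R := ℂ) (X ∘ f : σ → MvPolynomial τ ℂ) :=
    MvPolynomial.algHom_ext fun j => by rw [rename_X, aeval_X]; rfl
  rw [e]
  refine Nat.le_zero.1 (degreeOf_aeval_le c (X ∘ f) p fun d _ => le_of_eq ?_)
  exact Finset.sum_eq_zero fun j _ => by
    rw [Function.comp, degreeOf_X, if_neg (hf j).symm, mul_zero]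

variable {n : ℕ} [NeZero n] {Ψ : State (n + 2) → MvPolynomial (Fin (n + 2)) ℂ}

theorem degreeOf_restr_le {D : ℕ} (hd : ∀ s i, degreeOf i (Ψ s) ≤ D) (x : ℂ) (s : State n)
    (i : Fin n) : degreeOf i (restr Ψ x s) ≤ D := by
  have hi := i.2
  refine degreeOf_aeval_le _ _ _ fun d hm => ?_
  rw [Finset.sum_eq_single ⟨i + 1, by omega⟩]
  · refine (Nat.mul_le_of_le_div _ _ _ ?_).trans ((monomial_le_degreeOf ⟨i + 1, by omega⟩ hm).trans
      (hd _ _))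
    have : bsub x (⟨i + 1, by omega⟩ : Fin (n + 2)) = X i := by
      rw [bsub, if_neg (by simp), dif_pos (by simp)]
      rfl
    rw [this, degreeOf_X, if_pos rfl, Nat.div_one]
  · intro j _ hj
    rw [bsub]
    split_ifs with h1 h2
    · rw [degreeOf_C, mul_zero]
    · rw [degreeOf_X, if_neg, mul_zero]
      intro e
      apply hj
      ext
      have := congrArg Fin.val e
      simp at this ⊢
      omega
    · rw [degreeOf_C, mul_zero]
  · exact fun hc => absurd (Finset.mem_univ _) hc

theorem two_le_degreeOf_quadProd {x : ℂ} (hx : x ≠ 0) (i : Fin n) :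
    2 ≤ degreeOf i (quadProd n x) := by
  have h0 := quadProd_ne_zero (n := n) hx
  have h1 := sum_degreeOf_le (c := i) h0 (Finset.singleton_subset_iff.2 (Finset.mem_univ i))
  rw [Finset.sum_singleton, degreeOf_mul_eq (X_sub_C_prime _ _).ne_zero
    (X_sub_C_prime _ _).ne_zero] at h1
  have h2 : ∀ a : ℂ, 1 ≤ degreeOf i (X i - C a : MvPolynomial (Fin n) ℂ) := fun a =>
    one_le_degreeOf (z := 0) (t := 1) (by simp)
  have := h2 (q ^ 2 * x)
  have := h2 (-(q ^ 2 * x))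
  rw [quadProd]
  omega

/-- The square of `quadProd` has degree at least four in each variable, which turns the bound 2 (n +
1) into 2 (n - 1), the one needed for size n. -/
theorem degreeOf_le_of_restr_eq (hd : ∀ s i, degreeOf i (Ψ s) ≤ 2 * (n + 2 - 1)) {x : ℂ}
    (hx : x ≠ 0) {Φ : State n → MvPolynomial (Fin n) ℂ}
    (hΦ : ∀ s, restr Ψ x s = quadProd n x ^ 2 * Φ s) (s : State n) (i : Fin n) :
    degreeOf i (Φ s) ≤ 2 * (n - 1) := by
  by_cases h0 : Φ s = 0
  · simp [h0]
  have h1 := degreeOf_restr_le hd x s i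
  have h2 := quadProd_ne_zero (n := n) hx
  rw [hΦ, degreeOf_mul_eq (pow_ne_zero _ h2) h0, degreeOf_pow_eq _ _ _ h2] at h1
  have := two_le_degreeOf_quadProd hx i
  omega

theorem one_sub_q_mul : (1 - q) * (1 - q ^ 2) = 3 := by
  linear_combination q_pow_three - q_sq

/-- The recursion for the nontrivial factors. -/
theorem Good.eval_factor_arcPt (h : Good Ψ) {x : ℂ} (hx : x ≠ 0)
    {Φ : State n → MvPolynomial (Fin n) ℂ} (hg : Good Φ)
    (hΦ : ∀ s, Rotor.restr Ψ x s = quadProd n x ^ 2 * Φ s) {c : ℂ} (hc : Factorizes Φ c) {m k : ℕ}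
    (hmk : m + k = n) {F : MvPolynomial (Fin (n + 2)) ℂ}
    (hF : Ψ (mnc (n + 2) (m + 2)) = trivialFactor (n + 2) (m + 2) * F) (ζ : ℕ → ℂ) :
    -q * x ^ 2 * eval (fun j : Fin (n + 2) => arcPt x (m + 1) ζ j) F =
      c * kap m k * pv (m + 2) (arcPt x (m + 1) ζ) * pv k fun j => ζ (m + j) := by
  obtain ⟨F', hF'⟩ := hg.trivialFactor_dvd (m := m) (by omega)
  have h1 := h.factor_restr hx hΦ (by omega) hF hF' ζ
  rw [hc m k hmk F' hF'] at h1
  -- The constants combine by (1 - q) (1 - q²) = 3 and q^m q^(2m) = 1, and -q x² is left.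
  rw [pv_arcPt m hx]
  have h2 : q ^ m * q ^ (2 * m) = 1 := by
    rw [← pow_add, show m + 2 * m = 3 * m by ring, pow_mul, q_pow_three, one_pow]
  generalize eval (fun j : Fin (n + 2) => arcPt x (m + 1) ζ j) F = f at *
  generalize ∏ j ∈ Finset.range m, (ζ j ^ 2 - q * x ^ 2) = A at *
  linear_combination (-(q / 3) * (1 - q) * x * q ^ (2 * m)) * h1 +
    (-(q / 3) * x ^ 2 * f) * ((1 - q) * (1 - q ^ 2)) * (-h2) - (-(q / 3) * x ^ 2 * f) * one_sub_q_mul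

theorem arcPt_shift (x : ℂ) (m : ℕ) (ζ : ℕ → ℂ) :
    (fun j => arcPt x (m + 1) ζ (m + 2 + j)) = fun j => ζ (m + j) := by
  funext j
  rw [show m + 2 + j = m + j + 2 by ring, arcPt_add_two_of_le x (by omega)]

/-- The factorization follows from the recursion by interpolation. -/
theorem Good.eval_factor_of_arcPt {N : ℕ} [NeZero N] {Ψ : State N → MvPolynomial (Fin N) ℂ}
    (h : Good Ψ) (hd : ∀ s i, degreeOf i (Ψ s) ≤ 2 * (N - 1)) {m k : ℕ} (hm : 2 ≤ m)
    (hmk : m + k = N) {F : MvPolynomial (Fin N) ℂ} (hF : Ψ (mnc N m) = trivialFactor N m * F)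
    {c : ℂ} (hc : ∀ x ζ, x ≠ 0 → eval (fun j : Fin N => arcPt x (m - 1) ζ j) F =
      c * pv m (arcPt x (m - 1) ζ) * pv k fun j => arcPt x (m - 1) ζ (m + j)) (ζ : ℕ → ℂ) :
    eval (fun j : Fin N => ζ j) F = c * pv m ζ * pv k fun j => ζ (m + j) := by
  let G : MvPolynomial (Fin N) ℂ :=
    C c * rename (fun i : Fin m => (⟨i, by omega⟩ : Fin N)) (rotorP m) *
      rename (fun i : Fin k => (⟨m + i, by omega⟩ : Fin N)) (rotorP k)
  have hG : ∀ ζ : ℕ → ℂ, eval (fun j : Fin N => ζ j) G = c * pv m ζ * pv k fun j => ζ (m + j) :=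
    fun ζ => by
      simp only [G, map_mul, eval_C, eval_rename]
      rfl
  have hE : F - G = 0 := by
    refine eq_zero_of_arcPt hm (by omega) (fun l ζ hl => ?_) (fun x ζ hx => ?_) ?_
    · rw [map_sub, map_sub, h.factor_swap hmk hF hl, hG, hG, pv_swap hl]
      have e : ∀ j, (ζ ∘ Equiv.swap l (l + 1)) (m + j) = ζ (m + j) := fun j => by
        rw [Function.comp, swap_eq_self_of_le hl (by omega)]
      simp only [e]
    · rw [map_sub, hG (arcPt x (m - 1) ζ), hc x ζ hx, sub_self]
    · have d1 : degreeOf (0 : Fin N) F ≤ m - 1 := degreeOf_factor_le (by omega) hmk hF (hd _ _)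
      have d2 : degreeOf (0 : Fin N) (rename (fun i : Fin m => (⟨i, by omega⟩ : Fin N))
          (rotorP m)) = degreeOf (⟨0, by omega⟩ : Fin m) (rotorP m) :=
        degreeOf_rename_of_injective (f := fun i : Fin m => (⟨i, by omega⟩ : Fin N))
          (fun i j hij => by simpa [Fin.ext_iff] using hij) ⟨0, by omega⟩
      have d3 : degreeOf (0 : Fin N) (rename (fun i : Fin k => (⟨m + i, by omega⟩ : Fin N))
          (rotorP k)) = 0 := degreeOf_rename_eq_zero (fun j hj => by
        have := congrArg Fin.val hj
        simp at this
        omega) _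
      have d4 : degreeOf (0 : Fin N) G ≤ degreeOf (⟨0, by omega⟩ : Fin m) (rotorP m) := by
        refine (degreeOf_mul_le _ _ _).trans ?_
        rw [d3, add_zero, ← d2]
        exact degreeOf_C_mul_le _ _ _
      -- The bound m for the degree of P_m is below 2 (m - 1) only for m > 2; for m = 2 the sharper
      -- bound for even sizes is used.
      have d5 : degreeOf (⟨0, by omega⟩ : Fin m) (rotorP m) < 2 * (m - 1) := by
        rcases Nat.lt_or_ge 2 m with h2 | h2
        · have := degreeOf_rotorP_le (⟨0, by omega⟩ : Fin m)
          omega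
        · have e : m = 2 := by omega
          have := degreeOf_rotorP_le_of_even (e ▸ even_two) (⟨0, by omega⟩ : Fin m)
          omega
      refine lt_of_le_of_lt (degreeOf_sub_le' 0 F G (max (m - 1) (2 * (m - 1) - 1))
        (d1.trans (le_max_left _ _)) ((d4.trans (by omega)).trans (le_max_right _ _))) ?_
      omega
  rw [sub_eq_zero.1 hE, hG]

/-- The constant obtained at z_{m-1} = -q z_0 = -q x could depend on x. At a point with one special
pair for x and another for y, the same factor is computed from either pair, after a rotation for the
second one. This gives y² C(x) = x² C(y). -/
theorem Good.exists_factor_arcPt_const (h : Good Ψ)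
    (hd : ∀ s i, degreeOf i (Ψ s) ≤ 2 * (n + 2 - 1)) {C : ℂ → ℂ}
    (hC : ∀ x, x ≠ 0 → ∀ m k, m + k = n → ∀ F,
      Ψ (mnc (n + 2) (m + 2)) = trivialFactor (n + 2) (m + 2) * F → ∀ ζ,
      -q * x ^ 2 * eval (fun j : Fin (n + 2) => arcPt x (m + 1) ζ j) F =
        C x * kap m k * pv (m + 2) (arcPt x (m + 1) ζ) * pv k fun j => ζ (m + j)) :
    ∃ c, ∀ x, x ≠ 0 → C x = -q * x ^ 2 * c := by
  have hn : 0 < n := Nat.pos_of_ne_zero (NeZero.ne n)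
  obtain ⟨F, hF⟩ := h.trivialFactor_dvd (m := 2) (by omega)
  have p2 : ∀ x ζ, pv 2 (arcPt x 1 ζ) = -(q / 3) * (1 - q) * x := fun x ζ => by
    rw [pv_two, arcPt_zero, arcPt_self x one_ne_zero]
    ring
  have h1q : 1 - q ≠ 0 := sub_ne_zero.2 q_ne_one.symm
  have hq := q_ne_zero
  rcases Nat.lt_or_ge 1 n with hn1 | hn1
  · obtain ⟨F', hF'⟩ := h.trivialFactor_dvd (m := n) (by omega)
    have key : ∀ x y, x ≠ 0 → y ≠ 0 → y ^ 2 * C x = x ^ 2 * C y := by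
      intro x y hx hy
      obtain ⟨r, rfl⟩ : ∃ r, n = r + 2 := ⟨n - 2, by omega⟩
      obtain ⟨η, hη⟩ := exists_pv_arcPt_ne_zero (rotorP_ne_zero r) hy
      -- The first block is x, -q x, and the second begins with y and ends with -q y. `η'` is what
      -- remains after rotating by two and removing the pair for y.
      let ζ := arcPt x 1 (arcPt y (r + 1) η)
      have e1 := hC x hx 0 (r + 2) (by omega) F hF (arcPt y (r + 1) η)
      let η' : ℕ → ℂ := fun j => if j < r then η j else ζ (j - r)
      have e2 := hC y hy r 2 rfl F' hF' η'
      have e3 := h.factor_rotSeq (m := 2) (k := r + 2) (by omega) hF hF' ζ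
      have e4 : (fun j : Fin (r + 2 + 2) => rotSeq 2 (r + 2) ζ j) =
          fun j : Fin (r + 2 + 2) => arcPt y (r + 1) η' j := by
        funext j
        have hj := j.2
        rw [rotSeq]
        split_ifs with h1
        · have e : ζ (2 + j) = arcPt y (r + 1) η j := by
            simp only [ζ]
            rw [show 2 + (j : ℕ) = j + 2 from add_comm _ _, arcPt_add_two_of_le x (by omega)]
          rw [e]
          simp only [arcPt, η']
          split_ifs <;> first | rfl | omega
        · obtain ⟨i, hi⟩ : ∃ i, (j : ℕ) = r + i + 2 := ⟨j - r - 2, by omega⟩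
          rw [hi, arcPt_add_two_of_le y (by omega)]
          simp only [η']
          rw [if_neg (by omega)]
          congr 1
          omega
      have e5 : pv (r + 2) (arcPt y (r + 1) η') = pv (r + 2) (arcPt y (r + 1) η) := by
        refine pv_congr fun j hj => ?_
        simp only [arcPt, η']
        split_ifs <;> first | rfl | omega
      have e6 : pv 2 (fun j => η' (r + j)) = pv 2 ζ := by
        refine pv_congr fun j hj => ?_
        simp only [η']
        rw [if_neg (by omega), Nat.add_sub_cancel_left]
      rw [e4] at e3
      rw [e3, e5, e6, p2] at e2
      rw [zero_add, p2] at e1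
      simp only [zero_add] at e1
      have k1 : kap 0 (r + 2) = 1 := if_neg (by simp)
      have k2 : kap r 2 = 1 := if_neg (by simp)
      rw [k1] at e1
      rw [k2] at e2
      have e7 : eval (fun j : Fin (r + 2 + 2) => arcPt x 1 (arcPt y (r + 1) η) j) F =
        eval (fun j : Fin (r + 2 + 2) => ζ j) F := rfl
      rw [e7] at e1
      have hA : (-(q / 3) * (1 - q) * x) * pv (r + 2) (arcPt y (r + 1) η) ≠ 0 :=
        mul_ne_zero (mul_ne_zero (mul_ne_zero (neg_ne_zero.2 (div_ne_zero hq (by norm_num))) h1q)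
          hx) hη
      refine mul_right_cancel₀ hA ?_
      linear_combination y ^ 2 * (-e1) + x ^ 2 * e2
    refine ⟨-C 1 / q, fun x hx => ?_⟩
    have := key x 1 hx one_ne_zero
    field_simp
    linear_combination this
  -- Three points have no room for two special pairs; here the explicit form b (z_0 + z_1) of the
  -- factor settles the dependence on x.
  · obtain rfl : n = 1 := by omega
    obtain ⟨b, hb⟩ := h.exists_factor_three hd hF
    refine ⟨3 * b / (-q), fun x hx => ?_⟩
    have e1 := hC x hx 0 1 rfl F hF 0
    have k1 : kap 0 1 = 1 := if_neg (by simp)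
    rw [hb (arcPt x 1 0), zero_add, p2, arcPt_zero, arcPt_self x one_ne_zero, pv_one, k1] at e1
    have hA : -(q / 3) * (1 - q) * x ≠ 0 :=
      mul_ne_zero (mul_ne_zero (neg_ne_zero.2 (div_ne_zero hq (by norm_num))) h1q) hx
    refine mul_right_cancel₀ hA ?_
    rw [show -q * x ^ 2 * (3 * b / -q) = 3 * b * x ^ 2 by field_simp]
    linear_combination -e1

/-- The maximally nested components of a solution of the exchange relations of low degree. -/
theorem Good.exists_factorizes : ∀ (N : ℕ) [NeZero N] {Ψ : State N → MvPolynomial (Fin N) ℂ},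
    Good Ψ → (∀ s i, degreeOf i (Ψ s) ≤ 2 * (N - 1)) → ∃ c, Factorizes Ψ c
  | 0, h0, _, _, _ => absurd rfl h0.out
  | 1, _, _, _, hd => exists_factorizes_one hd
  | 2, _, _, h, hd => h.exists_factorizes_two hd
  | n + 3, _, Ψ, h, hd => by
    -- The restricted vector depends on x, and so may its constant.
    have hex : ∀ x : ℂ, ∃ c, x ≠ 0 → ∀ m k, m + k = n + 1 → ∀ F,
        Ψ (mnc (n + 1 + 2) (m + 2)) = trivialFactor (n + 1 + 2) (m + 2) * F → ∀ ζ,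
        -q * x ^ 2 * eval (fun j : Fin (n + 1 + 2) => arcPt x (m + 1) ζ j) F =
          c * kap m k * pv (m + 2) (arcPt x (m + 1) ζ) * pv k fun j => ζ (m + j) := by
      intro x
      by_cases hx : x = 0
      · exact ⟨0, fun h => absurd hx h⟩
      · obtain ⟨Φ, hg, hΦ⟩ := Good.exists_restr_eq (n := n + 1) h hx
        obtain ⟨c, hc⟩ := Good.exists_factorizes (n + 1) hg (degreeOf_le_of_restr_eq hd hx hΦ)
        exact ⟨c, fun _ m k hmk F hF ζ => Good.eval_factor_arcPt h hx hg hΦ hc hmk hF ζ⟩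
    choose C hC using hex
    obtain ⟨c, hc⟩ := Good.exists_factor_arcPt_const (n := n + 1) h hd hC
    have main : ∀ m k, 2 ≤ m → m + k = n + 3 → ∀ F,
        Ψ (mnc (n + 3) m) = trivialFactor (n + 3) m * F → ∀ ζ : ℕ → ℂ,
        eval (fun j : Fin (n + 3) => ζ j) F =
          c * kap m k * pv m ζ * pv k fun j => ζ (m + j) := by
      intro m k hm hmk F hF
      obtain ⟨m, rfl⟩ : ∃ r, m = r + 2 := ⟨m - 2, by omega⟩
      refine h.eval_factor_of_arcPt hd hm hmk hF fun x ζ hx => ?_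
      have e := hC x hx m k (by omega) F hF ζ
      rw [show m + 2 - 1 = m + 1 by omega, arcPt_shift, kap_add_two]
      rw [hc x hx] at e
      refine mul_left_cancel₀ (mul_ne_zero (neg_ne_zero.2 q_ne_zero) (pow_ne_zero 2 hx)) ?_
      rw [e]
      ring
    refine ⟨c, fun m k hmk F hF ζ => ?_⟩
    -- As N ≥ 3, the case m < 2 has k ≥ 2 and reduces to the rotated component.
    rcases Nat.lt_or_ge m 2 with hm | hm
    · exact h.factor_of_rotSeq hmk (main k m (by omega) (by omega)) hF ζ
    · exact main m k hm hmk F hF ζ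

/-! ### Ground states satisfy the exchange relations up to scalar functions -/

variable {N : ℕ} [NeZero N] {Ψ : State N → MvPolynomial (Fin N) ℂ}

/-- Eigenvectors that depend polynomially on the parameters are proportional. -/
theorem proportional_of_eigen (c : ℤ) {v w : (Fin N → ℂ) → State N → ℂ}
    (hv : ∀ s, IsPoly fun z => v z s) (hw : ∀ s, IsPoly fun z => w z s)
    (ev_v : ∀ z, rowOp (wt (z (col c)) z) (v z) = ev (z (col c)) z • v z)
    (ev_w : ∀ z, rowOp (wt (z (col c)) z) (w z) = ev (z (col c)) z • w z)
    (z : Fin N → ℂ) (s : State N) : (∑ s', w z s') * v z s = (∑ s', v z s') * w z s := by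
  choose p hp using hv
  choose r hr using hw
  -- Q solves the eigenvalue equation and its components sum to zero, so uniqueness makes it vanish.
  let Q : State N → MvPolynomial (Fin N) ℂ := fun s => (∑ s', r s') * p s - (∑ s', p s') * r s
  have hQ : ∀ z s, evalv Q z s = (∑ s', w z s') * v z s - (∑ s', v z s') * w z s := fun z s => by
    simp only [evalv, Q, map_sub, map_mul, map_sum, hp, hr]
  have hQ' : ∀ z, evalv Q z = (∑ s', w z s') • v z - (∑ s', v z s') • w z := fun z => by
    funext s
    rw [hQ]
    rfl
  have h0 : ∀ z, z (col c) ≠ 0 → evalv Q z s = 0 := fun z hz =>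
    evalv_eq_zero c hz Q (fun _ => 1) rfl (fun y hy => by
      rw [hQ', map_sub, map_smul, map_smul, ← hy, ev_v, ev_w, smul_sub,
        smul_comm, smul_comm (∑ s', v y s') (ev _ _)])
      (fun y _ => by
        simp only [one_mul, hQ, Finset.sum_sub_distrib, ← Finset.mul_sum]
        ring) z rfl s
  have key : ∀ z, eval z (Q s) = eval z (0 : MvPolynomial (Fin N) ℂ) :=
    IsPoly.eq_of_mul (X_ne_zero (col c)) (IsPoly.eval _) (IsPoly.eval _) fun z => by
      rw [eval_X, map_zero, mul_zero, mul_eq_zero]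
      exact or_iff_not_imp_left.2 (h0 z)
  have := key z
  rw [map_zero] at this
  exact sub_eq_zero.1 ((hQ z s).symm.trans this)

/-- The eigenvalue equation, for the values of `t` for which it makes sense to cut the cylinder. -/
def IsEigen (Ψ : State N → MvPolynomial (Fin N) ℂ) : Prop :=
  ∀ (z : Fin N → ℂ) (c : Fin N), rowOp (wt (z c) z) (evalv Ψ z) = ev (z c) z • evalv Ψ z

/-- Let a be the parameter in column 1 of y. The row at t = a over the swapped point is forced in
column 0 and equals R after a face; the row over y is forced in column 1 and equals the same face
after R. So the face intertwines the two rows and maps the eigenvector at the swapped point to one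
at y. -/
theorem IsEigen.rowOp_faceOp_evalv (hΨ : IsEigen Ψ) (hN : 2 ≤ N) (y : Fin N → ℂ) :
    rowOp (wt (y (col (0 + 1))) y) (faceOp 0 (xw (y (col (0 + 1))) (y (col 0)))
      (evalv Ψ (y ∘ Equiv.swap (col 0) (col (0 + 1))))) =
    ev (y (col (0 + 1))) y • faceOp 0 (xw (y (col (0 + 1))) (y (col 0)))
      (evalv Ψ (y ∘ Equiv.swap (col 0) (col (0 + 1)))) := by
  have hne := col_succ_ne hN 0
  set z := y ∘ Equiv.swap (col 0) (col (0 + 1)) with hz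
  set a := y (col (0 + 1)) with ha
  have z0 : z (col 0) = a := by rw [hz, Function.comp, Equiv.swap_apply_left]
  have z1 : z (col (0 + 1)) = y (col 0) := by rw [hz, Function.comp, Equiv.swap_apply_right]
  have hW : rowOp (Function.update (wt a y) (col 0) (forcedWeight 1)) =
      rowOp (Function.update (wt a z) (col (0 + 1)) (forcedWeight 1)) := by
    set d := faceWeight false false a a with hd
    let W := Function.update (Function.update (wt a y) (col 0) (forcedWeight 1)) (col (0 + 1))
      (forcedWeight 1)
    have w1 : W (col (0 + 1)) = forcedWeight 1 := Function.update_self _ _ _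
    have w0 : W (col 0) = forcedWeight 1 :=
      (Function.update_of_ne hne _ _).trans (Function.update_self _ _ _)
    have e1 : Function.update (wt a y) (col 0) (forcedWeight 1) =
        Function.update W (col (0 + 1)) (forcedWeight d) := by
      rw [Function.update_idem, eq_comm, Function.update_eq_self_iff,
        Function.update_of_ne hne.symm, forced_eq (forced_wt ha.symm), hd, wt, ← ha]
    have e2 : Function.update (wt a z) (col (0 + 1)) (forcedWeight 1) =
        Function.update W (col 0) (forcedWeight d) := by
      funext c
      by_cases h1 : c = col (0 + 1)
      · rw [h1, Function.update_self, Function.update_of_ne hne.symm, w1]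
      · rw [Function.update_of_ne h1]
        by_cases h0 : c = col 0
        · rw [h0, Function.update_self, forced_eq (forced_wt z0), hd, wt, z0]
        · have w2 : W c = wt a y c :=
            (Function.update_of_ne h1 _ _).trans (Function.update_of_ne h0 _ _)
          rw [Function.update_of_ne h0, w2]
          funext b
          rw [wt, wt, hz, Function.comp, Equiv.swap_apply_of_ne_of_ne h0 h1]
    have e3 : Function.update W (col (0 + 1)) (forcedWeight 1) = W := Function.update_idem _ _ _
    have e4 : Function.update W (col 0) (forcedWeight 1) = W := by
      rw [Function.update_eq_self_iff, w0]
    rw [e1, e2, rowOp_update_smul W (col (0 + 1)) d, rowOp_update_smul W (col 0) d, e3, e4]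
  have hev : ev a z = ev a y := by
    rw [ev, ev, hz]
    exact Equiv.prod_comp (Equiv.swap (col 0) (col (0 + 1))) fun i => q * a ^ 2 - y i ^ 2
  have h1 := hΨ z (col 0)
  rw [z0, rowOp_right hN (forced_wt z0)] at h1
  have h2 : wt a z (col (0 + 1)) = xw a (y (col 0)) := by
    funext b
    rw [wt, xw, z1]
  rw [h2] at h1
  rw [rowOp_left hN (forced_wt ha.symm), hW, h1, map_smul, hev]
  rfl

/-- The two vectors are eigenvectors at the same point, hence proportional, and the ratio is read
off from the sums of their components. -/
theorem IsEigen.exch (hΨ : IsEigen Ψ) (hN : 2 ≤ N) (z : Fin N → ℂ) (s : State N) :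
    (∑ s', evalv Ψ (z ∘ Equiv.swap (col 0) (col (0 + 1))) s') *
      faceOp 0 (xw (z (col 0)) (z (col (0 + 1)))) (evalv Ψ z) s =
    scal (z (col 0)) (z (col (0 + 1))) * (∑ s', evalv Ψ z s') *
      evalv Ψ (z ∘ Equiv.swap (col 0) (col (0 + 1))) s := by
  have key := proportional_of_eigen (0 + 1) (v := evalv Ψ) (w := fun y =>
      faceOp 0 (xw (y (col (0 + 1))) (y (col 0)))
        (evalv Ψ (y ∘ Equiv.swap (col 0) (col (0 + 1))))) (fun s => IsPoly.eval _)
    (fun s => isPoly_faceOp (fun s => (IsPoly.eval (Ψ s)).comp fun i => IsPoly.var _)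
      (fun b => isPoly_xw (IsPoly.var _) (IsPoly.var _) b) _ _)
    (fun z => hΨ z _) (hΨ.rowOp_faceOp_evalv hN) (z ∘ Equiv.swap (col 0) (col (0 + 1))) s
  have e : (z ∘ Equiv.swap (col 0) (col (0 + 1))) ∘ Equiv.swap (col 0) (col (0 + 1)) = z := by
    funext c
    simp
  simp only [e, sum_faceOp, sum_xw, Function.comp_apply (f := z), Equiv.swap_apply_left,
    Equiv.swap_apply_right] at key
  exact key.symm

theorem IsEigen.rot (hΨ : IsEigen Ψ) (z : Fin N → ℂ) (s : State N) :
    (∑ s', evalv Ψ (fun j => z (j + 1)) s') * evalv Ψ z (rotState s) =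
      (∑ s', evalv Ψ z s') * evalv Ψ (fun j => z (j + 1)) s := by
  have key := proportional_of_eigen 0 (v := evalv Ψ) (w := fun y =>
      push rotState (evalv Ψ fun j => y (j + 1))) (fun s => IsPoly.eval _)
    (fun s => isPoly_push (fun s => (IsPoly.eval (Ψ s)).comp fun i => IsPoly.var _) _ _)
    (fun z => hΨ z _) (fun y => by
      have h1 := hΨ (fun j => y (j + 1)) (col (-1))
      have e : (col (-1) : Fin N) + 1 = col 0 := by rw [← col_add_one]; rfl
      simp only [e] at h1
      rw [← push_rot_rowOp (w := wt (y (col 0)) fun j => y (j + 1)) (fun c => rfl)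
        (c := col (-1)) (forced_wt (by simp only [e])), h1, map_smul]
      congr 1
      exact Equiv.prod_comp (Equiv.addRight (1 : Fin N)) fun i => q * y (col 0) ^ 2 - y i ^ 2)
    z (rotState s)
  rw [sum_push, push_apply_injective rotState_injective] at key
  exact key

/-! ### Primitive vectors of polynomials -/

/-- A vector of polynomials without common divisors. -/
def Primitive {S σ : Type*} (Ψ : S → MvPolynomial σ ℂ) : Prop :=
  ∀ A D, (∀ s, A ∣ D * Ψ s) → A ∣ D

theorem Primitive.rename {S σ : Type*} {Ψ : S → MvPolynomial σ ℂ} (h : Primitive Ψ)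
    (e : σ ≃ σ) : Primitive fun s => rename e (Ψ s) := fun A D hA => by
  have inv : ∀ p : MvPolynomial σ ℂ, MvPolynomial.rename e (MvPolynomial.rename e.symm p) = p :=
    fun p => by rw [rename_rename, e.self_comp_symm, rename_id_apply]
  have inv' : ∀ p : MvPolynomial σ ℂ, MvPolynomial.rename e.symm (MvPolynomial.rename e p) = p :=
    fun p => by rw [rename_rename, e.symm_comp_self, rename_id_apply]
  have := h (MvPolynomial.rename e.symm A) (MvPolynomial.rename e.symm D) fun s => by
    have := map_dvd (MvPolynomial.rename e.symm) (hA s)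
    rwa [map_mul, inv'] at this
  have := map_dvd (MvPolynomial.rename e) this
  rwa [inv, inv] at this

/-- The greatest common divisor is split off. Its homogeneity under multiplication by D gives
primitivity in the form required. -/
theorem exists_primitive {S σ : Type*} [Fintype S] [Nonempty S] {Ψ : S → MvPolynomial σ ℂ}
    (h : Ψ ≠ 0) : ∃ g Φ, g ≠ 0 ∧ (∀ s, Ψ s = g * Φ s) ∧ Primitive Φ := by
  let : StrongNormalizationMonoid (MvPolynomial σ ℂ) :=
    UniqueFactorizationMonoid.strongNormalizationMonoid
  let : NormalizedGCDMonoid (MvPolynomial σ ℂ) := UniqueFactorizationMonoid.toNormalizedGCDMonoid _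
  obtain ⟨Φ, h1, h2⟩ := Finset.extract_gcd Ψ (Finset.univ_nonempty (α := S))
  refine ⟨Finset.univ.gcd Ψ, Φ, fun h0 => h ?_, fun s => h1 s (Finset.mem_univ s),
    fun A D hA => ?_⟩
  · funext s
    rw [h1 s (Finset.mem_univ s), h0, zero_mul]
    rfl
  · have e := Finset.gcd_mul_left' (s := Finset.univ) (f := Φ) D
    rw [h2, mul_one] at e
    exact (Finset.dvd_gcd fun s _ => hA s).trans e.dvd

theorem eval_eq_of_degreeOf_zero {σ : Type*} [Fintype σ] {p : MvPolynomial σ ℂ} {z y : σ → ℂ}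
    (h : ∀ c, z c ≠ y c → degreeOf c p = 0) : eval z p = eval y p := by
  rw [eval_eq', eval_eq']
  refine Finset.sum_congr rfl fun d hd => ?_
  congr 1
  refine Finset.prod_congr rfl fun c _ => ?_
  by_cases hc : z c = y c
  · rw [hc]
  · rw [Nat.le_zero.1 ((monomial_le_degreeOf c hd).trans (h c hc).le), pow_zero, pow_zero]

/-! ### Ground states satisfy the exchange relations -/

variable {N : ℕ} [NeZero N] {Ψ : State N → MvPolynomial (Fin N) ℂ}

theorem eval_rename_equiv {σ : Type*} (e : σ ≃ σ) (p : MvPolynomial σ ℂ) (z : σ → ℂ) :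
    eval z (rename e p) = eval (z ∘ e) p := eval_rename _ _ _

theorem IsEigen.sum_ne_zero (h : IsEigen Ψ) (h0 : Ψ ≠ 0) : ∑ s, Ψ s ≠ 0 := fun hs => h0 (by
  funext s
  refine MvPolynomial.funext fun z => ?_
  refine IsPoly.eq_of_mul (X_ne_zero (col 0)) (IsPoly.eval _) (IsPoly.eval _) (fun z => ?_) z
  rw [eval_X, Pi.zero_apply, map_zero, mul_zero, mul_eq_zero]
  refine or_iff_not_imp_left.2 fun hz => evalv_eq_zero 0 hz Ψ (fun _ => 1) rfl
    (fun y hy => hy ▸ h y _) (fun y _ => ?_) z rfl s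
  have := congrArg (eval y) hs
  rw [map_sum, map_zero] at this
  simpa [evalv] using this)

/-- The factor in the exchange relation as a polynomial. -/
noncomputable def scalPoly (N : ℕ) [NeZero N] : MvPolynomial (Fin N) ℂ :=
  C q * X (col 0) ^ 2 - X (col (0 + 1)) ^ 2

theorem eval_scalPoly (z : Fin N → ℂ) :
    eval z (scalPoly N) = scal (z (col 0)) (z (col (0 + 1))) := by
  simp [scalPoly, scal]

theorem scalPoly_ne_zero (hN : 2 ≤ N) : scalPoly N ≠ 0 := fun h => by
  have := eval_scalPoly fun c : Fin N => if c = col 0 then 1 else 0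
  rw [h, map_zero, if_pos rfl, if_neg (col_succ_ne hN 0).symm] at this
  simp only [scal, one_pow, mul_one, ne_eq, OfNat.ofNat_ne_zero, not_false_eq_true, zero_pow,
    sub_zero] at this
  exact q_ne_zero this.symm

theorem degreeOf_scalPoly {c : Fin N} (h0 : c ≠ col 0) (h1 : c ≠ col (0 + 1)) :
    degreeOf c (scalPoly N) = 0 := by
  refine Nat.le_zero.1 (degreeOf_sub_le' c _ _ 0 ?_ ?_)
  · refine (degreeOf_C_mul_le _ _ _).trans ((degreeOf_pow_le _ _ _).trans ?_)
    rw [degreeOf_X, if_neg h0, mul_zero]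
  · refine (degreeOf_pow_le _ _ _).trans ?_
    rw [degreeOf_X, if_neg h1, mul_zero]

/-- The exchange relation of a primitive eigenvector with an unknown factor. -/
theorem IsEigen.exists_exch (h : IsEigen Ψ) (hp : Primitive Ψ) (h0 : Ψ ≠ 0) (hN : 2 ≤ N) :
    ∃ B : MvPolynomial (Fin N) ℂ, scalPoly N * ∑ s, Ψ s =
      rename (Equiv.swap (col 0) (col (0 + 1))) (∑ s, Ψ s) * B ∧
      ∀ z s, faceOp 0 (xw (z (col 0)) (z (col (0 + 1)))) (evalv Ψ z) s =
        eval z B * evalv Ψ (z ∘ Equiv.swap (col 0) (col (0 + 1))) s := by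
  set σ : Equiv.Perm (Fin N) := Equiv.swap (col 0) (col (0 + 1)) with hσ
  set Z := ∑ s, Ψ s with hZ
  have hZ0 : Z ≠ 0 := h.sum_ne_zero h0
  have hZs : rename σ Z ≠ 0 := fun e => hZ0 (rename_injective σ σ.injective (by rw [e, map_zero]))
  have eZ : ∀ z, eval z Z = ∑ s, evalv Ψ z s := fun z => by rw [hZ, map_sum]; rfl
  have hF : ∀ s, IsPoly fun z : Fin N → ℂ =>
      faceOp 0 (xw (z (col 0)) (z (col (0 + 1)))) (evalv Ψ z) s := fun s =>
    isPoly_faceOp (fun s => IsPoly.eval _) (fun b => isPoly_xw (IsPoly.var _) (IsPoly.var _) b) _ _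
  -- Primitivity of the swapped vector permits division of the exchange relation by the sum of its
  -- components.
  obtain ⟨B, hB⟩ : rename σ Z ∣ scalPoly N * Z := hp.rename σ _ _ fun s => by
    obtain ⟨r, hr⟩ := hF s
    refine ⟨r, MvPolynomial.funext fun z => ?_⟩
    rw [map_mul, map_mul, map_mul, hr, eval_scalPoly, eval_rename_equiv, eval_rename_equiv, eZ, eZ]
    exact (h.exch hN z s).symm
  refine ⟨B, hB, fun z s => ?_⟩
  refine IsPoly.eq_of_mul hZs (hF s) ((IsPoly.eval B).mul ((IsPoly.eval (Ψ s)).comp fun i =>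
    IsPoly.var (σ i))) (fun z => ?_) z
  have e1 := congrArg (eval z) hB
  rw [map_mul, map_mul, eval_scalPoly, eZ] at e1
  rw [← mul_assoc, ← e1, eval_rename_equiv, eZ]
  exact h.exch hN z s

/-- The unknown factor in the exchange relation depends on two parameters only. -/
theorem degreeOf_eq_zero_of_exch {Z B : MvPolynomial (Fin N) ℂ} (hZ : Z ≠ 0) (hN : 2 ≤ N)
    (hB : scalPoly N * Z = rename (Equiv.swap (col 0) (col (0 + 1))) Z * B) {c : Fin N}
    (h0 : c ≠ col 0) (h1 : c ≠ col (0 + 1)) : degreeOf c B = 0 := by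
  set σ : Equiv.Perm (Fin N) := Equiv.swap (col 0) (col (0 + 1)) with hσ
  have inj := rename_injective (R := ℂ) σ σ.injective
  have hne : ∀ {p : MvPolynomial (Fin N) ℂ}, p ≠ 0 → rename σ p ≠ 0 := fun hp e =>
    hp (inj (by rw [e, map_zero]))
  have hS := scalPoly_ne_zero hN
  have hB0 : B ≠ 0 := fun e => mul_ne_zero hS hZ (by rw [hB, e, mul_zero])
  have hB' := congrArg (rename σ) hB
  rw [map_mul, map_mul, rename_rename, show (σ : Fin N → Fin N) ∘ σ = id by
    funext j; simp [hσ], rename_id_apply] at hB'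
  -- Applying the relation twice gives back the original sum, so B times its swap is the product of
  -- the known factors, in which only two variables occur.
  have key : B * rename σ B = scalPoly N * rename σ (scalPoly N) := by
    refine mul_left_cancel₀ (mul_ne_zero hZ (hne hZ)) ?_
    linear_combination (-B * rename σ Z) * hB' - rename σ (scalPoly N) * rename σ Z * hB
  have hσc : σ c = c := Equiv.swap_apply_of_ne_of_ne h0 h1
  have d1 : degreeOf c (rename σ (scalPoly N)) = 0 := by
    have := degreeOf_rename_of_injective (p := scalPoly N) σ.injective c
    rw [hσc, degreeOf_scalPoly h0 h1] at this
    exact this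
  have := congrArg (degreeOf c) key
  rw [degreeOf_mul_eq hB0 (hne hB0), degreeOf_mul_eq hS (hne hS), d1, degreeOf_scalPoly h0 h1]
    at this
  omega

/-- The sum of the components is multiplied by a constant under a rotation. -/
theorem IsEigen.exists_rot (h : IsEigen Ψ) (hp : Primitive Ψ) :
    ∃ u : ℂ, u ≠ 0 ∧ ∀ z, ∑ s, evalv Ψ (fun j => z (j + 1)) s = u * ∑ s, evalv Ψ z s := by
  set Z := ∑ s, Ψ s with hZ
  have eZ : ∀ z, eval z Z = ∑ s, evalv Ψ z s := fun z => by rw [hZ, map_sum]; rfl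
  let τ : Equiv.Perm (Fin N) := Equiv.addRight 1
  have e : ∀ s, rename τ Z * Ψ (rotState s) = Z * rename τ (Ψ s) := fun s =>
    MvPolynomial.funext fun z => by
      rw [map_mul, map_mul, eval_rename_equiv, eval_rename_equiv, eZ, eZ]
      exact h.rot z s
  have d1 : rename τ Z ∣ Z := hp.rename τ _ _ fun s => ⟨_, (e s).symm⟩
  have d2 : Z ∣ rename τ Z := hp _ _ fun s => by
    obtain ⟨s, rfl⟩ := rotState_surjective s
    exact ⟨_, e s⟩
  obtain ⟨w, hw⟩ := associated_of_dvd_dvd d2 d1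
  obtain ⟨u, hu, hu'⟩ := isUnit_iff_eq_C_of_isReduced.1 w.isUnit
  refine ⟨u, hu.ne_zero, fun z => ?_⟩
  have := congrArg (eval z) hw
  rw [hu', map_mul, eval_C, eval_rename_equiv, eZ, eZ] at this
  rw [mul_comm, this]
  rfl

/-- The sequence with the first term moved to position `k`. -/
def moveSeq (k : ℕ) (ζ : ℕ → ℂ) (j : ℕ) : ℂ :=
  if j < k then ζ (j + 1) else if j = k then ζ 0 else ζ j

theorem moveSeq_swap (k : ℕ) (ζ : ℕ → ℂ) :
    moveSeq k ζ ∘ Equiv.swap k (k + 1) = moveSeq (k + 1) ζ := by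
  funext j
  simp only [Function.comp, moveSeq, Equiv.swap_apply_def]
  split_ifs <;> first | rfl | omega | (congr 1; omega)

/-- N - 1 exchanges carry the first parameter around the cylinder, and the result is a rotation.
This is the monodromy condition that ties the unknown factors β and u together. -/
theorem prod_scal_eq {Z : (Fin N → ℂ) → ℂ} {u : ℂ} (hu : u ≠ 0) {β : ℂ → ℂ → ℂ}
    (hrot : ∀ z, Z (fun j => z (j + 1)) = u * Z z)
    (hβ : ∀ z, scal (z (col 0)) (z (col (0 + 1))) * Z z =
      β (z (col 0)) (z (col (0 + 1))) * Z (z ∘ Equiv.swap (col 0) (col (0 + 1)))) (ζ : ℕ → ℂ) :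
    (∏ j ∈ Finset.range (N - 1), scal (ζ 0) (ζ (j + 1))) * Z (fun j => ζ j) =
      (u * ∏ j ∈ Finset.range (N - 1), β (ζ 0) (ζ (j + 1))) * Z fun j => ζ j := by
  have hrot' : ∀ (k : ℕ) z, Z (fun j => z (j + col (k : ℤ))) = u ^ k * Z z := by
    intro k
    induction k with
    | zero => intro z; simp [col_zero]
    | succ k ih =>
      intro z
      have e : (fun j : Fin N => z (j + col ((k + 1 : ℕ) : ℤ))) =
          fun j : Fin N => (fun i => z (i + 1)) (j + col (k : ℤ)) := by
        funext j
        rw [Nat.cast_succ, col_add_one, ← add_assoc]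
      rw [e, ih fun i => z (i + 1), hrot z]
      ring
  have hk : ∀ (k : ℕ) z, scal (z (col k)) (z (col (k + 1))) * Z z =
      β (z (col k)) (z (col (k + 1))) * Z (z ∘ Equiv.swap (col k) (col (k + 1))) := by
    intro k z
    have e0 : (col 0 : Fin N) + col (k : ℤ) = col (k : ℤ) := by rw [col_zero, zero_add]
    have e1 : (col (0 + 1) : Fin N) + col (k : ℤ) = col ((k : ℤ) + 1) := by
      rw [col_add_one, col_add_one, col_zero, zero_add, add_comm]
    have h1 := hβ fun j => z (j + col (k : ℤ))
    have h2 : (fun j => z (j + col (k : ℤ))) ∘ Equiv.swap (col 0) (col (0 + 1)) =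
        fun j : Fin N => (z ∘ Equiv.swap (col (k : ℤ)) (col ((k : ℤ) + 1))) (j + col (k : ℤ)) := by
      funext j
      simp only [Function.comp, Equiv.swap_apply_def]
      congr 1
      rw [← e1]
      have i0 : j + col (k : ℤ) = col (k : ℤ) ↔ j = col 0 := by rw [col_zero]; simp
      have i1 : j + col (k : ℤ) = col (0 + 1) + col (k : ℤ) ↔ j = col (0 + 1) := add_left_inj _
      simp only [i0, i1]
      split_ifs <;> simp [e0]
    rw [h2, hrot', hrot'] at h1
    simp only [e0, e1] at h1
    refine mul_left_cancel₀ (pow_ne_zero k hu) ?_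
    linear_combination h1
  have main : ∀ k < N, (∏ j ∈ Finset.range k, scal (ζ 0) (ζ (j + 1))) * Z (fun j => ζ j) =
      (∏ j ∈ Finset.range k, β (ζ 0) (ζ (j + 1))) * Z fun j => moveSeq k ζ j := by
    intro k
    induction k with
    | zero =>
      intro _
      simp only [Finset.range_zero, Finset.prod_empty]
      congr 2
      funext j
      rw [moveSeq]
      split_ifs with h1 h2
      · omega
      · rw [h2]
      · rfl
    | succ k ih =>
      intro hkN
      have h1 := hk k fun j => moveSeq k ζ j
      have c0 : ((col (k : ℤ) : Fin N) : ℕ) = k := col_nat_val (by omega)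
      have c1 : ((col ((k : ℤ) + 1) : Fin N) : ℕ) = k + 1 := by
        rw [← Nat.cast_succ]
        exact col_nat_val hkN
      have m0 : moveSeq k ζ k = ζ 0 := by simp [moveSeq]
      have m1 : moveSeq k ζ (k + 1) = ζ (k + 1) := by simp [moveSeq]
      rw [comp_swap_col hkN, moveSeq_swap, c0, c1, m0, m1] at h1
      rw [Finset.prod_range_succ, Finset.prod_range_succ, mul_right_comm, ih (by omega)]
      linear_combination (∏ j ∈ Finset.range k, β (ζ 0) (ζ (j + 1))) * h1
  have hpos := NeZero.pos N
  rw [main (N - 1) (by omega)]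
  have e : (fun j : Fin N => moveSeq (N - 1) ζ j) =
      fun j : Fin N => (fun i : Fin N => ζ i) (j + 1) := by
    funext j
    have hj := j.2
    rw [moveSeq]
    split_ifs with h1 h2
    · congr 1
      rw [← col_val j, ← col_add_one, ← Nat.cast_succ, col_nat_val (by omega),
        col_nat_val (by omega)]
    · have e : (j : Fin N) + 1 = col 0 := by
        rw [← col_val j, ← col_add_one, h2, col_eq_iff]
        exact ⟨1, by push_cast [hpos]; ring⟩
      simp only [e, col_zero]
      rfl
    · omega
  rw [e, hrot fun i : Fin N => ζ i]
  ring

/-! ### Ground states are solutions of the exchange relations -/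

variable {N : ℕ} [NeZero N] {Ψ : State N → MvPolynomial (Fin N) ℂ}

theorem IsEigen.rot_of_sum (h : IsEigen Ψ) (h0 : Ψ ≠ 0)
    (hu : ∀ z, ∑ s, evalv Ψ (fun j => z (j + 1)) s = ∑ s, evalv Ψ z s) (z : Fin N → ℂ)
    (s : State N) : evalv Ψ z (rotState s) = evalv Ψ (fun j => z (j + 1)) s := by
  refine IsPoly.eq_of_mul (h.sum_ne_zero h0) (IsPoly.eval _)
    ((IsPoly.eval (Ψ s)).comp fun i => IsPoly.var (i + 1)) (fun z => ?_) z
  have e := h.rot z s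
  rw [hu] at e
  rw [map_sum]
  exact e

theorem xw_self (a : ℂ) (v : State N → ℂ) (i : ℤ) : faceOp i (xw a a) v = scal a a • v := by
  have e : ∀ b, b ≠ (false, false) → xw a a b = 0 := forced_faceWeight a
  rw [faceOp, LinearMap.sum_apply, Finset.sum_eq_single (false, false)]
  · rw [LinearMap.smul_apply, push_faceState_false]
    congr 1
    simp only [xw, faceWeight, omegaD, scal]
    linear_combination (-a ^ 2) * q_pow_three
  · intro b _ hb
    rw [e b hb, zero_smul, LinearMap.zero_apply]
  · exact fun hc => absurd (Finset.mem_univ _) hc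

/-- A primitive vector does not vanish on the diagonal. -/
theorem Primitive.exists_diagonal (hp : Primitive Ψ) (hN : 2 ≤ N) :
    ∃ z s, z (col (0 + 1)) = z (col 0) ∧ z (col 0) ≠ 0 ∧ evalv Ψ z s ≠ 0 := by
  by_contra! hc
  have hne := (col_succ_ne hN 0).symm
  have hd : X (col (0 + 1)) - X (col 0) ∣ (X (col 0) : MvPolynomial (Fin N) ℂ) :=
    hp _ _ fun s => (X_sub_X_dvd_iff hne).2 fun z hz => by
      rw [map_mul, eval_X, mul_eq_zero]
      exact or_iff_not_imp_left.2 fun h => hc z s hz h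
  have := (X_sub_X_dvd_iff hne).1 hd (fun _ => 1) rfl
  simp at this

/-- The unknown factor in the exchange relation is the known one. -/
theorem IsEigen.factor_eq (h : IsEigen Ψ) (hp : Primitive Ψ) (h0 : Ψ ≠ 0) (hN : 2 ≤ N)
    {B : MvPolynomial (Fin N) ℂ} (hB : scalPoly N * ∑ s, Ψ s =
      rename (Equiv.swap (col 0) (col (0 + 1))) (∑ s, Ψ s) * B)
    (hx : ∀ z s, faceOp 0 (xw (z (col 0)) (z (col (0 + 1)))) (evalv Ψ z) s =
        eval z B * evalv Ψ (z ∘ Equiv.swap (col 0) (col (0 + 1))) s)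
    {u : ℂ} (hu0 : u ≠ 0)
    (hu : ∀ z, ∑ s, evalv Ψ (fun j => z (j + 1)) s = u * ∑ s, evalv Ψ z s) :
    B = scalPoly N ∧ u = 1 := by
  set Z := ∑ s, Ψ s with hZ
  have hZ0 : Z ≠ 0 := h.sum_ne_zero h0
  have eZ : ∀ z, eval z Z = ∑ s, evalv Ψ z s := fun z => by rw [hZ, map_sum]; rfl
  have hne := (col_succ_ne hN 0 : (col 0 : Fin N) ≠ col (0 + 1))
  let β : ℂ → ℂ → ℂ := fun x y => eval (fun j : Fin N => if j = col 0 then x else y) B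
  have hβ : ∀ z, eval z B = β (z (col 0)) (z (col (0 + 1))) := fun z =>
    eval_eq_of_degreeOf_zero fun c hc => degreeOf_eq_zero_of_exch hZ0 hN hB
      (fun e => hc (by rw [e, if_pos rfl])) (fun e => hc (by rw [e, if_neg hne.symm]))
  have hloop := prod_scal_eq (Z := fun z => eval z Z) hu0 (β := β)
    (fun z => by rw [eZ, eZ, hu]) (fun z => by
      have e := congrArg (eval z) hB
      rw [map_mul, map_mul, eval_scalPoly, eval_rename_equiv, hβ] at e
      rw [e, mul_comm])
  have iS : ∀ i j : ℕ, IsPoly fun z : Fin N → ℂ => scal (natExt z i) (natExt z j) := fun i j =>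
    ((IsPoly.const q).mul ((isPoly_natExt _).pow 2)).sub ((isPoly_natExt _).pow 2)
  have iB : ∀ i j : ℕ, IsPoly fun z : Fin N → ℂ => β (natExt z i) (natExt z j) := fun i j =>
    (IsPoly.eval B).comp fun c => IsPoly.ite _ (isPoly_natExt _) (isPoly_natExt _)
  have i1 : IsPoly fun z : Fin N → ℂ =>
      ∏ j ∈ Finset.range (N - 1), scal (natExt z 0) (natExt z (j + 1)) :=
    IsPoly.prod _ fun j _ => iS 0 (j + 1)
  have i2 : IsPoly fun z : Fin N → ℂ =>
      u * ∏ j ∈ Finset.range (N - 1), β (natExt z 0) (natExt z (j + 1)) :=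
    (IsPoly.const u).mul (IsPoly.prod _ fun j _ => iB 0 (j + 1))
  have hprod := IsPoly.eq_of_mul hZ0 i1 i2 fun z => by
    have e := hloop (natExt z)
    simp only [natExt_val] at e
    rw [mul_comm, e, mul_comm]
  -- All parameters except the first are set equal in the monodromy condition.
  have hpow : scalPoly N ^ (N - 1) = C u * B ^ (N - 1) := MvPolynomial.funext fun z => by
    have e := hprod fun j => if j = col 0 then z (col 0) else z (col (0 + 1))
    have n0 : natExt (fun j : Fin N => if j = col 0 then z (col 0) else z (col (0 + 1))) 0 =
        z (col 0) := by
      have := congrFun (natExt_val fun j : Fin N => if j = col 0 then z (col 0) else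
        z (col (0 + 1))) (col 0)
      rw [if_pos rfl, col_zero] at this
      rw [col_zero]
      exact this
    have n1 : ∀ j ∈ Finset.range (N - 1), natExt (fun j : Fin N => if j = col 0 then z (col 0) else
        z (col (0 + 1))) (j + 1) = z (col (0 + 1)) := fun j hj => by
      have hj : j + 1 < N := by rw [Finset.mem_range] at hj; omega
      have := congrFun (natExt_val fun j : Fin N => if j = col 0 then z (col 0) else
        z (col (0 + 1))) ⟨j + 1, hj⟩
      rw [if_neg (by rw [col_zero, Fin.ext_iff]; simp)] at this
      exact this
    rw [n0, Finset.prod_congr rfl fun j hj => by rw [n1 j hj],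
      Finset.prod_congr (f := fun j => β _ _) rfl fun j hj => by rw [n1 j hj],
      Finset.prod_const, Finset.prod_const, Finset.card_range] at e
    rw [map_pow, map_mul, map_pow, eval_C, eval_scalPoly, hβ, e]
  have hN1 : N - 1 ≠ 0 := by omega
  -- Divisibility of the powers descends to the polynomials themselves, so B and `scalPoly` differ
  -- by a constant ε.
  have d1 : B ∣ scalPoly N := (IsIntegrallyClosed.pow_dvd_pow_iff hN1).1 ⟨C u, by
    rw [hpow, mul_comm]⟩
  have d2 : scalPoly N ∣ B := (IsIntegrallyClosed.pow_dvd_pow_iff hN1).1 ⟨C u⁻¹, by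
    rw [hpow, mul_right_comm, ← C_mul, mul_inv_cancel₀ hu0, C_1, one_mul]⟩
  obtain ⟨w, hw⟩ := associated_of_dvd_dvd d2 d1
  obtain ⟨ε, -, hε⟩ := isUnit_iff_eq_C_of_isReduced.1 w.isUnit
  rw [hε] at hw
  -- On the diagonal z_0 = z_1 the face operator is multiplication by `scal`. A primitive vector
  -- does not vanish there, so ε = 1, and then u = 1.
  obtain ⟨z, s, hz1, hz0, hzs⟩ := hp.exists_diagonal hN
  have hzz : z ∘ Equiv.swap (col 0) (col (0 + 1)) = z := by
    funext j
    simp only [Function.comp, Equiv.swap_apply_def]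
    split_ifs with h1 h2
    · rw [h1, hz1]
    · rw [h2, hz1]
    · rfl
  have e := hx z s
  rw [hz1, hzz, xw_self, Pi.smul_apply, smul_eq_mul, ← hw, map_mul, eval_scalPoly, hz1, eval_C] at e
  have e2 : scal (z (col 0)) (z (col 0)) ≠ 0 := by
    rw [scal, ← sub_one_mul]
    exact mul_ne_zero (sub_ne_zero.2 q_ne_one) (pow_ne_zero 2 hz0)
  have hε1 : ε = 1 := by
    refine mul_left_cancel₀ e2 ?_
    rw [mul_one]
    exact (mul_right_cancel₀ hzs e).symm
  have hBS : B = scalPoly N := by rw [← hw, hε1, C_1, mul_one]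
  refine ⟨hBS, ?_⟩
  rw [hBS] at hpow
  have hS := pow_ne_zero (N - 1) (scalPoly_ne_zero hN)
  have : (C u : MvPolynomial (Fin N) ℂ) = C 1 := by
    refine mul_right_cancel₀ hS ?_
    rw [← hpow, C_1, one_mul]
  exact C_injective _ _ this

theorem IsEigen.good (h : IsEigen Ψ) (hp : Primitive Ψ) (h0 : Ψ ≠ 0) : Good Ψ := by
  rcases Nat.lt_or_ge N 2 with hN | hN
  · refine ⟨fun h2 => absurd h2 (by omega), h.rot_of_sum h0 fun z => ?_⟩
    obtain rfl : N = 1 := by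
      have := NeZero.pos N
      omega
    congr 1
    funext s
    congr 1
    funext j
    rw [Subsingleton.elim (j + 1) j]
  · obtain ⟨B, hB, hx⟩ := h.exists_exch hp h0 hN
    obtain ⟨u, hu0, hu⟩ := h.exists_rot hp
    obtain ⟨rfl, rfl⟩ := h.factor_eq hp h0 hN hB hx hu0 hu
    refine ⟨fun _ z => ?_, h.rot_of_sum h0 fun z => by rw [hu, one_mul]⟩
    funext s
    rw [hx, eval_scalPoly]
    rfl

theorem IsGroundState.isEigen (h : IsGroundState Ψ) : IsEigen Ψ := fun z c => by
  have := h.eigen (z c) z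
  rw [mulVec_transferMatrix rfl] at this
  exact this

/-- The constant in the factorization does not vanish. -/
theorem Good.factorizes_ne_zero (h : Good Ψ) (h0 : Ψ ≠ 0) {c : ℂ} (hc : Factorizes Ψ c) :
    c ≠ 0 := by
  rintro rfl
  obtain ⟨F, hF⟩ := h.trivialFactor_dvd (m := 0) (Nat.zero_le N)
  have hF0 : F = 0 := MvPolynomial.funext fun z => by
    obtain ⟨ζ, rfl⟩ := exists_nat_ext z
    rw [hc 0 N (zero_add N) F hF, map_zero]
    ring
  -- The component of kind (0, N) is zero, and this single condition kills the whole vector by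
  -- uniqueness.
  rw [hF0, mul_zero] at hF
  classical
  apply h0
  funext s
  refine MvPolynomial.funext fun z => ?_
  refine IsPoly.eq_of_mul (X_ne_zero (col 0)) (IsPoly.eval _) (IsPoly.eval _) (fun z => ?_) z
  rw [eval_X, Pi.zero_apply, map_zero, mul_zero, mul_eq_zero]
  refine or_iff_not_imp_left.2 fun hz => evalv_eq_zero 0 hz Ψ
    (Pi.single (nested N 0, nested N 0) 1) (Pi.single_eq_same _ _)
    (fun y hy => hy ▸ h.rowOp_evalv y _) (fun y _ => ?_) z rfl s
  rw [Finset.sum_eq_single (nested N 0, nested N 0)]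
  · have e : Ψ (nested N 0, nested N 0) = 0 := by
      have := hF
      rwa [mnc, Nat.cast_zero] at this
    rw [evalv, e, map_zero, mul_zero]
  · intro b _ hb
    rw [Pi.single_eq_of_ne hb, zero_mul]
  · exact fun hc => absurd (Finset.mem_univ _) hc

/-- Rotations permute the components and shift the variables, so a bound for all components in one
variable holds in every variable. -/
theorem Good.degreeOf_le_of_degreeOf_le (h : Good Ψ) {D : ℕ} {i : Fin N}
    (hd : ∀ s, degreeOf i (Ψ s) ≤ D) (s : State N) (j : Fin N) : degreeOf j (Ψ s) ≤ D := by
  have step : ∀ (i : Fin N), (∀ s, degreeOf i (Ψ s) ≤ D) → ∀ s, degreeOf (i + 1) (Ψ s) ≤ D := by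
    intro i hi s'
    obtain ⟨s, rfl⟩ := rotState_surjective s'
    have e : Ψ (rotState s) = rename (Equiv.addRight (1 : Fin N)) (Ψ s) :=
      MvPolynomial.funext fun z => by
        rw [eval_rename_equiv]
        exact h.rot z s
    rw [e]
    exact (degreeOf_rename_of_injective (p := Ψ s) (Equiv.addRight (1 : Fin N)).injective i).trans_le
      (hi s)
  have key : ∀ (k : ℕ) s, degreeOf (i + col (k : ℤ)) (Ψ s) ≤ D := by
    intro k
    induction k with
    | zero => rwa [Nat.cast_zero, col_zero, add_zero]
    | succ k ih =>
      rw [Nat.cast_succ, col_add_one, ← add_assoc]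
      exact step _ ih
  have := key ((j - i : Fin N) : ℕ) s
  rwa [col_val, add_sub_cancel] at this

theorem IsEigen.of_mul {Φ : State N → MvPolynomial (Fin N) ℂ} {g : MvPolynomial (Fin N) ℂ}
    (hg : g ≠ 0) (h : IsEigen fun s => g * Φ s) : IsEigen Φ := fun z c => by
  funext s
  have i1 : IsPoly fun z : Fin N → ℂ => rowOp (wt (z c) z) (evalv Φ z) s :=
    isPoly_rowOp (fun s => IsPoly.eval _)
      (fun c' b => IsPoly.faceWeight _ _ (IsPoly.var c') (IsPoly.var c)) s
  have i2 : IsPoly fun z : Fin N → ℂ => ev (z c) z * evalv Φ z s :=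
    (IsPoly.prod _ fun i _ => ((IsPoly.const q).mul ((IsPoly.var c).pow 2)).sub
      ((IsPoly.var i).pow 2)).mul (IsPoly.eval _)
  refine IsPoly.eq_of_mul hg i1 i2 (fun z => ?_) z
  have e : evalv (fun s => g * Φ s) z = eval z g • evalv Φ z := by
    funext s
    exact map_mul _ _ _
  have := congrFun (h z c) s
  rw [e, map_smul] at this
  simp only [Pi.smul_apply, smul_eq_mul] at this
  rw [this]
  ring

theorem degreeOf_sum_X_le (j : Fin N) : degreeOf j (∑ i : Fin N, X i : MvPolynomial (Fin N) ℂ) ≤ 1 :=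
  (degreeOf_sum_le _ _ _).trans (Finset.sup_le fun i _ => by
    rw [degreeOf_X]
    split_ifs <;> omega)

/-- A non-zero solution of the exchange relations does not have too small degrees. -/
theorem Good.not_degreeOf_lt {Φ : State N → MvPolynomial (Fin N) ℂ} (h : Good Φ) (h0 : Φ ≠ 0)
    (hd : ∀ s i, degreeOf i (Φ s) + 1 ≤ 2 * (N - 1)) : False := by
  -- Multiplication by this symmetric linear form stays within the degree bound, so both vectors
  -- factorize. Comparing them gives Q c = c', hence c = 0 at the points 0 and e_0.
  let Q : MvPolynomial (Fin N) ℂ := ∑ i : Fin N, X i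
  have hQ : ∀ z, eval z Q = ∑ i, z i := fun z => by
    rw [map_sum]
    exact Finset.sum_congr rfl fun i _ => eval_X i
  have hQΦ : Good fun s => Q * Φ s := h.mul fun z π => by
    rw [hQ, hQ]
    exact Equiv.sum_comp π z
  obtain ⟨c, hc⟩ := Good.exists_factorizes N h fun s i => (Nat.le_succ _).trans (hd s i)
  obtain ⟨c', hc'⟩ := Good.exists_factorizes N hQΦ fun s i =>
    (degreeOf_mul_le _ _ _).trans ((Nat.add_le_add_right (degreeOf_sum_X_le i) _).trans
      (by rw [add_comm]; exact hd s i))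
  obtain ⟨F, hF⟩ := h.trivialFactor_dvd (m := 0) (Nat.zero_le N)
  have key : ∀ z : Fin N → ℂ, eval z (Q * C c) = eval z (C c') :=
    IsPoly.eq_of_mul (rotorP_ne_zero N) (IsPoly.eval _) (IsPoly.eval _) fun z => by
      obtain ⟨ζ, rfl⟩ := exists_nat_ext z
      have e1 := hc 0 N (zero_add N) F hF ζ
      have e2 := hc' 0 N (zero_add N) (Q * F) (by simp only [hF]; ring) ζ
      have k0 : kap 0 N = 1 := if_neg (by simp)
      simp only [pv_zero, k0, zero_add, mul_one] at e1 e2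
      rw [map_mul, e1] at e2
      rw [map_mul, eval_C, eval_C]
      change pv N ζ * _ = pv N ζ * _
      have e3 : (pv N fun j => ζ j) = pv N ζ := rfl
      rw [e3] at e2
      linear_combination e2
  have z0 := key 0
  have z1 := key (Pi.single 0 1)
  rw [map_mul, hQ, eval_C, eval_C] at z0 z1
  rw [Finset.sum_pi_single', if_pos (Finset.mem_univ _), one_mul] at z1
  simp only [Pi.zero_apply, Finset.sum_const_zero, zero_mul] at z0
  exact h.factorizes_ne_zero h0 hc (z1.trans z0.symm)

/-- Ground states satisfy the exchange relations. -/
theorem IsGroundState.good (h : IsGroundState Ψ) : Good Ψ := by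
  have : Nonempty (State N) := ⟨(nested N 0, nested N 0)⟩
  obtain ⟨g, Φ, hg, hΨ, hp⟩ := exists_primitive h.ne_zero
  have hΨ' : Ψ = fun s => g * Φ s := _root_.funext hΨ
  have hΦ0 : Φ ≠ 0 := by
    rintro rfl
    exact h.ne_zero (_root_.funext fun s => by rw [hΨ, Pi.zero_apply, mul_zero])
  have hΦ : Good Φ := (IsEigen.of_mul hg (hΨ' ▸ h.isEigen)).good hp hΦ0
  -- A variable in the common divisor g lowers the degree of all components of Φ in that variable,
  -- hence by rotation in every variable. Otherwise g is constant and therefore symmetric.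
  by_cases hc : ∃ i, degreeOf i g ≠ 0
  · obtain ⟨i, hi⟩ := hc
    have hd : ∀ s, Φ s ≠ 0 → degreeOf i g + degreeOf i (Φ s) ≤ 2 * (N - 1) := fun s hs => by
      have := h.degree s i
      rwa [hΨ, degreeOf_mul_eq hg hs] at this
    obtain ⟨s₀, hs₀⟩ := Function.ne_iff.1 hΦ0
    have h1 := hd s₀ hs₀
    refine (hΦ.not_degreeOf_lt hΦ0 fun s j => ?_).elim
    have := hΦ.degreeOf_le_of_degreeOf_le (D := 2 * (N - 1) - 1) (i := i) (fun s => by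
      by_cases hs : Φ s = 0
      · simp [hs]
      · have := hd s hs
        omega) s j
    omega
  · push Not at hc
    rw [hΨ']
    exact hΦ.mul fun z π => eval_eq_of_degreeOf_zero fun c _ => hc c

/-! ### Alternants -/

/-- The alternant with exponents `e`. -/
noncomputable def alternant {N : ℕ} (e : ℕ → ℕ) (u : Fin N → ℂ) : ℂ :=
  (Matrix.of fun i j : Fin N => u i ^ e j).det

variable {n : ℕ}

/-- The indices `0` and `1` and the other ones. -/
def splitTwo (n : ℕ) : Fin 2 ⊕ Fin n ≃ Fin (n + 2) :=
  finSumFinEquiv.trans (finCongr (add_comm 2 n))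

theorem splitTwo_inl (i : Fin 2) : ((splitTwo n (Sum.inl i) : Fin (n + 2)) : ℕ) = i := rfl

theorem splitTwo_inr (j : Fin n) : ((splitTwo n (Sum.inr j) : Fin (n + 2)) : ℕ) = 2 + j := rfl

/-- If the exponents satisfy a linear recursion, an alternant factors when two of the variables are
roots of its characteristic polynomial. -/
theorem alternant_splitTwo {e : ℕ → ℕ} {β γ : ℂ} {h : ℂ → ℂ}
    (he : ∀ j t, t ^ e (j + 2) = β * t ^ e (j + 1) + γ * t ^ e j + h t * t ^ e j)
    (v : Fin 2 ⊕ Fin n → ℂ) (h0 : h (v (Sum.inl 0)) = 0) (h1 : h (v (Sum.inl 1)) = 0) :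
    (Matrix.of fun i j => v i ^ e (splitTwo n j)).det =
      (v (Sum.inl 0) ^ e 0 * v (Sum.inl 1) ^ e 1 - v (Sum.inl 0) ^ e 1 * v (Sum.inl 1) ^ e 0) *
        (∏ j, h (v (Sum.inr j))) * alternant e fun j => v (Sum.inr j) := by
  -- Unipotent column operations: from column j the combination of the columns j - 1 and j - 2
  -- prescribed by the recursion is subtracted. The two rows at roots of h then vanish outside the
  -- first two columns.
  let B : Matrix (Fin (n + 2)) (Fin (n + 2)) ℂ := Matrix.of fun i j =>
    (if i = j then 1 else 0) - (if 2 ≤ (j : ℕ) then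
      (if i = ⟨j - 1, by omega⟩ then β else 0) + if i = ⟨j - 2, by omega⟩ then γ else 0 else 0)
  have hB : B.det = 1 := by
    rw [Matrix.det_of_isUpperTriangular]
    · refine Finset.prod_eq_one fun i _ => ?_
      simp only [B, Matrix.of_apply, if_true, Fin.ext_iff]
      split_ifs <;> first | omega | simp
    · intro i j hij
      have hij' : (j : ℕ) < i := hij
      simp only [B, Matrix.of_apply, Fin.ext_iff]
      split_ifs <;> first | omega | simp
  have hmul : (Matrix.of fun i j => v i ^ e (splitTwo n j)) * B.submatrix (splitTwo n) (splitTwo n) =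
      Matrix.fromBlocks (Matrix.of fun i j : Fin 2 => v (Sum.inl i) ^ e j) 0
        (Matrix.of fun (i : Fin n) (j : Fin 2) => v (Sum.inr i) ^ e j)
        (Matrix.of fun i j : Fin n => h (v (Sum.inr i)) *
          (Matrix.of fun i j : Fin n => v (Sum.inr i) ^ e j) i j) := by
    have key : ∀ i (j : Fin (n + 2)), ((Matrix.of fun i j => v i ^ e (splitTwo n j)) *
        B.submatrix (splitTwo n) (splitTwo n)) i ((splitTwo n).symm j) = v i ^ e j -
          if 2 ≤ (j : ℕ) then v i ^ e (j - 1) * β + v i ^ e (j - 2) * γ else 0 := fun i j => by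
      rw [Matrix.mul_apply]
      refine ((splitTwo n).sum_comp fun k => v i ^ e k * B k _).trans ?_
      simp only [B, Matrix.of_apply, Equiv.apply_symm_apply, mul_sub, Finset.sum_sub_distrib,
        mul_ite, mul_one, mul_zero, Finset.sum_ite_eq', Finset.mem_univ, if_true]
      split_ifs
      · simp [mul_add, Finset.sum_add_distrib]
      · simp
    have hr : ∀ i (j : Fin n), ((Matrix.of fun i j => v i ^ e (splitTwo n j)) *
        B.submatrix (splitTwo n) (splitTwo n)) i (Sum.inr j) = h (v i) * v i ^ e j := fun i j => by
      have := key i (splitTwo n (Sum.inr j))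
      rw [Equiv.symm_apply_apply, splitTwo_inr, if_pos (by omega),
        show 2 + (j : ℕ) - 1 = j + 1 by omega, show 2 + (j : ℕ) - 2 = j by omega, add_comm 2,
        he] at this
      rw [this]
      ring
    have hl : ∀ i (j : Fin 2), ((Matrix.of fun i j => v i ^ e (splitTwo n j)) *
        B.submatrix (splitTwo n) (splitTwo n)) i (Sum.inl j) = v i ^ e j := fun i j => by
      have := key i (splitTwo n (Sum.inl j))
      rwa [Equiv.symm_apply_apply, splitTwo_inl, if_neg (by omega), sub_zero] at this
    ext (i | i) (j | j)
    · exact hl _ j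
    · rw [hr, Matrix.fromBlocks_apply₁₂, Matrix.zero_apply]
      fin_cases i
      · simp [h0]
      · simp [h1]
    · exact hl _ j
    · exact hr _ j
  have := congrArg Matrix.det hmul
  rw [Matrix.det_mul, Matrix.det_submatrix_equiv_self, hB, mul_one, Matrix.det_fromBlocks_zero₁₂,
    Matrix.det_mul_column, Matrix.det_fin_two] at this
  rw [this, alternant]
  simp only [Matrix.of_apply, Fin.val_zero, Fin.val_one]
  ring

/-- The sign depends only on the arrangement of the rows, not on the exponents, so it enters both
sides of `SumFormula` as a square. -/
theorem exists_sign_alternant (σ : Fin 2 ⊕ Fin n ≃ Fin (n + 2)) : ∃ ε : ℂ, ε * ε = 1 ∧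
    ∀ (e : ℕ → ℕ) (v : Fin (n + 2) → ℂ) (β γ : ℂ) (h : ℂ → ℂ),
      (∀ j t, t ^ e (j + 2) = β * t ^ e (j + 1) + γ * t ^ e j + h t * t ^ e j) →
      h (v (σ (Sum.inl 0))) = 0 → h (v (σ (Sum.inl 1))) = 0 →
      alternant e v = ε * ((v (σ (Sum.inl 0)) ^ e 0 * v (σ (Sum.inl 1)) ^ e 1 -
        v (σ (Sum.inl 0)) ^ e 1 * v (σ (Sum.inl 1)) ^ e 0) *
        (∏ j, h (v (σ (Sum.inr j)))) * alternant e fun j => v (σ (Sum.inr j))) := by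
  have hs : ∀ s : ℤˣ, ((s : ℤ) : ℂ) * ((s : ℤ) : ℂ) = 1 := fun s => by
    rw [← Int.cast_mul, ← Units.val_mul, Int.units_mul_self, Units.val_one, Int.cast_one]
  refine ⟨_, hs (Equiv.Perm.sign (σ.trans (splitTwo n).symm)), fun e v β γ h he h0 h1 => ?_⟩
  rw [← alternant_splitTwo he (fun i => v (σ i)) h0 h1, alternant,
    ← Matrix.det_submatrix_equiv_self (splitTwo n)]
  have := Matrix.det_permute (σ.trans (splitTwo n).symm)
    ((Matrix.of fun i j : Fin (n + 2) => v i ^ e j).submatrix (splitTwo n) (splitTwo n))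
  rw [Matrix.submatrix_submatrix] at this
  have e2 : (Matrix.of fun i j : Fin (n + 2) => v i ^ e j).submatrix
      (splitTwo n ∘ (σ.trans (splitTwo n).symm)) (splitTwo n ∘ id) =
      Matrix.of fun i j => v (σ i) ^ e (splitTwo n j) := by
    ext i j
    simp
  rw [e2] at this
  rw [this, ← mul_assoc, hs, one_mul]

theorem isPoly_alternant {N : ℕ} (e : ℕ → ℕ) :
    IsPoly fun z : Fin N → ℂ => alternant e fun i => z i ^ 2 :=
  IsPoly.det (M := fun z => Matrix.of fun i j : Fin N => (z i ^ 2) ^ e j) fun i _ =>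
    ((IsPoly.var i).pow 2).pow _

theorem alternant_eq_zero {N : ℕ} (e : ℕ → ℕ) {u : Fin N → ℂ} {i j : Fin N} (hij : i ≠ j)
    (h : u i = u j) : alternant e u = 0 :=
  Matrix.det_zero_of_row_eq hij (by funext l; simp [h])

theorem alternant_id_ne_zero {N : ℕ} {u : Fin N → ℂ} (h : Function.Injective u) :
    alternant (fun j => j) u ≠ 0 :=
  Matrix.det_vandermonde_ne_zero_iff.2 h

theorem schur_eq {N : ℕ} (lam : Fin N → ℕ) (e : ℕ → ℕ) (u : Fin N → ℂ)
    (h : ∀ j : Fin N, lam j + (N - 1 - j) = e (Fin.rev j)) :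
    schur lam u = alternant e u / alternant (fun j => j) u := by
  have key : ∀ f : ℕ → ℕ, (Matrix.of fun i j : Fin N => u i ^ f (Fin.rev j)).det =
      Equiv.Perm.sign (Fin.revPerm (n := N)) * alternant f u := fun f =>
    Matrix.det_permute' (Fin.revPerm (n := N)) (Matrix.of fun i j : Fin N => u i ^ f j)
  have e1 : (fun i j : Fin N => u i ^ (N - 1 - (j : ℕ))) = fun i j => u i ^ ((Fin.rev j : ℕ)) := by
    funext i j
    rw [Fin.val_rev, Nat.sub_sub, add_comm 1]
  have h0 : (((Equiv.Perm.sign (Fin.revPerm (n := N)) : ℤˣ) : ℤ) : ℂ) ≠ 0 := by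
    rcases Int.units_eq_one_or (Equiv.Perm.sign (Fin.revPerm (n := N))) with h | h <;> simp [h]
  simp only [schur, h]
  rw [key e, e1, key fun j => j, mul_div_mul_left _ _ h0]

/-! ### The normalization -/

/-- The sum of the components is `d` times a product of two Schur functions. -/
def SumFormula {N : ℕ} [NeZero N] (Ψ : State N → MvPolynomial (Fin N) ℂ) (d : ℂ) : Prop :=
  ∀ z : Fin N → ℂ, (∑ s, evalv Ψ z s) * alternant (fun j => j) (fun i => z i ^ 2) ^ 2 =
    d * (alternant (fun j => j + j / 2) (fun i => z i ^ 2) *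
      alternant (fun j => j + (j + 1) / 2) fun i => z i ^ 2)

/-- At points with coinciding squares all alternants vanish, so the identity without denominators
holds everywhere and may be specialized. -/
theorem IsNormalized.sumFormula {N : ℕ} [NeZero N] {Ψ : State N → MvPolynomial (Fin N) ℂ}
    (h : IsNormalized Ψ) : SumFormula Ψ 1 := fun z => by
  by_cases hz : Function.Injective fun i => z i ^ 2
  · have hV := alternant_id_ne_zero hz
    have e := h z hz
    rw [schur_eq _ (fun j => j + j / 2) _ fun j => by rw [Fin.val_rev]; omega,
      schur_eq _ (fun j => j + (j + 1) / 2) _ fun j => by rw [Fin.val_rev]; omega] at e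
    simp only [evalv]
    rw [e]
    field_simp
  · simp only [Function.Injective, not_forall] at hz
    obtain ⟨i, j, hij, hne⟩ := hz
    rw [alternant_eq_zero _ hne hij, alternant_eq_zero _ hne hij]
    ring

variable {n : ℕ}

theorem bijective_sum_elim_zero_last : Function.Bijective
    (Sum.elim ![0, Fin.last (n + 1)] fun j : Fin n => j.castSucc.succ :
      Fin 2 ⊕ Fin n → Fin (n + 2)) := by
  refine (Fintype.bijective_iff_injective_and_card _).2 ⟨?_, by simp [add_comm]⟩
  rintro (i | i) (j | j) h
  · fin_cases i <;> fin_cases j <;> simp [Fin.ext_iff] at h ⊢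
  · have := j.2
    fin_cases i <;> simp [Fin.ext_iff] at h
    omega
  · have := i.2
    fin_cases j <;> simp [Fin.ext_iff] at h
    omega
  · simpa [Fin.ext_iff] using h

/-- At (1, z, -q) two of the squares are 1 and q². The exponents j + ⌊j/2⌋ and j + ⌊(j+1)/2⌋ grow by
3 every two steps, so their alternants split off t³ - 1; the Vandermonde determinant splits off (t -
1) (t - q²). The quotient t - q squared matches `quadProd`, and the 2 × 2 minors give (q - 1) / (q²
- 1) = -q. -/
theorem SumFormula.restr [NeZero n] {Ψ : State (n + 2) → MvPolynomial (Fin (n + 2)) ℂ} (h : Good Ψ)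
    {d : ℂ} (hd : SumFormula Ψ d) {Φ : State n → MvPolynomial (Fin n) ℂ}
    (hΦ : ∀ s, Rotor.restr Ψ 1 s = quadProd n 1 ^ 2 * Φ s) : SumFormula Φ (-q * d) := by
  obtain ⟨ε, hε, key⟩ := exists_sign_alternant (Equiv.ofBijective _ (bijective_sum_elim_zero_last (n := n)))
  refine IsPoly.eq_of_mul (p := (∏ j : Fin n, ((X j ^ 2) ^ 3 - 1)) ^ 2) (fun h0 => ?_)
    ((IsPoly.sum _ fun s _ => IsPoly.eval _).mul ((isPoly_alternant _).pow 2))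
    ((IsPoly.const _).mul ((isPoly_alternant _).mul (isPoly_alternant _))) fun z => ?_
  · have := congrArg (eval fun _ => 0) h0
    simp at this
  · have hZ : ∑ s, evalv Ψ (bpt 1 z) s =
        (∏ j, (z j ^ 2 - q)) ^ 2 * ∑ s, evalv Φ z s := by
      rw [h.evalv_bpt, sum_push, Finset.mul_sum]
      refine Finset.sum_congr rfl fun s _ => ?_
      rw [evalv, hΦ, map_mul, map_pow, eval_quadProd, one_pow, mul_one]
      rfl
    have hb0 : bpt 1 z 0 = 1 := bpt_zero 1 z rfl
    have hb1 : bpt 1 z (Fin.last (n + 1)) = -q := (bpt_last 1 z rfl).trans (mul_one _)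
    have hb2 : ∀ j : Fin n, bpt 1 z j.castSucc.succ = z j := fun j => bpt_mid 1 z j rfl
    have h3 := q_pow_three
    have hq : 1 + q + q ^ 2 = 0 := by rw [q_sq]; ring
    have k1 := key (fun j => j) (fun i => bpt 1 z i ^ 2) (1 + q ^ 2) (-q ^ 2)
      (fun t => (t - 1) * (t - q ^ 2)) (fun j t => by ring) (by simp [hb0]) (by simp [hb1])
    have k2 := key (fun j => j + j / 2) (fun i => bpt 1 z i ^ 2) 0 1 (fun t => t ^ 3 - 1)
      (fun j t => by
        rw [show j + 2 + (j + 2) / 2 = j + j / 2 + 3 by omega]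
        ring) (by simp [hb0]) (by simp [hb1]; linear_combination (q ^ 3 + 1) * h3)
    have k3 := key (fun j => j + (j + 1) / 2) (fun i => bpt 1 z i ^ 2) 0 1 (fun t => t ^ 3 - 1)
      (fun j t => by
        rw [show j + 2 + (j + 2 + 1) / 2 = j + (j + 1) / 2 + 3 by omega]
        ring) (by simp [hb0]) (by simp [hb1]; linear_combination (q ^ 3 + 1) * h3)
    have e := hd (bpt 1 z)
    rw [k1, k2, k3, hZ] at e
    simp only [Equiv.ofBijective_apply, Sum.elim_inl, Sum.elim_inr, Matrix.cons_val_zero,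
      Matrix.cons_val_one, hb0, hb1, hb2] at e
    have hp : ∏ j, ((z j ^ 2) ^ 3 - 1) =
        (∏ j, (z j ^ 2 - q)) * ∏ j, ((z j ^ 2 - 1) * (z j ^ 2 - q ^ 2)) := by
      rw [← Finset.prod_mul_distrib]
      refine Finset.prod_congr rfl fun j _ => ?_
      linear_combination (z j ^ 4 - z j ^ 2) * hq + (1 - z j ^ 2) * h3
    simp only [map_pow, map_prod, map_sub, eval_X, map_one]
    rw [hp]
    generalize ∏ j, (z j ^ 2 - q) = A at *
    generalize ∏ j, ((z j ^ 2 - 1) * (z j ^ 2 - q ^ 2)) = B at *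
    generalize alternant (fun j => j) _ = V at *
    generalize alternant (fun j => j + j / 2) _ = a at *
    generalize alternant (fun j => j + (j + 1) / 2) _ = b at *
    generalize ∑ s, evalv Φ z s = Z at *
    grind

instance : Subsingleton (LinkPattern 1) := ⟨fun σ τ => by
  ext i
  have := σ.partner_lt i
  have := σ.lt_partner i
  have := τ.partner_lt i
  have := τ.lt_partner i
  push_cast at *
  omega⟩

theorem Good.eval_mnc_zero {N : ℕ} [NeZero N] {Ψ : State N → MvPolynomial (Fin N) ℂ} (h : Good Ψ)
    {c : ℂ} (hc : Factorizes Ψ c) (ζ : ℕ → ℂ) :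
    evalv Ψ (fun j => ζ j) (mnc N 0) = pairProd N ζ * (c * pv N ζ) := by
  obtain ⟨F, hF⟩ := h.trivialFactor_dvd (Nat.zero_le N)
  rw [evalv, hF, map_mul, hc 0 N (zero_add N) F hF, eval_trivialFactor_of_eq (zero_add N), pv_zero,
    kap, if_neg (by simp)]
  simp [pairProd, crossProd]

/-- At (1, -q) only the state without an arc from 0 to 1 in either colour survives. This is the base
case in place of a restriction to zero points. -/
theorem Good.sum_two {Ψ : State 2 → MvPolynomial (Fin 2) ℂ} (h : Good Ψ) {c : ℂ}
    (hc : Factorizes Ψ c) : ∑ s, evalv Ψ ![1, -q] s = -q * c := by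
  have hq := q_pow_three
  have hq2 := q_sq
  have e0 : (fun j : Fin 2 => (fun i : ℕ => if i = 0 then (1 : ℂ) else -q) j) = ![1, -q] := by
    funext j
    fin_cases j <;> rfl
  have e1 : (fun j : Fin 2 => (fun i : ℕ => if i = 0 then -q else (1 : ℂ)) j) =
      fun j => (![1, -q] : Fin 2 → ℂ) (j + col ((1 : ℕ) : ℤ)) := by
    funext j
    fin_cases j <;> rfl
  have t00 : evalv Ψ ![1, -q] (nested 2 0, nested 2 0) = -q * c := by
    have := h.eval_mnc_zero hc fun i : ℕ => if i = 0 then (1 : ℂ) else -q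
    rw [e0, pv_two] at this
    refine this.trans ?_
    simp [pairProd, Finset.prod_range_succ]
    grind
  have t11 : evalv Ψ ![1, -q] (nested 2 1, nested 2 1) = 0 := by
    have := h.rot_nested 0 0 1 ![1, -q]
    rw [Nat.cast_one, zero_add] at this
    rw [this]
    have := h.eval_mnc_zero hc fun i : ℕ => if i = 0 then -q else (1 : ℂ)
    rw [e1] at this
    refine this.trans ?_
    simp [pairProd, Finset.prod_range_succ]
  have t01 : evalv Ψ ![1, -q] (nested 2 0, nested 2 1) = 0 := by
    obtain ⟨F, hF⟩ := h.trivialFactor_dvd (m := 1) (by omega)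
    have : evalv Ψ ![1, -q] (mnc 2 1) = 0 := by
      have ht := eval_trivialFactor_of_eq (show 1 + 1 = 2 from rfl)
        fun i : ℕ => if i = 0 then (1 : ℂ) else -q
      rw [e0] at ht
      rw [evalv, hF, map_mul, ht]
      simp [crossProd]
    exact this
  have t10 : evalv Ψ ![1, -q] (nested 2 1, nested 2 0) = 0 := by
    rw [← t01]
    exact congrArg (eval _) (h.swap_colour (nested 2 0, nested 2 1))
  classical
  rw [Fintype.sum_prod_type, show (Finset.univ : Finset (LinkPattern 2)) = {nested 2 0, nested 2 1}
    from (Finset.eq_univ_of_forall fun σ => by simpa using LinkPattern.eq_nested_two σ).symm]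
  simp only [Finset.sum_pair LinkPattern.nested_two_ne, t00, t01, t10, t11, add_zero]

/-- The constant in the factorization is determined by the sum of the components. -/
theorem Good.factorizes_eq : ∀ (N : ℕ) [NeZero N] {Ψ : State N → MvPolynomial (Fin N) ℂ},
    Good Ψ → (∀ s i, degreeOf i (Ψ s) ≤ 2 * (N - 1)) → ∀ {c d : ℂ}, Factorizes Ψ c →
      SumFormula Ψ d → c = d
  | 0, h0, _, _, _, _, _, _, _ => absurd rfl h0.out
  | 1, _, Ψ, h, _, c, d, hc, hd => by
    have e := hd fun j => (0 : ℕ → ℂ) j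
    have := h.eval_mnc_zero hc 0
    rw [Fintype.sum_subsingleton _ (mnc 1 0), this] at e
    simpa [pairProd, pv_one, alternant] using e
  | 2, _, Ψ, h, _, c, d, hc, hd => by
    have e := hd ![1, -q]
    rw [h.sum_two hc] at e
    simp only [alternant, Matrix.det_fin_two, Matrix.of_apply] at e
    simp at e
    have := q_pow_three
    have := q_sq
    have := q_ne_one
    have := q_ne_zero
    grind
  | n + 3, _, Ψ, h, hdeg, c, d, hc, hd => by
    obtain ⟨Φ, hg, hΦ⟩ := h.exists_restr_eq one_ne_zero
    have hdeg' := degreeOf_le_of_restr_eq hdeg one_ne_zero hΦ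
    obtain ⟨c', hc'⟩ := exists_factorizes (n + 1) hg hdeg'
    -- The smaller vector has the constant -q d by induction, and the recursion at x = 1 identifies
    -- it with -q c.
    rw [factorizes_eq (n + 1) hg hdeg' hc' (hd.restr h hΦ)] at hc'
    obtain ⟨F, hF⟩ := h.trivialFactor_dvd (le_refl (n + 1 + 2))
    obtain ⟨ζ, hζ⟩ := exists_pv_arcPt_ne_zero (rotorP_ne_zero (n + 1)) one_ne_zero
    have e := h.eval_factor_arcPt one_ne_zero hg hΦ hc' (add_zero (n + 1)) hF ζ
    rw [hc (n + 1 + 2) 0 rfl F hF, pv_zero, pv_zero, kap_add_two, kap, if_neg (by simp)] at e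
    have hq := q_ne_zero
    refine mul_right_cancel₀ (mul_ne_zero hq hζ) ?_
    linear_combination -e

/-- The components of kind `(m, k)` of a ground state factorize. -/
theorem Good.mnc_eq {N : ℕ} [NeZero N] {Ψ : State N → MvPolynomial (Fin N) ℂ} (h : Good Ψ) {c : ℂ}
    (hc : Factorizes Ψ c) {m k : ℕ} (hmk : m + k = N) {f : Fin m → Fin N} {g : Fin k → Fin N}
    (hf : ∀ i, (f i : ℕ) = i) (hg : ∀ i, (g i : ℕ) = m + i) :
    Ψ (mnc N m) = trivialFactor N m * (C (c * if Odd m ∧ Odd k then 1 / 3 else 1) *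
      rename f (rotorP m) * rename g (rotorP k)) := by
  obtain ⟨F, hF⟩ := h.trivialFactor_dvd (m := m) (by omega)
  rw [hF]
  congr 1
  refine MvPolynomial.funext fun z => ?_
  obtain ⟨ζ, rfl⟩ := exists_nat_ext z
  rw [hc m k hmk F hF]
  simp only [map_mul, eval_C, eval_rename, Function.comp_def, hf, hg]
  rfl

end Rotor

theorem mainTheorem8 :
    ∃ P : (k : ℕ) → MvPolynomial (Fin k) ℂ,
      (∀ (n : ℕ) (z : Fin (2 * n) → ℂ),
        (∀ i j, i ≠ j → z i ≠ z j ∧ z i + Rotor.q * z j ≠ 0) →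
          eval z (P (2 * n)) = Rotor.pfaffianFormula n z) ∧
      (∀ (n : ℕ) (z : Fin (2 * n + 1) → ℂ),
        Tendsto
          (fun w : ℂ => (-3 * Rotor.q ^ (n + 2)) *
            (eval (Fin.snoc z w : Fin (2 * n + 2) → ℂ) (P (2 * n + 2)) / w ^ (2 * n + 1)))
          (Bornology.cobounded ℂ) (𝓝 (eval z (P (2 * n + 1))))) ∧
      ∀ (N : ℕ) [NeZero N] (Ψ : Rotor.State N → MvPolynomial (Fin N) ℂ),
        Rotor.IsGroundState Ψ →
          ∃ c : ℂ, c ≠ 0 ∧ (Rotor.IsNormalized Ψ → c = 1) ∧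
            ∀ (m k : ℕ) (h : m + k = N),
              Ψ (Rotor.mnc N m) =
                Rotor.trivialFactor N m *
                  (C (c * if Odd m ∧ Odd k then 1 / 3 else 1) *
                    rename (fun i : Fin m => (⟨i, by omega⟩ : Fin N)) (P m) *
                    rename (fun i : Fin k => (⟨m + i, by omega⟩ : Fin N)) (P k)) := by
  refine ⟨Rotor.rotorP, fun n z h => ?_, fun n z => ?_, fun N _ Ψ h => ?_⟩
  · rw [Rotor.rotorP_even (even_two_mul n)]
    exact Rotor.eval_evenP_eq_pfaffianFormula n z h
  · have := Rotor.tendsto_rotorP_odd (odd_two_mul_add_one n) z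
    rwa [show (2 * n + 1) / 2 = n by omega] at this
  · obtain ⟨c, hc⟩ := Rotor.Good.exists_factorizes N h.good h.degree
    exact ⟨c, h.good.factorizes_ne_zero h.ne_zero hc,
      fun hn => Rotor.Good.factorizes_eq N h.good h.degree hc hn.sumFormula,
      fun m k hmk => h.good.mnc_eq hc hmk (fun _ => rfl) fun _ => rfl⟩
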